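/- Let $k\ge 1$ be an integer and let $\Gamma\subset SL(2,\mathbb R)$ be a discrete, torsion-free subgroup of finite covolume, acting on the upper half-plane $\mathbb H$ (with $z=x+iy$ and measure $dx\,dy/y^2$). Let $g\in S_{4k}(\Gamma)$ be a holomorphic cusp form of weight $4k$ and let $s\in\mathbb C$ with $\operatorname{Re}s>1$. *Hyperbolic elements.* For hyperbolic $\gamma$ let $N(\gamma)>1$ be the square of the larger absolute value of its eigenvalues and $\ell(\gamma)=\log N(\gamma)$. Let $\mathcal H(\Gamma)$ and $\Pr(\Gamma)$ be the sets of $\Gamma$-conjugacy classes of hyperbolic, respectively primitive hyperbolic (not a proper power in $\Gamma$), elements. For $\gamma=\begin{pmatrix}a&b\\c&d\end{pmatrix}$ put $Q_\gamma(z)=cz^2+(d-a)z-b$ and $j(\gamma,z)=cz+d$, and $$\alpha_{2k}(\gamma,g)=\int_{z_0}^{\gamma z_0}Q_\gamma(z)^{2k-1}g(z)\,dz ,\qquad z_0\in\mathbb H \text{ arbitrary},$$ where $\gamma$ is represented by the matrix of positive trace among $\pm\gamma$ (the sign of $Q_\gamma^{2k-1}$ depends on it). *Dirichlet series.* Put $$\Psi_\Gamma(s;g)=\sum_{\gamma\in\Pr(\Gamma)}\frac{\overline{\alpha_{2k}(\gamma,g)}}{2^{6k-3}\,\ell(\gamma)\,\sinh^{2k-1}(\ell(\gamma)/2)}\Bigl\{\sum_{j=1}^{2k}p_j(s)\,\frac{d}{ds}\log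 Z^{(j)}_\gamma(s)\Bigr\},$$ $$Z^{(j)}_\gamma(s)=\prod_{m=0}^\infty\bigl(1-N(\gamma)^{-(s+m)}\bigr)^{\binom{j+m-1}{m}},\qquad p_j(s)=(j-1)!\binom{2k-1}{j-1}\binom{2k+j-2}{j-1}\prod_{i=j+1}^{2k}(2s-i)\in\mathbb Z[2s].$$ *Poincaré series.* Put $r(z,z')=1-\bigl|\frac{z-z'}{\bar z-z'}\bigr|^2$, $$Q_s(z,z')=\frac{\Gamma(s)^2}{\pi\Gamma(2s)}\,r^s\,{}_2F_1(s,s;2s;r),\quad r=r(z,z'),\qquad G_s(z,z')=\sum_{\gamma\in\Gamma}Q_s(z,\gamma z'),$$ $L_{2j}=(yy')^{-2j}\frac{\partial^2}{\partial z\,\partial z'}(yy')^{2j}$, and $$F^{(k)}_s(z)=L_{2k-2}\cdots L_2L_0\bigl(G_s(z,z')-Q_s(z,z')\bigr)\Big|_{z'=z},\qquad \langle F^{(k)}_s,g\rangle=\int_{\Gamma\backslash\mathbb H}F^{(k)}_s(z)\overline{g(z)}\,y^{4k}\,\frac{dx\,dy}{y^2}.$$ *Local integrals.* For hyperbolic $P\in\Gamma$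 write $P=P_0^n$ with $P_0\in\Gamma$ primitive hyperbolic and $n\ge1$, choose $\tau\in SL(2,\mathbb R)$ with $\tau P_0\tau^{-1}=\operatorname{diag}(N(P_0)^{1/2},N(P_0)^{-1/2})$ (again for the matrix of positive trace among $\pm P_0$), and put $$I^{(k)}_s(P;g)=\frac{N(P)^k}{(N(P)-1)^{2k}}\int_{\{z\in\mathbb H:\,1\le|z|<N(P_0)\}}\frac{f^{(k)}_s(r(z,N(P)z))}{z^{2k}}\,\overline{j(\tau^{-1},z)^{-4k}g(\tau^{-1}z)}\,y^{4k}\,\frac{dx\,dy}{y^2},$$ $$f_s^{(k)}(r)=\frac{(-1)^k}{\pi}\frac{\Gamma(s+k)^2}{\Gamma(2s)}(r-1)^{2k}r^{s-k}{}_2F_1(s+k,s+k;2s;r).$$ **Theorem.** Every hyperbolic $P\in\Gamma$ admits such $P_0$, $n$ and $\tau$. The series $\Psi_\Gamma(s;g)$, the integral $\langle F^{(k)}_s,g\rangle$, the integrals $I^{(k)}_s(P;g)$ and the series $\sum_{P\in\mathcal H(\Gamma)}I_s^{(k)}(P;g)$ converge absolutely, and, for all choices of representatives $P$ and of $P_0,n,\tau$,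 $$\Psi_\Gamma(s;g)=(-1)^{k+1}\langle F^{(k)}_s,g\rangle=\sum_{P\in\mathcal H(\Gamma)}(-1)^{k+1}I^{(k)}_s(P;g).$$ -/

import Mathlib

open scoped UpperHalfPlane MatrixGroups

noncomputable section

namespace GeodesicPeriods

open Complex MeasureTheory

/-! ### The resolvent kernel on the upper half-plane and the Poincaré series -/

/-- The point-pair function `r(z, w) = 1 - |(z - w) / (conj z - w)|²`. -/
def rInv (z w : ℂ) : ℝ := 1 - ‖(z - w) / ((starRingEnd ℂ) z - w)‖ ^ 2

/-- The free-space resolvent kernel `Q_s(z, z')` of `-y² ∂_z ∂_{z̄} + s (s - 1) / 4`. Its value on the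
diagonal, where the kernel is singular, is irrelevant below. -/
def resolventQ (s : ℂ) (z w : ℍ) : ℂ :=
  Complex.Gamma s ^ 2 / (Real.pi * Complex.Gamma (2 * s)) * ((rInv z w : ℝ) : ℂ) ^ s *
    ordinaryHypergeometric s s (2 * s) ((rInv z w : ℝ) : ℂ)

/-- The resolvent kernel `G_s(z, z') = ∑_{γ ∈ Γ} Q_s(z, γ z')` of the quotient. -/
def resolventG (Γ : Subgroup SL(2, ℝ)) (s : ℂ) (z w : ℍ) : ℂ :=
  ∑' γ : Γ, resolventQ s z ((γ : SL(2, ℝ)) • w)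

/-- The derivative `∂/∂z = (∂/∂x - i ∂/∂y) / 2` of a function on the upper half-plane. -/
def dZ (f : ℍ → ℂ) (z : ℍ) : ℂ :=
  (1 / 2) * (fderiv ℝ (f ∘ UpperHalfPlane.ofComplex) (z : ℂ) 1
    - I * fderiv ℝ (f ∘ UpperHalfPlane.ofComplex) (z : ℂ) I)

/-- `L_{2j} = (y y')^{-2j} ∂²/∂z∂z' (y y')^{2j}`. -/
def opL (j : ℕ) (K : ℍ → ℍ → ℂ) (z w : ℍ) : ℂ :=
  (((z.im * w.im) ^ (2 * j) : ℝ) : ℂ)⁻¹ *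
    dZ (fun z' ↦ dZ (fun w' ↦ (((z'.im * w'.im) ^ (2 * j) : ℝ) : ℂ) * K z' w') w) z

/-- `L_{2k-2} ⋯ L_2 L_0`. -/
def iterL : ℕ → (ℍ → ℍ → ℂ) → ℍ → ℍ → ℂ
  | 0, K => K
  | k + 1, K => opL k (iterL k K)

/-- The Poincaré series `F_s^{(k)}(z) = L_{2k-2} ⋯ L_2 L_0 (G_s(z, z') - Q_s(z, z'))` at `z' = z`.
The `γ = 1` term of `G_s` is cancelled, on the diagonal too. -/
def poincareF (Γ : Subgroup SL(2, ℝ)) (k : ℕ) (s : ℂ) (z : ℍ) : ℂ :=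
  iterL k (fun z' w' ↦ resolventG Γ s z' w' - resolventQ s z' w') z z

/-- Holomorphic cusp forms of weight `4k` for `Γ`. -/
abbrev CuspForms (Γ : Subgroup SL(2, ℝ)) (k : ℕ) : Type :=
  CuspForm (Γ.map Matrix.SpecialLinearGroup.toGL) (4 * (k : ℤ))

/-- The density `F_s^{(k)}(z) conj(g(z)) y^{4k}` of the scalar product, against `dx dy / y²`. -/
def scalarDensity (Γ : Subgroup SL(2, ℝ)) (k : ℕ) (s : ℂ) (g : ℍ → ℂ) (z : ℍ) : ℂ :=
  poincareF Γ k s z * (starRingEnd ℂ) (g z) * (z.im : ℂ) ^ (4 * k)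

/-! ### Hyperbolic elements and their classes -/

/-- Hyperbolic elements of `SL(2, ℝ)`: those with `|tr γ| > 2`. -/
def IsHyp (γ : SL(2, ℝ)) : Prop := (γ : Matrix (Fin 2) (Fin 2) ℝ).IsHyperbolic

/-- The norm `N(γ)`, the square of the larger absolute value of an eigenvalue of `γ`. -/
def normN (γ : SL(2, ℝ)) : ℝ :=
  ((|(γ : Matrix (Fin 2) (Fin 2) ℝ).trace|
    + √((γ : Matrix (Fin 2) (Fin 2) ℝ).trace ^ 2 - 4)) / 2) ^ 2

/-- The length `ℓ(γ) = log N(γ)` of the closed geodesic associated with `γ`. -/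
def len (γ : SL(2, ℝ)) : ℝ := Real.log (normN γ)

/-- The matrix among `γ`, `-γ` with positive trace (for hyperbolic `γ`). -/
def posRep (γ : SL(2, ℝ)) : SL(2, ℝ) :=
  if 0 < (γ : Matrix (Fin 2) (Fin 2) ℝ).trace then γ else -γ

/-- Hyperbolic elements of `Γ` that are not a proper power in `Γ`. -/
def IsPrimHyp (Γ : Subgroup SL(2, ℝ)) (γ : Γ) : Prop :=
  IsHyp γ ∧ ∀ (δ : Γ) (n : ℕ), δ ^ n = γ → n = 1

/-- `H(Γ)`: the `Γ`-conjugacy classes of hyperbolic elements of `Γ`. -/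
def HypClass (Γ : Subgroup SL(2, ℝ)) : Type :=
  {c : ConjClasses Γ // ∃ γ : Γ, ConjClasses.mk γ = c ∧ IsHyp γ}

/-- `Pr(Γ)`: the `Γ`-conjugacy classes of primitive hyperbolic elements of `Γ`. -/
def PrimClass (Γ : Subgroup SL(2, ℝ)) : Type :=
  {c : ConjClasses Γ // ∃ γ : Γ, ConjClasses.mk γ = c ∧ IsPrimHyp Γ γ}

/-- A representative of a primitive hyperbolic class. -/
def PrimClass.rep {Γ : Subgroup SL(2, ℝ)} (c : PrimClass Γ) : SL(2, ℝ) := (c.2.choose : Γ)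

/-! ### Periods and the Dirichlet series -/

/-- `Q_γ(z) = c z² + (d - a) z - b`. -/
def quadQ (γ : SL(2, ℝ)) (z : ℂ) : ℂ :=
  (γ 1 0 : ℂ) * z ^ 2 + ((γ 1 1 : ℂ) - (γ 0 0 : ℂ)) * z - (γ 0 1 : ℂ)

/-- The period `α_{2k}(γ, g) = ∫_{z₀}^{γ z₀} Q_γ(z)^{2k-1} g(z) dz`, along the segment from `z₀` to
`γ z₀`. -/
def period (k : ℕ) (g : ℍ → ℂ) (z₀ : ℍ) (γ : SL(2, ℝ)) : ℂ :=
  ∫ t in (0 : ℝ)..1,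
    quadQ γ ((z₀ : ℂ) + t * (((γ • z₀ : ℍ) : ℂ) - z₀)) ^ (2 * k - 1) *
      g (UpperHalfPlane.ofComplex ((z₀ : ℂ) + t * (((γ • z₀ : ℍ) : ℂ) - z₀))) *
      (((γ • z₀ : ℍ) : ℂ) - z₀)

/-- `β_{2k}(γ, g) = conj α_{2k}(γ, g) / (2^{6k-3} sinh^{2k-1}(ℓ(γ)/2))`, where the period is that of
the matrix of positive trace among `γ`, `-γ`. -/
def beta (k : ℕ) (g : ℍ → ℂ) (z₀ : ℍ) (γ : SL(2, ℝ)) : ℂ :=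
  (starRingEnd ℂ) (period k g z₀ (posRep γ)) /
    ((2 ^ (6 * k - 3) * Real.sinh (len γ / 2) ^ (2 * k - 1) : ℝ) : ℂ)

/-- The local higher Selberg zeta function of rank `j ≥ 1`,
`Z_γ^{(j)}(s) = ∏_{m ≥ 0} (1 - N(γ)^{-(s+m)})^{binom(j+m-1, m)}`. -/
def localZeta (γ : SL(2, ℝ)) (j : ℕ) (s : ℂ) : ℂ :=
  ∏' m : ℕ, (1 - ((normN γ : ℝ) : ℂ) ^ (-(s + m))) ^ ((j + m - 1).choose m)

/-- `p_j`, as an integral polynomial in `X = 2s`: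
`(j-1)! binom(2k-1, j-1) binom(2k+j-2, j-1) ∏_{i=j+1}^{2k} (X - i)`. -/
def polyP (k j : ℕ) : Polynomial ℤ :=
  Polynomial.C ((((j - 1).factorial * (2 * k - 1).choose (j - 1) *
      (2 * k + j - 2).choose (j - 1) : ℕ) : ℤ)) *
    ∏ i ∈ Finset.Icc (j + 1) (2 * k), (Polynomial.X - Polynomial.C (i : ℤ))

/-- The term of `Ψ_Γ(s; g)` attached to `γ`:
`β_{2k}(γ, g) / ℓ(γ) * ∑_{j=1}^{2k} p_j(s) (d/ds) log Z_γ^{(j)}(s)`. -/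
def psiTerm (k : ℕ) (g : ℍ → ℂ) (z₀ : ℍ) (s : ℂ) (γ : SL(2, ℝ)) : ℂ :=
  beta k g z₀ γ / (len γ : ℂ) *
    ∑ j ∈ Finset.Icc 1 (2 * k), Polynomial.aeval (2 * s) (polyP k j) * logDeriv (localZeta γ j) s

/-- `Ψ_Γ(s; g)`. -/
def Psi (Γ : Subgroup SL(2, ℝ)) (k : ℕ) (g : ℍ → ℂ) (z₀ : ℍ) (s : ℂ) : ℂ :=
  ∑' c : PrimClass Γ, psiTerm k g z₀ s c.rep

/-! ### The local integrals -/

/-- `f_s^{(k)}(r) = (-1)^k π⁻¹ Γ(s+k)² Γ(2s)⁻¹ (r-1)^{2k} r^{s-k} ₂F₁(s+k, s+k; 2s; r)`. -/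
def radialF (k : ℕ) (s : ℂ) (r : ℝ) : ℂ :=
  (-1) ^ k / Real.pi * Complex.Gamma (s + k) ^ 2 / Complex.Gamma (2 * s) *
    ((r : ℂ) - 1) ^ (2 * k) * (r : ℂ) ^ (s - k) *
    ordinaryHypergeometric (s + k) (s + k) (2 * s) (r : ℂ)

/-- The choices that enter the local integral of a hyperbolic class: a representative `P`, the
primitive hyperbolic `P₀` with `P = P₀ ^ n`, and `τ ∈ SL(2, ℝ)` that diagonalises `P₀`. -/
structure LocalData (Γ : Subgroup SL(2, ℝ)) (c : HypClass Γ) where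
  P : Γ
  mk_P : ConjClasses.mk P = c.1
  P₀ : Γ
  prim : IsPrimHyp Γ P₀
  n : ℕ
  pow_eq : P₀ ^ n = P
  τ : SL(2, ℝ)
  diag : ((τ * posRep P₀ * τ⁻¹ : SL(2, ℝ)) : Matrix (Fin 2) (Fin 2) ℝ) =
    !![√(normN P₀), 0; 0, (√(normN P₀))⁻¹]

/-- `𝓕₀ = {z : 1 ≤ |z| < N}`. -/
def annulus (N : ℝ) : Set ℍ := {z | 1 ≤ ‖(z : ℂ)‖ ∧ ‖(z : ℂ)‖ < N}

/-- `g_τ(z) = j(τ⁻¹, z)^{-4k} g(τ⁻¹ z)`, with `j(σ, z) = c z + d`. -/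
def twist (k : ℕ) (g : ℍ → ℂ) (τ : SL(2, ℝ)) (z : ℍ) : ℂ :=
  (((τ⁻¹ 1 0 : ℝ) : ℂ) * z + ((τ⁻¹ 1 1 : ℝ) : ℂ)) ^ (-(4 * (k : ℤ))) * g (τ⁻¹ • z)

/-- The integrand `z^{-2k} f_s^{(k)}(r(z, N z)) conj(g_τ(z)) y^{4k}` of the local integral,
against `dx dy / y²`. -/
def localDensity (k : ℕ) (s : ℂ) (g : ℍ → ℂ) (N : ℝ) (τ : SL(2, ℝ)) (z : ℍ) : ℂ :=
  1 / (z : ℂ) ^ (2 * k) * radialF k s (rInv z (N * z)) *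
    (starRingEnd ℂ) (twist k g τ z) * (z.im : ℂ) ^ (4 * k)

/-- The local integral `I_s^{(k)}(P; g)`. -/
def localI {Γ : Subgroup SL(2, ℝ)} {c : HypClass Γ} (k : ℕ) (s : ℂ) (g : ℍ → ℂ)
    (D : LocalData Γ c) : ℂ :=
  ((normN D.P ^ k / (normN D.P - 1) ^ (2 * k) : ℝ) : ℂ) *
    ∫ z in annulus (normN D.P₀), localDensity k s g (normN D.P) D.τ z

end GeodesicPeriods

end

open scoped UpperHalfPlane MatrixGroups

noncomputable section

namespace GeodesicPeriods

open Complex MeasureTheory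

/-! ### The action of `SL(2, ℝ)` on the upper half-plane -/

/-! The Poincaré series is expanded over `Γ`, its scalar product with `g` is unfolded one conjugacy
class at a time, and the integrals that survive are evaluated in closed form.

Single terms. Put h = j(γ,w)(z - γw) and r = r(z,γw). Then Q_s(z,γw) = B_0(r), where B_j(r) = ∑
Γ(s+j+n)²/(π Γ(2s+n) n!) r^{s+j+n} satisfies B_{j+1} = r (r d/dr)² B_j. The conjugate of h is
antiholomorphic in z and in w, so ∂²/∂z∂w meets only B_j(r); it turns (-1/16)^j conj(h)^{2j} B_j(r)
into the same expression for j+1 divided by (yy')² (`exists_kerE_bound`). Hence y^{4k} F is the sum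
over γ ≠ 1 of (-1/16)^k conj(Q_γ)^{2k} B_k(r(z,γz)) (`poincareF_eq`).

Convergence. Let ε be the smallest displacement of z by a nontrivial element. The orbit sum of r^{Re
s} is O(ε^{-2}), the singularity at r = 1 costs a further power of 1/ε, and y^{2k}|g| is O(ε^M) for
every M (`IsCuspidal.exists_phi_le`). No geometric description of the cusps is needed for the last
bound: by a commutator estimate short elements commute, by a packing argument the thick part is
compact modulo `Γ`, and hyperbolic displacements are bounded below; so a tiny displacement comes
from a parabolic generator, towards whose fixed point g decays exponentially. The sum of the
absolute values of the terms of F conj(g) y^{4k} is thus bounded on the half-plane, and finite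
covolume gives absolute convergence.

Unfolding. The sum over a class becomes one integral over a fundamental domain of the centraliser,
which is infinite cyclic. For a parabolic class the kernel depends on y alone and the constant
Fourier coefficient of g is zero; elliptic classes do not exist because `Γ` is discrete and
torsion-free. The hyperbolic classes give the local integrals.

Evaluation. In the coordinates w = e^u (t + i) the function r depends on t alone, and the u-integral
is the period of P₀ up to a constant. The t-integral is, term by term, a beta integral. With q =
N(P)^{-1} the resulting series at x = 4q/(1+q)² comes from the generating function q^s/(1-q)
(`hasSum_choose`, a residue computation) by applying x^{1/2} · x d/dx a total of 2k-1 times, which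
produces ∑ p_j(s) q^s (1-q)^{-j} (`integral_resB_eq_sum`). Summing over P = P₀^n gives Lambert
series, which are the logarithmic derivatives of the local zeta functions divided by ℓ(P₀). -/

/-- The automorphy factor `c z + d`. -/
def autj (γ : SL(2, ℝ)) (z : ℂ) : ℂ := (γ 1 0 : ℂ) * z + (γ 1 1 : ℂ)

/-- The polarised quadratic form `(c w + d) z - (a w + b) = j(γ, w) (z - γ w)`. -/
def bilin (γ : SL(2, ℝ)) (z w : ℂ) : ℂ :=
  ((γ 1 0 : ℂ) * w + (γ 1 1 : ℂ)) * z - ((γ 0 0 : ℂ) * w + (γ 0 1 : ℂ))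

theorem det_entries (γ : SL(2, ℝ)) : γ 0 0 * γ 1 1 - γ 0 1 * γ 1 0 = 1 := by
  have := γ.det_coe
  rwa [Matrix.det_fin_two] at this

theorem det_entries_complex (γ : SL(2, ℝ)) :
    (γ 0 0 : ℂ) * γ 1 1 - (γ 0 1 : ℂ) * γ 1 0 = 1 := by
  exact_mod_cast det_entries γ

theorem autj_ne_zero (γ : SL(2, ℝ)) (z : ℍ) : autj γ z ≠ 0 := by
  intro h
  have h1 := congrArg Complex.im h
  have h2 := congrArg Complex.re h
  simp [autj] at h1 h2
  have hd := det_entries γ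
  rcases h1 with h1 | h1
  · rw [h1] at h2 hd; simp at h2; rw [h2] at hd; simp at hd
  · exact z.im_ne_zero h1

theorem coe_smul_eq (γ : SL(2, ℝ)) (z : ℍ) :
    ((γ • z : ℍ) : ℂ) = ((γ 0 0 : ℂ) * z + (γ 0 1 : ℂ)) / autj γ z := by
  simpa [autj] using UpperHalfPlane.coe_specialLinearGroup_apply γ z

theorem bilin_eq (γ : SL(2, ℝ)) (z : ℂ) (w : ℍ) :
    bilin γ z w = autj γ w * (z - (γ • w : ℍ)) := by
  rw [coe_smul_eq, mul_sub, mul_div_cancel₀ _ (autj_ne_zero γ w)]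
  simp only [bilin, autj]

theorem im_smul_eq (γ : SL(2, ℝ)) (z : ℍ) : (γ • z).im = z.im / ‖autj γ z‖ ^ 2 := by
  have h := coe_smul_eq γ z
  have h1 : (γ • z).im = ((γ • z : ℍ) : ℂ).im := rfl
  have hd := det_entries γ
  have hn : Complex.normSq (autj γ z) ≠ 0 := by
    simpa [Complex.normSq_eq_zero] using autj_ne_zero γ z
  rw [h1, h, Complex.div_im, ← Complex.normSq_eq_norm_sq]
  field_simp
  simp [autj]
  linear_combination z.im * hd

theorem autj_mul (γ δ : SL(2, ℝ)) (z : ℍ) :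
    autj (γ * δ) z = autj γ (δ • z : ℍ) * autj δ z := by
  have h : autj γ (δ • z : ℍ) * autj δ z =
      (γ 1 0 : ℂ) * ((δ 0 0 : ℂ) * z + (δ 0 1 : ℂ)) + (γ 1 1 : ℂ) * autj δ z := by
    rw [coe_smul_eq]
    have := autj_ne_zero δ z
    rw [autj, add_mul, mul_assoc, div_mul_cancel₀ _ this]
  rw [h]
  simp [autj, Matrix.mul_apply, Fin.sum_univ_two]
  ring

theorem smul_sub_smul (σ : SL(2, ℝ)) (z w : ℍ) :
    ((σ • z : ℍ) : ℂ) - (σ • w : ℍ) = ((z : ℂ) - w) / (autj σ z * autj σ w) := by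
  have h1 := autj_ne_zero σ z
  have h2 := autj_ne_zero σ w
  have hd := det_entries_complex σ
  rw [coe_smul_eq, coe_smul_eq]
  field_simp
  simp only [autj]
  linear_combination ((z : ℂ) - w) * hd

theorem bilin_conj (σ γ : SL(2, ℝ)) (z w : ℍ) :
    bilin (σ * γ * σ⁻¹) (σ • z : ℍ) (σ • w : ℍ) = bilin γ z w / (autj σ z * autj σ w) := by
  have h1 : (σ * γ * σ⁻¹) • σ • w = σ • γ • w := by simp [mul_smul]
  have h2 : autj (σ * γ * σ⁻¹) (σ • w : ℍ) * autj σ w = autj σ (γ • w : ℍ) * autj γ w := by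
    rw [← autj_mul, ← autj_mul]; simp
  have h3 := autj_ne_zero σ w
  have h4 := autj_ne_zero σ z
  have h5 := autj_ne_zero σ (γ • w)
  rw [bilin_eq, bilin_eq, h1, smul_sub_smul, eq_div_iff (mul_ne_zero h4 h3), eq_comm]
  field_simp
  linear_combination (-((z : ℂ) - (γ • w : ℍ))) * h2

theorem quadQ_eq_bilin (γ : SL(2, ℝ)) (z : ℂ) : quadQ γ z = bilin γ z z := by
  simp only [quadQ, bilin]; ring

/-- This is the equation det γ = 1 in disguise. It places r in (0, 1] and bounds |h(z,w)| by
|h(z̄,w)|, and all estimates of the kernels rest on these two facts. -/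
theorem norm_bilin_conj_sq (γ : SL(2, ℝ)) (z w : ℂ) :
    ‖bilin γ ((starRingEnd ℂ) z) w‖ ^ 2 = ‖bilin γ z w‖ ^ 2 + 4 * z.im * w.im := by
  have hd := det_entries γ
  rw [← Complex.normSq_eq_norm_sq, ← Complex.normSq_eq_norm_sq]
  simp [bilin, Complex.normSq_apply]
  linear_combination 4 * z.im * w.im * hd

theorem norm_bilin_conj_pos (γ : SL(2, ℝ)) {z w : ℂ} (hz : 0 < z.im) (hw : 0 < w.im) :
    0 < ‖bilin γ ((starRingEnd ℂ) z) w‖ := by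
  have h := norm_bilin_conj_sq γ z w
  refine (norm_nonneg _).lt_of_ne' fun h0 ↦ ?_
  rw [h0] at h
  have : 0 < 4 * z.im * w.im := by positivity
  nlinarith [sq_nonneg ‖bilin γ z w‖]

/-- The value of `r(z, γ w)` for complex numbers `z`, `w`. -/
def rGam (γ : SL(2, ℝ)) (z w : ℂ) : ℝ :=
  4 * z.im * w.im / ‖bilin γ ((starRingEnd ℂ) z) w‖ ^ 2

theorem rInv_smul (γ : SL(2, ℝ)) (z w : ℍ) : rInv z (γ • w : ℍ) = rGam γ z w := by
  have hp := norm_bilin_conj_pos γ z.im_pos w.im_pos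
  have h := norm_bilin_conj_sq γ z w
  have h3 : ‖autj γ w‖ ≠ 0 := by simpa using autj_ne_zero γ w
  have hq : ((z : ℂ) - (γ • w : ℍ)) / ((starRingEnd ℂ) (z : ℂ) - (γ • w : ℍ)) =
      bilin γ z w / bilin γ ((starRingEnd ℂ) (z : ℂ)) w := by
    rw [bilin_eq, bilin_eq, mul_div_mul_left _ _ (autj_ne_zero γ w)]
  rw [rInv, hq, norm_div, div_pow, rGam, eq_div_iff (by positivity), sub_mul,
    div_mul_cancel₀ _ (by positivity)]
  linear_combination h

theorem one_sub_rGam (γ : SL(2, ℝ)) {z w : ℂ} (hz : 0 < z.im) (hw : 0 < w.im) :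
    1 - rGam γ z w = ‖bilin γ z w‖ ^ 2 / ‖bilin γ ((starRingEnd ℂ) z) w‖ ^ 2 := by
  have hp := norm_bilin_conj_pos γ hz hw
  have h := norm_bilin_conj_sq γ z w
  rw [rGam, eq_div_iff (by positivity), sub_mul, div_mul_cancel₀ _ (by positivity)]
  linear_combination h

theorem rGam_pos (γ : SL(2, ℝ)) {z w : ℂ} (hz : 0 < z.im) (hw : 0 < w.im) : 0 < rGam γ z w := by
  have hp := norm_bilin_conj_pos γ hz hw
  unfold rGam; positivity

/-- The quotient in `rInv` has modulus tanh of half the distance. In this form every comparison of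
values of r reduces to a triangle inequality. -/
theorem rInv_eq_cosh (z w : ℍ) : rInv z w = 1 / Real.cosh (dist z w / 2) ^ 2 := by
  have h := UpperHalfPlane.tanh_half_dist z w
  have h1 : ‖((z : ℂ) - w) / ((starRingEnd ℂ) (z : ℂ) - w)‖ = Real.tanh (dist z w / 2) := by
    rw [h, norm_div, Complex.dist_eq, Complex.dist_eq]
    congr 1
    rw [← Complex.norm_conj ((z : ℂ) - (starRingEnd ℂ) (w : ℂ))]
    simp
  have h2 := Real.cosh_sq (dist z w / 2)
  have h3 := Real.cosh_pos (dist z w / 2)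
  rw [rInv, h1, Real.tanh_eq_sinh_div_cosh]
  field_simp
  linarith

/-- On the diagonal the quadratic form Q_γ measures displacement; in particular its zeros in the
half-plane are the fixed points of γ. -/
theorem two_sinh_half_dist (γ : SL(2, ℝ)) (z : ℍ) :
    2 * Real.sinh (dist z (γ • z) / 2) = ‖bilin γ z z‖ / z.im := by
  have h3 : 0 < ‖autj γ z‖ := by simpa using autj_ne_zero γ z
  have hz := z.im_pos
  rw [UpperHalfPlane.sinh_half_dist, im_smul_eq, bilin_eq, norm_mul, Complex.dist_eq]
  have : √(z.im * (z.im / ‖autj γ z‖ ^ 2)) = z.im / ‖autj γ z‖ := by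
    rw [show z.im * (z.im / ‖autj γ z‖ ^ 2) = (z.im / ‖autj γ z‖) ^ 2 by ring]
    exact Real.sqrt_sq (by positivity)
  rw [this]
  field_simp

theorem dist_conj_smul (σ γ : SL(2, ℝ)) (z : ℍ) :
    dist (σ • z) ((σ * γ * σ⁻¹) • σ • z) = dist z (γ • z) := by
  have h1 : (σ * γ * σ⁻¹) • σ • z = σ • γ • z := by simp [mul_smul]
  rw [h1, dist_smul]

/-! ### Discrete torsion-free groups -/

/-- Proper discontinuity, applied to K and its closed R-neighbourhood, which is compact because the
half-plane is a proper metric space. -/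
theorem finite_dist_le (Γ : Subgroup SL(2, ℝ)) [DiscreteTopology Γ] {K : Set ℍ}
    (hK : IsCompact K) (R : ℝ) :
    {γ : SL(2, ℝ) | γ ∈ Γ ∧ ∃ z ∈ K, dist z (γ • z) ≤ R}.Finite := by
  have h := ProperlyDiscontinuousSMul.finite_disjoint_inter_image (Γ := Γ) hK
    (hK.cthickening (r := R))
  refine (h.image (fun γ : Γ ↦ (γ : SL(2, ℝ)))).subset ?_
  rintro γ ⟨hγ, z, hz, hd⟩
  refine ⟨⟨γ, hγ⟩, ⟨γ • z, ⟨z, hz, rfl⟩, ?_⟩, rfl⟩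
  exact Metric.mem_cthickening_of_dist_le _ z R K hz (by rwa [dist_comm])

/-- All powers of γ fix z, and only finitely many elements of `Γ` do; so γ has finite order. -/
theorem eq_one_of_fixed {Γ : Subgroup SL(2, ℝ)} [DiscreteTopology Γ]
    (htf : ∀ γ ∈ Γ, IsOfFinOrder γ → γ = 1) {γ : SL(2, ℝ)} (hγ : γ ∈ Γ) {z : ℍ}
    (hz : γ • z = z) : γ = 1 := by
  refine htf γ hγ ?_
  by_contra h
  have hinj := injective_pow_iff_not_isOfFinOrder.2 h
  refine Set.infinite_of_injective_forall_mem hinj (fun n ↦ ?_)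
    (finite_dist_le Γ (isCompact_singleton (x := z)) 0)
  have : γ ^ n • z = z := by
    induction n with
    | zero => simp
    | succ n ih => rw [pow_succ, mul_smul, hz, ih]
  exact ⟨Γ.pow_mem hγ n, z, rfl, by rw [this, dist_self]⟩

theorem dist_smul_pos {Γ : Subgroup SL(2, ℝ)} [DiscreteTopology Γ]
    (htf : ∀ γ ∈ Γ, IsOfFinOrder γ → γ = 1) {γ : SL(2, ℝ)} (hγ : γ ∈ Γ) (h1 : γ ≠ 1) (z : ℍ) :
    0 < dist z (γ • z) :=
  dist_pos.2 fun h ↦ h1 (eq_one_of_fixed htf hγ h.symm)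

theorem neg_one_notMem {Γ : Subgroup SL(2, ℝ)}
    (htf : ∀ γ ∈ Γ, IsOfFinOrder γ → γ = 1) : (-1 : SL(2, ℝ)) ∉ Γ := by
  intro h
  have h1 := htf _ h (isOfFinOrder_iff_pow_eq_one.2 ⟨2, by norm_num, by simp⟩)
  have := congrArg (fun γ : SL(2, ℝ) ↦ γ 0 0) h1
  norm_num at this

/-- The trace as a real number. -/
def tr (γ : SL(2, ℝ)) : ℝ := γ 0 0 + γ 1 1

theorem tr_eq_trace (γ : SL(2, ℝ)) : (γ : Matrix (Fin 2) (Fin 2) ℝ).trace = tr γ :=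
  Matrix.trace_fin_two _

theorem isHyp_iff (γ : SL(2, ℝ)) : IsHyp γ ↔ 4 < tr γ ^ 2 := by
  rw [IsHyp, Matrix.IsHyperbolic, Matrix.discr_fin_two, γ.det_coe, tr_eq_trace]
  constructor <;> intro h <;> linarith

/-- If |tr γ| < 2, the root of Q_γ in the upper half-plane, written down below, would be a fixed
point. -/
theorem four_le_tr_sq {Γ : Subgroup SL(2, ℝ)} [DiscreteTopology Γ]
    (htf : ∀ γ ∈ Γ, IsOfFinOrder γ → γ = 1) {γ : SL(2, ℝ)} (hγ : γ ∈ Γ) : 4 ≤ tr γ ^ 2 := by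
  by_contra! h
  have hd := det_entries γ
  have hc : γ 1 0 ≠ 0 := by
    intro hc
    rw [tr] at h
    rw [hc] at hd
    nlinarith [sq_nonneg (γ 0 0 - γ 1 1)]
  set D := √(4 - tr γ ^ 2)
  have hD : 0 < D := Real.sqrt_pos.2 (by linarith)
  have hD2 : D ^ 2 = 4 - tr γ ^ 2 := Real.sq_sqrt (by linarith)
  let z : ℍ := ⟨⟨(γ 0 0 - γ 1 1) / (2 * γ 1 0), D / (2 * |γ 1 0|)⟩, by positivity⟩
  have hre : z.re = (γ 0 0 - γ 1 1) / (2 * γ 1 0) := rfl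
  have him : z.im = D / (2 * |γ 1 0|) := rfl
  have him2 : z.im ^ 2 = D ^ 2 / (4 * (γ 1 0) ^ 2) := by rw [him, div_pow, mul_pow, sq_abs]; ring
  have hb : bilin γ z z = 0 := by
    apply Complex.ext
    · have h1 : (bilin γ z z).re =
          γ 1 0 * (z.re ^ 2 - z.im ^ 2) + (γ 1 1 - γ 0 0) * z.re - γ 0 1 := by
        simp [bilin]; ring
      rw [h1, him2, hre, hD2, tr]
      simp only [Complex.zero_re]
      field_simp
      linear_combination 16 * hd
    · have h1 : (bilin γ z z).im = z.im * (2 * γ 1 0 * z.re + (γ 1 1 - γ 0 0)) := by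
        simp [bilin]; ring
      rw [h1, hre]
      simp only [Complex.zero_im]
      field_simp
      ring
  have h2 := two_sinh_half_dist γ z
  rw [hb] at h2
  simp at h2
  have h3 := eq_one_of_fixed htf hγ h2.symm
  rw [h3] at hc
  simp at hc

/-! ### A commutator estimate for elements of small displacement -/

/-- The squared displacement of `i`, as a function of the matrix. -/
def disp (A : Matrix (Fin 2) (Fin 2) ℝ) : ℝ := (A 0 1 + A 1 0) ^ 2 + (A 0 0 - A 1 1) ^ 2

/-- The squared Frobenius norm. -/
def frobSq (A : Matrix (Fin 2) (Fin 2) ℝ) : ℝ := A 0 0 ^ 2 + A 0 1 ^ 2 + A 1 0 ^ 2 + A 1 1 ^ 2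

theorem frobSq_nonneg (A : Matrix (Fin 2) (Fin 2) ℝ) : 0 ≤ frobSq A := by
  unfold frobSq; positivity

theorem frobSq_mul_le (A B : Matrix (Fin 2) (Fin 2) ℝ) :
    frobSq (A * B) ≤ frobSq A * frobSq B := by
  have key (p q r s : ℝ) : (p * r + q * s) ^ 2 ≤ (p ^ 2 + q ^ 2) * (r ^ 2 + s ^ 2) := by
    nlinarith [sq_nonneg (p * s - q * r)]
  simp only [frobSq, Matrix.mul_apply, Fin.sum_univ_two]
  have h1 := key (A 0 0) (A 0 1) (B 0 0) (B 1 0)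
  have h2 := key (A 0 0) (A 0 1) (B 0 1) (B 1 1)
  have h3 := key (A 1 0) (A 1 1) (B 0 0) (B 1 0)
  have h4 := key (A 1 0) (A 1 1) (B 0 1) (B 1 1)
  linarith

theorem frobSq_sub_le (A B : Matrix (Fin 2) (Fin 2) ℝ) :
    frobSq (A - B) ≤ 2 * frobSq A + 2 * frobSq B := by
  simp only [frobSq, Matrix.sub_apply]
  nlinarith [sq_nonneg (A 0 0 + B 0 0), sq_nonneg (A 0 1 + B 0 1), sq_nonneg (A 1 0 + B 1 0),
    sq_nonneg (A 1 1 + B 1 1)]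

theorem frobSq_eq (A : SL(2, ℝ)) : frobSq A = disp A + 2 := by
  simp only [frobSq, disp]
  linear_combination 2 * det_entries A

/-- With det A = 1 and ε the sign of the trace, the left side equals disp A + 4 - 2|tr A|. The trace
hypothesis is essential: rotations about i have displacement 0 without being ±1. -/
theorem exists_sign_frobSq_le (A : SL(2, ℝ)) (hA : 4 ≤ tr A ^ 2) :
    ∃ ε : ℝ, frobSq ((A : Matrix (Fin 2) (Fin 2) ℝ) - ε • 1) ≤ disp A := by
  have hd := det_entries A
  have h2 : 2 ≤ |tr A| := by
    rw [← Real.sqrt_sq_eq_abs]; exact Real.le_sqrt_of_sq_le (by linarith)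
  rcases le_abs.1 h2 with h | h
  · refine ⟨1, ?_⟩
    simp only [frobSq, disp, tr] at *
    simp
    nlinarith
  · refine ⟨-1, ?_⟩
    simp only [frobSq, disp, tr] at *
    simp
    nlinarith

/-- Subtracting scalars from A and B does not change AB - BA, so the commutator differs from 1 by
(XY - YX)A⁻¹B⁻¹ with X and Y small. The constant is 4 · 9 · 2: the factor 4 from XY - YX, 9 from the
norm of A⁻¹B⁻¹, and 2 from the passage back to `disp`. -/
theorem disp_commutator_le {A B : SL(2, ℝ)} (hA : 4 ≤ tr A ^ 2) (hB : 4 ≤ tr B ^ 2)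
    (h1 : disp A ≤ 1) (h2 : disp B ≤ 1) :
    disp ((A * B * A⁻¹ * B⁻¹ : SL(2, ℝ)) : Matrix (Fin 2) (Fin 2) ℝ) ≤ 72 * disp A * disp B := by
  obtain ⟨a, ha⟩ := exists_sign_frobSq_le A hA
  obtain ⟨b, hb⟩ := exists_sign_frobSq_le B hB
  set X := (A : Matrix (Fin 2) (Fin 2) ℝ) - a • 1 with hX
  set Y := (B : Matrix (Fin 2) (Fin 2) ℝ) - b • 1 with hY
  set C := A * B * A⁻¹ * B⁻¹ with hC
  have hC1 : (C : Matrix (Fin 2) (Fin 2) ℝ) - 1 =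
      (X * Y - Y * X) * ((A⁻¹ * B⁻¹ : SL(2, ℝ)) : Matrix (Fin 2) (Fin 2) ℝ) := by
    have e1 : X * Y - Y * X = ((A * B : SL(2, ℝ)) : Matrix (Fin 2) (Fin 2) ℝ) -
        ((B * A : SL(2, ℝ)) : Matrix (Fin 2) (Fin 2) ℝ) := by
      simp only [hX, hY, Matrix.SpecialLinearGroup.coe_mul]
      simp only [sub_mul, mul_sub, Algebra.smul_mul_assoc, Algebra.mul_smul_comm, one_mul, mul_one]
      rw [smul_sub, smul_sub, smul_comm a b]
      abel
    rw [e1, sub_mul, ← Matrix.SpecialLinearGroup.coe_mul, ← Matrix.SpecialLinearGroup.coe_mul,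
      show A * B * (A⁻¹ * B⁻¹) = C by rw [hC]; group,
      show B * A * (A⁻¹ * B⁻¹) = 1 by group]
    simp
  have hXY : frobSq (X * Y - Y * X) ≤ 4 * (disp A * disp B) := by
    have e1 := frobSq_sub_le (X * Y) (Y * X)
    have e2 := frobSq_mul_le X Y
    have e3 := frobSq_mul_le Y X
    have e4 : frobSq X * frobSq Y ≤ disp A * disp B :=
      mul_le_mul ha hb (frobSq_nonneg _) ((frobSq_nonneg _).trans ha)
    linarith [mul_comm (frobSq X) (frobSq Y)]
  have hinv (M : SL(2, ℝ)) :
      frobSq ((M⁻¹ : SL(2, ℝ)) : Matrix (Fin 2) (Fin 2) ℝ) = frobSq M := by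
    simp [frobSq, Matrix.SpecialLinearGroup.coe_inv, Matrix.adjugate_fin_two]
    ring
  have hI : frobSq ((A⁻¹ * B⁻¹ : SL(2, ℝ)) : Matrix (Fin 2) (Fin 2) ℝ) ≤ 9 := by
    rw [Matrix.SpecialLinearGroup.coe_mul]
    refine (frobSq_mul_le _ _).trans ?_
    rw [hinv, hinv, frobSq_eq, frobSq_eq]
    have : 0 ≤ disp (A : Matrix (Fin 2) (Fin 2) ℝ) := (frobSq_nonneg _).trans ha
    have : 0 ≤ disp (B : Matrix (Fin 2) (Fin 2) ℝ) := (frobSq_nonneg _).trans hb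
    nlinarith
  have hC2 : frobSq ((C : Matrix (Fin 2) (Fin 2) ℝ) - 1) ≤ 36 * (disp A * disp B) := by
    rw [hC1]
    refine (frobSq_mul_le _ _).trans ?_
    have := mul_le_mul hXY hI (frobSq_nonneg _) ((frobSq_nonneg _).trans hXY)
    linarith
  have hC3 : disp (C : Matrix (Fin 2) (Fin 2) ℝ) ≤
      2 * frobSq ((C : Matrix (Fin 2) (Fin 2) ℝ) - 1) := by
    simp only [disp, frobSq, Matrix.sub_apply]
    simp
    nlinarith [sq_nonneg (C 0 1 - C 1 0), sq_nonneg (C 0 0 - 1 + (C 1 1 - 1))]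
  linarith

theorem disp_eq_sinh (A : SL(2, ℝ)) :
    disp A = (2 * Real.sinh (dist UpperHalfPlane.I (A • UpperHalfPlane.I) / 2)) ^ 2 := by
  rw [two_sinh_half_dist, div_pow, ← Complex.normSq_eq_norm_sq]
  simp [bilin, Complex.normSq_apply, disp]
  ring

theorem dist_commutator_lt {A B : SL(2, ℝ)} (hA : 4 ≤ tr A ^ 2) (hB : 4 ≤ tr B ^ 2) (z : ℍ)
    (h0 : 0 < dist z (A • z)) (h1 : dist z (A • z) ≤ 1 / 10) (h2 : dist z (B • z) ≤ 1 / 10) :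
    dist z ((A * B * A⁻¹ * B⁻¹) • z) < dist z (A • z) := by
  set σ := z.toSL2R⁻¹ with hσ
  have hσz : σ • z = UpperHalfPlane.I := by
    rw [hσ, inv_smul_eq_iff, UpperHalfPlane.toSL2R_smul_I]
  have htr (M : SL(2, ℝ)) : tr (σ * M * σ⁻¹) = tr M := by
    rw [← tr_eq_trace, ← tr_eq_trace, Matrix.SpecialLinearGroup.coe_mul, Matrix.trace_mul_comm,
      ← Matrix.SpecialLinearGroup.coe_mul, inv_mul_cancel_left]
  have hdist (M : SL(2, ℝ)) : disp ((σ * M * σ⁻¹ : SL(2, ℝ)) : Matrix (Fin 2) (Fin 2) ℝ) =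
      (2 * Real.sinh (dist z (M • z) / 2)) ^ 2 := by
    rw [disp_eq_sinh, ← hσz, dist_conj_smul]
  -- The threshold 1/10 is chosen so that `disp` is at most 1/81, which beats the constant 72 of the
  -- commutator estimate.
  have hmono {d : ℝ} (hd0 : 0 ≤ d) (hd : d ≤ 1 / 10) : (2 * Real.sinh (d / 2)) ^ 2 ≤ 1 / 81 := by
    have e1 : Real.sinh (d / 2) ≤ 1 / 18 := by
      have e2 : Real.sinh (d / 2) ≤ Real.sinh (1 / 20) := Real.sinh_le_sinh.2 (by linarith)
      have e3 : Real.sinh (1 / 20) ≤ 1 / 18 := by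
        rw [Real.sinh_eq]
        have e4 := Real.add_one_le_exp (-(1 / 20 : ℝ))
        have e5 : Real.exp (1 / 20) ≤ 20 / 19 := by
          have : Real.exp (1 / 20) = (Real.exp (-(1 / 20)))⁻¹ := by rw [Real.exp_neg, inv_inv]
          rw [this]
          refine inv_le_of_inv_le₀ (by norm_num) ?_
          norm_num at e4 ⊢
          exact e4
        norm_num at e4 e5 ⊢
        linarith
      linarith
    have e6 : 0 ≤ Real.sinh (d / 2) := Real.sinh_nonneg_iff.2 (by linarith)
    nlinarith
  have hle := disp_commutator_le (A := σ * A * σ⁻¹) (B := σ * B * σ⁻¹) (by rwa [htr])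
    (by rwa [htr]) (by rw [hdist]; linarith [hmono h0.le h1])
    (by rw [hdist]; linarith [hmono dist_nonneg h2])
  rw [show σ * A * σ⁻¹ * (σ * B * σ⁻¹) * (σ * A * σ⁻¹)⁻¹ * (σ * B * σ⁻¹)⁻¹ =
    σ * (A * B * A⁻¹ * B⁻¹) * σ⁻¹ by group, hdist, hdist, hdist] at hle
  have hs : 0 < Real.sinh (dist z (A • z) / 2) := Real.sinh_pos_iff.2 (by linarith)
  have h3 := hmono dist_nonneg h2
  have h4 : (2 * Real.sinh (dist z ((A * B * A⁻¹ * B⁻¹) • z) / 2)) ^ 2 <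
      (2 * Real.sinh (dist z (A • z) / 2)) ^ 2 := by
    have : 0 < (2 * Real.sinh (dist z (A • z) / 2)) ^ 2 := by positivity
    nlinarith
  have h5 := lt_of_pow_lt_pow_left₀ 2 (by positivity) h4
  have h6 := Real.sinh_lt_sinh.1 (lt_of_mul_lt_mul_left h5 (by norm_num))
  linarith

/-- `γ` has the smallest displacement at `z` among the nontrivial elements of `Γ`. -/
def IsMinAt (Γ : Subgroup SL(2, ℝ)) (z : ℍ) (γ : SL(2, ℝ)) : Prop :=
  γ ∈ Γ ∧ γ ≠ 1 ∧ ∀ δ ∈ Γ, δ ≠ 1 → dist z (γ • z) ≤ dist z (δ • z)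

theorem exists_isMinAt {Γ : Subgroup SL(2, ℝ)} [DiscreteTopology Γ] {γ : SL(2, ℝ)} (hγ : γ ∈ Γ)
    (h1 : γ ≠ 1) (z : ℍ) : ∃ δ, IsMinAt Γ z δ := by
  have hf := finite_dist_le Γ (isCompact_singleton (x := z)) (dist z (γ • z))
  obtain ⟨δ, ⟨⟨hδ, w, hw, hd⟩, hδ1⟩, hmin⟩ := Set.exists_min_image _ (fun δ : SL(2, ℝ) ↦ dist z (δ • z))
    (hf.subset (Set.inter_subset_left (t := {δ | δ ≠ 1}))) ⟨γ, ⟨hγ, z, rfl, le_rfl⟩, h1⟩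
  rw [Set.mem_singleton_iff] at hw
  subst hw
  refine ⟨δ, hδ, hδ1, fun ε hε hε1 ↦ ?_⟩
  rcases le_total (dist w (ε • w)) (dist w (γ • w)) with h | h
  · exact hmin ε ⟨⟨hε, w, rfl, h⟩, hε1⟩
  · exact hd.trans h

/-- Otherwise the commutator would be a nontrivial element of `Γ` that moves z by less than the
minimum. -/
theorem IsMinAt.commute {Γ : Subgroup SL(2, ℝ)} [DiscreteTopology Γ]
    (htf : ∀ γ ∈ Γ, IsOfFinOrder γ → γ = 1) {z : ℍ} {γ δ : SL(2, ℝ)} (h : IsMinAt Γ z γ)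
    (hγ : dist z (γ • z) ≤ 1 / 10) (hδ : δ ∈ Γ) (hd : dist z (δ • z) ≤ 1 / 10) :
    Commute γ δ := by
  by_contra hc
  have hC : γ * δ * γ⁻¹ * δ⁻¹ ∈ Γ :=
    Γ.mul_mem (Γ.mul_mem (Γ.mul_mem h.1 hδ) (Γ.inv_mem h.1)) (Γ.inv_mem hδ)
  have hC1 : γ * δ * γ⁻¹ * δ⁻¹ ≠ 1 := by
    intro h1
    apply hc
    rw [mul_inv_eq_one, mul_inv_eq_iff_eq_mul] at h1
    exact h1
  have := dist_commutator_lt (four_le_tr_sq htf h.1) (four_le_tr_sq htf hδ) z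
    (dist_smul_pos htf h.1 h.2.1 z) hγ hd
  exact absurd (h.2.2 _ hC hC1) (not_le.2 this)

/-! ### Normal forms and centralisers -/

theorem ext_entries {A B : SL(2, ℝ)} (h1 : A 0 0 = B 0 0) (h2 : A 0 1 = B 0 1)
    (h3 : A 1 0 = B 1 0) (h4 : A 1 1 = B 1 1) : A = B := by
  apply Matrix.SpecialLinearGroup.ext
  intro i j
  fin_cases i <;> fin_cases j <;> assumption

theorem mul_entry (A B : SL(2, ℝ)) (i j : Fin 2) :
    (A * B) i j = A i 0 * B 0 j + A i 1 * B 1 j := by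
  simp [Matrix.mul_apply, Fin.sum_univ_two]

theorem exists_of_entries (p q r s : ℝ) (h : p * s - q * r = 1) :
    ∃ τ : SL(2, ℝ), τ 0 0 = p ∧ τ 0 1 = q ∧ τ 1 0 = r ∧ τ 1 1 = s :=
  ⟨⟨!![p, q; r, s], by rw [Matrix.det_fin_two_of, h]⟩, rfl, rfl, rfl, rfl⟩

theorem posRep_eq_or (γ : SL(2, ℝ)) : posRep γ = γ ∨ posRep γ = -γ := by
  unfold posRep; split <;> simp

theorem tr_neg (γ : SL(2, ℝ)) : tr (-γ) = -tr γ := by simp [tr]; ring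

theorem abs_tr_posRep (γ : SL(2, ℝ)) : tr (posRep γ) = |tr γ| := by
  unfold posRep
  rw [tr_eq_trace]
  split_ifs with h
  · rw [abs_of_pos h]
  · rw [tr_neg, abs_of_nonpos (not_lt.1 h)]

theorem SL_neg_smul (γ : SL(2, ℝ)) (z : ℍ) : (-γ) • z = γ • z := by
  apply UpperHalfPlane.ext
  rw [coe_smul_eq, coe_smul_eq]
  simp only [autj, Matrix.SpecialLinearGroup.coe_neg, Matrix.neg_apply, Complex.ofReal_neg]
  rw [← neg_div_neg_eq]
  congr 1 <;> ring

theorem posRep_smul (γ : SL(2, ℝ)) (z : ℍ) : posRep γ • z = γ • z := by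
  rcases posRep_eq_or γ with h | h <;> rw [h]
  exact SL_neg_smul γ z

theorem normN_eq (γ : SL(2, ℝ)) : normN γ = ((|tr γ| + √(tr γ ^ 2 - 4)) / 2) ^ 2 := by
  rw [normN, tr_eq_trace]

theorem IsHyp.two_lt {γ : SL(2, ℝ)} (h : IsHyp γ) : 2 < |tr γ| := by
  rw [isHyp_iff] at h
  rw [← Real.sqrt_sq_eq_abs]
  exact Real.lt_sqrt_of_sq_lt (by linarith)

theorem IsHyp.one_lt_sqrt {γ : SL(2, ℝ)} (h : IsHyp γ) : 1 < √(normN γ) := by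
  have h2 := h.two_lt
  rw [normN_eq, Real.sqrt_sq (by positivity)]
  linarith [Real.sqrt_nonneg (tr γ ^ 2 - 4)]

theorem IsHyp.one_lt_normN {γ : SL(2, ℝ)} (h : IsHyp γ) : 1 < normN γ := by
  have := h.one_lt_sqrt
  rwa [Real.lt_sqrt zero_le_one, one_pow] at this

theorem IsHyp.sqrt_add_inv {γ : SL(2, ℝ)} (h : IsHyp γ) :
    √(normN γ) + (√(normN γ))⁻¹ = |tr γ| := by
  have h1 := h.one_lt_sqrt
  have h2 := h.two_lt
  have h3 := (isHyp_iff γ).1 h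
  have h4 : √(normN γ) = (|tr γ| + √(tr γ ^ 2 - 4)) / 2 := by
    rw [normN_eq, Real.sqrt_sq (by positivity)]
  have h5 := Real.sq_sqrt (show 0 ≤ tr γ ^ 2 - 4 by linarith)
  have h6 := sq_abs (tr γ)
  have h7 : √(normN γ) * √(normN γ) + 1 = |tr γ| * √(normN γ) := by
    rw [h4]; nlinarith
  field_simp
  linarith

/-- The diagonal matrix with entries `l`, `l⁻¹`. -/
def diagL (l : ℝ) (hl : l ≠ 0) : SL(2, ℝ) := ⟨!![l, 0; 0, l⁻¹], by simp [Matrix.det_fin_two, hl]⟩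

/-- The unipotent matrix with upper right entry `t`. -/
def unip (t : ℝ) : SL(2, ℝ) := ⟨!![1, t; 0, 1], by simp [Matrix.det_fin_two]⟩

@[simp] theorem diagL_00 (l : ℝ) (hl : l ≠ 0) : diagL l hl 0 0 = l := rfl
@[simp] theorem diagL_01 (l : ℝ) (hl : l ≠ 0) : diagL l hl 0 1 = 0 := rfl
@[simp] theorem diagL_10 (l : ℝ) (hl : l ≠ 0) : diagL l hl 1 0 = 0 := rfl
@[simp] theorem diagL_11 (l : ℝ) (hl : l ≠ 0) : diagL l hl 1 1 = l⁻¹ := rfl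
@[simp] theorem unip_00 (t : ℝ) : unip t 0 0 = 1 := rfl
@[simp] theorem unip_01 (t : ℝ) : unip t 0 1 = t := rfl
@[simp] theorem unip_10 (t : ℝ) : unip t 1 0 = 0 := rfl
@[simp] theorem unip_11 (t : ℝ) : unip t 1 1 = 1 := rfl

/-- The rows of τ are left eigenvectors of γ for l and l⁻¹, scaled to determinant 1. The general
formula for them divides by the lower left entry, so upper triangular γ is treated separately. -/
theorem exists_diag_conj {γ : SL(2, ℝ)} {l : ℝ} (hl : 1 < l) (ht : tr γ = l + l⁻¹) :
    ∃ τ : SL(2, ℝ), τ * γ * τ⁻¹ = diagL l (by positivity) := by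
  have hd := det_entries γ
  have hl0 : l ≠ 0 := by positivity
  have hll : l⁻¹ < 1 := inv_lt_one_of_one_lt₀ hl
  have hm : l * l⁻¹ = 1 := mul_inv_cancel₀ hl0
  obtain ⟨u, hu⟩ : ∃ u, u = l⁻¹ := ⟨_, rfl⟩
  rw [← hu] at ht hll hm
  simp only [tr] at ht
  have hD : γ 1 1 = l + u - γ 0 0 := by linarith
  suffices ∃ τ : SL(2, ℝ), τ * γ = diagL l (by positivity) * τ by
    obtain ⟨τ, h⟩ := this
    exact ⟨τ, by rw [h, mul_inv_cancel_right]⟩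
  have key (p q r t : ℝ) (hdet : p * t - q * r = 1)
      (e1 : p * γ 0 0 + q * γ 1 0 = l * p) (e2 : p * γ 0 1 + q * γ 1 1 = l * q)
      (e3 : r * γ 0 0 + t * γ 1 0 = u * r) (e4 : r * γ 0 1 + t * γ 1 1 = u * t) :
      ∃ τ : SL(2, ℝ), τ * γ = diagL l (by positivity) * τ := by
    obtain ⟨τ, h1, h2, h3, h4⟩ := exists_of_entries p q r t hdet
    refine ⟨τ, ?_⟩
    apply ext_entries <;> simp only [mul_entry, diagL_00, diagL_01, diagL_10, diagL_11, h1, h2, h3,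
      h4, e1, e2, e3, e4, ← hu] <;> ring
  by_cases hc : γ 1 0 = 0
  · have hprod : (γ 0 0 - l) * (γ 0 0 - u) = 0 := by
      rw [hc, hD] at hd; linear_combination -hd + hm
    rcases mul_eq_zero.1 hprod with h | h
    · have ha : γ 0 0 = l := by linarith
      have hdd : γ 1 1 = u := by linarith
      have hne : l - u ≠ 0 := by linarith
      refine key 1 (γ 0 1 / (l - u)) 0 1 (by ring) ?_ ?_ ?_ ?_
      · rw [hc, ha]; ring
      · rw [hdd]; field_simp; ring
      · rw [hc]; ring
      · rw [hdd]; ring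
    · have ha : γ 0 0 = u := by linarith
      have hdd : γ 1 1 = l := by linarith
      have hne : u - l ≠ 0 := by linarith
      refine key 0 1 (-1) (-(γ 0 1 / (u - l))) (by ring) ?_ ?_ ?_ ?_
      · rw [hc]; ring
      · rw [hdd]; ring
      · rw [hc, ha]; ring
      · rw [hdd]; field_simp; ring
  · have hne : γ 1 0 * (u - l) ≠ 0 := mul_ne_zero hc (by linarith)
    have hb : γ 0 1 = (γ 0 0 * (l + u - γ 0 0) - 1) / γ 1 0 := by
      rw [hD] at hd; field_simp; linear_combination -hd
    have hne2 : u - l ≠ 0 := by linarith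
    refine key (γ 1 0 / (γ 1 0 * (u - l))) ((l - γ 0 0) / (γ 1 0 * (u - l))) (γ 1 0)
      (u - γ 0 0) ?_ ?_ ?_ ?_ ?_
    · field_simp; ring
    · field_simp; ring
    · rw [hb, hD]; field_simp; linear_combination hm
    · ring
    · rw [hb, hD]; field_simp; linear_combination hm

theorem IsHyp.exists_diag {γ : SL(2, ℝ)} (h : IsHyp γ) :
    ∃ τ : SL(2, ℝ), τ * posRep γ * τ⁻¹ =
      diagL (√(normN γ)) (zero_lt_one.trans h.one_lt_sqrt).ne' :=
  exists_diag_conj h.one_lt_sqrt (by rw [abs_tr_posRep, h.sqrt_add_inv])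

/-- The second row of τ is a left fixed vector of γ, and the square root in its scaling normalises t
to modulus 1. The sign of t is invariant under conjugation in SL(2, ℝ), so both values occur. -/
theorem exists_unip_conj {γ : SL(2, ℝ)} (ht : tr γ = 2) (h1 : γ ≠ 1) :
    ∃ (τ : SL(2, ℝ)) (t : ℝ), (t = 1 ∨ t = -1) ∧ τ * γ * τ⁻¹ = unip t := by
  have hd := det_entries γ
  simp only [tr] at ht
  have hD : γ 1 1 = 2 - γ 0 0 := by linarith
  suffices ∃ (τ : SL(2, ℝ)) (t : ℝ), (t = 1 ∨ t = -1) ∧ τ * γ = unip t * τ by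
    obtain ⟨τ, t, h, h'⟩ := this
    exact ⟨τ, t, h, by rw [h', mul_inv_cancel_right]⟩
  have key (p q r s t : ℝ) (h : t = 1 ∨ t = -1) (hdet : p * s - q * r = 1)
      (e1 : p * γ 0 0 + q * γ 1 0 = p + t * r) (e2 : p * γ 0 1 + q * γ 1 1 = q + t * s)
      (e3 : r * γ 0 0 + s * γ 1 0 = r) (e4 : r * γ 0 1 + s * γ 1 1 = s) :
      ∃ (τ : SL(2, ℝ)) (t : ℝ), (t = 1 ∨ t = -1) ∧ τ * γ = unip t * τ := by
    obtain ⟨τ, h1, h2, h3, h4⟩ := exists_of_entries p q r s hdet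
    refine ⟨τ, t, h, ?_⟩
    apply ext_entries <;> simp only [mul_entry, unip_00, unip_01, unip_10, unip_11, h1, h2, h3,
      h4, e1, e2, e3, e4] <;> ring
  by_cases hc : γ 1 0 = 0
  · have ha : γ 0 0 = 1 := by
      have : (γ 0 0 - 1) ^ 2 = 0 := by rw [hc, hD] at hd; linear_combination -hd
      have := pow_eq_zero_iff (two_ne_zero) |>.1 this
      linarith
    have hdd : γ 1 1 = 1 := by linarith
    have hb : γ 0 1 ≠ 0 := fun hb ↦ h1 (ext_entries (by simpa using ha) (by simpa using hb)
      (by simpa using hc) (by simpa using hdd))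
    have hs : √|γ 0 1| ^ 2 = |γ 0 1| := Real.sq_sqrt (abs_nonneg _)
    have hs0 : √|γ 0 1| ≠ 0 := by simpa using hb
    set u := √|γ 0 1|
    rcases lt_or_gt_of_ne hb with h | h
    · rw [abs_of_neg h] at hs
      refine key u⁻¹ 0 0 u (-1) (Or.inr rfl) ?_ ?_ ?_ ?_ ?_
      · field_simp; ring
      · rw [ha, hc]; ring
      · rw [hdd]; field_simp; linear_combination hs
      · rw [ha, hc]; ring
      · rw [hdd]; ring
    · rw [abs_of_pos h] at hs
      refine key u⁻¹ 0 0 u 1 (Or.inl rfl) ?_ ?_ ?_ ?_ ?_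
      · field_simp; ring
      · rw [ha, hc]; ring
      · rw [hdd]; field_simp; linear_combination -hs
      · rw [ha, hc]; ring
      · rw [hdd]; ring
  · have hb : γ 0 1 = -(γ 0 0 - 1) ^ 2 / γ 1 0 := by
      rw [hD] at hd; field_simp; linarith
    have hs : √|γ 1 0| ^ 2 = |γ 1 0| := Real.sq_sqrt (abs_nonneg _)
    have hs0 : √|γ 1 0| ≠ 0 := by simpa using hc
    set u := √|γ 1 0|
    rcases lt_or_gt_of_ne hc with h | h
    · rw [abs_of_neg h] at hs
      have hcu : γ 1 0 = -u ^ 2 := by linarith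
      rw [hcu] at hb
      refine key 0 u⁻¹ (-u) ((1 - γ 0 0) / u) 1 (Or.inl rfl) ?_ ?_ ?_ ?_ ?_
      · field_simp; ring
      · rw [hcu]; field_simp; ring
      · rw [hb, hD]; field_simp; ring
      · rw [hcu]; field_simp; ring
      · rw [hb, hD]; field_simp; ring
    · rw [abs_of_pos h] at hs
      have hcu : γ 1 0 = u ^ 2 := by linarith
      rw [hcu] at hb
      refine key 0 (-u⁻¹) u ((1 - γ 0 0) / u) (-1) (Or.inr rfl) ?_ ?_ ?_ ?_ ?_
      · field_simp; ring
      · rw [hcu]; field_simp; ring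
      · rw [hb, hD]; field_simp; ring
      · rw [hcu]; field_simp; ring
      · rw [hb, hD]; field_simp; ring

theorem commute_posRep {γ δ : SL(2, ℝ)} (h : Commute δ γ) : Commute δ (posRep γ) := by
  rcases posRep_eq_or γ with h' | h' <;> rw [h']
  · exact h
  · exact h.neg_right

theorem commute_conj {γ δ : SL(2, ℝ)} (τ : SL(2, ℝ)) (h : Commute δ γ) :
    Commute (τ * δ * τ⁻¹) (τ * γ * τ⁻¹) := by
  rw [Commute, SemiconjBy]
  calc τ * δ * τ⁻¹ * (τ * γ * τ⁻¹) = τ * (δ * γ) * τ⁻¹ := by group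
    _ = τ * (γ * δ) * τ⁻¹ := by rw [h.eq]
    _ = _ := by group

theorem commute_diagL {l : ℝ} (hl : 1 < l) (hl0 : l ≠ 0) {A : SL(2, ℝ)}
    (h : Commute A (diagL l hl0)) : A 0 1 = 0 ∧ A 1 0 = 0 := by
  have hll : l⁻¹ < 1 := inv_lt_one_of_one_lt₀ hl
  have h1 := congrArg (fun M : SL(2, ℝ) ↦ M 0 1) h.eq
  have h2 := congrArg (fun M : SL(2, ℝ) ↦ M 1 0) h.eq
  simp only [mul_entry, diagL_00, diagL_01, diagL_10, diagL_11] at h1 h2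
  have hne : l - l⁻¹ ≠ 0 := by linarith
  constructor
  · exact (mul_eq_zero.1 (show A 0 1 * (l - l⁻¹) = 0 by linarith)).resolve_right hne
  · exact (mul_eq_zero.1 (show A 1 0 * (l - l⁻¹) = 0 by linarith)).resolve_right hne

theorem commute_unip {t : ℝ} (ht : t ≠ 0) {A : SL(2, ℝ)}
    (h : Commute A (unip t)) : A 1 0 = 0 ∧ A 1 1 = A 0 0 := by
  have h1 := congrArg (fun M : SL(2, ℝ) ↦ M 0 0) h.eq
  have h2 := congrArg (fun M : SL(2, ℝ) ↦ M 0 1) h.eq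
  simp only [mul_entry, unip_00, unip_01, unip_10, unip_11] at h1 h2
  constructor
  · exact (mul_eq_zero.1 (show t * A 1 0 = 0 by linarith)).resolve_left ht
  · exact (mul_left_cancel₀ ht (show t * A 1 1 = t * A 0 0 by linarith))

theorem sinh_half_dist_diag {A : SL(2, ℝ)} (h1 : A 0 1 = 0) (h2 : A 1 0 = 0) (w : ℍ) :
    Real.sinh (dist w (A • w) / 2) =
      Real.sinh (|Real.log (|A 0 0|)|) * (‖(w : ℂ)‖ / w.im) := by
  have h := two_sinh_half_dist A w
  have hd := det_entries A
  rw [h1, zero_mul, sub_zero] at hd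
  have ha : A 0 0 ≠ 0 := left_ne_zero_of_mul (hd ▸ one_ne_zero)
  have hi : A 1 1 = (A 0 0)⁻¹ := eq_inv_of_mul_eq_one_right hd
  have hb : bilin A w w = ((A 1 1 - A 0 0 : ℝ) : ℂ) * w := by
    simp [bilin, h1, h2]; ring
  rw [hb, norm_mul, Complex.norm_real, Real.norm_eq_abs] at h
  have hs : |A 1 1 - A 0 0| = 2 * Real.sinh (|Real.log (|A 0 0|)|) := by
    rw [← Real.abs_sinh, Real.sinh_log (abs_pos.2 ha), hi, abs_div, abs_two, mul_div_cancel₀ _ two_ne_zero, ← abs_inv]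
    rcases abs_choice (A 0 0) with h | h <;> rcases abs_choice ((A 0 0)⁻¹) with h' | h' <;>
      rw [h, h']
    · rw [abs_sub_comm]
    · rw [abs_eq_self] at h; rw [abs_eq_neg_self, inv_nonpos] at h'
      exact absurd (le_antisymm h' h) ha
    · rw [abs_eq_neg_self] at h; rw [abs_eq_self, inv_nonneg] at h'
      exact absurd (le_antisymm h h') ha
    · congr 1; ring
  rw [hs] at h
  linarith [mul_div_assoc (2 * Real.sinh (|Real.log (|A 0 0|)|)) ‖(w : ℂ)‖ w.im]

theorem sinh_half_dist_unip {A : SL(2, ℝ)} (h1 : A 1 0 = 0) (h2 : A 1 1 = A 0 0) (w : ℍ) :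
    Real.sinh (dist w (A • w) / 2) = |A 0 1| * (1 / (2 * w.im)) := by
  have h := two_sinh_half_dist A w
  have hb : bilin A w w = ((-A 0 1 : ℝ) : ℂ) := by
    simp [bilin, h1, h2]
  rw [hb, Complex.norm_real, Real.norm_eq_abs, abs_neg] at h
  have := w.im_pos
  field_simp at h ⊢
  linarith

theorem neg_conj (τ γ : SL(2, ℝ)) : τ * (-γ) * τ⁻¹ = -(τ * γ * τ⁻¹) := by
  rw [mul_neg, neg_mul]

/-- A translation character on the centraliser of a nontrivial element. -/
theorem exists_character {Γ : Subgroup SL(2, ℝ)} [DiscreteTopology Γ]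
    (htf : ∀ γ ∈ Γ, IsOfFinOrder γ → γ = 1) {γ : SL(2, ℝ)} (hγ : γ ∈ Γ) (h1 : γ ≠ 1) :
    ∃ (χ : SL(2, ℝ) → ℝ) (S : ℝ → ℝ) (ρ : ℍ → ℝ),
      (∀ δ ε, Commute δ γ → Commute ε γ → χ (δ * ε) = χ δ + χ ε) ∧ StrictMono S ∧ S 0 = 0 ∧
      (∀ z, 0 < ρ z) ∧
      (∀ δ, Commute δ γ → ∀ z, Real.sinh (dist z (δ • z) / 2) = S |χ δ| * ρ z) ∧ 0 < χ γ := by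
  by_cases hh : IsHyp γ
  · obtain ⟨τ, hτ⟩ := hh.exists_diag
    have hl := hh.one_lt_sqrt
    set l := √(normN γ)
    have key (δ) (hδ : Commute δ γ) : (τ * δ * τ⁻¹) 0 1 = 0 ∧ (τ * δ * τ⁻¹) 1 0 = 0 := by
      refine commute_diagL hl (by positivity) ?_
      rw [← hτ]; exact commute_conj τ (commute_posRep hδ)
    have hne (δ) (hδ : Commute δ γ) : (τ * δ * τ⁻¹) 0 0 ≠ 0 := by
      have := det_entries (τ * δ * τ⁻¹)
      rw [(key δ hδ).1, zero_mul, sub_zero] at this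
      exact left_ne_zero_of_mul (this ▸ one_ne_zero)
    -- After conjugation the centraliser is diagonal; the character is the logarithm of the modulus
    -- of the first eigenvalue, and the displacement factor depends only on the angular position of
    -- τz.
    refine ⟨fun δ ↦ Real.log |(τ * δ * τ⁻¹) 0 0|, Real.sinh,
      fun z ↦ ‖((τ • z : ℍ) : ℂ)‖ / (τ • z).im, ?_, Real.sinh_strictMono, Real.sinh_zero, ?_, ?_, ?_⟩
    · intro δ ε hδ hε
      have e : τ * (δ * ε) * τ⁻¹ = (τ * δ * τ⁻¹) * (τ * ε * τ⁻¹) := by group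
      dsimp only
      rw [e, mul_entry (τ * δ * τ⁻¹), (key δ hδ).1, zero_mul, add_zero, abs_mul, Real.log_mul]
      · exact abs_ne_zero.2 (hne δ hδ)
      · exact abs_ne_zero.2 (hne ε hε)
    · intro z
      exact div_pos (norm_pos_iff.2 (UpperHalfPlane.ne_zero _)) (τ • z).im_pos
    · intro δ hδ z
      rw [← dist_conj_smul τ, sinh_half_dist_diag (key δ hδ).1 (key δ hδ).2]
    · have : |(τ * γ * τ⁻¹) 0 0| = l := by
        rcases posRep_eq_or γ with h | h <;> rw [h] at hτ
        · rw [hτ, diagL_00, abs_of_pos (by linarith)]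
        · rw [neg_conj] at hτ
          rw [← neg_neg (τ * γ * τ⁻¹), hτ]
          simp only [Matrix.SpecialLinearGroup.coe_neg, Matrix.neg_apply, diagL_00, abs_neg]
          exact abs_of_pos (by linarith)
      show 0 < Real.log |(τ * γ * τ⁻¹) 0 0|
      rw [this]; exact Real.log_pos hl
  · have htr : tr (posRep γ) = 2 := by
      have h4 := four_le_tr_sq htf hγ
      rw [isHyp_iff, not_lt] at hh
      rw [abs_tr_posRep, ← Real.sqrt_sq_eq_abs, le_antisymm hh h4,
        show (4 : ℝ) = 2 ^ 2 by norm_num, Real.sqrt_sq (by norm_num)]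
    have hp1 : posRep γ ≠ 1 := by
      rcases posRep_eq_or γ with h | h <;> rw [h]
      · exact h1
      · intro h'
        exact neg_one_notMem htf (by rw [← h', neg_neg]; exact hγ)
    obtain ⟨τ, t, ht, hτ⟩ := exists_unip_conj htr hp1
    have ht0 : t ≠ 0 := by rcases ht with rfl | rfl <;> norm_num
    have htt : t * t = 1 := by rcases ht with rfl | rfl <;> norm_num
    have key (δ) (hδ : Commute δ γ) :
        (τ * δ * τ⁻¹) 1 0 = 0 ∧ (τ * δ * τ⁻¹) 1 1 = (τ * δ * τ⁻¹) 0 0 := by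
      refine commute_unip ht0 ?_
      rw [← hτ]; exact commute_conj τ (commute_posRep hδ)
    have hsq (δ) (hδ : Commute δ γ) : (τ * δ * τ⁻¹) 0 0 * (τ * δ * τ⁻¹) 0 0 = 1 := by
      have := det_entries (τ * δ * τ⁻¹)
      rwa [(key δ hδ).1, (key δ hδ).2, mul_zero, sub_zero] at this
    -- After conjugation the centraliser consists of ± unipotent matrices. The diagonal entry ±1
    -- removes the sign ambiguity, and the factor t makes the value at γ positive.
    refine ⟨fun δ ↦ t * (τ * δ * τ⁻¹) 0 1 * (τ * δ * τ⁻¹) 0 0, id,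
      fun z ↦ 1 / (2 * (τ • z).im), ?_, strictMono_id, rfl, ?_, ?_, ?_⟩
    · intro δ ε hδ hε
      have e : τ * (δ * ε) * τ⁻¹ = (τ * δ * τ⁻¹) * (τ * ε * τ⁻¹) := by group
      have e1 := hsq δ hδ
      have e2 := hsq ε hε
      dsimp only
      rw [e, mul_entry (τ * δ * τ⁻¹), mul_entry (τ * δ * τ⁻¹), (key ε hε).1, (key ε hε).2]
      linear_combination t * (τ * ε * τ⁻¹) 0 1 * (τ * ε * τ⁻¹) 0 0 * e1 +
        t * (τ * δ * τ⁻¹) 0 1 * (τ * δ * τ⁻¹) 0 0 * e2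
    · intro z
      have := (τ • z).im_pos
      positivity
    · intro δ hδ z
      rw [← dist_conj_smul τ, sinh_half_dist_unip (key δ hδ).1 (key δ hδ).2]
      have e1 : |t| = 1 := by rcases ht with rfl | rfl <;> norm_num
      have e2 : |(τ * δ * τ⁻¹) 0 0| = 1 := by
        have := congrArg abs (hsq δ hδ)
        rw [abs_mul, abs_one] at this
        nlinarith [abs_nonneg ((τ * δ * τ⁻¹) 0 0)]
      simp only [id, abs_mul, e1, e2, one_mul, mul_one]
    · rcases posRep_eq_or γ with h | h <;> rw [h] at hτ
      · dsimp only
        rw [hτ, unip_01, unip_00, htt]; norm_num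
      · rw [neg_conj] at hτ
        dsimp only
        rw [← neg_neg (τ * γ * τ⁻¹), hτ]
        simp [htt]

/-- `γ` generates its centraliser in `Γ`, and its displacement is minimal among its powers. -/
structure IsGen (Γ : Subgroup SL(2, ℝ)) (γ : SL(2, ℝ)) : Prop where
  mem : γ ∈ Γ
  ne_one : γ ≠ 1
  exists_zpow : ∀ δ ∈ Γ, Commute δ γ → ∃ n : ℤ, δ = γ ^ n
  dist_le : ∀ n : ℤ, n ≠ 0 → ∀ z : ℍ, dist z (γ • z) ≤ dist z (γ ^ n • z)

/-- The translation character is injective on the centraliser in `Γ`, and by discreteness it takes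
finitely many values in (0, χ(γ)]; an element with the smallest positive value generates by division
with remainder. Displacement grows with |χ|, so powers of the generator move no point less than the
generator does. -/
theorem exists_isGen {Γ : Subgroup SL(2, ℝ)} [DiscreteTopology Γ]
    (htf : ∀ γ ∈ Γ, IsOfFinOrder γ → γ = 1) {γ : SL(2, ℝ)} (hγ : γ ∈ Γ) (h1 : γ ≠ 1) :
    ∃ γ₀, IsGen Γ γ₀ ∧ ∃ m : ℕ, 0 < m ∧ γ = γ₀ ^ m := by
  obtain ⟨χ, S, ρ, hadd, hS, hS0, hρ, hdist, hχ⟩ := exists_character htf hγ h1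
  have hz (δ) (hδ : δ ∈ Γ) (hc : Commute δ γ) (h0 : χ δ = 0) : δ = 1 := by
    by_contra hne
    have e1 := hdist δ hc UpperHalfPlane.I
    rw [h0, abs_zero, hS0, zero_mul, Real.sinh_eq_zero] at e1
    linarith [dist_smul_pos htf hδ hne UpperHalfPlane.I]
  have hone : χ 1 = 0 := by
    have := hadd 1 1 (Commute.one_left _) (Commute.one_left _)
    rw [one_mul] at this; linarith
  have hinv (δ) (hc : Commute δ γ) : χ δ⁻¹ = -χ δ := by
    have := hadd δ δ⁻¹ hc hc.inv_left
    rw [mul_inv_cancel, hone] at this; linarith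
  have hpow (δ) (hc : Commute δ γ) (n : ℕ) : χ (δ ^ n) = n * χ δ := by
    induction n with
    | zero => simp [hone]
    | succ n ih => rw [pow_succ, hadd _ _ (hc.pow_left n) hc, ih]; push_cast; ring
  have hzpow (δ) (hc : Commute δ γ) (n : ℤ) : χ (δ ^ n) = n * χ δ := by
    obtain ⟨m, rfl | rfl⟩ := n.eq_nat_or_neg
    · rw [zpow_natCast, hpow δ hc]; simp
    · rw [zpow_neg, zpow_natCast, hinv _ (hc.pow_left m), hpow δ hc]; simp
  have hfin : {δ | (δ ∈ Γ ∧ Commute δ γ) ∧ 0 < χ δ ∧ χ δ ≤ χ γ}.Finite := by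
    refine (finite_dist_le Γ (isCompact_singleton (x := UpperHalfPlane.I))
      (2 * (S (χ γ) * ρ UpperHalfPlane.I))).subset ?_
    rintro δ ⟨⟨hδ, hc⟩, h0, hle⟩
    refine ⟨hδ, _, rfl, ?_⟩
    have e1 := hdist δ hc UpperHalfPlane.I
    rw [abs_of_pos h0] at e1
    have e2 : S (χ δ) * ρ UpperHalfPlane.I ≤ S (χ γ) * ρ UpperHalfPlane.I :=
      mul_le_mul_of_nonneg_right (hS.monotone hle) (hρ _).le
    have e3 : dist UpperHalfPlane.I (δ • UpperHalfPlane.I) / 2 ≤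
        Real.sinh (dist UpperHalfPlane.I (δ • UpperHalfPlane.I) / 2) :=
      Real.self_le_sinh_iff.2 (by positivity)
    linarith
  obtain ⟨γ₀, ⟨⟨hγ₀, hc₀⟩, hpos, hle⟩, hmin⟩ := Set.exists_min_image _ χ hfin
    ⟨γ, ⟨hγ, Commute.refl γ⟩, hχ, le_rfl⟩
  have hgen (δ) (hδ : δ ∈ Γ) (hc : Commute δ γ) : δ = γ₀ ^ ⌊χ δ / χ γ₀⌋ := by
    set n := ⌊χ δ / χ γ₀⌋
    have hcn : Commute (γ₀ ^ n)⁻¹ γ := (hc₀.zpow_left n).inv_left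
    have e1 : χ (δ * (γ₀ ^ n)⁻¹) = χ δ - n * χ γ₀ := by
      rw [hadd _ _ hc hcn, hinv _ (hc₀.zpow_left n), hzpow _ hc₀]; ring
    have e2 : (n : ℝ) * χ γ₀ ≤ χ δ := (le_div_iff₀ hpos).1 (Int.floor_le _)
    have e3 : χ δ < (n + 1) * χ γ₀ := (div_lt_iff₀ hpos).1 (Int.lt_floor_add_one _)
    have hmem : δ * (γ₀ ^ n)⁻¹ ∈ Γ := Γ.mul_mem hδ (Γ.inv_mem (Γ.zpow_mem hγ₀ n))
    rw [← mul_inv_eq_one]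
    refine hz _ hmem (hc.mul_left hcn) ?_
    by_contra hne
    have e4 : 0 < χ (δ * (γ₀ ^ n)⁻¹) := lt_of_le_of_ne (by rw [e1]; linarith) (Ne.symm hne)
    have := hmin _ ⟨⟨hmem, hc.mul_left hcn⟩, e4, by rw [e1]; linarith⟩
    rw [e1] at this; linarith
  have hγn := hgen γ hγ (Commute.refl γ)
  have hnpos : 0 < ⌊χ γ / χ γ₀⌋ := by
    rw [Int.floor_pos, le_div_iff₀ hpos]; linarith
  obtain ⟨m, hm⟩ := Int.eq_ofNat_of_zero_le hnpos.le
  rw [hm, zpow_natCast] at hγn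
  refine ⟨γ₀, ⟨hγ₀, ?_, fun δ hδ hc ↦ ⟨_, hgen δ hδ ?_⟩, fun n hn z ↦ ?_⟩, m, by omega, hγn⟩
  · rintro rfl; rw [hone] at hpos; exact lt_irrefl _ hpos
  · rw [hγn]; exact hc.pow_right m
  · have e1 := hdist γ₀ hc₀ z
    have e2 := hdist _ (hc₀.zpow_left n) z
    rw [hzpow _ hc₀, abs_mul] at e2
    have e3 : |χ γ₀| ≤ |(n : ℝ)| * |χ γ₀| := by
      have : (1 : ℝ) ≤ |(n : ℝ)| := by exact_mod_cast Int.one_le_abs hn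
      nlinarith [abs_nonneg (χ γ₀)]
    have e4 := mul_le_mul_of_nonneg_right (hS.monotone e3) (hρ z).le
    rw [← e1, ← e2] at e4
    linarith [Real.sinh_le_sinh.1 e4]

/-- Every nontrivial element of `Γ` displaces `z` by at least `ε`. -/
def Thick (Γ : Subgroup SL(2, ℝ)) (ε : ℝ) (z : ℍ) : Prop :=
  ∀ γ ∈ Γ, γ ≠ 1 → ε ≤ dist z (γ • z)

/-- The element of smallest displacement at w commutes with γ, hence is a power of γ, and such a
power moves w at least as far as γ. -/
theorem IsGen.thick {Γ : Subgroup SL(2, ℝ)} [DiscreteTopology Γ]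
    (htf : ∀ γ ∈ Γ, IsOfFinOrder γ → γ = 1) {γ : SL(2, ℝ)} (h : IsGen Γ γ) {w : ℍ}
    (hw : dist w (γ • w) ≤ 1 / 10) : Thick Γ (dist w (γ • w)) w := by
  obtain ⟨δ, hδ⟩ := exists_isMinAt h.mem h.ne_one w
  have h1 := hδ.2.2 γ h.mem h.ne_one
  obtain ⟨n, hn⟩ := h.exists_zpow δ hδ.1 (hδ.commute htf (h1.trans hw) h.mem hw)
  have hn0 : n ≠ 0 := by rintro rfl; exact hδ.2.1 (by rw [hn, zpow_zero])
  intro ε hε hε1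
  exact (h.dist_le n hn0 w).trans (hn ▸ hδ.2.2 ε hε hε1)

/-! ### Volumes of balls and the thick part -/

instance : SMulInvariantMeasure SL(2, ℝ) ℍ volume :=
  ⟨fun c _ hs ↦ SMulInvariantMeasure.measure_preimage_smul (c : GL (Fin 2) ℝ) hs⟩

theorem volume_ball_eq (z : ℍ) (r : ℝ) :
    volume (Metric.ball z r) = volume (Metric.ball UpperHalfPlane.I r) := by
  rw [← UpperHalfPlane.toSL2R_smul_I z, ← Metric.smul_ball, measure_smul]

/-- By invariance the centre is i. The Euclidean disc of radius r/4 about i lies in the ball, and y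
< 5/4 on it. -/
theorem volume_ball_ge {r : ℝ} (hr : 0 < r) (hr1 : r ≤ 1) (z : ℍ) :
    ENNReal.ofReal (r ^ 2 / 10) ≤ volume (Metric.ball z r) := by
  rw [volume_ball_eq, UpperHalfPlane.volume_eq_lintegral]
  have hsub : Metric.ball Complex.I (r / 4) ⊆
      UpperHalfPlane.coe '' Metric.ball UpperHalfPlane.I r := by
    intro w hw
    rw [Metric.mem_ball, Complex.dist_eq] at hw
    have him := (Complex.abs_im_le_norm (w - Complex.I)).trans_lt hw
    rw [Complex.sub_im, Complex.I_im, abs_lt] at him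
    refine ⟨⟨w, by linarith⟩, ?_, rfl⟩
    rw [Metric.mem_ball]
    refine (UpperHalfPlane.dist_le_dist_coe_div_sqrt _ _).trans_lt ?_
    have e1 : (1 : ℝ) / 2 ≤ √((⟨w, by linarith⟩ : ℍ).im * UpperHalfPlane.I.im) := by
      refine Real.le_sqrt_of_sq_le ?_
      rw [UpperHalfPlane.I_im, mul_one]
      show ((1 : ℝ) / 2) ^ 2 ≤ w.im
      linarith
    rw [div_lt_iff₀ (by linarith)]
    have e2 : dist (((⟨w, by linarith⟩ : ℍ)) : ℂ) (UpperHalfPlane.I : ℍ) < r / 4 := by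
      rw [Complex.dist_eq]; exact hw
    nlinarith
  refine le_trans ?_ (lintegral_mono_set hsub)
  have hle : ∀ w ∈ Metric.ball Complex.I (r / 4),
      ENNReal.ofReal (16 / 25) ≤ ((((1 / ‖w.im‖₊) ^ 2 : NNReal)) : ENNReal) := by
    intro w hw
    rw [Metric.mem_ball, Complex.dist_eq] at hw
    have him := (Complex.abs_im_le_norm (w - Complex.I)).trans_lt hw
    rw [Complex.sub_im, Complex.I_im, abs_lt] at him
    rw [ENNReal.ofReal, ENNReal.coe_le_coe, Real.toNNReal_le_iff_le_coe]
    have h0 : 0 < w.im := by linarith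
    push_cast
    rw [Real.norm_of_nonneg h0.le, div_pow, one_pow, div_le_div_iff₀ (by norm_num) (by positivity)]
    nlinarith
  refine le_trans ?_ (setLIntegral_mono' measurableSet_ball hle)
  rw [setLIntegral_const, Complex.volume_ball]
  rw [← ENNReal.ofReal_pow (by positivity), ← ENNReal.ofReal_coe_nnreal, ← ENNReal.ofReal_mul (by positivity),
    ← ENNReal.ofReal_mul (by positivity)]
  refine ENNReal.ofReal_le_ofReal ?_
  have : (3 : ℝ) < Real.pi := Real.pi_gt_three
  simp only [NNReal.coe_real_pi]
  nlinarith [sq_nonneg r]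

theorem volume_ball_pos (z : ℍ) {r : ℝ} (hr : 0 < r) : 0 < volume (Metric.ball z r) := by
  have h : 0 < min r 1 := lt_min hr one_pos
  refine lt_of_lt_of_le ?_ ((volume_ball_ge h (min_le_right _ _) z).trans
    (measure_mono (Metric.ball_subset_ball (min_le_left _ _))))
  rw [ENNReal.ofReal_pos]; positivity

theorem countable_of_discrete (Γ : Subgroup SL(2, ℝ)) [DiscreteTopology Γ] : Countable Γ := by
  have h : (Γ : Set SL(2, ℝ)) ⊆ ⋃ n : ℕ, {γ : SL(2, ℝ) | γ ∈ Γ ∧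
      ∃ z ∈ ({UpperHalfPlane.I} : Set ℍ), dist z (γ • z) ≤ n} := by
    intro γ hγ
    obtain ⟨n, hn⟩ := exists_nat_ge (dist UpperHalfPlane.I (γ • UpperHalfPlane.I))
    exact Set.mem_iUnion.2 ⟨n, hγ, _, rfl, hn⟩
  exact ((Set.countable_iUnion fun n : ℕ ↦
    (finite_dist_le Γ isCompact_singleton (n : ℝ)).countable).mono h).to_subtype

/-- A packing argument. Around thick points whose orbits are ε-separated, the balls of radius ε/2
and all their translates are disjoint, so finite covolume bounds the number of such points. The
closed ε-balls around a maximal configuration then meet the orbit of every thick point. -/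
theorem exists_compact_thick {Γ : Subgroup SL(2, ℝ)} [DiscreteTopology Γ] {𝓕 : Set ℍ}
    (h𝓕 : IsFundamentalDomain Γ 𝓕 (volume : Measure ℍ)) (hcof : volume 𝓕 < ⊤) {ε : ℝ}
    (hε : 0 < ε) :
    ∃ K : Set ℍ, IsCompact K ∧ ∀ z, Thick Γ ε z → ∃ σ ∈ Γ, σ • z ∈ K := by
  classical
  have := countable_of_discrete Γ
  let P : Finset ℍ → Prop := fun t ↦ (∀ x ∈ t, Thick Γ ε x) ∧
    ∀ x ∈ t, ∀ y ∈ t, x ≠ y → ∀ σ ∈ Γ, ε ≤ dist x (σ • y)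
  set v := volume (Metric.ball UpperHalfPlane.I (ε / 2)) with hv
  have hv0 : v ≠ 0 := (volume_ball_pos _ (half_pos hε)).ne'
  have hbound (t : Finset ℍ) (ht : P t) : (t.card : ENNReal) * v ≤ volume 𝓕 := by
    have hU : volume (⋃ x ∈ t, Metric.ball x (ε / 2)) = t.card * v := by
      rw [measure_biUnion_finset]
      · simp [volume_ball_eq, hv]
      · intro x hx y hy hxy
        refine Metric.ball_disjoint_ball ?_
        have := ht.2 x hx y hy hxy 1 Γ.one_mem
        rw [one_smul] at this; linarith
      · exact fun _ _ ↦ measurableSet_ball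
    rw [← hU]
    refine h𝓕.measure_le_of_pairwise_disjoint
      (Finset.measurableSet_biUnion t fun _ _ ↦ measurableSet_ball).nullMeasurableSet ?_
    intro σ₁ σ₂ hne
    refine (Disjoint.mono inf_le_left inf_le_left ?_).aedisjoint
    rw [Set.disjoint_left]
    rintro _ ⟨u, hu, rfl⟩ ⟨u', hu', h⟩
    simp only [Set.mem_iUnion, Metric.mem_ball] at hu hu'
    obtain ⟨x, hx, hux⟩ := hu
    obtain ⟨y, hy, huy⟩ := hu'
    have hlt : dist x (((σ₁⁻¹ * σ₂ : Γ) : SL(2, ℝ)) • y) < ε := by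
      have e1 : u = ((σ₁⁻¹ * σ₂ : Γ) : SL(2, ℝ)) • u' := by
        have h' : (σ₂ : SL(2, ℝ)) • u' = (σ₁ : SL(2, ℝ)) • u := h
        rw [Subgroup.coe_mul, mul_smul, h', Subgroup.coe_inv, inv_smul_smul]
      calc dist x (((σ₁⁻¹ * σ₂ : Γ) : SL(2, ℝ)) • y)
          ≤ dist x u + dist u (((σ₁⁻¹ * σ₂ : Γ) : SL(2, ℝ)) • y) := dist_triangle _ _ _
        _ = dist u x + dist u' y := by rw [dist_comm x u, e1, dist_smul]
        _ < ε := by linarith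
    by_cases hxy : x = y
    · subst hxy
      refine absurd (ht.1 x hx _ (σ₁⁻¹ * σ₂ : Γ).2 ?_) (not_le.2 hlt)
      intro h1
      apply hne
      have : σ₁⁻¹ * σ₂ = 1 := Subtype.ext h1
      exact (inv_mul_eq_one.1 this)
    · exact absurd (ht.2 x hx y hy hxy _ (σ₁⁻¹ * σ₂ : Γ).2) (not_le.2 hlt)
  have hcard : ∃ N : ℕ, ∀ t, P t → t.card ≤ N := by
    have hfin : volume 𝓕 / v ≠ ⊤ := ENNReal.div_ne_top hcof.ne hv0
    obtain ⟨N, hN⟩ := ENNReal.exists_nat_gt hfin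
    refine ⟨N, fun t ht ↦ ?_⟩
    have hvt : v ≠ ⊤ := measure_ball_lt_top.ne
    have := (ENNReal.le_div_iff_mul_le (Or.inl hv0) (Or.inl hvt)).2 (hbound t ht)
    exact_mod_cast (this.trans_lt hN).le
  obtain ⟨N, hN⟩ := hcard
  obtain ⟨t, ht, hmax⟩ : ∃ t, P t ∧ ∀ t', P t' → t'.card ≤ t.card := by
    have hne : ∃ n, ∃ t, P t ∧ t.card = n := ⟨0, ∅, ⟨by simp, by simp⟩, rfl⟩
    have hb : ∀ n, (∃ t, P t ∧ t.card = n) → n ≤ N := by rintro n ⟨t, ht, rfl⟩; exact hN t ht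
    obtain ⟨t, ht, hc⟩ := Nat.findGreatest_spec (P := fun n ↦ ∃ t, P t ∧ t.card = n)
      (hb _ hne.choose_spec) hne.choose_spec
    exact ⟨t, ht, fun t' ht' ↦ hc ▸ Nat.le_findGreatest (hN t' ht') ⟨t', ht', rfl⟩⟩
  refine ⟨⋃ x ∈ t, Metric.closedBall x ε,
    t.isCompact_biUnion fun x _ ↦ isCompact_closedBall x ε, fun z hz ↦ ?_⟩
  by_contra! hcon
  have hfar (x) (hx : x ∈ t) (σ) (hσ : σ ∈ Γ) : ε ≤ dist x (σ • z) := by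
    by_contra! hlt
    refine hcon σ hσ (Set.mem_biUnion hx ?_)
    rw [Metric.mem_closedBall, dist_comm]; exact hlt.le
  have hzt : z ∉ t := by
    intro hzt
    have := hfar z hzt 1 Γ.one_mem
    rw [one_smul, dist_self] at this; linarith
  have hP : P (insert z t) := by
    refine ⟨fun x hx ↦ ?_, fun x hx y hy hxy σ hσ ↦ ?_⟩
    · rcases Finset.mem_insert.1 hx with rfl | hx
      · exact hz
      · exact ht.1 x hx
    · rcases Finset.mem_insert.1 hx with hx' | hx' <;> rcases Finset.mem_insert.1 hy with hy' | hy'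
      · exact absurd (hx'.trans hy'.symm) hxy
      · have := hfar y hy' σ⁻¹ (Γ.inv_mem hσ)
        rw [hx', dist_comm]
        rwa [← dist_smul σ, smul_inv_smul] at this
      · rw [hy']; exact hfar x hx' σ hσ
      · exact ht.2 x hx' y hy' hxy σ hσ
  have := hmax _ hP
  rw [Finset.card_insert_of_notMem hzt] at this
  omega

/-! ### Cusp forms as functions on the upper half-plane -/

/-- The properties of a cusp form of weight `4k` that are used below. -/
structure IsCuspidal (Γ : Subgroup SL(2, ℝ)) (k : ℕ) (g : ℍ → ℂ) : Prop where
  holo : DifferentiableOn ℂ (g ∘ UpperHalfPlane.ofComplex) {z | 0 < z.im}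
  smul_eq : ∀ γ ∈ Γ, ∀ z : ℍ, g (γ • z) = autj γ z ^ (4 * k) * g z
  zero_at : ∀ γ ∈ Γ, ∀ (τ : SL(2, ℝ)) (t : ℝ), t ≠ 0 → τ * posRep γ * τ⁻¹ = unip t →
    UpperHalfPlane.IsZeroAtImInfty (twist k g τ)
  twist_holo : ∀ τ : SL(2, ℝ),
    DifferentiableOn ℂ (twist k g τ ∘ UpperHalfPlane.ofComplex) {z | 0 < z.im}

theorem slash_toGL (n : ℤ) (g : ℍ → ℂ) (γ : SL(2, ℝ)) (z : ℍ) :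
    SlashAction.map n (Matrix.SpecialLinearGroup.toGL γ) g z = g (γ • z) * autj γ z ^ (-n) := by
  rw [ModularForm.slash_apply]
  have h1 : (Matrix.SpecialLinearGroup.toGL γ : GL (Fin 2) ℝ).det.val = 1 := by simp
  have h2 : UpperHalfPlane.σ (Matrix.SpecialLinearGroup.toGL γ) (g (Matrix.SpecialLinearGroup.toGL γ • z)) =
      g (γ • z) := by
    rw [UpperHalfPlane.σ, if_pos (by rw [h1]; norm_num)]; rfl
  rw [h2, h1]
  simp only [abs_one, Complex.ofReal_one, one_zpow, mul_one]
  rfl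

theorem twist_eq_slash (k : ℕ) (g : ℍ → ℂ) (τ : SL(2, ℝ)) :
    twist k g τ = SlashAction.map (4 * (k : ℤ)) (Matrix.SpecialLinearGroup.toGL τ⁻¹) g := by
  funext z
  rw [slash_toGL, twist, mul_comm]
  rfl

theorem isCuspidal_of_cuspForm {Γ : Subgroup SL(2, ℝ)} {k : ℕ} (g : CuspForms Γ k) :
    IsCuspidal Γ k g where
  holo := UpperHalfPlane.mdifferentiable_iff.1 (CuspFormClass.holo g)
  smul_eq γ hγ z := by
    have h := congrFun (SlashInvariantForm.slash_action_eqn g (Matrix.SpecialLinearGroup.toGL γ)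
      (Subgroup.mem_map_of_mem _ hγ)) z
    rw [slash_toGL, zpow_neg] at h
    have h1 : autj γ z ^ (4 * k) = autj γ z ^ (4 * (k : ℤ)) := by
      rw [← zpow_natCast]; push_cast; rfl
    rw [← h, h1]
    field_simp [autj_ne_zero γ z]
  zero_at γ hγ τ t ht hτ := by
    rw [twist_eq_slash]
    -- The relevant cusp is τ⁻¹∞, the fixed point of the parabolic element γ.
    refine CuspFormClass.zero_at_cusps g (c := (Matrix.SpecialLinearGroup.toGL τ⁻¹ : GL (Fin 2) ℝ) • OnePoint.infty) ?_ _ rfl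
    have hA : ∃ A : SL(2, ℝ), τ * γ * τ⁻¹ = A ∧ A 1 0 = 0 ∧
        (A : Matrix (Fin 2) (Fin 2) ℝ).IsParabolic := by
      have hu : (unip t : Matrix (Fin 2) (Fin 2) ℝ).IsParabolic := by
        refine ⟨?_, ?_⟩
        · rintro ⟨x, hx⟩
          have := congrArg (fun M : Matrix (Fin 2) (Fin 2) ℝ ↦ M 0 1) hx
          simp [Matrix.scalar_apply] at this
          exact ht this.symm
        · rw [Matrix.discr_fin_two, (unip t).det_coe, tr_eq_trace]
          simp [tr]; norm_num
      rcases posRep_eq_or γ with h | h <;> rw [h] at hτ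
      · exact ⟨_, hτ, rfl, hu⟩
      · rw [neg_conj] at hτ
        refine ⟨-unip t, by rw [← hτ, neg_neg], by simp, ?_⟩
        rw [Matrix.SpecialLinearGroup.coe_neg]
        exact hu.neg
    obtain ⟨A, hA, hA0, hAp⟩ := hA
    refine ⟨Matrix.SpecialLinearGroup.toGL γ, Subgroup.mem_map_of_mem _ hγ, ?_, ?_⟩
    · have e1 : (Matrix.SpecialLinearGroup.toGL A : GL (Fin 2) ℝ).IsParabolic := hAp
      rw [← hA, map_mul, map_mul, map_inv] at e1
      exact (Matrix.isParabolic_conj_iff (Matrix.SpecialLinearGroup.toGL τ)).1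
        (by simpa [Matrix.GeneralLinearGroup.IsParabolic] using e1)
    · have e1 : γ * τ⁻¹ = τ⁻¹ * A := by rw [← hA]; group
      rw [← mul_smul, ← map_mul, e1, map_mul, mul_smul]
      congr 1
      rw [OnePoint.smul_infty_eq_self_iff]
      exact hA0
  twist_holo τ := by
    rw [twist_eq_slash]
    exact UpperHalfPlane.mdifferentiable_iff.1 ((CuspFormClass.holo g).slash _ _)

theorem twist_eq (k : ℕ) (g : ℍ → ℂ) (τ : SL(2, ℝ)) (w : ℍ) :
    twist k g τ w = (autj τ⁻¹ w ^ (4 * k))⁻¹ * g (τ⁻¹ • w) := by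
  rw [twist, zpow_neg]
  congr 2

theorem autj_pow_mul_twist (k : ℕ) (g : ℍ → ℂ) (τ : SL(2, ℝ)) (w : ℍ) :
    autj τ⁻¹ w ^ (4 * k) * twist k g τ w = g (τ⁻¹ • w) := by
  rw [twist_eq, mul_inv_cancel_left₀ (pow_ne_zero _ (autj_ne_zero _ _))]

theorem IsCuspidal.twist_smul {Γ : Subgroup SL(2, ℝ)} {k : ℕ} {g : ℍ → ℂ}
    (hg : IsCuspidal Γ k g) {γ : SL(2, ℝ)} (hγ : γ ∈ Γ) (τ : SL(2, ℝ)) (w : ℍ) :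
    twist k g τ ((τ * γ * τ⁻¹) • w) = autj (τ * γ * τ⁻¹) w ^ (4 * k) * twist k g τ w := by
  set A := τ * γ * τ⁻¹ with hA
  have h1 : τ⁻¹ * A = γ * τ⁻¹ := by rw [hA]; group
  have h2 : τ⁻¹ • A • w = γ • τ⁻¹ • w := by rw [← mul_smul, h1, mul_smul]
  have h3 : autj τ⁻¹ (A • w : ℍ) * autj A w = autj γ (τ⁻¹ • w : ℍ) * autj τ⁻¹ w := by
    rw [← autj_mul, ← autj_mul, h1]
  have h4 := autj_ne_zero τ⁻¹ (A • w)
  have h5 := autj_ne_zero τ⁻¹ w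
  rw [twist_eq, twist_eq, h2, hg.smul_eq γ hγ]
  have h6 := congrArg (· ^ (4 * k)) h3
  simp only [mul_pow] at h6
  field_simp
  linear_combination (-g (τ⁻¹ • w)) * h6

/-- The matrix of positive trace need not lie in `Γ`, but the weight is even and the sign
disappears. -/
theorem IsCuspidal.twist_smul_posRep {Γ : Subgroup SL(2, ℝ)} {k : ℕ} {g : ℍ → ℂ}
    (hg : IsCuspidal Γ k g) {γ : SL(2, ℝ)} (hγ : γ ∈ Γ) (τ : SL(2, ℝ)) (w : ℍ) :
    twist k g τ ((τ * posRep γ * τ⁻¹) • w) =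
      autj (τ * posRep γ * τ⁻¹) w ^ (4 * k) * twist k g τ w := by
  rcases posRep_eq_or γ with h | h <;> rw [h]
  · exact hg.twist_smul hγ τ w
  · rw [neg_conj, SL_neg_smul, hg.twist_smul hγ]
    congr 1
    have : autj (-(τ * γ * τ⁻¹)) w = -autj (τ * γ * τ⁻¹) w := by
      simp only [autj, Matrix.SpecialLinearGroup.coe_neg, Matrix.neg_apply, Complex.ofReal_neg]
      ring
    rw [this, Even.neg_pow]
    exact ⟨2 * k, by ring⟩

/-- `y^{2k} |g(z)|`. -/
def phi (k : ℕ) (g : ℍ → ℂ) (z : ℍ) : ℝ := ‖g z‖ * z.im ^ (2 * k)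

theorem phi_twist (k : ℕ) (g : ℍ → ℂ) (τ : SL(2, ℝ)) (w : ℍ) :
    phi k (twist k g τ) w = phi k g (τ⁻¹ • w) := by
  have h5 : ‖autj τ⁻¹ w‖ ≠ 0 := by simpa using autj_ne_zero τ⁻¹ w
  rw [phi, phi, ← autj_pow_mul_twist k g τ w, norm_mul, norm_pow, im_smul_eq, div_pow,
    ← pow_mul, show 2 * (2 * k) = 4 * k by ring]
  field_simp

theorem IsCuspidal.phi_smul {Γ : Subgroup SL(2, ℝ)} {k : ℕ} {g : ℍ → ℂ}
    (hg : IsCuspidal Γ k g) {γ : SL(2, ℝ)} (hγ : γ ∈ Γ) (z : ℍ) :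
    phi k g (γ • z) = phi k g z := by
  have h5 : ‖autj γ z‖ ≠ 0 := by simpa using autj_ne_zero γ z
  rw [phi, phi, hg.smul_eq γ hγ, norm_mul, norm_pow, im_smul_eq, div_pow,
    ← pow_mul, show 2 * (2 * k) = 4 * k by ring]
  field_simp

theorem continuous_of_differentiableOn {g : ℍ → ℂ}
    (hg : DifferentiableOn ℂ (g ∘ UpperHalfPlane.ofComplex) {z | 0 < z.im}) : Continuous g := by
  have h : g = fun z : ℍ ↦ (g ∘ UpperHalfPlane.ofComplex) (z : ℂ) := by
    funext z; simp
  rw [h]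
  exact hg.continuousOn.comp_continuous UpperHalfPlane.continuous_coe fun z ↦ z.im_pos

theorem IsCuspidal.continuous {Γ : Subgroup SL(2, ℝ)} {k : ℕ} {g : ℍ → ℂ}
    (hg : IsCuspidal Γ k g) : Continuous g := continuous_of_differentiableOn hg.holo

theorem IsCuspidal.continuous_phi {Γ : Subgroup SL(2, ℝ)} {k : ℕ} {g : ℍ → ℂ}
    (hg : IsCuspidal Γ k g) : Continuous (phi k g) :=
  hg.continuous.norm.mul (UpperHalfPlane.continuous_im.pow _)

/-- Schwarz's lemma in the cusp. -/
theorem norm_le_of_cusp {F : ℍ → ℂ}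
    (hF : DifferentiableOn ℂ (F ∘ UpperHalfPlane.ofComplex) {z | 0 < z.im})
    (hper : Function.Periodic (F ∘ UpperHalfPlane.ofComplex) (1 : ℝ))
    (hzero : UpperHalfPlane.IsZeroAtImInfty F) {y₀ B : ℝ} (hy₀ : 0 < y₀)
    (hB : ∀ w : ℍ, w.im = y₀ → ‖F w‖ ≤ B) (w : ℍ) (hw : y₀ ≤ w.im) :
    ‖F w‖ ≤ B * Real.exp (-(2 * Real.pi * (w.im - y₀))) := by
  have hM := UpperHalfPlane.mdifferentiable_iff.2 hF
  have hd := UpperHalfPlane.differentiableOn_cuspFunction_ball one_pos hper hM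
    hzero.isBoundedAtImInfty
  have h0 := hzero.cuspFunction_apply_zero (h := 1) one_pos
  set f := UpperHalfPlane.cuspFunction 1 F with hf
  have hfw (w : ℍ) : f (Function.Periodic.qParam 1 w) = F w :=
    UpperHalfPlane.eq_cuspFunction w one_ne_zero hper
  set R := Real.exp (-2 * Real.pi * y₀) with hR
  have hR0 : 0 < R := Real.exp_pos _
  have hR1 : R < 1 := by
    rw [hR, Real.exp_lt_one_iff]; nlinarith [Real.pi_pos]
  -- This is f(q)/q, holomorphic also at 0 because the cusp function vanishes there. The maximum
  -- principle is applied on the disc |q| < R, whose boundary circle is the image of the line Im w =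
  -- y₀.
  have hds : DifferentiableOn ℂ (dslope f 0) (Metric.ball 0 1) :=
    (differentiableOn_dslope (Metric.ball_mem_nhds _ one_pos)).2 hd
  have hbd : ∀ q ∈ frontier (Metric.ball (0 : ℂ) R), ‖dslope f 0 q‖ ≤ B / R := by
    intro q hq
    rw [frontier_ball _ hR0.ne', mem_sphere_zero_iff_norm] at hq
    have hq0 : q ≠ 0 := by rintro rfl; rw [norm_zero] at hq; exact hR0.ne hq
    have him : (Function.Periodic.invQParam 1 q).im = y₀ := by
      rw [Function.Periodic.im_invQParam, hq, hR, Real.log_exp]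
      field_simp
    have e1 := hfw ⟨Function.Periodic.invQParam 1 q, by rw [him]; exact hy₀⟩
    have e2 := Function.Periodic.qParam_right_inv (h := 1) one_ne_zero hq0
    change f (Function.Periodic.qParam 1 (Function.Periodic.invQParam 1 q)) = _ at e1
    rw [e2] at e1
    rw [dslope_of_ne _ hq0, slope_def_field, h0, sub_zero, sub_zero, norm_div, hq, e1]
    gcongr
    exact hB _ him
  have hcl : DiffContOnCl ℂ (dslope f 0) (Metric.ball 0 R) := by
    refine (hds.mono ?_).diffContOnCl
    exact (Metric.closure_ball_subset_closedBall).trans (Metric.closedBall_subset_ball hR1)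
  have hq : ‖Function.Periodic.qParam 1 (w : ℂ)‖ = Real.exp (-2 * Real.pi * w.im) := by
    rw [Function.Periodic.norm_qParam, div_one]; rfl
  set q := Function.Periodic.qParam 1 (w : ℂ) with hqd
  have hq0 : q ≠ 0 := Function.Periodic.qParam_ne_zero _
  have hqmem : q ∈ closure (Metric.ball (0 : ℂ) R) := by
    rw [closure_ball _ hR0.ne', mem_closedBall_zero_iff, hq, hR, Real.exp_le_exp]
    nlinarith [Real.pi_pos]
  have hle := Complex.norm_le_of_forall_mem_frontier_norm_le Metric.isBounded_ball hcl hbd hqmem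
  rw [dslope_of_ne _ hq0, slope_def_field, h0, sub_zero, sub_zero, norm_div, hfw,
    div_le_iff₀ (by rw [hq]; exact Real.exp_pos _), hq] at hle
  refine hle.trans (le_of_eq ?_)
  rw [hR, div_mul_eq_mul_div, mul_div_assoc, ← Real.exp_sub]
  congr 2; ring

/-! ### Traces of powers and a lower bound for hyperbolic displacements -/

theorem tr_conj (σ γ : SL(2, ℝ)) : tr (σ * γ * σ⁻¹) = tr γ := by
  rw [← tr_eq_trace, ← tr_eq_trace, Matrix.SpecialLinearGroup.coe_mul, Matrix.trace_mul_comm,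
    ← Matrix.SpecialLinearGroup.coe_mul, inv_mul_cancel_left]

theorem unip_pow (t : ℝ) (n : ℕ) : unip t ^ n = unip (n * t) := by
  induction n with
  | zero => apply ext_entries <;> simp
  | succ n ih => rw [pow_succ, ih]; apply ext_entries <;> simp [mul_entry]; ring

theorem diagL_pow (l : ℝ) (hl : l ≠ 0) (n : ℕ) : diagL l hl ^ n = diagL (l ^ n) (pow_ne_zero n hl) := by
  induction n with
  | zero => apply ext_entries <;> simp
  | succ n ih =>
    rw [pow_succ, ih]; apply ext_entries <;> simp [mul_entry, pow_succ, mul_comm]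

theorem conj_pow_eq (τ γ : SL(2, ℝ)) (n : ℕ) : τ * γ ^ n * τ⁻¹ = (τ * γ * τ⁻¹) ^ n :=
  (_root_.conj_pow).symm

theorem posRep_pow_eq_or (γ : SL(2, ℝ)) (n : ℕ) : γ ^ n = posRep γ ^ n ∨ γ ^ n = -posRep γ ^ n := by
  rcases posRep_eq_or γ with h | h
  · rw [h]; exact Or.inl rfl
  · rw [h, neg_pow]
    rcases neg_one_pow_eq_or SL(2, ℝ) n with h' | h' <;> rw [h']
    · left; rw [one_mul]
    · right; rw [neg_one_mul, neg_neg]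

theorem tr_pow_sq (γ : SL(2, ℝ)) (n : ℕ) : tr (γ ^ n) ^ 2 = tr (posRep γ ^ n) ^ 2 := by
  rcases posRep_pow_eq_or γ n with h | h <;> rw [h]
  rw [tr_neg, neg_sq]

theorem tr_pow_sq_of_parabolic {γ : SL(2, ℝ)} (h : tr γ ^ 2 = 4) (n : ℕ) :
    tr (γ ^ n) ^ 2 = 4 := by
  rw [tr_pow_sq]
  have htr : tr (posRep γ) = 2 := by
    rw [abs_tr_posRep, ← Real.sqrt_sq_eq_abs, h,
      show (4 : ℝ) = 2 ^ 2 by norm_num, Real.sqrt_sq (by norm_num)]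
  by_cases h1 : posRep γ = 1
  · rw [h1, one_pow]; norm_num [tr]
  · obtain ⟨τ, t, -, hτ⟩ := exists_unip_conj htr h1
    rw [← tr_conj τ, conj_pow_eq, hτ, unip_pow]
    norm_num [tr]

/-- Displacements of the hyperbolic elements of `Γ` are bounded below. -/
theorem exists_hyp_dist_ge {Γ : Subgroup SL(2, ℝ)} [DiscreteTopology Γ]
    (htf : ∀ γ ∈ Γ, IsOfFinOrder γ → γ = 1) {𝓕 : Set ℍ}
    (h𝓕 : IsFundamentalDomain Γ 𝓕 (volume : Measure ℍ)) (hcof : volume 𝓕 < ⊤) :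
    ∃ ℓ : ℝ, 0 < ℓ ∧ ∀ γ ∈ Γ, IsHyp γ → ∀ z : ℍ, ℓ ≤ dist z (γ • z) := by
  obtain ⟨K, hK, hKΓ⟩ := exists_compact_thick h𝓕 hcof (ε := 1 / 10) (by norm_num)
  have hlow (γ : SL(2, ℝ)) (hh : IsHyp γ) : ∃ (τ : SL(2, ℝ)) (L : ℝ), 0 < L ∧ ∀ z : ℍ,
      Real.sinh (dist z (γ • z) / 2) = Real.sinh L * (‖((τ • z : ℍ) : ℂ)‖ / (τ • z).im) := by
    obtain ⟨τ, hτ⟩ := hh.exists_diag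
    refine ⟨τ, Real.log √(normN γ), Real.log_pos hh.one_lt_sqrt, fun z ↦ ?_⟩
    have hp : 0 < √(normN γ) := by linarith [hh.one_lt_sqrt]
    rw [← posRep_smul, ← dist_conj_smul τ, sinh_half_dist_diag (by rw [hτ]; rfl) (by rw [hτ]; rfl),
      hτ, diagL_00, abs_of_pos hp, abs_of_pos (Real.log_pos hh.one_lt_sqrt)]
  have hdist (γ : SL(2, ℝ)) (hh : IsHyp γ) : ∃ L : ℝ, 0 < L ∧ ∀ z : ℍ, L ≤ dist z (γ • z) := by
    obtain ⟨τ, L, hL, h⟩ := hlow γ hh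
    refine ⟨2 * L, by positivity, fun z ↦ ?_⟩
    have h1 := h z
    have h2 : 1 ≤ ‖((τ • z : ℍ) : ℂ)‖ / (τ • z).im := by
      rw [one_le_div (τ • z).im_pos]
      exact (le_abs_self _).trans (Complex.abs_im_le_norm _)
    have h3 : Real.sinh L ≤ Real.sinh (dist z (γ • z) / 2) := by
      rw [h1]; nlinarith [Real.sinh_pos_iff.2 hL]
    linarith [Real.sinh_le_sinh.1 h3]
  choose! L hL0 hL using hdist
  have hfin := finite_dist_le Γ hK (1 / 10)
  obtain ⟨ℓ, hℓ0, hℓ⟩ : ∃ ℓ : ℝ, 0 < ℓ ∧ ∀ γ ∈ Γ, (∃ z ∈ K, dist z (γ • z) ≤ 1 / 10) → IsHyp γ →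
      ℓ ≤ L γ := by
    have hfin2 := hfin.subset (Set.inter_subset_left (t := {γ | IsHyp γ}))
    rcases Set.eq_empty_or_nonempty ({γ : SL(2, ℝ) | γ ∈ Γ ∧ ∃ z ∈ K, dist z (γ • z) ≤ 1 / 10} ∩
      {γ | IsHyp γ}) with h | h
    · refine ⟨1, one_pos, fun γ hγ hz hh ↦ ?_⟩
      have : γ ∈ ({γ : SL(2, ℝ) | γ ∈ Γ ∧ ∃ z ∈ K, dist z (γ • z) ≤ 1 / 10} ∩
        {γ | IsHyp γ}) := ⟨⟨hγ, hz⟩, hh⟩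
      rw [h] at this; exact this.elim
    · obtain ⟨γ₁, hγ₁, hmin⟩ := Set.exists_min_image _ L hfin2 h
      exact ⟨L γ₁, hL0 _ hγ₁.2, fun γ hγ hz hh ↦ hmin γ ⟨⟨hγ, hz⟩, hh⟩⟩
  refine ⟨min ℓ (1 / 10), lt_min hℓ0 (by norm_num), fun γ hγ hh z ↦ ?_⟩
  have hne : γ ≠ 1 := by
    rintro rfl
    rw [isHyp_iff] at hh; norm_num [tr] at hh
  obtain ⟨γ₀, hgen, m, hm, rfl⟩ := exists_isGen htf hγ hne
  have hz := hgen.dist_le m (by exact_mod_cast hm.ne') z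
  rw [zpow_natCast] at hz
  refine le_trans ?_ hz
  by_contra! hlt
  have hlt1 : dist z (γ₀ • z) < 1 / 10 := hlt.trans_le (min_le_right _ _)
  have hh₀ : IsHyp γ₀ := by
    by_contra hnh
    have h4 := four_le_tr_sq htf hgen.mem
    rw [isHyp_iff, not_lt] at hnh
    have := tr_pow_sq_of_parabolic (le_antisymm hnh h4) m
    rw [isHyp_iff] at hh
    linarith
  obtain ⟨τ, l, hl, hs⟩ := hlow γ₀ hh₀
  have hsl := Real.sinh_pos_iff.2 hl
  -- Displacement grows with the distance from the axis of γ₀, so some point is moved by exactly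
  -- 1/10. In the coordinate τw the factor |τw|/Im τw must equal ρ, whence √(ρ² - 1) + i.
  obtain ⟨w, hw⟩ : ∃ w : ℍ, dist w (γ₀ • w) = 1 / 10 := by
    set ρ := Real.sinh (1 / 20) / Real.sinh l with hρ
    have h1 : 1 ≤ ρ := by
      rw [hρ, one_le_div hsl]
      have h2 : 1 ≤ ‖((τ • z : ℍ) : ℂ)‖ / (τ • z).im := by
        rw [one_le_div (τ • z).im_pos]
        exact (le_abs_self _).trans (Complex.abs_im_le_norm _)
      have h3 : Real.sinh (dist z (γ₀ • z) / 2) ≤ Real.sinh (1 / 20) :=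
        Real.sinh_le_sinh.2 (by linarith)
      rw [hs z] at h3
      nlinarith
    refine ⟨τ⁻¹ • (⟨⟨√(ρ ^ 2 - 1), 1⟩, one_pos⟩ : ℍ), ?_⟩
    have h2 := hs (τ⁻¹ • (⟨⟨√(ρ ^ 2 - 1), 1⟩, one_pos⟩ : ℍ))
    have h3 : ‖(⟨√(ρ ^ 2 - 1), 1⟩ : ℂ)‖ = ρ := by
      rw [Complex.norm_def, Complex.normSq_apply]
      have : √(ρ ^ 2 - 1) * √(ρ ^ 2 - 1) = ρ ^ 2 - 1 := Real.mul_self_sqrt (by nlinarith)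
      simp only [this]
      rw [show ρ ^ 2 - 1 + 1 * 1 = ρ ^ 2 by ring, Real.sqrt_sq (by linarith)]
    rw [smul_inv_smul] at h2
    change _ = Real.sinh l * (‖(⟨√(ρ ^ 2 - 1), 1⟩ : ℂ)‖ / 1) at h2
    rw [h3, div_one, hρ, mul_div_cancel₀ _ hsl.ne'] at h2
    have := Real.sinh_injective h2
    linarith
  -- The point w is thick, so a translate of it lies in K and a conjugate of γ₀ is among the
  -- finitely many elements that define ℓ. Its displacement is therefore at least ℓ everywhere,
  -- against the small displacement of γ₀ at z.
  have hthick := hgen.thick htf hw.le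
  rw [hw] at hthick
  obtain ⟨σ, hσ, hσK⟩ := hKΓ w hthick
  have hconj : σ * γ₀ * σ⁻¹ ∈ Γ := Γ.mul_mem (Γ.mul_mem hσ hgen.mem) (Γ.inv_mem hσ)
  have hhc : IsHyp (σ * γ₀ * σ⁻¹) := by
    rw [isHyp_iff, tr_conj]
    exact (isHyp_iff _).1 hh₀
  have h1 := hℓ _ hconj ⟨_, hσK, by rw [dist_conj_smul, hw]⟩ hhc
  have h2 := hL _ hhc (σ • z)
  rw [dist_conj_smul] at h2
  linarith [min_le_left ℓ (1 / 10)]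

/-! ### Horocyclic coordinates -/

/-- The coordinates `(t, u) ↦ e^u (t + i)`, in which the invariant measure is `dt du`. -/
def horo (p : ℝ × ℝ) : ℍ := ⟨⟨Real.exp p.2 * p.1, Real.exp p.2⟩, Real.exp_pos _⟩

@[simp] theorem horo_im (p : ℝ × ℝ) : (horo p).im = Real.exp p.2 := rfl
@[simp] theorem horo_re (p : ℝ × ℝ) : (horo p).re = Real.exp p.2 * p.1 := rfl

theorem coe_horo (p : ℝ × ℝ) : (horo p : ℂ) = Real.exp p.2 * (p.1 + I) := by
  apply Complex.ext <;> simp [horo, Complex.exp_ofReal_re, Complex.exp_ofReal_im]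

/-- Horocyclic coordinates as a homeomorphism. -/
def horoHomeo : ℝ × ℝ ≃ₜ ℍ where
  toFun := horo
  invFun z := (z.re / z.im, Real.log z.im)
  left_inv p := by
    have := Real.exp_pos p.2
    simp [this.ne']
  right_inv z := by
    have := z.im_pos
    apply UpperHalfPlane.ext
    apply Complex.ext
    · show Real.exp (Real.log z.im) * (z.re / z.im) = z.re
      rw [Real.exp_log this]; field_simp
    · show Real.exp (Real.log z.im) = z.im
      rw [Real.exp_log this]
  continuous_toFun := by
    rw [UpperHalfPlane.isEmbedding_coe.continuous_iff]
    have : (UpperHalfPlane.coe ∘ horo) = fun p : ℝ × ℝ ↦ ((Real.exp p.2 : ℝ) : ℂ) * (p.1 + I) := by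
      funext p; exact coe_horo p
    rw [this]; fun_prop
  continuous_invFun := by
    refine Continuous.prodMk (UpperHalfPlane.continuous_re.div UpperHalfPlane.continuous_im
      fun z ↦ z.im_ne_zero) (UpperHalfPlane.continuous_im.log fun z ↦ z.im_ne_zero)

/-- The Jacobian of (t, u) ↦ (e^u t, e^u) is e^{2u} = y², which cancels the density y^{-2}. -/
theorem measurePreserving_horo :
    MeasurePreserving horoHomeo (volume : Measure (ℝ × ℝ)) (volume : Measure ℍ) := by
  refine ⟨horoHomeo.measurable, ?_⟩
  ext s hs
  rw [Measure.map_apply horoHomeo.measurable hs, UpperHalfPlane.volume_eq_lintegral]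
  set F : ℝ × ℝ → ℝ × ℝ := fun p ↦ (Real.exp p.2 * p.1, Real.exp p.2) with hF
  let F' : ℝ × ℝ → (ℝ × ℝ →L[ℝ] ℝ × ℝ) := fun p ↦ LinearMap.toContinuousLinearMap
    (Matrix.toLin (Module.Basis.finTwoProd ℝ) (Module.Basis.finTwoProd ℝ)
      !![Real.exp p.2, Real.exp p.2 * p.1; 0, Real.exp p.2])
  have hder (p : ℝ × ℝ) : HasFDerivAt F (F' p) p := by
    have h1 : HasFDerivAt (fun p : ℝ × ℝ ↦ Real.exp p.2)
        (Real.exp p.2 • ContinuousLinearMap.snd ℝ ℝ ℝ) p := (hasFDerivAt_snd).exp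
    have h2 := (h1.mul (hasFDerivAt_fst (𝕜 := ℝ) (p := p))).prodMk h1
    refine h2.congr_fderiv ?_
    ext <;> simp [F', Matrix.toLin_finTwoProd_apply, mul_comm]
  have hdet (p : ℝ × ℝ) : (F' p).det = Real.exp p.2 * Real.exp p.2 := by
    simp [F', ContinuousLinearMap.det, LinearMap.det_toLin, Matrix.det_fin_two_of]
  have hinj : Set.InjOn F (horoHomeo ⁻¹' s) := by
    rintro ⟨a, b⟩ - ⟨c, d⟩ - h
    simp only [hF, Prod.mk.injEq] at h
    have h2 := Real.exp_injective h.2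
    subst h2
    simpa [(Real.exp_pos b).ne'] using h.1
  have himg : (UpperHalfPlane.coe '' s : Set ℂ) =
      Complex.measurableEquivRealProd ⁻¹' (F '' (horoHomeo ⁻¹' s)) := by
    ext w
    constructor
    · rintro ⟨z, hz, rfl⟩
      refine ⟨horoHomeo.symm z, by simpa using hz, ?_⟩
      have h1 : horo (horoHomeo.symm z) = z := horoHomeo.apply_symm_apply z
      conv_rhs => rw [← h1]
      rfl
    · rintro ⟨p, hp, hw⟩
      refine ⟨horo p, hp, ?_⟩
      apply Complex.measurableEquivRealProd.injective
      rw [← hw]; rfl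
  have hmp := Complex.volume_preserving_equiv_real_prod
  have hcv := lintegral_image_eq_lintegral_abs_det_fderiv_mul volume
    (horoHomeo.measurable hs) (fun p _ ↦ (hder p).hasFDerivWithinAt) hinj
    (fun p ↦ ((((1 / ‖p.2‖₊) ^ 2 : NNReal)) : ENNReal))
  rw [himg]
  have h3 := hmp.setLIntegral_comp_preimage_emb Complex.measurableEquivRealProd.measurableEmbedding
    (fun p : ℝ × ℝ ↦ ((((1 / ‖p.2‖₊) ^ 2 : NNReal)) : ENNReal)) (F '' (horoHomeo ⁻¹' s))
  have h4 : ∫⁻ z in Complex.measurableEquivRealProd ⁻¹' (F '' (horoHomeo ⁻¹' s)),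
      ((((1 / ‖z.im‖₊) ^ 2 : NNReal)) : ENNReal) =
      ∫⁻ p in F '' (horoHomeo ⁻¹' s), ((((1 / ‖p.2‖₊) ^ 2 : NNReal)) : ENNReal) := h3
  rw [h4, hcv, ← setLIntegral_one]
  refine lintegral_congr fun p ↦ ?_
  rw [hdet, ENNReal.ofReal, ← ENNReal.coe_mul, ← ENNReal.coe_one, ENNReal.coe_inj]
  have := Real.exp_pos p.2
  ext
  rw [NNReal.coe_mul, Real.coe_toNNReal _ (abs_nonneg _)]
  push_cast
  rw [abs_of_pos (by positivity), Real.norm_of_nonneg this.le]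
  field_simp

/-! ### Integrability of powers of the point-pair function -/

theorem rInv_horo (p : ℝ × ℝ) :
    rInv UpperHalfPlane.I (horo p) =
      (Real.cosh (p.2 / 2) ^ 2 + Real.exp p.2 * p.1 ^ 2 / 4)⁻¹ := by
  have h := rInv_eq_cosh UpperHalfPlane.I (horo p)
  have h1 := UpperHalfPlane.cosh_dist UpperHalfPlane.I (horo p)
  have h2 := Real.cosh_sq' (dist UpperHalfPlane.I (horo p) / 2)
  have h3 := Real.cosh_two_mul (dist UpperHalfPlane.I (horo p) / 2)
  have h5 := Real.cosh_sq' (p.2 / 2)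
  have h6 := Real.cosh_two_mul (p.2 / 2)
  rw [mul_div_cancel₀ _ two_ne_zero] at h3 h6
  rw [h, one_div]
  congr 1
  have hd : dist ((UpperHalfPlane.I : ℍ) : ℂ) (horo p) ^ 2 =
      (Real.exp p.2 * p.1) ^ 2 + (1 - Real.exp p.2) ^ 2 := by
    rw [Complex.dist_eq, ← Complex.normSq_eq_norm_sq, Complex.normSq_apply]
    simp [horo]
    ring
  rw [hd, UpperHalfPlane.I_im, horo_im] at h1
  have he : Real.cosh p.2 = (Real.exp p.2 + (Real.exp p.2)⁻¹) / 2 := by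
    rw [Real.cosh_eq, Real.exp_neg]
  have hpos := Real.exp_pos p.2
  have h7 : ((Real.exp p.2 * p.1) ^ 2 + (1 - Real.exp p.2) ^ 2) / (2 * 1 * Real.exp p.2) =
      Real.exp p.2 * p.1 ^ 2 / 2 + Real.cosh p.2 - 1 := by
    rw [he]; field_simp; ring
  rw [h7] at h1
  linarith

theorem integrable_exp_neg_mul_abs {c : ℝ} (hc : 0 < c) :
    Integrable fun u : ℝ ↦ Real.exp (-c * |u|) := by
  rw [← integrableOn_univ, ← Set.Iic_union_Ioi (a := (0 : ℝ)), integrableOn_union]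
  constructor
  · refine (integrableOn_exp_mul_Iic hc 0).congr_fun (fun u hu ↦ ?_) measurableSet_Iic
    simp only [abs_of_nonpos (Set.mem_Iic.1 hu)]; congr 1; ring
  · refine (integrableOn_exp_mul_Ioi (neg_lt_zero.2 hc) 0).congr_fun (fun u hu ↦ ?_) measurableSet_Ioi
    simp only [abs_of_pos (Set.mem_Ioi.1 hu)]

theorem lintegral_rInv_lt_top {σ : ℝ} (hσ : 1 < σ) :
    ∫⁻ w : ℍ, ENNReal.ofReal (rInv UpperHalfPlane.I w ^ σ) < ⊤ := by
  rw [← measurePreserving_horo.lintegral_comp_emb horoHomeo.measurableEmbedding]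
  -- The exponent σ is split between two lower bounds for 1/r: e^{|u|}/4 with exponent σ - b and
  -- e^u(1 + t²)/4 with exponent b. Here b > 1/2 makes the t-integral finite, and 2b < σ leaves the
  -- decay e^{-c|u|} with c = σ - 2b.
  set b := (1 + σ) / 4 with hb
  set c := (σ - 1) / 2 with hc
  have hi1 : Integrable (fun t : ℝ ↦ (1 + ‖t‖ ^ 2) ^ (-(2 * b) / 2)) :=
    integrable_rpow_neg_one_add_norm_sq (by simp; linarith)
  have hi2 : Integrable (fun u : ℝ ↦ (4 : ℝ) ^ σ * Real.exp (-c * |u|)) :=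
    (integrable_exp_neg_mul_abs (by rw [hc]; linarith)).const_mul _
  have hprod := hi1.mul_prod hi2
  refine lt_of_le_of_lt (lintegral_mono fun p ↦ ?_) hprod.lintegral_lt_top
  refine ENNReal.ofReal_le_ofReal ?_
  show rInv UpperHalfPlane.I (horo p) ^ σ ≤ _
  rw [rInv_horo]
  set D := Real.cosh (p.2 / 2) ^ 2 + Real.exp p.2 * p.1 ^ 2 / 4 with hD
  have hcosh : Real.exp |p.2| / 4 ≤ Real.cosh (p.2 / 2) ^ 2 := by
    rw [← Real.cosh_abs, abs_div, abs_two, Real.cosh_eq]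
    have e1 : Real.exp |p.2| = Real.exp (|p.2| / 2) ^ 2 := by
      rw [← Real.exp_nat_mul]; congr 1; push_cast; ring
    rw [e1]
    nlinarith [Real.exp_pos (|p.2| / 2), Real.exp_pos (-(|p.2| / 2))]
  have hpos := Real.exp_pos p.2
  have hD1 : Real.exp |p.2| / 4 ≤ D := by
    have : 0 ≤ Real.exp p.2 * p.1 ^ 2 / 4 := by positivity
    linarith
  have hD2 : Real.exp p.2 / 4 * (1 + p.1 ^ 2) ≤ D := by
    have := Real.exp_le_exp.2 (le_abs_self p.2)
    rw [hD]; linarith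
  have hD0 : 0 < D := lt_of_lt_of_le (by positivity) hD1
  have hsb : 0 ≤ σ - b := by rw [hb]; linarith
  have hb0 : 0 ≤ b := by rw [hb]; linarith
  have hE1 : (Real.exp |p.2| / 4) ^ (σ - b) ≤ D ^ (σ - b) :=
    Real.rpow_le_rpow (by positivity) hD1 hsb
  have hE2 : (Real.exp p.2 / 4 * (1 + p.1 ^ 2)) ^ b ≤ D ^ b :=
    Real.rpow_le_rpow (by positivity) hD2 hb0
  have hDσ : D ^ σ = D ^ (σ - b) * D ^ b := by rw [← Real.rpow_add hD0]; congr 1; ring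
  rw [Real.inv_rpow hD0.le, hDσ]
  have hle := mul_le_mul hE1 hE2 (by positivity) (by positivity)
  refine (inv_anti₀ (by positivity) hle).trans ?_
  rw [Real.mul_rpow (by positivity) (by positivity), Real.div_rpow (by positivity) (by positivity),
    Real.div_rpow (by positivity) (by positivity), ← Real.exp_mul, ← Real.exp_mul,
    Real.norm_eq_abs, sq_abs, show -(2 * b) / 2 = -b by ring,
    Real.rpow_neg (by positivity : (0 : ℝ) ≤ 1 + p.1 ^ 2)]
  have e4 : (4 : ℝ) ^ σ = 4 ^ (σ - b) * 4 ^ b := by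
    rw [← Real.rpow_add (by norm_num)]; congr 1; ring
  have e5 : (Real.exp (|p.2| * (σ - b)) / 4 ^ (σ - b) * (Real.exp (p.2 * b) / 4 ^ b *
      (1 + p.1 ^ 2) ^ b))⁻¹ = ((1 + p.1 ^ 2) ^ b)⁻¹ *
      (4 ^ σ * Real.exp (-(|p.2| * (σ - b) + p.2 * b))) := by
    rw [Real.exp_neg, Real.exp_add, e4]
    have : (0 : ℝ) < (1 + p.1 ^ 2) ^ b := by positivity
    have : (0 : ℝ) < 4 ^ b := by positivity
    have : (0 : ℝ) < 4 ^ (σ - b) := by positivity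
    field_simp
  rw [e5]
  gcongr
  have := neg_abs_le p.2
  rw [hb, hc]
  nlinarith [abs_nonneg p.2]

theorem cosh_add_le {a b : ℝ} (hb : 0 ≤ b) :
    Real.cosh (a + b) ≤ Real.exp b * Real.cosh a := by
  rw [Real.cosh_eq, Real.cosh_eq, neg_add, Real.exp_add, Real.exp_add]
  have h1 : Real.exp (-b) ≤ Real.exp b := Real.exp_le_exp.2 (by linarith)
  nlinarith [Real.exp_pos a, Real.exp_pos (-a)]

theorem rInv_pos (z w : ℍ) : 0 < rInv z w := by
  rw [rInv_eq_cosh]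
  have := Real.cosh_pos (dist z w / 2)
  positivity

theorem rInv_le_exp_mul {z w z' w' : ℍ} {ρ : ℝ} (hρ : 0 ≤ ρ) (h : dist z' w' ≤ dist z w + ρ) :
    rInv z w ≤ Real.exp ρ * rInv z' w' := by
  rw [rInv_eq_cosh, rInv_eq_cosh]
  have h1 : Real.cosh (dist z' w' / 2) ≤ Real.exp (ρ / 2) * Real.cosh (dist z w / 2) := by
    refine le_trans ?_ (cosh_add_le (by positivity))
    rw [Real.cosh_le_cosh, abs_of_nonneg (by positivity), abs_of_nonneg (by positivity)]
    linarith
  have h2 : Real.cosh (dist z' w' / 2) ^ 2 ≤ Real.exp ρ * Real.cosh (dist z w / 2) ^ 2 := by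
    have e : Real.exp ρ = Real.exp (ρ / 2) ^ 2 := by
      rw [← Real.exp_nat_mul]; congr 1; push_cast; ring
    rw [e, ← mul_pow]
    exact pow_le_pow_left₀ (Real.cosh_pos _).le h1 2
  have h3 := Real.cosh_pos (dist z w / 2)
  have h4 := Real.cosh_pos (dist z' w' / 2)
  rw [mul_one_div, div_le_div_iff₀ (by positivity) (by positivity)]
  linarith

theorem rInv_smul_smul (σ : SL(2, ℝ)) (z w : ℍ) : rInv (σ • z : ℍ) (σ • w : ℍ) = rInv z w := by
  rw [rInv_eq_cosh, rInv_eq_cosh, dist_smul]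

/-- Sums of powers of the point-pair function over an orbit. -/
theorem exists_sum_rGam_le {σ : ℝ} (hσ : 1 < σ) :
    ∃ C : ℝ, 0 < C ∧ ∀ (Γ : Subgroup SL(2, ℝ)) [DiscreteTopology Γ] (z : ℍ) (ε : ℝ), 0 < ε → ε ≤ 1 →
      Thick Γ ε z → (Summable fun γ : Γ ↦ rGam γ z z ^ σ) ∧
        ∑' γ : Γ, rGam γ z z ^ σ ≤ C / ε ^ 2 := by
  set J := ∫⁻ w : ℍ, ENNReal.ofReal (rInv UpperHalfPlane.I w ^ σ) with hJ
  have hJtop : J < ⊤ := lintegral_rInv_lt_top hσ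
  have hJz (z : ℍ) : ∫⁻ w : ℍ, ENNReal.ofReal (rInv z w ^ σ) = J := by
    have hm := measurePreserving_smul (z.toSL2R) (volume : Measure ℍ)
    rw [hJ, ← hm.lintegral_comp_emb (measurableEmbedding_const_smul _)]
    refine lintegral_congr fun w ↦ ?_
    have h := rInv_smul_smul z.toSL2R UpperHalfPlane.I w
    rw [UpperHalfPlane.toSL2R_smul_I] at h
    rw [h]
  refine ⟨Real.exp σ * 40 * (J.toReal + 1), by positivity, fun Γ _ z ε hε hε1 hth ↦ ?_⟩
  have := countable_of_discrete Γ
  set f : Γ → ENNReal := fun γ ↦ ENNReal.ofReal (rGam γ z z ^ σ) with hf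
  -- Each term is compared with the integral of r(z,·)^σ over the ball of radius ε/2 about γz. These
  -- balls are disjoint by thickness and have volume at least ε²/40, which explains the factor
  -- ε^{-2} in the bound.
  have hterm (γ : Γ) : f γ * ENNReal.ofReal (ε ^ 2 / 40) ≤
      ENNReal.ofReal (Real.exp σ) *
        ∫⁻ w in Metric.ball ((γ : SL(2, ℝ)) • z) (ε / 2), ENNReal.ofReal (rInv z w ^ σ) := by
    have hv := volume_ball_ge (half_pos hε) (by linarith) ((γ : SL(2, ℝ)) • z)
    rw [show (ε / 2) ^ 2 / 10 = ε ^ 2 / 40 by ring] at hv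
    rw [← lintegral_const_mul' _ _ ENNReal.ofReal_ne_top]
    calc f γ * ENNReal.ofReal (ε ^ 2 / 40)
        ≤ f γ * volume (Metric.ball ((γ : SL(2, ℝ)) • z) (ε / 2)) := by gcongr
      _ = ∫⁻ _ in Metric.ball ((γ : SL(2, ℝ)) • z) (ε / 2), f γ := by rw [setLIntegral_const]
      _ ≤ _ := by
        refine setLIntegral_mono' measurableSet_ball fun w hw ↦ ?_
        rw [hf, ← ENNReal.ofReal_mul (Real.exp_pos _).le]
        refine ENNReal.ofReal_le_ofReal ?_
        rw [Metric.mem_ball] at hw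
        have h1 : rInv z ((γ : SL(2, ℝ)) • z : ℍ) ≤ Real.exp 1 * rInv z w := by
          refine rInv_le_exp_mul zero_le_one ?_
          have := dist_triangle_right z w ((γ : SL(2, ℝ)) • z)
          linarith
        rw [← rInv_smul]
        have h2 := Real.rpow_le_rpow (rInv_pos _ _).le h1 (by linarith : 0 ≤ σ)
        rwa [Real.mul_rpow (Real.exp_pos _).le (rInv_pos _ _).le, ← Real.exp_mul, one_mul] at h2
  have hdisj : Pairwise (Function.onFun Disjoint
      fun γ : Γ ↦ Metric.ball ((γ : SL(2, ℝ)) • z) (ε / 2)) := by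
    intro γ δ hne
    refine Metric.ball_disjoint_ball ?_
    have h1 : ((γ⁻¹ * δ : Γ) : SL(2, ℝ)) ≠ 1 := by
      intro h; apply hne
      have : γ⁻¹ * δ = 1 := Subtype.ext h
      exact inv_mul_eq_one.1 this
    have h2 := hth _ (γ⁻¹ * δ : Γ).2 h1
    rw [Subgroup.coe_mul, Subgroup.coe_inv, mul_smul, ← dist_smul (γ : SL(2, ℝ)), smul_inv_smul] at h2
    linarith
  have hsum : (∑' γ, f γ) * ENNReal.ofReal (ε ^ 2 / 40) ≤ ENNReal.ofReal (Real.exp σ) * J := by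
    rw [← ENNReal.tsum_mul_right]
    refine (ENNReal.tsum_le_tsum hterm).trans ?_
    rw [ENNReal.tsum_mul_left, ← lintegral_iUnion (fun _ ↦ measurableSet_ball) hdisj, ← hJz z]
    gcongr
    exact Measure.restrict_le_self
  have hε40 : ENNReal.ofReal (ε ^ 2 / 40) ≠ 0 := by
    rw [Ne, ENNReal.ofReal_eq_zero, not_le]; positivity
  have hle : ∑' γ, f γ ≤ ENNReal.ofReal (Real.exp σ * 40 * (J.toReal + 1) / ε ^ 2) := by
    have h1 := (ENNReal.le_div_iff_mul_le (Or.inl hε40) (Or.inl ENNReal.ofReal_ne_top)).2 hsum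
    refine h1.trans ?_
    rw [← ENNReal.ofReal_toReal hJtop.ne, ← ENNReal.ofReal_mul (Real.exp_pos _).le,
      ← ENNReal.ofReal_div_of_pos (by positivity), ENNReal.toReal_ofReal ENNReal.toReal_nonneg]
    refine ENNReal.ofReal_le_ofReal ?_
    rw [div_div_eq_mul_div]
    gcongr ?_ / _
    nlinarith [Real.exp_pos σ]
  have hnn (γ : Γ) : 0 ≤ rGam γ z z ^ σ := by
    rw [← rInv_smul]; exact Real.rpow_nonneg (rInv_pos _ _).le _
  have hs : Summable fun γ : Γ ↦ rGam γ z z ^ σ := by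
    have := ENNReal.summable_toReal (hle.trans_lt ENNReal.ofReal_lt_top).ne
    refine this.congr fun γ ↦ ?_
    rw [hf, ENNReal.toReal_ofReal (hnn γ)]
  refine ⟨hs, ?_⟩
  rw [hf, ← ENNReal.ofReal_tsum_of_nonneg hnn hs] at hle
  exact (ENNReal.ofReal_le_ofReal_iff (by positivity)).1 hle

theorem sinh_le_two_mul {x : ℝ} (h0 : 0 ≤ x) (h1 : x ≤ 1) : Real.sinh x ≤ 2 * x := by
  have e1 := Real.abs_exp_sub_one_le (x := x) (by rwa [abs_of_nonneg h0])
  rw [abs_of_nonneg h0] at e1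
  have e2 := (abs_le.1 e1).2
  have e3 := Real.add_one_le_exp (-x)
  rw [Real.sinh_eq]; linarith

theorem unip_smul (t : ℝ) (w : ℍ) : ((unip t • w : ℍ) : ℂ) = w + t := by
  rw [coe_smul_eq]; simp [autj]

theorem periodic_of_unip {F : ℍ → ℂ} {t : ℝ} (ht : t = 1 ∨ t = -1)
    (h : ∀ w : ℍ, F (unip t • w) = F w) :
    Function.Periodic (F ∘ UpperHalfPlane.ofComplex) (1 : ℝ) := by
  intro x
  by_cases hx : 0 < x.im
  · have hx1 : 0 < (x + (1 : ℝ)).im := by simpa using hx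
    simp only [Function.comp]
    rw [UpperHalfPlane.ofComplex_apply_of_im_pos hx, UpperHalfPlane.ofComplex_apply_of_im_pos hx1]
    rcases ht with rfl | rfl
    · rw [← h ⟨x, hx⟩]; congr 1; apply UpperHalfPlane.ext; rw [unip_smul]
    · rw [← h ⟨x + (1 : ℝ), hx1⟩]; congr 1; apply UpperHalfPlane.ext; rw [unip_smul]; simp
  · simp only [Function.comp]
    rw [UpperHalfPlane.ofComplex_apply_eq_of_im_nonpos (by simpa using hx) (not_lt.1 hx)]

/-- Decay of a cusp form in terms of the local displacement. -/
theorem IsCuspidal.exists_phi_le {Γ : Subgroup SL(2, ℝ)} [DiscreteTopology Γ]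
    (htf : ∀ γ ∈ Γ, IsOfFinOrder γ → γ = 1) {𝓕 : Set ℍ}
    (h𝓕 : IsFundamentalDomain Γ 𝓕 (volume : Measure ℍ)) (hcof : volume 𝓕 < ⊤) {k : ℕ} {g : ℍ → ℂ}
    (hg : IsCuspidal Γ k g) (M : ℕ) :
    ∃ C : ℝ, 0 ≤ C ∧ ∀ z, ∃ ε, 0 < ε ∧ ε ≤ 1 ∧ Thick Γ ε z ∧ phi k g z ≤ C * ε ^ M := by
  obtain ⟨ℓ, hℓ0, hℓ⟩ := exists_hyp_dist_ge htf h𝓕 hcof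
  set ε₁ := min ℓ (1 / 10) with hε₁
  have hε0 : 0 < ε₁ := lt_min hℓ0 (by norm_num)
  have hε10 : ε₁ ≤ 1 / 10 := min_le_right _ _
  obtain ⟨K, hK, hKΓ⟩ := exists_compact_thick h𝓕 hcof hε0
  obtain ⟨B₀, hB₀⟩ := hK.exists_bound_of_continuousOn hg.continuous_phi.continuousOn
  set B := max B₀ 0 with hB
  have hBnn : 0 ≤ B := le_max_right _ _
  have hthickB (z : ℍ) (hz : Thick Γ ε₁ z) : phi k g z ≤ B := by
    obtain ⟨σ, hσ, hσK⟩ := hKΓ z hz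
    rw [← hg.phi_smul hσ]
    exact (le_abs_self _).trans ((hB₀ _ hσK).trans (le_max_left _ _))
  have hs0 : 0 < Real.sinh (ε₁ / 2) := Real.sinh_pos_iff.2 (by linarith)
  set y₀ := 1 / (2 * Real.sinh (ε₁ / 2)) with hy₀
  have hy0 : 0 < y₀ := by positivity
  set C₂ := B / y₀ ^ (2 * k) * Real.exp (2 * Real.pi * y₀) * (2 * k + M).factorial * 2 ^ M with hC₂
  have hC₂0 : 0 ≤ C₂ := by positivity
  refine ⟨max (B / ε₁ ^ M) C₂, le_max_of_le_right hC₂0, fun z ↦ ?_⟩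
  by_cases hz : Thick Γ ε₁ z
  · refine ⟨ε₁, hε0, by linarith, hz, ?_⟩
    calc phi k g z ≤ B := hthickB z hz
      _ = B / ε₁ ^ M * ε₁ ^ M := by field_simp
      _ ≤ _ := by gcongr; exact le_max_left _ _
  · simp only [Thick, not_forall, not_le] at hz
    obtain ⟨γ, hγ, hγ1, hlt⟩ := hz
    obtain ⟨δ, hδ⟩ := exists_isMinAt hγ hγ1 z
    obtain ⟨γ₀, hgen, m, hm, hδm⟩ := exists_isGen htf hδ.1 hδ.2.1
    -- The generator moves z no further than its power δ, so it has minimal displacement itself, and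
    -- its displacement serves as the thickness at z.
    have hle : dist z (γ₀ • z) ≤ dist z (δ • z) := by
      have := hgen.dist_le m (by exact_mod_cast hm.ne') z
      rwa [zpow_natCast, ← hδm] at this
    have hth : Thick Γ (dist z (γ₀ • z)) z := fun γ hγ h1 ↦ hle.trans (hδ.2.2 γ hγ h1)
    have hd : dist z (γ₀ • z) < ε₁ := (hth γ hγ hγ1).trans_lt hlt
    have hd0 := dist_smul_pos htf hgen.mem hgen.ne_one z
    refine ⟨_, hd0, by linarith, hth, ?_⟩
    -- Hyperbolic elements move every point by at least ℓ, so the generator is parabolic and z lies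
    -- near its fixed point.
    have hnh : ¬IsHyp γ₀ := fun hh ↦ by
      have := hℓ γ₀ hgen.mem hh z
      linarith [min_le_left ℓ (1 / 10)]
    have htr : tr (posRep γ₀) = 2 := by
      have h4 := four_le_tr_sq htf hgen.mem
      rw [isHyp_iff, not_lt] at hnh
      rw [abs_tr_posRep, ← Real.sqrt_sq_eq_abs, le_antisymm hnh h4,
        show (4 : ℝ) = 2 ^ 2 by norm_num, Real.sqrt_sq (by norm_num)]
    have hp1 : posRep γ₀ ≠ 1 := by
      rcases posRep_eq_or γ₀ with h | h <;> rw [h]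
      · exact hgen.ne_one
      · intro h'
        exact neg_one_notMem htf (by rw [← h', neg_neg]; exact hgen.mem)
    obtain ⟨τ, t, ht, hτ⟩ := exists_unip_conj htr hp1
    have ht0 : t ≠ 0 := by rcases ht with rfl | rfl <;> norm_num
    have ht1 : |t| = 1 := by rcases ht with rfl | rfl <;> norm_num
    have hdist (w : ℍ) : Real.sinh (dist (τ⁻¹ • w) (γ₀ • τ⁻¹ • w) / 2) = 1 / (2 * w.im) := by
      rw [← posRep_smul γ₀, ← dist_conj_smul τ, hτ, smul_inv_smul, sinh_half_dist_unip rfl rfl, unip_01,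
        ht1, one_mul]
    set F := twist k g τ with hF
    have hFper : ∀ w : ℍ, F (unip t • w) = F w := fun w ↦ by
      rw [← hτ, hF, hg.twist_smul_posRep hgen.mem, hτ]
      simp [autj]
    have hzw : τ⁻¹ • τ • z = z := inv_smul_smul τ z
    set w := τ • z with hw
    have hdw := hdist w
    rw [hzw] at hdw
    have hwpos := w.im_pos
    have hyw : y₀ ≤ w.im := by
      have h1 : Real.sinh (dist z (γ₀ • z) / 2) ≤ Real.sinh (ε₁ / 2) :=
        Real.sinh_le_sinh.2 (by linarith)
      rw [hdw, div_le_iff₀ (by positivity)] at h1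
      rw [hy₀, div_le_iff₀ (by positivity)]
      linarith
    -- On the horocycle at height y₀ the generator moves points by exactly ε₁; these points are
    -- thick, and the bound B from the compact set applies there.
    have hlevel (w' : ℍ) (hw' : w'.im = y₀) : ‖F w'‖ ≤ B / y₀ ^ (2 * k) := by
      have h1 := hdist w'
      rw [hw', hy₀, show 1 / (2 * (1 / (2 * Real.sinh (ε₁ / 2)))) = Real.sinh (ε₁ / 2) by
        field_simp] at h1
      have h2 : dist (τ⁻¹ • w') (γ₀ • τ⁻¹ • w') = ε₁ := by
        have := Real.sinh_injective h1; linarith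
      have h3 := hgen.thick htf (w := τ⁻¹ • w') (by rw [h2]; exact hε10)
      rw [h2] at h3
      have h4 := hthickB _ h3
      rw [← phi_twist, phi, hw'] at h4
      rwa [le_div_iff₀ (by positivity)]
    have hmain := norm_le_of_cusp (hg.twist_holo τ) (periodic_of_unip ht hFper)
      (hg.zero_at γ₀ hgen.mem τ t ht0 hτ) hy0 hlevel w hyw
    have hphi : phi k g z = ‖F w‖ * w.im ^ (2 * k) := by
      rw [← hzw, ← phi_twist]; rfl
    have hyd : 1 / w.im ≤ 2 * dist z (γ₀ • z) := by
      have h1 := sinh_le_two_mul (x := dist z (γ₀ • z) / 2) (by positivity) (by linarith)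
      rw [hdw] at h1
      have : 1 / w.im = 2 * (1 / (2 * w.im)) := by field_simp
      linarith
    -- Exponential decay in Im w beats every power, and 1/Im w is at most twice the displacement.
    have hexp : w.im ^ (2 * k) * Real.exp (-(2 * Real.pi * (w.im - y₀))) ≤
        Real.exp (2 * Real.pi * y₀) * (2 * k + M).factorial * (1 / w.im) ^ M := by
      have h1 := Real.pow_div_factorial_le_exp w.im hwpos.le (2 * k + M)
      rw [div_le_iff₀ (by positivity)] at h1
      have h2 : Real.exp w.im ≤ Real.exp (2 * Real.pi * w.im) :=
        Real.exp_le_exp.2 (by nlinarith [Real.pi_gt_three])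
      have h3 : w.im ^ (2 * k) * w.im ^ M ≤ Real.exp (2 * Real.pi * w.im) * (2 * k + M).factorial := by
        rw [← pow_add]
        exact h1.trans (by gcongr)
      rw [show -(2 * Real.pi * (w.im - y₀)) = 2 * Real.pi * y₀ + -(2 * Real.pi * w.im) by ring,
        Real.exp_add, Real.exp_neg, div_pow, one_pow]
      have h4 := Real.exp_pos (2 * Real.pi * w.im)
      have h5 := Real.exp_pos (2 * Real.pi * y₀)
      field_simp
      linarith
    rw [hphi]
    calc ‖F w‖ * w.im ^ (2 * k)
        ≤ (B / y₀ ^ (2 * k) * Real.exp (-(2 * Real.pi * (w.im - y₀)))) * w.im ^ (2 * k) := by gcongr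
      _ = B / y₀ ^ (2 * k) * (w.im ^ (2 * k) * Real.exp (-(2 * Real.pi * (w.im - y₀)))) := by ring
      _ ≤ B / y₀ ^ (2 * k) * (Real.exp (2 * Real.pi * y₀) * (2 * k + M).factorial *
          (1 / w.im) ^ M) := by gcongr
      _ ≤ B / y₀ ^ (2 * k) * (Real.exp (2 * Real.pi * y₀) * (2 * k + M).factorial *
          (2 * dist z (γ₀ • z)) ^ M) := by gcongr
      _ = C₂ * dist z (γ₀ • z) ^ M := by rw [hC₂, mul_pow]; ring
      _ ≤ _ := by gcongr; exact le_max_right _ _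

/-! ### Power series with coefficients of polynomial growth -/

/-- A sequence of polynomial growth. -/
def PolyBdd (c : ℕ → ℂ) : Prop := ∃ C : ℝ, ∃ M : ℕ, 0 ≤ C ∧ ∀ n, ‖c n‖ ≤ C * ((n : ℝ) + 1) ^ M

theorem succ_pow_le_choose (n M : ℕ) :
    ((n : ℝ) + 1) ^ M ≤ M.factorial * ((n + M).choose M : ℝ) := by
  have h1 := Nat.pow_succ_le_ascFactorial (n + 1) M
  rw [Nat.ascFactorial_eq_factorial_mul_choose] at h1
  exact_mod_cast h1

theorem PolyBdd.norm_summable {c : ℕ → ℂ} (hc : PolyBdd c) {x : ℂ} (hx : ‖x‖ < 1) :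
    Summable fun n ↦ ‖c n * x ^ n‖ := by
  obtain ⟨C, M, hC, h⟩ := hc
  have h1 := (summable_choose_mul_geometric_of_norm_lt_one (R := ℝ) M (r := ‖x‖)
    (by rwa [norm_norm])).mul_left (C * M.factorial)
  refine h1.of_nonneg_of_le (fun n ↦ norm_nonneg _) fun n ↦ ?_
  rw [norm_mul, norm_pow]
  calc ‖c n‖ * ‖x‖ ^ n ≤ (C * (M.factorial * ((n + M).choose M : ℝ))) * ‖x‖ ^ n := by
        gcongr
        exact (h n).trans (by gcongr; exact succ_pow_le_choose n M)
    _ = _ := by ring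

theorem PolyBdd.summable {c : ℕ → ℂ} (hc : PolyBdd c) {x : ℂ} (hx : ‖x‖ < 1) :
    Summable fun n ↦ c n * x ^ n := (hc.norm_summable hx).of_norm

theorem PolyBdd.norm_tsum_le {c : ℕ → ℂ} (hc : PolyBdd c) :
    ∃ C : ℝ, ∃ M : ℕ, 0 ≤ C ∧ ∀ x : ℂ, ‖x‖ < 1 → ∑' n, ‖c n * x ^ n‖ ≤ C / (1 - ‖x‖) ^ M := by
  have hc' := hc
  obtain ⟨C, M, hC, h⟩ := hc
  refine ⟨C * M.factorial, M + 1, by positivity, fun x hx ↦ ?_⟩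
  have h1 := (hasSum_choose_mul_geometric_of_norm_lt_one (𝕜 := ℝ) M (r := ‖x‖)
    (by rwa [norm_norm])).mul_left (C * M.factorial)
  refine (hc'.norm_summable hx).tsum_le_of_sum_le ?_ |>.trans (le_of_eq ?_) (b := C * M.factorial * (1 / (1 - ‖x‖) ^ (M + 1)))
  · intro s
    refine le_trans (Finset.sum_le_sum fun n _ ↦ ?_) (h1.summable.sum_le_tsum s fun n _ ↦ by positivity) |>.trans_eq h1.tsum_eq
    rw [norm_mul, norm_pow]
    calc ‖c n‖ * ‖x‖ ^ n ≤ (C * (M.factorial * ((n + M).choose M : ℝ))) * ‖x‖ ^ n := by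
          gcongr
          exact (h n).trans (by gcongr; exact succ_pow_le_choose n M)
      _ = _ := by ring
  · ring

theorem PolyBdd.affine_mul {c : ℕ → ℂ} (hc : PolyBdd c) (a : ℂ) :
    PolyBdd fun n ↦ (a + n) * c n := by
  obtain ⟨C, M, hC, h⟩ := hc
  refine ⟨(‖a‖ + 1) * C, M + 1, by positivity, fun n ↦ ?_⟩
  rw [norm_mul]
  have h1 : ‖a + n‖ ≤ (‖a‖ + 1) * ((n : ℝ) + 1) := by
    refine (norm_add_le _ _).trans ?_
    rw [Complex.norm_natCast]
    nlinarith [norm_nonneg a, (Nat.cast_nonneg n : (0 : ℝ) ≤ n)]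
  calc ‖a + n‖ * ‖c n‖ ≤ ((‖a‖ + 1) * ((n : ℝ) + 1)) * (C * ((n : ℝ) + 1) ^ M) := by
        gcongr; exact h n
    _ = _ := by ring

theorem PolyBdd.hasDerivAt {c : ℕ → ℂ} (hc : PolyBdd c) {x : ℂ} (hx : ‖x‖ < 1) :
    HasDerivAt (fun x ↦ ∑' n, c n * x ^ n) (∑' n, c n * (n * x ^ (n - 1))) x := by
  obtain ⟨ρ, hρ, hρ1⟩ := exists_between hx
  have hρ0 : 0 < ρ := (norm_nonneg x).trans_lt hρ
  have hρn : ‖(ρ : ℂ)‖ < 1 := by rwa [Complex.norm_of_nonneg hρ0.le]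
  have hsum := ((hc.affine_mul 0).norm_summable hρn).mul_left ρ⁻¹
  refine hasDerivAt_tsum_of_isPreconnected (t := Metric.ball 0 ρ) hsum Metric.isOpen_ball
    (convex_ball _ _).isPreconnected (g := fun n x ↦ c n * x ^ n)
    (g' := fun n x ↦ c n * (n * x ^ (n - 1))) (y₀ := 0) ?_ ?_ ?_ ?_ ?_
  · intro n y _
    exact (hasDerivAt_pow n y).const_mul (c n)
  · intro n y hy
    rw [mem_ball_zero_iff] at hy
    rcases n with _ | n
    · simp
    · simp only [norm_mul, norm_pow, Complex.norm_of_nonneg hρ0.le, zero_add, add_tsub_cancel_right]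
      have : ‖y‖ ^ n ≤ ρ ^ n := pow_le_pow_left₀ (norm_nonneg _) hy.le n
      calc ‖c (n + 1)‖ * (‖((n + 1 : ℕ) : ℂ)‖ * ‖y‖ ^ n)
          ≤ ‖c (n + 1)‖ * (‖((n + 1 : ℕ) : ℂ)‖ * ρ ^ n) := by gcongr
        _ = _ := by rw [pow_succ]; field_simp
  · simpa using hρ0
  · exact hc.summable (by simp)
  · simpa using hρ

/-- The Frobenius series `∑ c_n x^{a+n}`. -/
def frob (c : ℕ → ℂ) (a x : ℂ) : ℂ := x ^ a * ∑' n, c n * x ^ n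

/-- On Frobenius series x d/dx acts by multiplying the n-th coefficient by a + n, which preserves
polynomial growth. -/
theorem PolyBdd.hasDerivAt_frob {c : ℕ → ℂ} (hc : PolyBdd c) (a : ℂ) {x : ℂ} (hx : ‖x‖ < 1)
    (hx' : x ∈ slitPlane) :
    HasDerivAt (frob c a) (frob (fun n ↦ (a + n) * c n) a x / x) x := by
  have hx0 := slitPlane_ne_zero hx'
  have h1 : HasDerivAt (fun x : ℂ ↦ x ^ a) (a * x ^ (a - 1)) x := by
    simpa using (hasDerivAt_id x).cpow_const (c := a) hx'
  refine (h1.mul (hc.hasDerivAt hx)).congr_deriv ?_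
  have e1 : ∑' n, c n * (n * x ^ (n - 1)) = (∑' n : ℕ, (n : ℂ) * c n * x ^ n) / x := by
    rw [← tsum_div_const]
    refine tsum_congr fun n ↦ ?_
    rcases n with _ | n
    · simp
    · rw [add_tsub_cancel_right, pow_succ]; field_simp
  have e2 : ∑' n, (a + n) * c n * x ^ n = a * ∑' n, c n * x ^ n + ∑' n : ℕ, (n : ℂ) * c n * x ^ n := by
    rw [← tsum_mul_left, ← Summable.tsum_add ((hc.summable hx).mul_left a)]
    · exact tsum_congr fun n ↦ by ring
    · simpa using (hc.affine_mul 0).summable hx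
  rw [e1, frob, e2, cpow_sub _ _ hx0, cpow_one]
  field_simp

theorem PolyBdd.norm_frob_le {c : ℕ → ℂ} (hc : PolyBdd c) (a : ℂ) :
    ∃ C : ℝ, ∃ M : ℕ, 0 ≤ C ∧ ∀ r : ℝ, 0 < r → r < 1 →
      ‖frob c a r‖ ≤ C * r ^ a.re / (1 - r) ^ M := by
  obtain ⟨C, M, hC, h⟩ := hc.norm_tsum_le
  refine ⟨C, M, hC, fun r h0 h1 ↦ ?_⟩
  have hr : ‖(r : ℂ)‖ = r := Complex.norm_of_nonneg h0.le
  have h2 := h r (by rwa [hr])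
  have h3 := norm_tsum_le_tsum_norm (hc.norm_summable (x := (r : ℂ)) (by rwa [hr]))
  rw [hr] at h2
  rw [frob, norm_mul, norm_cpow_eq_rpow_re_of_pos h0]
  calc r ^ a.re * _ ≤ r ^ a.re * (C / (1 - r) ^ M) := by gcongr; exact h3.trans h2
    _ = _ := by ring

/-! ### The coefficients of the resolvent kernel -/

/-- `Γ(s+j+n)² / (π Γ(2s+n) n!)`. -/
def resCoeff (s : ℂ) (j n : ℕ) : ℂ :=
  Complex.Gamma (s + j + n) ^ 2 / (Real.pi * Complex.Gamma (2 * s + n) * n.factorial)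

theorem ne_neg_nat {s : ℂ} (hs : 0 < s.re) (m : ℕ) : s ≠ -m := by
  rintro rfl
  simp at hs
  linarith [(Nat.cast_nonneg m : (0 : ℝ) ≤ m)]

theorem Gamma_add_succ {s : ℂ} (hs : 0 < s.re) (n : ℕ) :
    Complex.Gamma (s + (n + 1 : ℕ)) = (s + n) * Complex.Gamma (s + n) := by
  rw [Nat.cast_succ, ← add_assoc, Complex.Gamma_add_one]
  intro h
  exact ne_neg_nat hs n (eq_neg_of_add_eq_zero_left h)

theorem resCoeff_succ_left {s : ℂ} (hs : 0 < s.re) (j n : ℕ) :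
    resCoeff s (j + 1) n = (s + j + n) ^ 2 * resCoeff s j n := by
  have := Gamma_add_succ hs (j + n)
  rw [resCoeff, resCoeff, show s + ((j + 1 : ℕ) : ℂ) + n = s + (j + n + 1 : ℕ) by push_cast; ring,
    this]
  push_cast
  ring_nf

theorem resCoeff_succ_right {s : ℂ} (hs : 0 < s.re) (j n : ℕ) :
    resCoeff s j (n + 1) = (s + j + n) ^ 2 / ((2 * s + n) * (n + 1)) * resCoeff s j n := by
  have h1 := Gamma_add_succ hs (j + n)
  have h2 : 0 < (2 * s).re := by simp [hs]
  rw [resCoeff, resCoeff, show s + (j : ℂ) + ((n + 1 : ℕ) : ℂ) = s + (j + n + 1 : ℕ) by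
    push_cast; ring, h1, Gamma_add_succ h2, Nat.factorial_succ]
  push_cast
  have h3 : (2 * s + n : ℂ) ≠ 0 := fun h ↦ ne_neg_nat h2 n (eq_neg_of_add_eq_zero_left h)
  have h4 : ((n : ℂ) + 1) ≠ 0 := Nat.cast_add_one_ne_zero n
  have h5 : (Real.pi : ℂ) ≠ 0 := by simp
  have h6 : Complex.Gamma (2 * s + n) ≠ 0 := Gamma_ne_zero fun m ↦ ne_neg_nat (by
    simp; linarith [(Nat.cast_nonneg n : (0 : ℝ) ≤ n)]) m
  have h7 : (n.factorial : ℂ) ≠ 0 := by exact_mod_cast n.factorial_ne_zero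
  rw [add_assoc s]
  field_simp

/-- By Bernoulli's inequality (n + A)/(n + 1) is at most ((n + 2)/(n + 1))^A, and the product of
these bounds telescopes. -/
theorem polyBdd_of_ratio {c : ℕ → ℂ} (A : ℕ)
    (h : ∀ n, ‖c (n + 1)‖ ≤ (((n : ℝ) + A) / (n + 1)) ^ 2 * ‖c n‖) : PolyBdd c := by
  refine ⟨‖c 0‖, 2 * A, norm_nonneg _, fun n ↦ ?_⟩
  induction n with
  | zero => simp
  | succ n ih =>
    have hn : (0 : ℝ) < n + 1 := by positivity
    have hB : ((n : ℝ) + A) / (n + 1) ≤ (((n : ℝ) + 2) / (n + 1)) ^ A := by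
      have h1 := one_add_mul_le_pow (a := 1 / ((n : ℝ) + 1)) (by
        have : (0 : ℝ) < 1 / (n + 1) := by positivity
        linarith) A
      rw [show 1 + 1 / ((n : ℝ) + 1) = (n + 2) / (n + 1) by field_simp; ring] at h1
      refine le_trans ?_ h1
      rw [div_le_iff₀ hn]
      field_simp
      linarith
    calc ‖c (n + 1)‖ ≤ (((n : ℝ) + A) / (n + 1)) ^ 2 * ‖c n‖ := h n
      _ ≤ ((((n : ℝ) + 2) / (n + 1)) ^ A) ^ 2 * (‖c 0‖ * ((n : ℝ) + 1) ^ (2 * A)) := by gcongr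
      _ = ‖c 0‖ * (((n + 1 : ℕ) : ℝ) + 1) ^ (2 * A) := by
        push_cast
        rw [← pow_mul, mul_comm A 2, div_pow, add_assoc, one_add_one_eq_two]
        field_simp

theorem polyBdd_resCoeff {s : ℂ} (hs : 1 < s.re) (j : ℕ) : PolyBdd (resCoeff s j) := by
  obtain ⟨A, hA⟩ := exists_nat_ge ‖s + j‖
  refine polyBdd_of_ratio A fun n ↦ ?_
  rw [resCoeff_succ_right (by linarith), norm_mul]
  gcongr
  rw [norm_div, norm_pow, norm_mul, div_pow]
  have h1 : ‖s + j + n‖ ≤ n + A := by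
    refine (norm_add_le _ _).trans ?_
    rw [Complex.norm_natCast]; linarith
  have h2 : (n : ℝ) + 1 ≤ ‖2 * s + n‖ := by
    refine le_trans ?_ (Complex.re_le_norm _)
    simp; linarith
  have h3 : ‖(n : ℂ) + 1‖ = n + 1 := by exact_mod_cast Complex.norm_natCast (n + 1)
  rw [h3, sq ((n : ℝ) + 1)]
  gcongr

theorem tsum_resCoeff {s : ℂ} (hs : 1 < s.re) (j : ℕ) (x : ℂ) :
    ∑' n, resCoeff s j n * x ^ n =
      Complex.Gamma (s + j) ^ 2 / (Real.pi * Complex.Gamma (2 * s)) *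
        ordinaryHypergeometric (s + j) (s + j) (2 * s) x := by
  rw [ordinaryHypergeometric_eq_tsum]
  dsimp only
  rw [← tsum_mul_left]
  refine tsum_congr fun n ↦ ?_
  have h1 : ∀ m : ℕ, s + j ≠ -m := ne_neg_nat (by simp; linarith [(Nat.cast_nonneg j : (0 : ℝ) ≤ j)])
  have h2 : ∀ m : ℕ, 2 * s ≠ -m := ne_neg_nat (by simp; linarith)
  rw [← Complex.Gamma_add_nat_div_Gamma_eq _ h1, ← Complex.Gamma_add_nat_div_Gamma_eq _ h2, resCoeff, smul_eq_mul]
  have h3 := Gamma_ne_zero h1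
  have h4 := Gamma_ne_zero h2
  generalize Complex.Gamma (2 * s) = G at *
  field_simp

/-- `B_j(r) = ∑ Γ(s+j+n)² / (π Γ(2s+n) n!) r^{s+j+n}`. -/
def resB (s : ℂ) (j : ℕ) (x : ℂ) : ℂ := frob (resCoeff s j) (s + j) x

/-- `r d/dr B_j(r)`. -/
def resB' (s : ℂ) (j : ℕ) (x : ℂ) : ℂ :=
  frob (fun n ↦ (s + j + n) * resCoeff s j n) (s + j) x

theorem hasDerivAt_resB {s : ℂ} (hs : 1 < s.re) (j : ℕ) {x : ℂ} (hx : ‖x‖ < 1)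
    (hx' : x ∈ slitPlane) : HasDerivAt (resB s j) (resB' s j x / x) x :=
  (polyBdd_resCoeff hs j).hasDerivAt_frob _ hx hx'

/-- Equivalent to B_{j+1} = x (x d/dx)² B_j: raising j multiplies the coefficients by (s + j + n)²
and shifts the exponent by one. This is what lets the iteration of the operators close up. -/
theorem hasDerivAt_resB' {s : ℂ} (hs : 1 < s.re) (j : ℕ) {x : ℂ} (hx : ‖x‖ < 1)
    (hx' : x ∈ slitPlane) : HasDerivAt (resB' s j) (resB s (j + 1) x / x ^ 2) x := by
  refine (((polyBdd_resCoeff hs j).affine_mul _).hasDerivAt_frob _ hx hx').congr_deriv ?_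
  have hx0 := slitPlane_ne_zero hx'
  have : resCoeff s (j + 1) = fun n : ℕ ↦ (s + j + n) * ((s + j + n) * resCoeff s j n) := by
    funext n; rw [resCoeff_succ_left (by linarith)]; ring
  rw [resB, this, frob, frob, Nat.cast_succ, ← add_assoc, cpow_add (s + j) _ hx0, cpow_one]
  field_simp

theorem resolventQ_eq {s : ℂ} (hs : 1 < s.re) (z w : ℍ) :
    resolventQ s z w = resB s 0 (rInv z w) := by
  have := tsum_resCoeff hs 0 (rInv z w)
  rw [Nat.cast_zero, add_zero] at this
  rw [resolventQ, resB, frob, this, Nat.cast_zero, add_zero]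
  ring

theorem radialF_eq {s : ℂ} (hs : 1 < s.re) (k : ℕ) {r : ℝ} (hr : 0 < r) :
    radialF k s r = (-1) ^ k * (1 - r) ^ (2 * k) / (r : ℂ) ^ (2 * k) * resB s k r := by
  have hr0 : (r : ℂ) ≠ 0 := by exact_mod_cast hr.ne'
  have hp : (r : ℂ) ^ (s + k) = (r : ℂ) ^ (s - k) * (r : ℂ) ^ (2 * k) := by
    rw [← cpow_natCast, ← cpow_add _ _ hr0]; congr 1; push_cast; ring
  have he : ((r : ℂ) - 1) ^ (2 * k) = (1 - r) ^ (2 * k) := by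
    rw [← neg_sub, (even_two_mul k).neg_pow]
  rw [radialF, resB, frob, tsum_resCoeff hs k, hp, he]
  field_simp

theorem norm_resB_le {s : ℂ} (hs : 1 < s.re) (j : ℕ) :
    ∃ C : ℝ, ∃ M : ℕ, 0 ≤ C ∧ ∀ r : ℝ, 0 < r → r < 1 →
      ‖resB s j r‖ ≤ C * r ^ (s.re + j) / (1 - r) ^ M := by
  simpa [resB] using (polyBdd_resCoeff hs j).norm_frob_le (s + j)

theorem norm_resB'_le {s : ℂ} (hs : 1 < s.re) (j : ℕ) :
    ∃ C : ℝ, ∃ M : ℕ, 0 ≤ C ∧ ∀ r : ℝ, 0 < r → r < 1 →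
      ‖resB' s j r‖ ≤ C * r ^ (s.re + j) / (1 - r) ^ M := by
  simpa [resB'] using ((polyBdd_resCoeff hs j).affine_mul (s + j)).norm_frob_le (s + j)

/-! ### Wirtinger derivatives -/

/-- The real-linear map `a dz + b dz̄`. -/
def wirt (a b : ℂ) : ℂ →L[ℝ] ℂ :=
  a • ContinuousLinearMap.id ℝ ℂ + b • (conjCLE : ℂ →L[ℝ] ℂ)

theorem wirt_apply (a b v : ℂ) : wirt a b v = a * v + b * (starRingEnd ℂ) v := by
  simp [wirt]

theorem norm_wirt_le (a b : ℂ) : ‖wirt a b‖ ≤ ‖a‖ + ‖b‖ := by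
  refine ContinuousLinearMap.opNorm_le_bound _ (by positivity) fun v ↦ ?_
  rw [wirt_apply]
  refine (norm_add_le _ _).trans ?_
  rw [norm_mul, norm_mul, norm_conj]
  exact le_of_eq (by ring)

/-- The functional `L ↦ (L 1 - i L i) / 2`. -/
def dzCoeff : (ℂ →L[ℝ] ℂ) →L[ℝ] ℂ :=
  (1 / 2 : ℂ) • (ContinuousLinearMap.apply ℝ ℂ (1 : ℂ) - I • ContinuousLinearMap.apply ℝ ℂ I)

theorem dzCoeff_apply (L : ℂ →L[ℝ] ℂ) : dzCoeff L = (1 / 2) * (L 1 - I * L I) := by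
  simp [dzCoeff]

theorem dzCoeff_wirt (a b : ℂ) : dzCoeff (wirt a b) = a := by
  rw [dzCoeff_apply, wirt_apply, wirt_apply, map_one, conj_I]
  linear_combination (-a / 2 + b / 2) * I_mul_I

theorem dZ_eq (f : ℍ → ℂ) (z : ℍ) :
    dZ f z = dzCoeff (fderiv ℝ (f ∘ UpperHalfPlane.ofComplex) (z : ℂ)) := (dzCoeff_apply _).symm

theorem HasDerivAt.hasFDerivAt_wirt {f : ℂ → ℂ} {a u : ℂ} (h : HasDerivAt f a u) :
    HasFDerivAt f (wirt a 0) u := by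
  refine (h.hasFDerivAt.restrictScalars ℝ).congr_fderiv ?_
  ext
  simp [wirt, mul_comm]

theorem hasFDerivAt_conj_wirt (u : ℂ) : HasFDerivAt (starRingEnd ℂ) (wirt 0 1) u := by
  refine (conjCLE : ℂ →L[ℝ] ℂ).hasFDerivAt.congr_fderiv ?_
  ext
  simp [wirt]

theorem HasFDerivAt.wirt_mul {f g : ℂ → ℂ} {a b a' b' u : ℂ} (hf : HasFDerivAt f (wirt a b) u)
    (hg : HasFDerivAt g (wirt a' b') u) :
    HasFDerivAt (fun u ↦ f u * g u) (wirt (a * g u + f u * a') (b * g u + f u * b')) u := by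
  refine (hf.mul hg).congr_fderiv ?_
  ext
  simp [wirt]; ring

theorem HasFDerivAt.wirt_add {f g : ℂ → ℂ} {a b a' b' u : ℂ} (hf : HasFDerivAt f (wirt a b) u)
    (hg : HasFDerivAt g (wirt a' b') u) :
    HasFDerivAt (fun u ↦ f u + g u) (wirt (a + a') (b + b')) u := by
  refine (hf.add hg).congr_fderiv ?_
  ext
  simp [wirt]; ring

theorem HasDerivAt.wirt_comp {φ f : ℂ → ℂ} {a b u c : ℂ} (hφ : HasDerivAt φ c (f u))
    (hf : HasFDerivAt f (wirt a b) u) :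
    HasFDerivAt (fun u ↦ φ (f u)) (wirt (c * a) (c * b)) u := by
  refine ((hφ.hasFDerivAt.restrictScalars ℝ).comp u hf).congr_fderiv ?_
  ext
  simp [wirt]; ring

/-! ### The building block of the iterated kernels

The function `p^A q^{-B} Φ(ρ)` with `q = q₁ ū + q₀`, `p = q̄₁ ū + q̄₀` and
`ρ = 4 Im(u) Im(q₁ q̄₀) / |q|²`. -/

/-- `q₁ ū + q₀`. -/
def cform (q₁ q₀ u : ℂ) : ℂ := q₁ * (starRingEnd ℂ) u + q₀

/-- `4 Im(u) Im(q₁ q̄₀) / |q₁ ū + q₀|²`. -/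
def crho (q₁ q₀ u : ℂ) : ℝ := 4 * u.im * (q₁ * (starRingEnd ℂ) q₀).im / ‖cform q₁ q₀ u‖ ^ 2

theorem norm_cform_sq (q₁ q₀ u : ℂ) :
    ‖cform q₁ q₀ u‖ ^ 2 = ‖cform ((starRingEnd ℂ) q₁) ((starRingEnd ℂ) q₀) u‖ ^ 2 + 4 * u.im * (q₁ * (starRingEnd ℂ) q₀).im := by
  simp only [← Complex.normSq_eq_norm_sq, Complex.normSq_apply, cform, add_re, add_im, mul_re,
    mul_im, conj_re, conj_im]
  ring

theorem norm_cform_conj_le {q₁ q₀ u : ℂ} (hv : 0 < (q₁ * (starRingEnd ℂ) q₀).im) (hu : 0 < u.im) :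
    ‖cform ((starRingEnd ℂ) q₁) ((starRingEnd ℂ) q₀) u‖ ≤ ‖cform q₁ q₀ u‖ := by
  refine (pow_le_pow_iff_left₀ (norm_nonneg _) (norm_nonneg _) two_ne_zero).1 ?_
  rw [norm_cform_sq q₁]
  have : 0 < 4 * u.im * (q₁ * (starRingEnd ℂ) q₀).im := by positivity
  linarith

theorem cform_ne_zero {q₁ q₀ u : ℂ} (hv : 0 < (q₁ * (starRingEnd ℂ) q₀).im) (hu : 0 < u.im) :
    cform q₁ q₀ u ≠ 0 := by
  intro h
  have := norm_cform_sq q₁ q₀ u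
  rw [h, norm_zero] at this
  have h2 : 0 < 4 * u.im * (q₁ * (starRingEnd ℂ) q₀).im := by positivity
  nlinarith [sq_nonneg ‖cform ((starRingEnd ℂ) q₁) ((starRingEnd ℂ) q₀) u‖]

/-- The product q₁(u - ū) is the difference p̄ - q, and |p| ≤ |q|. -/
theorem norm_coeff_mul_im_le {q₁ q₀ u : ℂ} (hv : 0 < (q₁ * (starRingEnd ℂ) q₀).im) (hu : 0 < u.im) :
    ‖q₁‖ * u.im ≤ ‖cform q₁ q₀ u‖ := by
  have h1 : q₁ * (u - (starRingEnd ℂ) u) = (starRingEnd ℂ) (cform ((starRingEnd ℂ) q₁) ((starRingEnd ℂ) q₀) u) - cform q₁ q₀ u := by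
    simp [cform]; ring
  have h2 := congrArg norm h1
  rw [norm_mul, Complex.sub_conj, norm_mul, norm_I, mul_one, Complex.norm_real, Real.norm_of_nonneg
    (by positivity)] at h2
  have h3 := norm_sub_le ((starRingEnd ℂ) (cform ((starRingEnd ℂ) q₁) ((starRingEnd ℂ) q₀) u)) (cform q₁ q₀ u)
  rw [norm_conj] at h3
  have h4 := norm_cform_conj_le hv hu
  linarith

theorem crho_pos {q₁ q₀ u : ℂ} (hv : 0 < (q₁ * (starRingEnd ℂ) q₀).im) (hu : 0 < u.im) : 0 < crho q₁ q₀ u := by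
  have := norm_pos_iff.2 (cform_ne_zero hv hu)
  rw [crho]; positivity

theorem coe_crho (q₁ q₀ u : ℂ) : (crho q₁ q₀ u : ℂ) =
    -2 * I * ((q₁ * (starRingEnd ℂ) q₀).im : ℂ) * (u - (starRingEnd ℂ) u) * (cform q₁ q₀ u * (starRingEnd ℂ) (cform q₁ q₀ u))⁻¹ := by
  rw [crho, Complex.mul_conj, Complex.normSq_eq_norm_sq, Complex.sub_conj]
  push_cast
  linear_combination (4 * (u.im : ℂ) * ((q₁ * (starRingEnd ℂ) q₀).im : ℂ) * ((‖cform q₁ q₀ u‖ : ℂ) ^ 2)⁻¹) * I_mul_I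

theorem hasFDerivAt_cform (q₁ q₀ u : ℂ) : HasFDerivAt (cform q₁ q₀) (wirt 0 q₁) u := by
  have h : HasDerivAt (fun x : ℂ ↦ q₁ * x + q₀) (q₁ * 1) ((starRingEnd ℂ) u) :=
    ((hasDerivAt_id' ((starRingEnd ℂ) u)).const_mul q₁).add_const q₀
  have := HasDerivAt.wirt_comp h (hasFDerivAt_conj_wirt u)
  rw [mul_one, mul_zero, mul_one] at this
  exact this

theorem hasFDerivAt_conj_cform (q₁ q₀ u : ℂ) :
    HasFDerivAt (fun u ↦ (starRingEnd ℂ) (cform q₁ q₀ u)) (wirt ((starRingEnd ℂ) q₁) 0) u := by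
  have h : HasDerivAt (fun x : ℂ ↦ (starRingEnd ℂ) q₁ * x + (starRingEnd ℂ) q₀) ((starRingEnd ℂ) q₁ * 1) u :=
    ((hasDerivAt_id' u).const_mul ((starRingEnd ℂ) q₁)).add_const ((starRingEnd ℂ) q₀)
  simpa [cform] using HasDerivAt.hasFDerivAt_wirt h

/-- The logarithmic derivative of ρ in u is 1/(u - ū) - q̄₁/q̄, and q̄ - (u - ū)q̄₁ = p. -/
theorem hasFDerivAt_crho {q₁ q₀ u : ℂ} (hv : 0 < (q₁ * (starRingEnd ℂ) q₀).im) (hu : 0 < u.im) :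
    HasFDerivAt (fun u ↦ (crho q₁ q₀ u : ℂ))
      (wirt (crho q₁ q₀ u * (cform ((starRingEnd ℂ) q₁) ((starRingEnd ℂ) q₀) u / ((u - (starRingEnd ℂ) u) * (starRingEnd ℂ) (cform q₁ q₀ u))))
        (crho q₁ q₀ u * ((starRingEnd ℂ) (cform ((starRingEnd ℂ) q₁) ((starRingEnd ℂ) q₀) u) / (((starRingEnd ℂ) u - u) * cform q₁ q₀ u)))) u := by
  have hq := cform_ne_zero hv hu
  have hq' : (starRingEnd ℂ) (cform q₁ q₀ u) ≠ 0 := by simpa using hq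
  have hd : u - (starRingEnd ℂ) u ≠ 0 := by
    rw [Complex.sub_conj]; simp [hu.ne', I_ne_zero]
  have hd' : (starRingEnd ℂ) u - u ≠ 0 := by rw [← neg_sub]; exact neg_ne_zero.2 hd
  have h1 := HasFDerivAt.wirt_add (HasDerivAt.hasFDerivAt_wirt (hasDerivAt_id u))
    (HasDerivAt.wirt_comp (hasDerivAt_neg ((starRingEnd ℂ) u)) (hasFDerivAt_conj_wirt u))
  have h2 := HasFDerivAt.wirt_mul (HasDerivAt.hasFDerivAt_wirt
    (hasDerivAt_const u (-2 * I * ((q₁ * (starRingEnd ℂ) q₀).im : ℂ)))) h1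
  have h3 := HasDerivAt.wirt_comp (f := fun u ↦ cform q₁ q₀ u * (starRingEnd ℂ) (cform q₁ q₀ u))
    (hasDerivAt_inv (mul_ne_zero hq hq'))
    (HasFDerivAt.wirt_mul (hasFDerivAt_cform q₁ q₀ u) (hasFDerivAt_conj_cform q₁ q₀ u))
  have h4 := HasFDerivAt.wirt_mul h2 h3
  have hfun : (fun u ↦ (crho q₁ q₀ u : ℂ)) = fun u ↦ -2 * I * ((q₁ * (starRingEnd ℂ) q₀).im : ℂ) *
      (id u + -(starRingEnd ℂ) u) * (cform q₁ q₀ u * (starRingEnd ℂ) (cform q₁ q₀ u))⁻¹ := by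
    funext u; rw [coe_crho, id, ← sub_eq_add_neg]
  rw [hfun]
  refine h4.congr_fderiv ?_
  rw [coe_crho]
  have e1 : cform ((starRingEnd ℂ) q₁) ((starRingEnd ℂ) q₀) u = (starRingEnd ℂ) (cform q₁ q₀ u) - (u - (starRingEnd ℂ) u) * (starRingEnd ℂ) q₁ := by
    simp [cform]; ring
  have e2 : (starRingEnd ℂ) (cform ((starRingEnd ℂ) q₁) ((starRingEnd ℂ) q₀) u) = cform q₁ q₀ u - ((starRingEnd ℂ) u - u) * q₁ := by
    simp [cform]; ring
  rw [e2, e1]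
  generalize (starRingEnd ℂ) (cform q₁ q₀ u) = q' at *
  generalize cform q₁ q₀ u = q at *
  have hd2 : id u + -(starRingEnd ℂ) u ≠ 0 := by rwa [id, ← sub_eq_add_neg]
  congr 1
  · field_simp
    simp
    ring
  · field_simp
    simp
    ring

/-- The building block `p^A q^{-B} Φ(ρ)`. -/
def block (Φ : ℂ → ℂ) (A B : ℕ) (q₁ q₀ u : ℂ) : ℂ :=
  cform ((starRingEnd ℂ) q₁) ((starRingEnd ℂ) q₀) u ^ A * (cform q₁ q₀ u ^ B)⁻¹ * Φ (crho q₁ q₀ u)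

/-- Both p and q are antiholomorphic in u, so ∂/∂u sees only Φ(ρ): it replaces Φ by Θ, raises A by
one and contributes a scalar factor. The ū-part is never used by value, but termwise differentiation
needs a bound for the whole real differential. -/
theorem hasFDerivAt_block {Φ Θ : ℂ → ℂ} (A B : ℕ) {q₁ q₀ u : ℂ} (hv : 0 < (q₁ * (starRingEnd ℂ) q₀).im)
    (hu : 0 < u.im)
    (hΦ : HasDerivAt Φ (Θ (crho q₁ q₀ u) / crho q₁ q₀ u) (crho q₁ q₀ u)) :
    ∃ b, HasFDerivAt (block Φ A B q₁ q₀)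
        (wirt (block Θ (A + 1) B q₁ q₀ u / ((u - (starRingEnd ℂ) u) * (starRingEnd ℂ) (cform q₁ q₀ u))) b) u ∧
      ‖wirt (block Θ (A + 1) B q₁ q₀ u / ((u - (starRingEnd ℂ) u) * (starRingEnd ℂ) (cform q₁ q₀ u))) b‖ ≤
        ‖cform q₁ q₀ u‖ ^ A / ‖cform q₁ q₀ u‖ ^ B / u.im *
          ((A + B) * ‖Φ (crho q₁ q₀ u)‖ + ‖Θ (crho q₁ q₀ u)‖) := by
  have hq := cform_ne_zero hv hu
  have hρ : (crho q₁ q₀ u : ℂ) ≠ 0 := by exact_mod_cast (crho_pos hv hu).ne'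
  have hd : u - (starRingEnd ℂ) u ≠ 0 := by
    rw [Complex.sub_conj]; simp [hu.ne', I_ne_zero]
  have h1 := HasDerivAt.wirt_comp (hasDerivAt_pow A _) (hasFDerivAt_cform ((starRingEnd ℂ) q₁) ((starRingEnd ℂ) q₀) u)
  have hinv : HasDerivAt (fun x : ℂ ↦ (x ^ B)⁻¹)
      (-((B : ℂ) * cform q₁ q₀ u ^ (B - 1)) / (cform q₁ q₀ u ^ B) ^ 2) (cform q₁ q₀ u) :=
    (hasDerivAt_pow B _).inv (pow_ne_zero B hq)
  have h2 := HasDerivAt.wirt_comp hinv (hasFDerivAt_cform q₁ q₀ u)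
  have h3 := HasDerivAt.wirt_comp hΦ (hasFDerivAt_crho hv hu)
  have h4 := HasFDerivAt.wirt_mul (HasFDerivAt.wirt_mul h1 h2) h3
  set p := cform ((starRingEnd ℂ) q₁) ((starRingEnd ℂ) q₀) u with hp
  set q := cform q₁ q₀ u with hqd
  set ρ := (crho q₁ q₀ u : ℂ) with hρd
  have hpq : ‖p‖ ≤ ‖q‖ := norm_cform_conj_le hv hu
  have hq1 := norm_coeff_mul_im_le hv hu
  have hqpos : 0 < ‖q‖ := norm_pos_iff.2 hq
  have hq1' : ‖q₁‖ ≤ ‖q‖ / u.im := by rwa [le_div_iff₀ hu]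
  have hdn : ‖u - (starRingEnd ℂ) u‖ = 2 * u.im := by
    rw [Complex.sub_conj, norm_mul, norm_I, mul_one, Complex.norm_real,
      Real.norm_of_nonneg (by positivity)]
  have hq'ne : (starRingEnd ℂ) q ≠ 0 := by simpa using hq
  refine ⟨_, h4.congr_fderiv (congrArg₂ wirt ?_ rfl), ?_⟩
  · simp only [block, ← hp, ← hqd, ← hρd]
    simp only [mul_zero, zero_mul, add_zero, zero_add]
    field_simp
    ring
  · refine (norm_wirt_le _ _).trans ?_
    have ha : ‖block Θ (A + 1) B q₁ q₀ u / ((u - (starRingEnd ℂ) u) * (starRingEnd ℂ) q)‖ ≤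
        ‖q‖ ^ A / ‖q‖ ^ B / u.im * (‖Θ ρ‖ / 2) := by
      rw [block, ← hp, ← hqd, ← hρd, norm_div, norm_mul, norm_mul, norm_mul, norm_conj, hdn, norm_inv, norm_pow,
        norm_pow]
      calc ‖p‖ ^ (A + 1) * (‖q‖ ^ B)⁻¹ * ‖Θ ρ‖ / (2 * u.im * ‖q‖)
          ≤ ‖q‖ ^ (A + 1) * (‖q‖ ^ B)⁻¹ * ‖Θ ρ‖ / (2 * u.im * ‖q‖) := by gcongr
        _ = _ := by rw [pow_succ]; field_simp
    have hb1 : ‖(A : ℂ) * p ^ (A - 1) * (starRingEnd ℂ) q₁ * (q ^ B)⁻¹ * Φ ρ‖ ≤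
        ‖q‖ ^ A / ‖q‖ ^ B / u.im * (A * ‖Φ ρ‖) := by
      rcases A with _ | A
      · simp
      · rw [add_tsub_cancel_right]
        simp only [norm_mul, norm_inv, norm_pow, norm_conj, Complex.norm_natCast]
        calc _ ≤ ((A + 1 : ℕ) : ℝ) * ‖q‖ ^ A * (‖q‖ / u.im) * (‖q‖ ^ B)⁻¹ * ‖Φ ρ‖ := by gcongr
          _ = _ := by rw [pow_succ]; field_simp
    have hb2 : ‖p ^ A * (-((B : ℂ) * q ^ (B - 1)) / (q ^ B) ^ 2 * q₁) * Φ ρ‖ ≤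
        ‖q‖ ^ A / ‖q‖ ^ B / u.im * (B * ‖Φ ρ‖) := by
      rcases B with _ | B
      · simp
      · rw [add_tsub_cancel_right]
        simp only [norm_mul, norm_div, norm_neg, norm_pow, Complex.norm_natCast]
        calc _ ≤ ‖q‖ ^ A * (((B + 1 : ℕ) : ℝ) * ‖q‖ ^ B / (‖q‖ ^ (B + 1)) ^ 2 * (‖q‖ / u.im)) *
              ‖Φ ρ‖ := by gcongr
          _ = _ := by field_simp; ring
    have hb3 : ‖p ^ A * (q ^ B)⁻¹ * (Θ ρ / ρ * (ρ * ((starRingEnd ℂ) p / (((starRingEnd ℂ) u - u) * q))))‖ ≤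
        ‖q‖ ^ A / ‖q‖ ^ B / u.im * (‖Θ ρ‖ / 2) := by
      have e : Θ ρ / ρ * (ρ * ((starRingEnd ℂ) p / (((starRingEnd ℂ) u - u) * q))) = Θ ρ * ((starRingEnd ℂ) p / (((starRingEnd ℂ) u - u) * q)) := by
        field_simp
      rw [e]
      simp only [norm_mul, norm_inv, norm_div, norm_pow, norm_conj]
      rw [norm_sub_rev, hdn]
      calc _ ≤ ‖q‖ ^ A * (‖q‖ ^ B)⁻¹ * (‖Θ ρ‖ * (‖q‖ / (2 * u.im * ‖q‖))) := by gcongr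
        _ = _ := by field_simp
    have hb := (norm_add₃_le (a := (A : ℂ) * p ^ (A - 1) * (starRingEnd ℂ) q₁ * (q ^ B)⁻¹ * Φ ρ)
      (b := p ^ A * (-((B : ℂ) * q ^ (B - 1)) / (q ^ B) ^ 2 * q₁) * Φ ρ)
      (c := p ^ A * (q ^ B)⁻¹ * (Θ ρ / ρ * (ρ * ((starRingEnd ℂ) p / (((starRingEnd ℂ) u - u) * q)))))).trans
      (add_le_add_three hb1 hb2 hb3)
    refine (add_le_add ha ((le_of_eq (congrArg norm ?_)).trans hb)).trans (le_of_eq ?_)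
    · ring
    · ring

/-! ### The terms of the iterated kernels -/

theorem conj_bilin (γ : SL(2, ℝ)) (z w : ℂ) : (starRingEnd ℂ) (bilin γ z w) = bilin γ ((starRingEnd ℂ) z) ((starRingEnd ℂ) w) := by
  simp [bilin]

theorem cform_left (γ : SL(2, ℝ)) (u w : ℂ) :
    cform ((γ 1 0 : ℂ) * w + γ 1 1) (-((γ 0 0 : ℂ) * w + γ 0 1)) u = bilin γ ((starRingEnd ℂ) u) w := by
  simp only [cform, bilin]; ring

theorem cform_conj_left (γ : SL(2, ℝ)) (u w : ℂ) :
    cform ((starRingEnd ℂ) ((γ 1 0 : ℂ) * w + γ 1 1)) ((starRingEnd ℂ) (-((γ 0 0 : ℂ) * w + γ 0 1))) u =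
      (starRingEnd ℂ) (bilin γ u w) := by
  simp only [cform, bilin, map_sub, map_mul, map_add, map_neg]; ring

theorem cform_right (γ : SL(2, ℝ)) (z u : ℂ) :
    cform ((γ 1 0 : ℂ) * z - γ 0 0) ((γ 1 1 : ℂ) * z - γ 0 1) u = bilin γ z ((starRingEnd ℂ) u) := by
  simp only [cform, bilin]; ring

theorem cform_conj_right (γ : SL(2, ℝ)) (z u : ℂ) :
    cform ((starRingEnd ℂ) ((γ 1 0 : ℂ) * z - γ 0 0)) ((starRingEnd ℂ) ((γ 1 1 : ℂ) * z - γ 0 1)) u = (starRingEnd ℂ) (bilin γ z u) := by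
  simp only [cform, bilin, map_sub, map_mul, map_add]; ring

theorem im_left (γ : SL(2, ℝ)) (w : ℂ) :
    (((γ 1 0 : ℂ) * w + γ 1 1) * (starRingEnd ℂ) (-((γ 0 0 : ℂ) * w + γ 0 1))).im = w.im := by
  have := det_entries γ
  simp
  linear_combination w.im * this

theorem im_right (γ : SL(2, ℝ)) (z : ℂ) :
    (((γ 1 0 : ℂ) * z - γ 0 0) * (starRingEnd ℂ) ((γ 1 1 : ℂ) * z - γ 0 1)).im = z.im := by
  have := det_entries γ
  simp
  linear_combination z.im * this

theorem norm_bilin_conj_right (γ : SL(2, ℝ)) (z w : ℂ) :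
    ‖bilin γ z ((starRingEnd ℂ) w)‖ = ‖bilin γ ((starRingEnd ℂ) z) w‖ := by
  rw [← norm_conj, conj_bilin, conj_conj]

theorem crho_left (γ : SL(2, ℝ)) (u w : ℂ) :
    crho ((γ 1 0 : ℂ) * w + γ 1 1) (-((γ 0 0 : ℂ) * w + γ 0 1)) u = rGam γ u w := by
  rw [crho, im_left, cform_left, rGam]

theorem crho_right (γ : SL(2, ℝ)) (z u : ℂ) :
    crho ((γ 1 0 : ℂ) * z - γ 0 0) ((γ 1 1 : ℂ) * z - γ 0 1) u = rGam γ z u := by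
  rw [crho, im_right, cform_right, rGam, norm_bilin_conj_right]; ring

/-- The term `(-1/16)^j conj(h)^{2j} B_j(r)`. -/
def kerE (s : ℂ) (j : ℕ) (γ : SL(2, ℝ)) (z w : ℂ) : ℂ :=
  (-1 / 16) ^ j * ((starRingEnd ℂ) (bilin γ z w) ^ (2 * j) * resB s j (rGam γ z w))

/-- The `∂/∂w`-derivative of `kerE`. -/
def kerA (s : ℂ) (j : ℕ) (γ : SL(2, ℝ)) (z w : ℂ) : ℂ :=
  (-1 / 16) ^ j / (w - (starRingEnd ℂ) w) *
    ((starRingEnd ℂ) (bilin γ z w) ^ (2 * j + 1) * (bilin γ ((starRingEnd ℂ) z) w)⁻¹ * resB' s j (rGam γ z w))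

theorem kerE_eq_block (s : ℂ) (j : ℕ) (γ : SL(2, ℝ)) (z w : ℂ) : kerE s j γ z w = (-1 / 16) ^ j *
    block (resB s j) (2 * j) 0 ((γ 1 0 : ℂ) * z - γ 0 0) ((γ 1 1 : ℂ) * z - γ 0 1) w := by
  rw [block, cform_conj_right, crho_right, kerE, pow_zero, inv_one, mul_one]

theorem kerA_eq_block (s : ℂ) (j : ℕ) (γ : SL(2, ℝ)) (z w : ℂ) :
    kerA s j γ z w = (-1 / 16) ^ j / (w - (starRingEnd ℂ) w) *
      block (resB' s j) (2 * j + 1) 1 ((γ 1 0 : ℂ) * w + γ 1 1) (-((γ 0 0 : ℂ) * w + γ 0 1)) z := by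
  rw [block, cform_conj_left, cform_left, crho_left, kerA, pow_one]

theorem mul_wirt (c a b : ℂ) : c • wirt a b = wirt (c * a) (c * b) := by
  ext
  simp [wirt]; ring

/-- Since |h(z̄,w)|² r = 4 Im z Im w, the growth of h^{2j} is paid for by the extra r^j in B_j.
Hence every kernel is controlled by r^{Re s}, whatever j is. -/
theorem bilin_pow_mul_rGam (γ : SL(2, ℝ)) {z w : ℂ} (hz : 0 < z.im) (hw : 0 < w.im) (σ : ℝ) (j : ℕ) :
    ‖bilin γ ((starRingEnd ℂ) z) w‖ ^ (2 * j) * rGam γ z w ^ (σ + j) =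
      4 ^ j * (z.im * w.im) ^ j * rGam γ z w ^ σ := by
  have h := norm_bilin_conj_pos γ hz hw
  have hr := rGam_pos γ hz hw
  have e : ‖bilin γ ((starRingEnd ℂ) z) w‖ ^ 2 * rGam γ z w = 4 * (z.im * w.im) := by
    rw [rGam]; field_simp
  rw [Real.rpow_add hr, Real.rpow_natCast, pow_mul, mul_comm (rGam γ z w ^ σ), ← mul_assoc,
    ← mul_pow, e, mul_pow]

theorem exists_resB_bound {s : ℂ} (hs : 1 < s.re) (j : ℕ) :
    ∃ C : ℝ, ∃ M : ℕ, 0 ≤ C ∧ ∀ r : ℝ, 0 < r → r < 1 →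
      ‖resB s j r‖ ≤ C * r ^ (s.re + j) / (1 - r) ^ M ∧
      ‖resB' s j r‖ ≤ C * r ^ (s.re + j) / (1 - r) ^ M ∧
      ‖resB s (j + 1) r / r‖ ≤ C * r ^ (s.re + j) / (1 - r) ^ M := by
  obtain ⟨C₁, M₁, h₁, H₁⟩ := norm_resB_le hs j
  obtain ⟨C₂, M₂, h₂, H₂⟩ := norm_resB'_le hs j
  obtain ⟨C₃, M₃, h₃, H₃⟩ := norm_resB_le hs (j + 1)
  refine ⟨C₁ + C₂ + C₃, M₁ + M₂ + M₃, by positivity, fun r h0 h1 ↦ ?_⟩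
  have key {C : ℝ} {M : ℕ} (hC : 0 ≤ C) (hC' : C ≤ C₁ + C₂ + C₃) (hM : M ≤ M₁ + M₂ + M₃) :
      C * r ^ (s.re + j) / (1 - r) ^ M ≤
        (C₁ + C₂ + C₃) * r ^ (s.re + j) / (1 - r) ^ (M₁ + M₂ + M₃) := by
    have : 0 < 1 - r := by linarith
    have h4 : (1 - r) ^ (M₁ + M₂ + M₃) ≤ (1 - r) ^ M := pow_le_pow_of_le_one this.le (by linarith) hM
    have := Real.rpow_nonneg h0.le (s.re + j)
    gcongr
  refine ⟨(H₁ r h0 h1).trans (key h₁ (by linarith) (by omega)),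
    (H₂ r h0 h1).trans (key h₂ (by linarith) (by omega)), ?_⟩
  refine le_trans ?_ (key h₃ (by linarith) (by omega) : C₃ * _ / (1 - r) ^ M₃ ≤ _)
  rw [norm_div, Complex.norm_of_nonneg h0.le, div_le_iff₀ h0]
  refine (H₃ r h0 h1).trans (le_of_eq ?_)
  rw [Nat.cast_succ, ← add_assoc, Real.rpow_add_one h0.ne']; ring

theorem norm_scale (j : ℕ) : ‖((-1 / 16 : ℂ)) ^ j‖ * 4 ^ j ≤ 1 := by
  rw [norm_pow, ← mul_pow]
  refine pow_le_one₀ (by positivity) ?_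
  norm_num

theorem norm_sub_conj {u : ℂ} (hu : 0 < u.im) : ‖u - (starRingEnd ℂ) u‖ = 2 * u.im := by
  rw [Complex.sub_conj, norm_mul, norm_I, mul_one, Complex.norm_real,
    Real.norm_of_nonneg (by positivity)]

theorem rGam_mem_slitPlane (γ : SL(2, ℝ)) {z w : ℂ} (hz : 0 < z.im) (hw : 0 < w.im) :
    (rGam γ z w : ℂ) ∈ slitPlane :=
  Complex.ofReal_mem_slitPlane.2 (rGam_pos γ hz hw)

theorem norm_bilin_le (γ : SL(2, ℝ)) {z w : ℂ} (hz : 0 < z.im) (hw : 0 < w.im) :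
    ‖bilin γ z w‖ ≤ ‖bilin γ ((starRingEnd ℂ) z) w‖ := by
  refine (pow_le_pow_iff_left₀ (norm_nonneg _) (norm_nonneg _) two_ne_zero).1 ?_
  rw [norm_bilin_conj_sq]
  have := mul_pos hz hw
  nlinarith

/-- One application of the mixed derivative to a single term: ∂_w takes `kerE` to `kerA`, and ∂_z
takes `kerA` to the next `kerE` divided by (yy')². The constants do not depend on γ, z or w, and the
factor r^{Re s} makes the bounds summable over `Γ`. -/
theorem exists_kerE_bound {s : ℂ} (hs : 1 < s.re) (j : ℕ) :
    ∃ C : ℝ, ∃ M : ℕ, 0 ≤ C ∧ ∀ (γ : SL(2, ℝ)) (z w : ℂ), 0 < z.im → 0 < w.im → rGam γ z w < 1 →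
      ‖kerE s j γ z w‖ ≤ C * (z.im * w.im) ^ j * rGam γ z w ^ s.re / (1 - rGam γ z w) ^ M ∧
      ‖kerA s j γ z w‖ ≤ C * (z.im * w.im) ^ j * rGam γ z w ^ s.re / (1 - rGam γ z w) ^ M / w.im ∧
      (∃ b, HasFDerivAt (fun w ↦ kerE s j γ z w) (wirt (kerA s j γ z w) b) w ∧
        ‖wirt (kerA s j γ z w) b‖ ≤
          C * (z.im * w.im) ^ j * rGam γ z w ^ s.re / (1 - rGam γ z w) ^ M / w.im) ∧
      ∃ b, HasFDerivAt (fun z ↦ kerA s j γ z w)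
          (wirt (kerE s (j + 1) γ z w / ((z.im * w.im) ^ 2 : ℝ)) b) z ∧
        ‖wirt (kerE s (j + 1) γ z w / ((z.im * w.im) ^ 2 : ℝ)) b‖ ≤
          C * (z.im * w.im) ^ j * rGam γ z w ^ s.re / (1 - rGam γ z w) ^ M / w.im / z.im := by
  obtain ⟨C, M, hC, H⟩ := exists_resB_bound hs j
  refine ⟨(2 * j + 3) * C, M, by positivity, fun γ z w hz hw hr1 ↦ ?_⟩
  have hr0 := rGam_pos γ hz hw
  obtain ⟨H1, H2, H3⟩ := H _ hr0 hr1
  have hm := norm_bilin_conj_pos γ hz hw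
  have hle := norm_bilin_le γ hz hw
  have hmem := rGam_mem_slitPlane γ hz hw
  have hnorm : ‖(rGam γ z w : ℂ)‖ < 1 := by rwa [Complex.norm_of_nonneg hr0.le]
  have hB := bilin_pow_mul_rGam γ hz hw s.re j
  set m := ‖bilin γ ((starRingEnd ℂ) z) w‖ with hmdef
  set r := rGam γ z w with hrdef
  have h1r : 0 < 1 - r := by linarith
  set X := (z.im * w.im) ^ j * r ^ s.re / (1 - r) ^ M with hX
  have hXnn : 0 ≤ X := by positivity
  have hκ := norm_scale j
  set κ := ‖((-1 / 16 : ℂ)) ^ j‖ with hκdef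
  have hκnn : 0 ≤ κ := norm_nonneg _
  have hgoal : (2 * j + 3) * C * (z.im * w.im) ^ j * r ^ s.re / (1 - r) ^ M =
      (2 * j + 3) * (C * X) := by rw [hX]; ring
  have hCX : 0 ≤ C * X := by positivity
  have hj : (0 : ℝ) ≤ j := Nat.cast_nonneg j
  have key (t : ℝ) (ht : t ≤ C * r ^ (s.re + j) / (1 - r) ^ M) : κ * (m ^ (2 * j) * t) ≤ C * X := by
    calc κ * (m ^ (2 * j) * t) ≤ κ * (m ^ (2 * j) * (C * r ^ (s.re + j) / (1 - r) ^ M)) := by gcongr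
      _ = κ * 4 ^ j * (C * X) := by
        rw [hX]
        linear_combination (κ * C / (1 - r) ^ M) * hB
      _ ≤ 1 * (C * X) := by gcongr
      _ = C * X := one_mul _
  have hwn := norm_sub_conj hw
  rw [hgoal]
  refine ⟨?_, ?_, ?_, ?_⟩
  · rw [kerE, norm_mul, norm_mul, norm_pow ((starRingEnd ℂ) _), norm_conj]
    calc κ * (‖bilin γ z w‖ ^ (2 * j) * ‖resB s j r‖) ≤ κ * (m ^ (2 * j) * ‖resB s j r‖) := by gcongr
      _ ≤ C * X := key _ H1
      _ ≤ _ := by nlinarith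
  · rw [kerA, norm_mul, norm_div, hwn, norm_mul, norm_mul, norm_pow ((starRingEnd ℂ) _), norm_conj, norm_inv]
    calc κ / (2 * w.im) * (‖bilin γ z w‖ ^ (2 * j + 1) * m⁻¹ * ‖resB' s j r‖)
        ≤ κ / (2 * w.im) * (m ^ (2 * j + 1) * m⁻¹ * ‖resB' s j r‖) := by gcongr
      _ = κ * (m ^ (2 * j) * ‖resB' s j r‖) / w.im / 2 := by rw [pow_succ]; field_simp
      _ ≤ C * X / w.im / 2 := by gcongr ?_ / w.im / 2; exact key _ H2
      _ ≤ (2 * j + 3) * (C * X) / w.im := by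
        rw [div_div, mul_comm w.im, ← div_div]
        gcongr
        linarith [mul_nonneg hj hCX]
  · have hv : 0 < (((γ 1 0 : ℂ) * z - γ 0 0) * (starRingEnd ℂ) ((γ 1 1 : ℂ) * z - γ 0 1)).im := by
      rwa [im_right]
    have hΦ : HasDerivAt (resB s j) (resB' s j r / r) (r : ℂ) := hasDerivAt_resB hs j hnorm hmem
    obtain ⟨b, hb, hb'⟩ := hasFDerivAt_block (Φ := resB s j) (Θ := resB' s j) (2 * j) 0 hv hw
      (by rw [crho_right]; exact hΦ)
    have hfun : (fun w ↦ kerE s j γ z w) = fun w ↦ (-1 / 16 : ℂ) ^ j *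
        block (resB s j) (2 * j) 0 ((γ 1 0 : ℂ) * z - γ 0 0) ((γ 1 1 : ℂ) * z - γ 0 1) w := by
      funext w; exact kerE_eq_block s j γ z w
    have ha : (-1 / 16 : ℂ) ^ j * (block (resB' s j) (2 * j + 1) 0 ((γ 1 0 : ℂ) * z - γ 0 0)
        ((γ 1 1 : ℂ) * z - γ 0 1) w / ((w - (starRingEnd ℂ) w) * (starRingEnd ℂ) (cform ((γ 1 0 : ℂ) * z - γ 0 0)
        ((γ 1 1 : ℂ) * z - γ 0 1) w))) = kerA s j γ z w := by
      have hc := conj_bilin γ z ((starRingEnd ℂ) w)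
      rw [conj_conj] at hc
      rw [block, cform_conj_right, crho_right, cform_right, hc, kerA, ← hrdef]
      generalize w - (starRingEnd ℂ) w = D
      ring
    refine ⟨(-1 / 16 : ℂ) ^ j * b, ?_, ?_⟩
    · rw [hfun, ← ha, ← mul_wirt]
      exact hb.const_mul _
    · rw [← ha, ← mul_wirt, norm_smul]
      rw [cform_right, norm_bilin_conj_right, crho_right, ← hmdef, ← hrdef, pow_zero, div_one] at hb'
      rw [cform_right]
      calc _ ≤ κ * (m ^ (2 * j) / w.im * (((2 * j : ℕ) + (0 : ℕ)) * ‖resB s j r‖ + ‖resB' s j r‖)) := by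
            gcongr
        _ = ((2 * j) * (κ * (m ^ (2 * j) * ‖resB s j r‖)) + κ * (m ^ (2 * j) * ‖resB' s j r‖)) / w.im := by
            push_cast; ring
        _ ≤ ((2 * j) * (C * X) + C * X) / w.im := by
            gcongr ?_ / w.im
            exact add_le_add (mul_le_mul_of_nonneg_left (key _ H1) (by positivity)) (key _ H2)
        _ ≤ _ := by gcongr; linarith
  · have hv : 0 < (((γ 1 0 : ℂ) * w + γ 1 1) * (starRingEnd ℂ) (-((γ 0 0 : ℂ) * w + γ 0 1))).im := by
      rwa [im_left]
    set Θ : ℂ → ℂ := fun x ↦ resB s (j + 1) x / x with hΘ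
    have hr0' : (r : ℂ) ≠ 0 := by exact_mod_cast hr0.ne'
    have hΦ : HasDerivAt (resB' s j) (Θ r / r) (r : ℂ) :=
      (hasDerivAt_resB' hs j hnorm hmem).congr_deriv (by rw [hΘ]; field_simp)
    obtain ⟨b, hb, hb'⟩ := hasFDerivAt_block (Φ := resB' s j) (Θ := Θ) (2 * j + 1) 1 hv hz
      (by rw [crho_left]; exact hΦ)
    have hfun : (fun z ↦ kerA s j γ z w) = fun z ↦ (-1 / 16 : ℂ) ^ j / (w - (starRingEnd ℂ) w) *
        block (resB' s j) (2 * j + 1) 1 ((γ 1 0 : ℂ) * w + γ 1 1) (-((γ 0 0 : ℂ) * w + γ 0 1)) z := by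
      funext z; exact kerA_eq_block s j γ z w
    have hmc : bilin γ ((starRingEnd ℂ) z) w ≠ 0 := norm_pos_iff.1 hm
    have hmc' : (starRingEnd ℂ) (bilin γ ((starRingEnd ℂ) z) w) ≠ 0 := by simpa using hmc
    have hdw : w - (starRingEnd ℂ) w ≠ 0 := norm_pos_iff.1 (by rw [hwn]; positivity)
    have hdz : z - (starRingEnd ℂ) z ≠ 0 := norm_pos_iff.1 (by rw [norm_sub_conj hz]; positivity)
    -- Both sides are 4yy'. Through this identity the denominator r in Θ, together with the factors
    -- from the two derivatives, becomes (yy')^{-2}, and the constant -1/16 appears.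
    have hrm : (r : ℂ) * (bilin γ ((starRingEnd ℂ) z) w * (starRingEnd ℂ) (bilin γ ((starRingEnd ℂ) z) w)) = -((z - (starRingEnd ℂ) z) * (w - (starRingEnd ℂ) w)) := by
      rw [Complex.mul_conj, Complex.normSq_eq_norm_sq, Complex.sub_conj, Complex.sub_conj, hrdef, rGam,
        ← hmdef]
      push_cast
      have : (m : ℂ) ≠ 0 := by exact_mod_cast hm.ne'
      field_simp
      linear_combination (4 * (z.im : ℂ) * w.im) * I_sq
    have hyy : ((z.im * w.im) ^ 2 : ℝ) = ((z - (starRingEnd ℂ) z) * (w - (starRingEnd ℂ) w)) ^ 2 / 16 := by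
      rw [Complex.sub_conj, Complex.sub_conj]
      push_cast
      linear_combination (-(z.im : ℂ) ^ 2 * w.im ^ 2 * (I ^ 2 - 1)) * I_sq
    have ha : (-1 / 16 : ℂ) ^ j / (w - (starRingEnd ℂ) w) * (block Θ (2 * j + 1 + 1) 1 ((γ 1 0 : ℂ) * w + γ 1 1)
        (-((γ 0 0 : ℂ) * w + γ 0 1)) z / ((z - (starRingEnd ℂ) z) * (starRingEnd ℂ) (cform ((γ 1 0 : ℂ) * w + γ 1 1)
        (-((γ 0 0 : ℂ) * w + γ 0 1)) z))) = kerE s (j + 1) γ z w / ((z.im * w.im) ^ 2 : ℝ) := by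
      rw [block, cform_conj_left, crho_left, cform_left, kerE, ← hrdef, hyy, hΘ]
      dsimp only
      have hr' : (r : ℂ) = -((z - (starRingEnd ℂ) z) * (w - (starRingEnd ℂ) w)) / (bilin γ ((starRingEnd ℂ) z) w * (starRingEnd ℂ) (bilin γ ((starRingEnd ℂ) z) w)) := by
        rw [eq_div_iff (mul_ne_zero hmc hmc')]; exact hrm
      have e1 : ∀ P R : ℂ, (-1 / 16 : ℂ) ^ j / (w - (starRingEnd ℂ) w) * (P * (bilin γ ((starRingEnd ℂ) z) w ^ 1)⁻¹ * (R / r) /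
          ((z - (starRingEnd ℂ) z) * (starRingEnd ℂ) (bilin γ ((starRingEnd ℂ) z) w))) = (-1 / 16 : ℂ) ^ (j + 1) * (P * R) /
          (((z - (starRingEnd ℂ) z) * (w - (starRingEnd ℂ) w)) ^ 2 / 16) := by
        intro P R
        rw [hr', pow_succ (-1 / 16 : ℂ) j]
        generalize (-1 / 16 : ℂ) ^ j = q
        generalize w - (starRingEnd ℂ) w = D at *
        generalize z - (starRingEnd ℂ) z = D' at *
        field_simp
      exact e1 _ _
    refine ⟨(-1 / 16 : ℂ) ^ j / (w - (starRingEnd ℂ) w) * b, ?_, ?_⟩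
    · rw [hfun, ← ha, ← mul_wirt]
      exact hb.const_mul _
    · rw [← ha, ← mul_wirt, norm_smul, norm_div, hwn]
      rw [cform_left, crho_left, ← hmdef, ← hrdef, pow_one] at hb'
      rw [cform_left]
      calc _ ≤ κ / (2 * w.im) * (m ^ (2 * j + 1) / m / z.im *
            (((2 * j + 1 : ℕ) + (1 : ℕ)) * ‖resB' s j r‖ + ‖Θ r‖)) := by gcongr
        _ = ((2 * j + 2) * (κ * (m ^ (2 * j) * ‖resB' s j r‖)) + κ * (m ^ (2 * j) * ‖Θ r‖)) /
            (2 * w.im) / z.im := by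
            push_cast
            rw [pow_succ]
            field_simp
            ring
        _ ≤ ((2 * j + 2) * (C * X) + C * X) / (2 * w.im) / z.im := by
            gcongr ?_ / (2 * w.im) / z.im
            exact add_le_add (mul_le_mul_of_nonneg_left (key _ H2) (by positivity)) (key _ H3)
        _ ≤ ((2 * j + 2) * (C * X) + C * X) / (1 * w.im) / z.im := by
            gcongr
            norm_num
        _ = _ := by rw [one_mul]; ring

section

open Filter Topology

/-! ### Termwise differentiation of the Poincaré series -/

theorem dZ_eq_tsum {ι : Type*} {V : Set ℂ} (hV : IsOpen V) (hV' : IsPreconnected V) {u : ι → ℝ}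
    (hu : Summable u) {T : ι → ℂ → ℂ} {T' : ι → ℂ → ℂ →L[ℝ] ℂ}
    (hT : ∀ i, ∀ x ∈ V, HasFDerivAt (T i) (T' i x) x) (hT' : ∀ i, ∀ x ∈ V, ‖T' i x‖ ≤ u i)
    {f : ℍ → ℂ} {z : ℍ} (hz : (z : ℂ) ∈ V) (hsum : Summable fun i ↦ T i z)
    (hf : ∀ w : ℍ, (w : ℂ) ∈ V → f w = ∑' i, T i w) :
    dZ f z = ∑' i, dzCoeff (T' i z) := by
  have h1 := hasFDerivAt_tsum_of_isPreconnected hu hV hV' hT hT' hz hsum hz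
  have h2 : f ∘ UpperHalfPlane.ofComplex =ᶠ[𝓝 (z : ℂ)] fun x ↦ ∑' i, T i x := by
    filter_upwards [hV.mem_nhds hz, UpperHalfPlane.isOpen_upperHalfPlaneSet.mem_nhds z.im_pos]
      with x hx hx'
    rw [Function.comp, UpperHalfPlane.ofComplex_apply_of_im_pos hx']
    exact hf ⟨x, hx'⟩ hx
  rw [dZ_eq, (h1.congr_of_eventuallyEq h2).fderiv]
  exact dzCoeff.map_tsum (.of_norm_bounded hu fun i ↦ hT' i _ hz)

/-- A neighbourhood on which all non-trivial terms of the Poincaré series are controlled. -/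
structure IsGoodNhd {ι : Type*} (V : Set ℂ) (γ : ι → SL(2, ℝ)) (R : ι → ℝ) (η H K : ℝ) : Prop where
  isOpen : IsOpen V
  isPreconnected : IsPreconnected V
  η_pos : 0 < η
  le_im : ∀ z ∈ V, η ≤ z.im
  im_le : ∀ z ∈ V, z.im ≤ H
  rGam_le : ∀ i, ∀ z ∈ V, ∀ w ∈ V, rGam (γ i) z w ≤ K * R i
  one_sub : ∀ i, ∀ z ∈ V, ∀ w ∈ V, η ≤ 1 - rGam (γ i) z w

/-- By induction: the factor (yy')^{2j} in the operator cancels the prefactor of the previous stage,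
the series is differentiated term by term, and the (yy')^{-2} gained from each term joins
(yy')^{-2j} to form the new prefactor. -/
theorem IsGoodNhd.iterL_eq {ι : Type*} {V : Set ℂ} {γ : ι → SL(2, ℝ)} {R : ι → ℝ} {η H K : ℝ}
    (hV : IsGoodNhd V γ R η H K) {s : ℂ} (hs : 1 < s.re)
    (hR : Summable fun i ↦ (K * R i) ^ s.re) {K₀ : ℍ → ℍ → ℂ}
    (hK₀ : ∀ z w : ℍ, (z : ℂ) ∈ V → (w : ℂ) ∈ V → K₀ z w = ∑' i, kerE s 0 (γ i) z w) (j : ℕ) :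
    ∀ z w : ℍ, (z : ℂ) ∈ V → (w : ℂ) ∈ V →
      iterL j K₀ z w = (((z.im * w.im) ^ (2 * j) : ℝ) : ℂ)⁻¹ * ∑' i, kerE s j (γ i) z w := by
  induction j with
  | zero =>
    intro z w hz hw
    simp [iterL, hK₀ z w hz hw]
  | succ j ih =>
    obtain ⟨C, M, hC, hE⟩ := exists_kerE_bound hs j
    have hη := hV.η_pos
    have hbd (i : ι) (z w : ℂ) (hz : z ∈ V) (hw : w ∈ V) :
        C * (z.im * w.im) ^ j * rGam (γ i) z w ^ s.re / (1 - rGam (γ i) z w) ^ M ≤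
          C * (H * H) ^ j / η ^ M * (K * R i) ^ s.re := by
      have z0 := hη.trans_le (hV.le_im z hz)
      have w0 := hη.trans_le (hV.le_im w hw)
      have hr := rGam_pos (γ i) z0 w0
      have h1 := Real.rpow_le_rpow hr.le (hV.rGam_le i z hz w hw) (by linarith : 0 ≤ s.re)
      have h2 := hV.one_sub i z hz w hw
      have hH : 0 ≤ H := z0.le.trans (hV.im_le z hz)
      have := hV.im_le z hz
      have := hV.im_le w hw
      have h3 := (Real.rpow_nonneg hr.le s.re).trans h1
      calc _ ≤ C * (H * H) ^ j * (K * R i) ^ s.re / η ^ M := by gcongr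
        _ = _ := by ring
    have hnn (i : ι) (z w : ℂ) (hz : z ∈ V) (hw : w ∈ V) :
        0 ≤ C * (z.im * w.im) ^ j * rGam (γ i) z w ^ s.re / (1 - rGam (γ i) z w) ^ M := by
      have z0 := hη.trans_le (hV.le_im z hz)
      have w0 := hη.trans_le (hV.le_im w hw)
      have hr := rGam_pos (γ i) z0 w0
      have h2 := hη.trans_le (hV.one_sub i z hz w hw)
      positivity
    have hsB : Summable fun i ↦ C * (H * H) ^ j / η ^ M * (K * R i) ^ s.re := hR.mul_left _
    have hlt (i : ι) (z w : ℂ) (hz : z ∈ V) (hw : w ∈ V) : rGam (γ i) z w < 1 := by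
      have := hV.one_sub i z hz w hw; linarith
    have hE' (i : ι) (z w : ℂ) (hz : z ∈ V) (hw : w ∈ V) :=
      hE (γ i) z w (hη.trans_le (hV.le_im z hz)) (hη.trans_le (hV.le_im w hw)) (hlt i z w hz hw)
    have hsE (z w : ℂ) (hz : z ∈ V) (hw : w ∈ V) : Summable fun i ↦ kerE s j (γ i) z w :=
      .of_norm_bounded hsB fun i ↦ (hE' i z w hz hw).1.trans (hbd i z w hz hw)
    have hdiv {a b x : ℝ} (hab : a ≤ b) (ha : 0 ≤ a) (hx : η ≤ x) : a / x ≤ b / η := by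
      have := ha.trans hab
      gcongr
    have hsA (z w : ℂ) (hz : z ∈ V) (hw : w ∈ V) : Summable fun i ↦ kerA s j (γ i) z w :=
      .of_norm_bounded (hsB.div_const η) fun i ↦ (hE' i z w hz hw).2.1.trans
        (hdiv (hbd i z w hz hw) (hnn i z w hz hw) (hV.le_im w hw))
    have hinner (z w : ℍ) (hz : (z : ℂ) ∈ V) (hw : (w : ℂ) ∈ V) :
        dZ (fun w' ↦ (((z.im * w'.im) ^ (2 * j) : ℝ) : ℂ) * iterL j K₀ z w') w =
          ∑' i, kerA s j (γ i) z w := by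
      have hch : ∀ i, ∃ b : ℂ → ℂ, ∀ x ∈ V,
          HasFDerivAt (fun w ↦ kerE s j (γ i) z w) (wirt (kerA s j (γ i) z x) (b x)) x ∧
          ‖wirt (kerA s j (γ i) z x) (b x)‖ ≤ C * (H * H) ^ j / η ^ M * (K * R i) ^ s.re / η := by
        intro i
        have : ∀ x : ℂ, ∃ b : ℂ, x ∈ V →
            HasFDerivAt (fun w ↦ kerE s j (γ i) z w) (wirt (kerA s j (γ i) z x) b) x ∧
            ‖wirt (kerA s j (γ i) z x) b‖ ≤ C * (H * H) ^ j / η ^ M * (K * R i) ^ s.re / η := by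
          intro x
          by_cases hx : x ∈ V
          · obtain ⟨b, h1, h2⟩ := (hE' i z x hz hx).2.2.1
            exact ⟨b, fun _ ↦ ⟨h1, h2.trans
              (hdiv (hbd i z x hz hx) (hnn i z x hz hx) (hV.le_im x hx))⟩⟩
          · exact ⟨0, fun h ↦ absurd h hx⟩
        exact Classical.axiomOfChoice this
      choose b hb using hch
      rw [dZ_eq_tsum hV.isOpen hV.isPreconnected (hsB.div_const η)
        (T := fun i x ↦ kerE s j (γ i) z x) (T' := fun i x ↦ wirt (kerA s j (γ i) z x) (b i x))
        (fun i x hx ↦ (hb i x hx).1) (fun i x hx ↦ (hb i x hx).2) hw (hsE z w hz hw)]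
      · simp_rw [dzCoeff_wirt]
      · intro w' hw'
        rw [ih z w' hz hw', mul_inv_cancel_left₀]
        have := z.im_pos
        have := w'.im_pos
        exact_mod_cast (by positivity : (z.im * w'.im) ^ (2 * j) ≠ 0)
    intro z w hz hw
    have houter : dZ (fun z' ↦ dZ (fun w' ↦ (((z'.im * w'.im) ^ (2 * j) : ℝ) : ℂ) *
        iterL j K₀ z' w') w) z =
        ∑' i, kerE s (j + 1) (γ i) z w / (((z.im * w.im) ^ 2 : ℝ) : ℂ) := by
      have hch : ∀ i, ∃ b : ℂ → ℂ, ∀ x ∈ V,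
          HasFDerivAt (fun z ↦ kerA s j (γ i) z w)
            (wirt (kerE s (j + 1) (γ i) x w / (((x.im * (w : ℂ).im) ^ 2 : ℝ) : ℂ)) (b x)) x ∧
          ‖wirt (kerE s (j + 1) (γ i) x w / (((x.im * (w : ℂ).im) ^ 2 : ℝ) : ℂ)) (b x)‖ ≤
            C * (H * H) ^ j / η ^ M * (K * R i) ^ s.re / η / η := by
        intro i
        have : ∀ x : ℂ, ∃ b : ℂ, x ∈ V →
            HasFDerivAt (fun z ↦ kerA s j (γ i) z w)
              (wirt (kerE s (j + 1) (γ i) x w / (((x.im * (w : ℂ).im) ^ 2 : ℝ) : ℂ)) b) x ∧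
            ‖wirt (kerE s (j + 1) (γ i) x w / (((x.im * (w : ℂ).im) ^ 2 : ℝ) : ℂ)) b‖ ≤
              C * (H * H) ^ j / η ^ M * (K * R i) ^ s.re / η / η := by
          intro x
          by_cases hx : x ∈ V
          · obtain ⟨b, h1, h2⟩ := (hE' i x w hx hw).2.2.2
            refine ⟨b, fun _ ↦ ⟨h1, h2.trans (hdiv (hdiv (hbd i x w hx hw) (hnn i x w hx hw)
              (hV.le_im w hw)) (div_nonneg (hnn i x w hx hw) ?_) (hV.le_im x hx))⟩⟩
            exact hη.le.trans (hV.le_im w hw)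
          · exact ⟨0, fun h ↦ absurd h hx⟩
        exact Classical.axiomOfChoice this
      choose b hb using hch
      rw [dZ_eq_tsum hV.isOpen hV.isPreconnected ((hsB.div_const η).div_const η)
        (T := fun i x ↦ kerA s j (γ i) x w)
        (T' := fun i x ↦ wirt (kerE s (j + 1) (γ i) x w /
          (((x.im * (w : ℂ).im) ^ 2 : ℝ) : ℂ)) (b i x))
        (fun i x hx ↦ (hb i x hx).1) (fun i x hx ↦ (hb i x hx).2) hz (hsA z w hz hw)]
      · simp_rw [dzCoeff_wirt]; rfl
      · intro z' hz'
        exact hinner z' w hz' hw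
    rw [iterL, opL, houter, tsum_div_const, show 2 * (j + 1) = 2 * j + 2 by ring, pow_add]
    push_cast
    rw [mul_inv]
    ring

/-- The non-trivial elements of `Γ`. -/
abbrev NonTriv (Γ : Subgroup SL(2, ℝ)) : Type := {γ : Γ // γ ≠ 1}

/-- Moving both points within ε/4 of z₀ changes a displacement by at most ε/2. So r changes by a
factor of at most e^{ε/2} and stays below 1/cosh²(ε/4). -/
theorem exists_isGoodNhd {Γ : Subgroup SL(2, ℝ)} {z₀ : ℍ} {ε : ℝ} (hε : 0 < ε)
    (hth : Thick Γ ε z₀) :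
    ∃ (V : Set ℂ) (η H : ℝ), (z₀ : ℂ) ∈ V ∧
      IsGoodNhd V (fun i : NonTriv Γ ↦ (i.1 : SL(2, ℝ)))
        (fun i ↦ rGam (i.1 : SL(2, ℝ)) z₀ z₀) η H (Real.exp (ε / 2)) := by
  have h1 : (UpperHalfPlane.coe '' Metric.ball z₀ (ε / 4)) ∈ 𝓝 (z₀ : ℂ) :=
    (UpperHalfPlane.isOpenEmbedding_coe.isOpenMap _ Metric.isOpen_ball).mem_nhds
      ⟨z₀, Metric.mem_ball_self (by positivity), rfl⟩
  obtain ⟨r, hr, hball⟩ := Metric.mem_nhds_iff.1 h1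
  set ρ := min r (z₀.im / 2) with hρ
  have hz0 := z₀.im_pos
  have hρ0 : 0 < ρ := lt_min hr (by positivity)
  have him (z : ℂ) (hz : z ∈ Metric.ball (z₀ : ℂ) ρ) : |z.im - z₀.im| ≤ z₀.im / 2 := by
    rw [Metric.mem_ball, Complex.dist_eq] at hz
    exact (Complex.abs_im_le_norm (z - z₀)).trans (hz.le.trans (min_le_right _ _))
  set c := 1 / Real.cosh (ε / 4) ^ 2 with hc
  have hcosh : 1 < Real.cosh (ε / 4) := Real.one_lt_cosh.2 (by positivity)
  have hc1 : c < 1 := by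
    rw [hc, div_lt_one (by positivity)]
    nlinarith
  have hdist (z w : ℂ) (hz : z ∈ Metric.ball (z₀ : ℂ) ρ) (hw : w ∈ Metric.ball (z₀ : ℂ) ρ) :
      ∃ z' w' : ℍ, (z' : ℂ) = z ∧ (w' : ℂ) = w ∧ ∀ γ : SL(2, ℝ),
        dist z₀ (γ • z₀) ≤ dist z' (γ • w') + ε / 2 := by
    obtain ⟨z', hz', rfl⟩ := hball (Metric.ball_subset_ball (min_le_left _ _) hz)
    obtain ⟨w', hw', rfl⟩ := hball (Metric.ball_subset_ball (min_le_left _ _) hw)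
    refine ⟨z', w', rfl, rfl, fun γ ↦ ?_⟩
    rw [Metric.mem_ball] at hz' hw'
    have := dist_triangle4 z₀ z' (γ • w') (γ • z₀)
    rw [dist_smul, dist_comm z₀ z'] at this
    linarith
  refine ⟨Metric.ball z₀ ρ, min (z₀.im / 2) (1 - c), 3 / 2 * z₀.im, Metric.mem_ball_self hρ0,
    Metric.isOpen_ball, (convex_ball _ _).isPreconnected, lt_min (by positivity) (by linarith),
    fun z hz ↦ ?_, fun z hz ↦ ?_, fun i z hz w hw ↦ ?_, fun i z hz w hw ↦ ?_⟩
  · refine (min_le_left _ _).trans ?_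
    linarith [(abs_le.1 (him z hz)).1]
  · linarith [(abs_le.1 (him z hz)).2]
  · obtain ⟨z', w', rfl, rfl, hd⟩ := hdist z w hz hw
    rw [← rInv_smul, ← rInv_smul]
    exact rInv_le_exp_mul (by positivity) (hd i.1)
  · obtain ⟨z', w', rfl, rfl, hd⟩ := hdist z w hz hw
    refine (min_le_right _ _).trans ?_
    have hne : ((i.1 : Γ) : SL(2, ℝ)) ≠ 1 := fun h ↦ i.2 (Subtype.ext h)
    have h2 := hth _ i.1.2 hne
    have h3 := hd i.1
    rw [← rInv_smul, rInv_eq_cosh, hc]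
    have h4 : Real.cosh (ε / 4) ≤ Real.cosh (dist z' ((i.1 : SL(2, ℝ)) • w') / 2) := by
      rw [Real.cosh_le_cosh, abs_of_pos (by positivity), abs_of_nonneg (by positivity)]
      linarith
    gcongr

/-- The diagonal term of the Poincaré series attached to `γ`, multiplied by `conj g`. -/
def diagTerm (k : ℕ) (s : ℂ) (g : ℍ → ℂ) (γ : SL(2, ℝ)) (z : ℍ) : ℂ :=
  (starRingEnd ℂ) (g z) * kerE s k γ z z

theorem summable_rGam_nonTriv {Γ : Subgroup SL(2, ℝ)} [DiscreteTopology Γ] {z : ℍ} {ε σ : ℝ}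
    (hσ : 1 < σ) (hε : 0 < ε) (hε1 : ε ≤ 1) (hth : Thick Γ ε z) (K : ℝ) (hK : 0 ≤ K) :
    Summable fun i : NonTriv Γ ↦ (K * rGam (i.1 : SL(2, ℝ)) z z) ^ σ := by
  obtain ⟨C, -, h⟩ := exists_sum_rGam_le hσ
  have h1 := ((h Γ z ε hε hε1 hth).1.subtype {γ : Γ | γ ≠ 1}).mul_left (K ^ σ)
  refine h1.congr fun i ↦ ?_
  rw [Real.mul_rpow hK (rGam_pos _ z.im_pos z.im_pos).le]
  rfl

theorem poincareF_eq {Γ : Subgroup SL(2, ℝ)} [DiscreteTopology Γ] {z : ℍ} {ε : ℝ} (hε : 0 < ε)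
    (hε1 : ε ≤ 1) (hth : Thick Γ ε z) {s : ℂ} (hs : 1 < s.re) (k : ℕ) :
    poincareF Γ k s z = ((z.im : ℂ) ^ (4 * k))⁻¹ * ∑' i : NonTriv Γ, kerE s k i.1 z z := by
  obtain ⟨V, η, H, hzV, hV⟩ := exists_isGoodNhd hε hth
  have hR := summable_rGam_nonTriv hs hε hε1 hth _ (Real.exp_pos (ε / 2)).le
  have hη := hV.η_pos
  rw [poincareF, hV.iterL_eq hs hR _ k z z hzV hzV]
  · congr 2
    rw [← sq, ← pow_mul]
    push_cast
    congr 1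
    ring
  · intro z' w' hz' hw'
    have hterm (γ : SL(2, ℝ)) : resolventQ s z' (γ • w') = kerE s 0 γ z' w' := by
      rw [resolventQ_eq hs, rInv_smul, kerE]; simp
    obtain ⟨C, M, hC, hE⟩ := exists_kerE_bound hs 0
    have hsum : Summable fun i : NonTriv Γ ↦ kerE s 0 i.1 z' w' := by
      refine .of_norm_bounded (hR.mul_left (C / η ^ M)) fun i ↦ ?_
      have h1 := hV.one_sub i _ hz' _ hw'
      refine (hE _ _ _ z'.im_pos w'.im_pos (by linarith)).1.trans ?_
      have hr := rGam_pos (i.1 : SL(2, ℝ)) z'.im_pos w'.im_pos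
      have h2 := Real.rpow_le_rpow hr.le (hV.rGam_le i _ hz' _ hw') (by linarith : 0 ≤ s.re)
      rw [pow_zero, mul_one]
      have h3 := (Real.rpow_nonneg hr.le s.re).trans h2
      calc _ ≤ C * (Real.exp (ε / 2) * rGam (i.1 : SL(2, ℝ)) z z) ^ s.re / η ^ M := by gcongr
        _ = _ := by ring
    have hsum' : Summable fun γ : Γ ↦ resolventQ s z' ((γ : SL(2, ℝ)) • w') := by
      rw [← (Set.finite_singleton (1 : Γ)).summable_compl_iff]
      refine hsum.congr fun i ↦ ?_
      rw [← hterm]; rfl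
    have h3 := hsum'.sum_add_tsum_subtype_compl {1}
    rw [Finset.sum_singleton] at h3
    -- The identity term of the series is `resolventQ s z' w'` itself, so it cancels on the diagonal
    -- too, whatever its value there.
    rw [resolventG, ← h3, OneMemClass.coe_one, one_smul, add_sub_cancel_left]
    rw [← (Equiv.subtypeEquivRight (p := fun x : Γ ↦ x ∉ ({1} : Finset Γ)) (q := fun x ↦ x ≠ 1)
      fun x ↦ by simp).tsum_eq]
    exact tsum_congr fun x ↦ hterm x.1

theorem scalarDensity_eq {Γ : Subgroup SL(2, ℝ)} [DiscreteTopology Γ] {z : ℍ} {ε : ℝ} (hε : 0 < ε)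
    (hε1 : ε ≤ 1) (hth : Thick Γ ε z) {s : ℂ} (hs : 1 < s.re) (k : ℕ) (g : ℍ → ℂ) :
    scalarDensity Γ k s g z = ∑' i : NonTriv Γ, diagTerm k s g i.1 z := by
  have h0 : (z.im : ℂ) ^ (4 * k) ≠ 0 := pow_ne_zero _ (by exact_mod_cast z.im_ne_zero)
  rw [scalarDensity, poincareF_eq hε hε1 hth hs]
  simp only [diagTerm]
  rw [tsum_mul_left]
  field_simp

/-- Here 1 - r = tanh²(d/2); for ε ≤ 1 the numerator sinh²(ε/2) is at least ε²/4 and cosh²(ε/2) is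
at most 2. -/
theorem one_sub_rGam_ge {Γ : Subgroup SL(2, ℝ)} {z : ℍ} {ε : ℝ} (hε : 0 < ε) (hε1 : ε ≤ 1)
    (hth : Thick Γ ε z) (i : NonTriv Γ) : ε ^ 2 / 8 ≤ 1 - rGam (i.1 : SL(2, ℝ)) z z := by
  have hne : ((i.1 : Γ) : SL(2, ℝ)) ≠ 1 := fun h ↦ i.2 (Subtype.ext h)
  have h2 := hth _ i.1.2 hne
  have h4 : Real.cosh (ε / 2) ≤ Real.cosh (dist z ((i.1 : SL(2, ℝ)) • z) / 2) := by
    rw [Real.cosh_le_cosh, abs_of_pos (by positivity), abs_of_nonneg (by positivity)]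
    linarith
  have h5 : 1 / Real.cosh (dist z ((i.1 : SL(2, ℝ)) • z) / 2) ^ 2 ≤ 1 / Real.cosh (ε / 2) ^ 2 := by
    gcongr
  have h6 := Real.cosh_sq (ε / 2)
  have h7 : ε / 2 ≤ Real.sinh (ε / 2) := Real.self_le_sinh_iff.2 (by positivity)
  have h8 := sinh_le_two_mul (x := ε / 2) (by positivity) (by linarith)
  have h9 : 1 - 1 / Real.cosh (ε / 2) ^ 2 = Real.sinh (ε / 2) ^ 2 / Real.cosh (ε / 2) ^ 2 := by
    rw [h6]
    have : 0 < Real.sinh (ε / 2) ^ 2 + 1 := by positivity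
    field_simp
    ring
  have h10 : ε ^ 2 / 8 ≤ Real.sinh (ε / 2) ^ 2 / Real.cosh (ε / 2) ^ 2 := by
    rw [le_div_iff₀ (by positivity), h6]
    have a1 : (ε / 2) ^ 2 ≤ Real.sinh (ε / 2) ^ 2 := pow_le_pow_left₀ (by positivity) h7 2
    have a2 : Real.sinh (ε / 2) ^ 2 ≤ 1 := pow_le_one₀ (by linarith) (by linarith)
    nlinarith [sq_nonneg ε]
  rw [← rInv_smul, rInv_eq_cosh]
  linarith

/-- The orbit sum costs ε^{-2} and the singularity at r = 1 costs ε^{-2M}; both are absorbed by the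
decay ε^{2M+2} of the cusp form. The resulting bound is uniform although ε varies with z. -/
theorem exists_diagTerm_bound {Γ : Subgroup SL(2, ℝ)} [DiscreteTopology Γ]
    (htf : ∀ γ ∈ Γ, IsOfFinOrder γ → γ = 1) {𝓕 : Set ℍ}
    (h𝓕 : IsFundamentalDomain Γ 𝓕 (volume : Measure ℍ)) (hcof : volume 𝓕 < ⊤) {k : ℕ} {g : ℍ → ℂ}
    (hg : IsCuspidal Γ k g) {s : ℂ} (hs : 1 < s.re) :
    ∃ C : ℝ, ∀ z, (Summable fun i : NonTriv Γ ↦ ‖diagTerm k s g i.1 z‖) ∧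
      ∑' i : NonTriv Γ, ‖diagTerm k s g i.1 z‖ ≤ C := by
  obtain ⟨C₁, M, hC₁, hE⟩ := exists_kerE_bound hs k
  obtain ⟨C₂, hC₂, hφ⟩ := hg.exists_phi_le htf h𝓕 hcof (2 * M + 2)
  obtain ⟨C₃, hC₃, hr⟩ := exists_sum_rGam_le hs
  refine ⟨C₁ * C₂ * C₃ * 8 ^ M, fun z ↦ ?_⟩
  obtain ⟨ε, hε, hε1, hth, hφz⟩ := hφ z
  obtain ⟨hsum, hle⟩ := hr Γ z ε hε hε1 hth
  have hz := z.im_pos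
  have hbd (i : NonTriv Γ) : ‖diagTerm k s g i.1 z‖ ≤
      C₁ * C₂ * 8 ^ M * ε ^ 2 * rGam (i.1 : SL(2, ℝ)) z z ^ s.re := by
    have h1 := one_sub_rGam_ge hε hε1 hth i
    have h2 := rGam_pos (i.1 : SL(2, ℝ)) hz hz
    have h3 : 0 < ε ^ 2 / 8 := by positivity
    have hk := (hE i.1 z z hz hz (by linarith)).1
    have h4 := Real.rpow_nonneg h2.le s.re
    rw [diagTerm, norm_mul, norm_conj]
    have hφ' : ‖g z‖ * (z.im * z.im) ^ k ≤ C₂ * ε ^ (2 * M + 2) := by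
      rw [← sq, ← pow_mul]; exact hφz
    calc ‖g z‖ * ‖kerE s k i.1 z z‖
        ≤ ‖g z‖ * (C₁ * (z.im * z.im) ^ k * rGam (i.1 : SL(2, ℝ)) z z ^ s.re /
          (ε ^ 2 / 8) ^ M) := by
          gcongr
          refine hk.trans ?_
          gcongr
          all_goals exact le_rfl
      _ = C₁ * (‖g z‖ * (z.im * z.im) ^ k) * rGam (i.1 : SL(2, ℝ)) z z ^ s.re / (ε ^ 2 / 8) ^ M := by
          ring
      _ ≤ C₁ * (C₂ * ε ^ (2 * M + 2)) * rGam (i.1 : SL(2, ℝ)) z z ^ s.re / (ε ^ 2 / 8) ^ M := by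
          gcongr
      _ = _ := by
          rw [div_pow, pow_add, pow_mul]
          field_simp
  have hsub : Summable fun i : NonTriv Γ ↦ rGam (i.1 : SL(2, ℝ)) z z ^ s.re :=
    hsum.subtype {γ : Γ | γ ≠ 1}
  have hS := hsub.mul_left (C₁ * C₂ * 8 ^ M * ε ^ 2)
  have hs' := hS.of_nonneg_of_le (fun i ↦ norm_nonneg _) hbd
  refine ⟨hs', (hs'.tsum_le_tsum hbd hS).trans ?_⟩
  rw [tsum_mul_left]
  have h5 : ∑' i : NonTriv Γ, rGam (i.1 : SL(2, ℝ)) z z ^ s.re ≤ C₃ / ε ^ 2 :=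
    (Summable.tsum_subtype_le (fun γ : Γ ↦ rGam γ z z ^ s.re) {γ : Γ | γ ≠ 1}
      (fun γ ↦ Real.rpow_nonneg (rGam_pos _ hz hz).le _) hsum).trans hle
  calc _ ≤ C₁ * C₂ * 8 ^ M * ε ^ 2 * (C₃ / ε ^ 2) := by gcongr
    _ = _ := by field_simp

end

/-! ### Transformation and continuity of the diagonal terms -/

theorem rGam_conj (σ γ : SL(2, ℝ)) (z w : ℍ) :
    rGam (σ * γ * σ⁻¹) (σ • z : ℍ) (σ • w : ℍ) = rGam γ z w := by
  rw [← rInv_smul, ← rInv_smul, ← rInv_smul_smul σ z (γ • w)]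
  congr 2
  simp [mul_smul]

theorem kerE_conj (s : ℂ) (k : ℕ) (σ γ : SL(2, ℝ)) (z : ℍ) :
    kerE s k (σ * γ * σ⁻¹) (σ • z : ℍ) (σ • z : ℍ) =
      ((starRingEnd ℂ) (autj σ z) ^ (4 * k))⁻¹ * kerE s k γ z z := by
  have h : (starRingEnd ℂ) (autj σ z) ≠ 0 := by simpa using autj_ne_zero σ z
  rw [kerE, kerE, rGam_conj, bilin_conj, map_div₀, map_mul, ← sq,
    div_pow ((starRingEnd ℂ) (bilin γ z z)), ← pow_mul, show 2 * (2 * k) = 4 * k by ring]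
  field_simp

theorem kerE_neg (s : ℂ) (k : ℕ) (γ : SL(2, ℝ)) (z w : ℂ) : kerE s k (-γ) z w = kerE s k γ z w := by
  have h (z w : ℂ) : bilin (-γ) z w = -bilin γ z w := by
    simp [bilin]; ring
  rw [kerE, kerE, rGam, rGam, h, h, norm_neg, map_neg, (even_two_mul k).neg_pow]

/-- The conjugate of g contributes conj(j(σ,z))^{4k} and the kernel its inverse. Conjugation in `Γ`
thus becomes translation of the variable, which makes unfolding possible. -/
theorem IsCuspidal.diagTerm_conj {Γ : Subgroup SL(2, ℝ)} {k : ℕ} {g : ℍ → ℂ}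
    (hg : IsCuspidal Γ k g) (s : ℂ) {σ : SL(2, ℝ)} (hσ : σ ∈ Γ) (γ : SL(2, ℝ)) (z : ℍ) :
    diagTerm k s g (σ * γ * σ⁻¹) (σ • z) = diagTerm k s g γ z := by
  have h : (starRingEnd ℂ) (autj σ z) ≠ 0 := by simpa using autj_ne_zero σ z
  rw [diagTerm, kerE_conj, hg.smul_eq σ hσ, diagTerm, map_mul, map_pow]
  field_simp

/-- A diagonal term in the coordinate `w = τ z`. -/
theorem diagTerm_inv_smul (k : ℕ) (s : ℂ) (g : ℍ → ℂ) (γ τ : SL(2, ℝ)) (w : ℍ) :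
    diagTerm k s g γ (τ⁻¹ • w) =
      (starRingEnd ℂ) (twist k g τ w) * kerE s k (τ * γ * τ⁻¹) w w := by
  have h : (starRingEnd ℂ) (autj τ⁻¹ w) ≠ 0 := by simpa using autj_ne_zero τ⁻¹ w
  have h1 := kerE_conj s k τ⁻¹ (τ * γ * τ⁻¹) w
  rw [show τ⁻¹ * (τ * γ * τ⁻¹) * τ⁻¹⁻¹ = γ by group] at h1
  rw [diagTerm, h1, ← autj_pow_mul_twist k g τ w, map_mul, map_pow]
  field_simp

theorem continuous_bilin (γ : SL(2, ℝ)) : Continuous fun z : ℍ ↦ bilin γ z z := by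
  simp only [bilin]
  have := UpperHalfPlane.continuous_coe
  fun_prop

theorem continuous_rGam (γ : SL(2, ℝ)) : Continuous fun z : ℍ ↦ rGam γ z z := by
  have h (z : ℍ) : rGam γ z z = 1 / Real.cosh (dist z (γ • z) / 2) ^ 2 := by
    rw [← rInv_smul, rInv_eq_cosh]
  simp_rw [h]
  refine continuous_const.div ((Real.continuous_cosh.comp ?_).pow 2)
    fun w ↦ (pow_pos (Real.cosh_pos _) 2).ne'
  exact (continuous_id.dist (continuous_const_smul γ)).div_const 2

theorem rGam_lt_one {γ : SL(2, ℝ)} {z : ℍ} (h : 0 < dist z (γ • z)) : rGam γ z z < 1 := by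
  rw [← rInv_smul, rInv_eq_cosh]
  have h1 : 1 < Real.cosh (dist z (γ • z) / 2) := Real.one_lt_cosh.2 (by positivity)
  rw [div_lt_one (by positivity)]
  nlinarith

theorem continuousAt_resB {s : ℂ} (hs : 1 < s.re) (k : ℕ) {r : ℝ} (h0 : 0 < r) (h1 : r < 1) :
    ContinuousAt (fun r : ℝ ↦ resB s k r) r := by
  have h := (hasDerivAt_resB hs k (x := (r : ℂ)) (by rwa [Complex.norm_of_nonneg h0.le])
    (Complex.ofReal_mem_slitPlane.2 h0)).continuousAt
  exact ContinuousAt.comp (f := fun r : ℝ ↦ (r : ℂ)) h Complex.continuous_ofReal.continuousAt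

theorem continuous_kerE {s : ℂ} (hs : 1 < s.re) (k : ℕ) {γ : SL(2, ℝ)}
    (h : ∀ z : ℍ, 0 < dist z (γ • z)) : Continuous fun z : ℍ ↦ kerE s k γ z z := by
  refine continuous_const.mul (((continuous_conj.comp (continuous_bilin γ)).pow _).mul ?_)
  refine continuous_iff_continuousAt.2 fun z ↦ ?_
  exact (continuousAt_resB hs k (rGam_pos γ z.im_pos z.im_pos)
    (rGam_lt_one (h z))).comp (f := fun z : ℍ ↦ rGam γ z z) (continuous_rGam γ).continuousAt

/-! ### Unfolding over a conjugacy class -/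

/-- The diagonal term of an element of `Γ`, zero for the identity. -/
def classTerm {Γ : Subgroup SL(2, ℝ)} (k : ℕ) (s : ℂ) (g : ℍ → ℂ) (γ : Γ) (z : ℍ) : ℂ :=
  open Classical in if γ = 1 then 0 else diagTerm k s g γ z

theorem classTerm_of_ne {Γ : Subgroup SL(2, ℝ)} {k : ℕ} {s : ℂ} {g : ℍ → ℂ} {γ : Γ} (h : γ ≠ 1) :
    classTerm k s g γ = diagTerm k s g γ := by
  funext z; rw [classTerm, if_neg h]

theorem continuous_classTerm {Γ : Subgroup SL(2, ℝ)} [DiscreteTopology Γ]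
    (htf : ∀ γ ∈ Γ, IsOfFinOrder γ → γ = 1) {k : ℕ} {g : ℍ → ℂ} (hg : Continuous g) {s : ℂ}
    (hs : 1 < s.re) (γ : Γ) : Continuous (classTerm k s g γ) := by
  by_cases h : γ = 1
  · have : classTerm k s g γ = fun _ ↦ 0 := by funext z; rw [classTerm, if_pos h]
    rw [this]; exact continuous_const
  · rw [classTerm_of_ne h]
    exact (continuous_conj.comp hg).mul (continuous_kerE hs k fun z ↦
      dist_smul_pos htf γ.2 (fun h' ↦ h (Subtype.ext h')) z)

theorem IsCuspidal.classTerm_conj {Γ : Subgroup SL(2, ℝ)} {k : ℕ} {g : ℍ → ℂ}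
    (hg : IsCuspidal Γ k g) (s : ℂ) (σ γ : Γ) (z : ℍ) :
    classTerm k s g (σ⁻¹ * γ * σ) z = classTerm k s g γ ((σ : SL(2, ℝ)) • z) := by
  have h1 : σ⁻¹ * γ * σ = 1 ↔ γ = 1 := by
    constructor
    · intro h
      have : γ = σ * (σ⁻¹ * γ * σ) * σ⁻¹ := by group
      rw [this, h]; group
    · rintro rfl; group
  by_cases h : γ = 1
  · rw [classTerm, classTerm, if_pos h, if_pos (h1.2 h)]
  · rw [classTerm, classTerm, if_neg h, if_neg (h1.not.2 h)]
    have := hg.diagTerm_conj s σ.2 ((σ⁻¹ * γ * σ : Γ) : SL(2, ℝ)) z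
    rw [← this]
    congr 1
    push_cast
    group

/-- The elements `σ` with `σ z` in an exact fundamental domain of the centraliser of `P` parametrise
the conjugacy class of `P`. -/
def classEquiv {Γ : Subgroup SL(2, ℝ)} {P P₀ : Γ} {𝓓 : Set ℍ}
    (hcomm : ∀ δ : Γ, Commute δ P → ∃ n : ℤ, δ = P₀ ^ n) (hP : Commute P₀ P)
    (h𝓓 : ∀ w : ℍ, ∃! n : ℤ, (P₀ : SL(2, ℝ)) ^ n • w ∈ 𝓓) (z : ℍ) :
    {σ : Γ | (σ : SL(2, ℝ)) • z ∈ 𝓓} ≃ {γ : Γ // ConjClasses.mk γ = ConjClasses.mk P} :=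
  Equiv.ofBijective (fun σ ↦ ⟨σ.1⁻¹ * P * σ.1, by
    rw [ConjClasses.mk_eq_mk_iff_isConj, isConj_iff]
    exact ⟨σ.1, by group⟩⟩) (by
    constructor
    · rintro ⟨σ, hσ⟩ ⟨σ', hσ'⟩ h
      have h1 : σ⁻¹ * P * σ = σ'⁻¹ * P * σ' := congrArg Subtype.val h
      have h2 : Commute (σ' * σ⁻¹) P := by
        rw [Commute, SemiconjBy]
        calc σ' * σ⁻¹ * P = σ' * (σ⁻¹ * P * σ) * σ⁻¹ := by group
          _ = σ' * (σ'⁻¹ * P * σ') * σ⁻¹ := by rw [h1]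
          _ = _ := by group
      obtain ⟨n, hn⟩ := hcomm _ h2
      have h3 : (P₀ : SL(2, ℝ)) ^ n • (σ : SL(2, ℝ)) • z = (σ' : SL(2, ℝ)) • z := by
        have : σ' = P₀ ^ n * σ := by rw [← hn]; group
        rw [this, ← mul_smul]; rfl
      have h4 := (h𝓓 ((σ : SL(2, ℝ)) • z)).unique (y₁ := n) (y₂ := 0) (by
        rw [h3]; exact hσ') (by rw [zpow_zero, one_smul]; exact hσ)
      rw [h4, zpow_zero, mul_inv_eq_one] at hn
      exact Subtype.ext hn.symm
    · rintro ⟨γ, hγ⟩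
      rw [ConjClasses.mk_eq_mk_iff_isConj, isConj_iff] at hγ
      obtain ⟨δ, hδ⟩ := hγ
      obtain ⟨n, hn, -⟩ := h𝓓 ((δ : SL(2, ℝ)) • z)
      have hc : P₀ ^ n * P = P * P₀ ^ n := (hP.zpow_left n).eq
      refine ⟨⟨P₀ ^ n * δ, ?_⟩, Subtype.ext ?_⟩
      · show ((P₀ ^ n * δ : Γ) : SL(2, ℝ)) • z ∈ 𝓓
        rw [Subgroup.coe_mul, mul_smul]; exact hn
      · show (P₀ ^ n * δ)⁻¹ * P * (P₀ ^ n * δ) = γ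
        calc (P₀ ^ n * δ)⁻¹ * P * (P₀ ^ n * δ) = δ⁻¹ * (P₀ ^ n)⁻¹ * (P * P₀ ^ n) * δ := by group
          _ = δ⁻¹ * (P₀ ^ n)⁻¹ * (P₀ ^ n * P) * δ := by rw [hc]
          _ = δ⁻¹ * P * δ := by group
          _ = γ := by rw [← hδ]; group)

/-- The pointwise form of unfolding: translating a domain of the centraliser of P over `Γ` lists
each conjugate of P exactly once. -/
theorem tsum_indicator_class {M : Type*} [AddCommMonoid M] [TopologicalSpace M] [T2Space M]
    {Γ : Subgroup SL(2, ℝ)} {P P₀ : Γ} {𝓓 : Set ℍ}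
    (hcomm : ∀ δ : Γ, Commute δ P → ∃ n : ℤ, δ = P₀ ^ n) (hP : Commute P₀ P)
    (h𝓓 : ∀ w : ℍ, ∃! n : ℤ, (P₀ : SL(2, ℝ)) ^ n • w ∈ 𝓓) {F : Γ → ℍ → M}
    (hF : ∀ (σ γ : Γ) (z : ℍ), F (σ⁻¹ * γ * σ) z = F γ ((σ : SL(2, ℝ)) • z)) (z : ℍ) :
    ∑' σ : Γ, 𝓓.indicator (F P) ((σ : SL(2, ℝ)) • z) =
      ∑' γ : {γ : Γ // ConjClasses.mk γ = ConjClasses.mk P}, F γ.1 z := by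
  rw [← (classEquiv hcomm hP h𝓓 z).tsum_eq, ← tsum_subtype_eq_of_support_subset
    (s := {σ : Γ | (σ : SL(2, ℝ)) • z ∈ 𝓓})]
  · refine tsum_congr fun σ ↦ ?_
    rw [Set.indicator_of_mem (show (σ.1 : SL(2, ℝ)) • z ∈ 𝓓 from σ.2), ← hF]
    rfl
  · intro σ hσ
    by_contra h
    exact hσ (Set.indicator_of_notMem (s := 𝓓) (a := (σ : SL(2, ℝ)) • z) h _)

section Unfold

variable {Γ : Subgroup SL(2, ℝ)} [DiscreteTopology Γ] {𝓕 𝓓 : Set ℍ} {P P₀ : Γ} {k : ℕ} {g : ℍ → ℂ}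
  {s : ℂ}

theorem IsCuspidal.lintegral_class (htf : ∀ γ ∈ Γ, IsOfFinOrder γ → γ = 1)
    (h𝓕 : IsFundamentalDomain Γ 𝓕 (volume : Measure ℍ)) (hg : IsCuspidal Γ k g) (hs : 1 < s.re)
    (hcomm : ∀ δ : Γ, Commute δ P → ∃ n : ℤ, δ = P₀ ^ n) (hP : Commute P₀ P)
    (h𝓓 : ∀ w : ℍ, ∃! n : ℤ, (P₀ : SL(2, ℝ)) ^ n • w ∈ 𝓓) (hm : MeasurableSet 𝓓) :
    ∫⁻ z in 𝓓, ‖classTerm k s g P z‖ₑ =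
      ∑' γ : {γ : Γ // ConjClasses.mk γ = ConjClasses.mk P}, ∫⁻ z in 𝓕, ‖classTerm k s g γ.1 z‖ₑ := by
  have := countable_of_discrete Γ
  have hmeas (γ : Γ) : Measurable fun z ↦ ‖classTerm k s g γ z‖ₑ :=
    (continuous_classTerm htf hg.continuous hs γ).measurable.enorm
  rw [← lintegral_indicator hm, h𝓕.lintegral_eq_tsum'', ← lintegral_tsum, ← lintegral_tsum]
  · refine lintegral_congr fun z ↦ ?_
    exact tsum_indicator_class hcomm hP h𝓓 (F := fun γ z ↦ ‖classTerm k s g γ z‖ₑ)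
      (fun σ γ z ↦ by rw [hg.classTerm_conj]) z
  · exact fun γ ↦ (hmeas γ.1).aemeasurable
  · intro σ
    exact (((hmeas P).indicator hm).comp (measurable_const_smul (σ : SL(2, ℝ)))).aemeasurable

theorem IsCuspidal.integral_class (htf : ∀ γ ∈ Γ, IsOfFinOrder γ → γ = 1)
    (h𝓕 : IsFundamentalDomain Γ 𝓕 (volume : Measure ℍ)) (hg : IsCuspidal Γ k g) (hs : 1 < s.re)
    (hcomm : ∀ δ : Γ, Commute δ P → ∃ n : ℤ, δ = P₀ ^ n) (hP : Commute P₀ P)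
    (h𝓓 : ∀ w : ℍ, ∃! n : ℤ, (P₀ : SL(2, ℝ)) ^ n • w ∈ 𝓓) (hm : MeasurableSet 𝓓)
    (hfin : ∑' γ : {γ : Γ // ConjClasses.mk γ = ConjClasses.mk P},
      ∫⁻ z in 𝓕, ‖classTerm k s g γ.1 z‖ₑ ≠ ⊤) :
    IntegrableOn (classTerm k s g P) 𝓓 ∧ ∫ z in 𝓓, classTerm k s g P z =
      ∑' γ : {γ : Γ // ConjClasses.mk γ = ConjClasses.mk P}, ∫ z in 𝓕, classTerm k s g γ.1 z := by
  have := countable_of_discrete Γ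
  have hcont (γ : Γ) := continuous_classTerm htf hg.continuous hs γ (k := k)
  have hl := hg.lintegral_class htf h𝓕 hs hcomm hP h𝓓 hm
  have hint : IntegrableOn (classTerm k s g P) 𝓓 := by
    refine ⟨(hcont P).aestronglyMeasurable, ?_⟩
    rw [HasFiniteIntegral, hl]
    exact hfin.lt_top
  refine ⟨hint, ?_⟩
  have hint' := hint.integrable_indicator hm
  rw [← integral_indicator hm, h𝓕.integral_eq_tsum'' _ hint', ← integral_tsum, ← integral_tsum]
  · refine integral_congr_ae (Filter.Eventually.of_forall fun z ↦ ?_)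
    exact tsum_indicator_class hcomm hP h𝓓 (F := fun γ z ↦ classTerm k s g γ z)
      (fun σ γ z ↦ hg.classTerm_conj s σ γ z) z
  · exact fun γ ↦ (hcont γ.1).aestronglyMeasurable
  · exact hfin
  · intro σ
    exact ((((hcont P).measurable.indicator hm).comp
      (measurable_const_smul (σ : SL(2, ℝ)))).aestronglyMeasurable)
  · have h1 := h𝓕.lintegral_eq_tsum'' (fun z ↦ ‖𝓓.indicator (classTerm k s g P) z‖ₑ)
    rw [← h1]
    exact hint'.2.ne

theorem IsCuspidal.scalarDensity_sum (htf : ∀ γ ∈ Γ, IsOfFinOrder γ → γ = 1)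
    (h𝓕 : IsFundamentalDomain Γ 𝓕 (volume : Measure ℍ)) (hcof : volume 𝓕 < ⊤)
    (hg : IsCuspidal Γ k g) (hs : 1 < s.re) :
    IntegrableOn (scalarDensity Γ k s g) 𝓕 ∧
      ∑' γ : Γ, ∫⁻ z in 𝓕, ‖classTerm k s g γ z‖ₑ ≠ ⊤ ∧
      ∫ z in 𝓕, scalarDensity Γ k s g z = ∑' γ : Γ, ∫ z in 𝓕, classTerm k s g γ z := by
  have := countable_of_discrete Γ
  have hcont (γ : Γ) := continuous_classTerm htf hg.continuous hs γ (k := k)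
  obtain ⟨C, hC⟩ := exists_diagTerm_bound htf h𝓕 hcof hg hs
  -- With exponent 0 the decay is irrelevant; this only supplies a thickness at each point, so that
  -- the termwise formula holds everywhere.
  obtain ⟨C', hC', hφ⟩ := hg.exists_phi_le htf h𝓕 hcof 0
  have hsub {M : Type} [AddCommMonoid M] [TopologicalSpace M] [T2Space M] (F : ℂ → M) (hF : F 0 = 0)
      (z : ℍ) : ∑' γ : Γ, F (classTerm k s g γ z) = ∑' i : NonTriv Γ, F (diagTerm k s g i.1 z) := by
    rw [← tsum_subtype_eq_of_support_subset (s := {γ : Γ | γ ≠ 1})]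
    · refine tsum_congr fun i ↦ ?_
      rw [classTerm_of_ne i.2]
    · intro γ hγ h
      refine hγ ?_
      dsimp only
      rw [classTerm, if_pos h, hF]
  have hsd : scalarDensity Γ k s g = fun z ↦ ∑' γ : Γ, classTerm k s g γ z := by
    funext z
    obtain ⟨ε, hε, hε1, hth, -⟩ := hφ z
    exact (scalarDensity_eq hε hε1 hth hs k g).trans (hsub id rfl z).symm
  have hpt (z : ℍ) : ∑' γ : Γ, ‖classTerm k s g γ z‖ₑ ≤ ENNReal.ofReal C := by
    obtain ⟨h1, h2⟩ := hC z
    rw [hsub (fun x ↦ ‖x‖ₑ) enorm_zero z]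
    simp_rw [← ofReal_norm]
    rw [← ENNReal.ofReal_tsum_of_nonneg (fun _ ↦ norm_nonneg _) h1]
    exact ENNReal.ofReal_le_ofReal h2
  have hfin : ∑' γ : Γ, ∫⁻ z in 𝓕, ‖classTerm k s g γ z‖ₑ ≠ ⊤ := by
    rw [← lintegral_tsum fun γ ↦ (hcont γ).measurable.enorm.aemeasurable]
    refine ((lintegral_mono hpt).trans_lt ?_).ne
    rw [setLIntegral_const]
    exact ENNReal.mul_lt_top ENNReal.ofReal_lt_top hcof
  refine ⟨?_, hfin, ?_⟩
  · rw [hsd]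
    refine ⟨(Measurable.tsum fun γ ↦ (hcont γ).measurable).aestronglyMeasurable, ?_⟩
    refine lt_of_le_of_lt (lintegral_mono fun z ↦ ?_) (lt_top_iff_ne_top.2 hfin |>.trans_le' (le_of_eq
      (lintegral_tsum fun γ ↦ (hcont γ).measurable.enorm.aemeasurable)))
    exact enorm_tsum_le_tsum_enorm
  · rw [hsd, integral_tsum (fun γ ↦ (hcont γ).aestronglyMeasurable) hfin]

end Unfold

/-! ### Powers of hyperbolic elements -/

theorem normN_of_abs_tr {γ : SL(2, ℝ)} {L : ℝ} (hL : 1 < L) (h : |tr γ| = L + L⁻¹) :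
    normN γ = L ^ 2 := by
  have hL0 : 0 < L := by linarith
  have hinv : L⁻¹ < 1 := inv_lt_one_of_one_lt₀ hL
  have h1 : tr γ ^ 2 - 4 = (L - L⁻¹) ^ 2 := by
    rw [← sq_abs, h]; field_simp; ring
  rw [normN_eq, h1, h, Real.sqrt_sq (by linarith)]
  ring

section

variable {γ τ : SL(2, ℝ)}

theorem diag_iff (h : IsHyp γ) :
    ((τ * posRep γ * τ⁻¹ : SL(2, ℝ)) : Matrix (Fin 2) (Fin 2) ℝ) =
      !![√(normN γ), 0; 0, (√(normN γ))⁻¹] ↔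
    τ * posRep γ * τ⁻¹ = diagL (√(normN γ)) (zero_lt_one.trans h.one_lt_sqrt).ne' :=
  (Subtype.ext_iff (a2 := diagL (√(normN γ)) (zero_lt_one.trans h.one_lt_sqrt).ne')).symm

theorem IsHyp.tr_posRep_pow (h : IsHyp γ) (n : ℕ) :
    tr (posRep γ ^ n) = √(normN γ) ^ n + (√(normN γ) ^ n)⁻¹ := by
  obtain ⟨σ, hσ⟩ := h.exists_diag
  rw [← tr_conj σ, conj_pow_eq, hσ, diagL_pow]
  rfl

theorem IsHyp.posRep_pow (h : IsHyp γ) (n : ℕ) : posRep (γ ^ n) = posRep γ ^ n := by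
  have hl := zero_lt_one.trans h.one_lt_sqrt
  have h1 : 0 < tr (posRep γ ^ n) := by rw [h.tr_posRep_pow]; positivity
  rcases posRep_pow_eq_or γ n with h2 | h2
  · rw [h2, posRep, tr_eq_trace, if_pos h1]
  · rw [h2, posRep, tr_eq_trace, tr_neg, if_neg (by linarith), neg_neg]

theorem IsHyp.normN_pow (h : IsHyp γ) {n : ℕ} (hn : n ≠ 0) : normN (γ ^ n) = normN γ ^ n := by
  have hl := h.one_lt_sqrt
  have h1 : |tr (γ ^ n)| = √(normN γ) ^ n + (√(normN γ) ^ n)⁻¹ := by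
    rw [← abs_tr_posRep, h.posRep_pow, h.tr_posRep_pow]
  rw [normN_of_abs_tr (one_lt_pow₀ hl hn) h1, ← pow_mul, mul_comm, pow_mul,
    Real.sq_sqrt (zero_lt_one.trans h.one_lt_normN).le]

theorem isHyp_pow_iff {n : ℕ} (hn : n ≠ 0) (h4 : 4 ≤ tr γ ^ 2) : IsHyp (γ ^ n) ↔ IsHyp γ := by
  constructor
  · intro h
    rw [isHyp_iff] at h ⊢
    refine lt_of_le_of_ne h4 fun h' ↦ ?_
    rw [tr_pow_sq_of_parabolic h'.symm] at h
    exact lt_irrefl _ h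
  · intro h
    have hl := h.one_lt_sqrt
    set L := √(normN γ) ^ n with hL
    have hL1 : 1 < L := one_lt_pow₀ hl hn
    have h1 : |tr (γ ^ n)| = L + L⁻¹ := by
      rw [← abs_tr_posRep, h.posRep_pow, h.tr_posRep_pow]
    have hL0 : 0 < L := by linarith
    have h2 : (L + L⁻¹) ^ 2 = 4 + (L - L⁻¹) ^ 2 := by field_simp; ring
    have h3 : L⁻¹ < 1 := inv_lt_one_of_one_lt₀ hL1
    rw [isHyp_iff, ← sq_abs, h1, h2]
    have : 0 < (L - L⁻¹) ^ 2 := by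
      have : 0 < L - L⁻¹ := by linarith
      positivity
    linarith

theorem IsHyp.conj_pow_posRep (h : IsHyp γ)
    (hτ : τ * posRep γ * τ⁻¹ = diagL (√(normN γ)) (zero_lt_one.trans h.one_lt_sqrt).ne') (n : ℕ) :
    τ * posRep (γ ^ n) * τ⁻¹ = diagL (√(normN γ) ^ n)
      (pow_ne_zero n (zero_lt_one.trans h.one_lt_sqrt).ne') := by
  rw [h.posRep_pow, conj_pow_eq, hτ, diagL_pow]

theorem diagL_smul (l : ℝ) (hl : l ≠ 0) (w : ℍ) : ((diagL l hl • w : ℍ) : ℂ) = (l : ℂ) ^ 2 * w := by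
  rw [coe_smul_eq]
  simp [autj]
  field_simp

theorem IsHyp.coe_smul_smul (h : IsHyp γ)
    (hτ : τ * posRep γ * τ⁻¹ = diagL (√(normN γ)) (zero_lt_one.trans h.one_lt_sqrt).ne') (w : ℍ) :
    ((τ • γ • w : ℍ) : ℂ) = (normN γ : ℂ) * (τ • w : ℍ) := by
  have h1 : τ • γ • w = (τ * posRep γ * τ⁻¹) • τ • w := by
    rw [← posRep_smul γ]
    simp [mul_smul]
  rw [h1, hτ, diagL_smul, ← Complex.ofReal_pow, Real.sq_sqrt (zero_lt_one.trans h.one_lt_normN).le]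

/-- A nontrivial power of a hyperbolic element has the same axis, and after diagonalisation both
centralisers consist of the diagonal matrices. -/
theorem IsHyp.commute_of_commute_pow (h : IsHyp γ) {n : ℕ} (hn : n ≠ 0) {δ : SL(2, ℝ)}
    (hc : Commute δ (γ ^ n)) : Commute δ γ := by
  obtain ⟨σ, hσ⟩ := h.exists_diag
  have h1 := commute_conj σ (commute_posRep hc)
  rw [h.conj_pow_posRep hσ] at h1
  obtain ⟨h01, h10⟩ := commute_diagL (one_lt_pow₀ h.one_lt_sqrt hn) _ h1
  have h2 : Commute (σ * δ * σ⁻¹) (σ * posRep γ * σ⁻¹) := by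
    rw [hσ, Commute, SemiconjBy]
    generalize σ * δ * σ⁻¹ = A at *
    apply ext_entries <;> simp [mul_entry, h01, h10, mul_comm]
  have h3 : Commute δ (posRep γ) := by
    have := commute_conj σ⁻¹ h2
    simpa [mul_assoc] using this
  rcases posRep_eq_or γ with h4 | h4 <;> rw [h4] at h3
  · exact h3
  · simpa using h3.neg_right

end

/-- P₀ is a positive power of the generator of its centraliser, and primitivity forces the exponent
to be 1. -/
theorem IsPrimHyp.isGen {Γ : Subgroup SL(2, ℝ)} [DiscreteTopology Γ]
    (htf : ∀ γ ∈ Γ, IsOfFinOrder γ → γ = 1) {P₀ : Γ} (h : IsPrimHyp Γ P₀) : IsGen Γ P₀ := by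
  have h1 : (P₀ : SL(2, ℝ)) ≠ 1 := by
    intro h'
    have := h.1
    rw [isHyp_iff, h'] at this
    norm_num [tr] at this
  obtain ⟨γ₀, hgen, m, hm, hP⟩ := exists_isGen htf P₀.2 h1
  have := h.2 ⟨γ₀, hgen.mem⟩ m (Subtype.ext hP.symm)
  rw [this, pow_one] at hP
  rwa [hP]

/-! ### Exact fundamental domains of cyclic groups -/

/-- The function ψ is a height on which γ acts as a translation: log|τw| for hyperbolic γ, Re(τw)
for parabolic γ. -/
theorem existsUnique_zpow_smul {γ : SL(2, ℝ)} {ψ : ℍ → ℝ} {a : ℝ} (ha : 0 < a)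
    (h : ∀ w, ψ (γ • w) = ψ w + a) (w : ℍ) : ∃! n : ℤ, ψ (γ ^ n • w) ∈ Set.Ico 0 a := by
  have h1 (n : ℤ) : ψ (γ ^ n • w) = ψ w + n • a := by
    induction n with
    | zero => simp
    | succ n ih => rw [add_comm, zpow_one_add, mul_smul, h, ih]; simp; ring
    | pred n ih =>
      have := h (γ ^ (-(n : ℤ) - 1) • w)
      rw [← mul_smul, ← zpow_one_add, add_sub_cancel, ih] at this
      simp at this ⊢
      linarith
  simp_rw [h1]
  simpa using existsUnique_add_zsmul_mem_Ico ha (ψ w) 0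

theorem measurableSet_annulus (N : ℝ) : MeasurableSet (annulus N) := by
  have h : Continuous fun z : ℍ ↦ ‖(z : ℂ)‖ := UpperHalfPlane.continuous_coe.norm
  exact (measurableSet_le measurable_const h.measurable).inter
    (measurableSet_lt h.measurable measurable_const)

theorem mem_annulus_iff {N : ℝ} (hN : 1 < N) (z : ℍ) :
    z ∈ annulus N ↔ Real.log ‖(z : ℂ)‖ ∈ Set.Ico 0 (Real.log N) := by
  have h0 : 0 < ‖(z : ℂ)‖ := norm_pos_iff.2 z.ne_zero
  rw [annulus, Set.mem_ofPred_eq, Set.mem_Ico, Real.log_nonneg_iff h0,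
    Real.log_lt_log_iff h0 (by linarith)]

theorem IsHyp.existsUnique_annulus {γ τ : SL(2, ℝ)} (h : IsHyp γ)
    (hτ : τ * posRep γ * τ⁻¹ = diagL (√(normN γ)) (zero_lt_one.trans h.one_lt_sqrt).ne') (w : ℍ) :
    ∃! n : ℤ, γ ^ n • w ∈ (fun z : ℍ ↦ τ • z) ⁻¹' annulus (normN γ) := by
  simp only [Set.mem_preimage, mem_annulus_iff h.one_lt_normN]
  refine existsUnique_zpow_smul (ψ := fun w : ℍ ↦ Real.log ‖((τ • w : ℍ) : ℂ)‖)
    (Real.log_pos h.one_lt_normN) (fun w ↦ ?_) w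
  have hN := zero_lt_one.trans h.one_lt_normN
  rw [h.coe_smul_smul hτ, norm_mul, Complex.norm_of_nonneg hN.le, Real.log_mul hN.ne'
    (norm_ne_zero_iff.2 (τ • w).ne_zero), add_comm]

/-! ### The local density -/

/-- For a dilation (1 - r)/r = (L - L⁻¹)²|w|²/(4y²). The factor ((1 - r)/r)^{2k} in `radialF`
therefore trades w^{-2k} y^{4k} for conj(w)^{2k}, the form in which Q_γ enters `kerE`. -/
theorem kerE_diagL {s : ℂ} (hs : 1 < s.re) (k : ℕ) {L : ℝ} (hL : 1 < L) (hL0 : L ≠ 0) (w : ℍ) :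
    kerE s k (diagL L hL0) w w =
      (((L ^ 2) ^ k / (L ^ 2 - 1) ^ (2 * k) : ℝ) : ℂ) * (1 / (w : ℂ) ^ (2 * k) *
        radialF k s (rInv w ((L ^ 2 : ℝ) * w)) * (w.im : ℂ) ^ (4 * k)) := by
  have hw := w.im_pos
  have hw0 : (w : ℂ) ≠ 0 := w.ne_zero
  have hr := rGam_pos (diagL L hL0) hw hw
  have hrI : rInv w ((L ^ 2 : ℝ) * w) = rGam (diagL L hL0) w w := by
    rw [← rInv_smul, diagL_smul, Complex.ofReal_pow]
  have h1 := one_sub_rGam (diagL L hL0) hw hw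
  have hbil : bilin (diagL L hL0) w w = -((L - L⁻¹ : ℝ) : ℂ) * w := by
    simp [bilin]; ring
  have hm := norm_bilin_conj_pos (diagL L hL0) hw hw
  have hbn : ‖bilin (diagL L hL0) w w‖ ^ 2 = (L - L⁻¹) ^ 2 * ‖(w : ℂ)‖ ^ 2 := by
    rw [hbil, norm_mul, norm_neg, Complex.norm_real, mul_pow, Real.norm_eq_abs, sq_abs]
  have h2 : (1 - rGam (diagL L hL0) w w) / rGam (diagL L hL0) w w =
      (L - L⁻¹) ^ 2 * ‖(w : ℂ)‖ ^ 2 / (4 * w.im ^ 2) := by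
    rw [h1, hbn, rGam]
    have : w.im ≠ 0 := hw.ne'
    show _ / _ / (4 * w.im * w.im / _) = _
    field_simp
  have hLinv : L⁻¹ < 1 := inv_lt_one_of_one_lt₀ hL
  have hD : (0 : ℝ) < L - L⁻¹ := by linarith
  rw [hrI, radialF_eq hs k hr, kerE, hbil]
  generalize rGam (diagL L hL0) w w = r at *
  have h3 : ((1 : ℂ) - r) ^ (2 * k) / (r : ℂ) ^ (2 * k) =
      (((L - L⁻¹ : ℝ) : ℂ) ^ 2 * ((w : ℂ) * (starRingEnd ℂ) (w : ℂ)) / (4 * (w.im : ℂ) ^ 2)) ^ (2 * k) := by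
    rw [← div_pow, Complex.mul_conj, Complex.normSq_eq_norm_sq]
    congr 1
    exact_mod_cast h2
  have h4 : (L ^ 2) ^ k / (L ^ 2 - 1) ^ (2 * k) = 1 / (L - L⁻¹) ^ (2 * k) := by
    have : L ^ 2 - 1 = L * (L - L⁻¹) := by field_simp
    rw [this, mul_pow, ← pow_mul]
    field_simp
  rw [h4, mul_div_assoc, h3, map_mul, map_neg, Complex.conj_ofReal, neg_mul, (even_two_mul k).neg_pow]
  push_cast
  have hD' : ((L : ℂ) - (L : ℂ)⁻¹) ≠ 0 := by exact_mod_cast hD.ne'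
  have hy : (w.im : ℂ) ≠ 0 := by exact_mod_cast hw.ne'
  generalize (L : ℂ) - (L : ℂ)⁻¹ = D at *
  generalize (starRingEnd ℂ) (w : ℂ) = wb at *
  have e1 : ((-1 / 16 : ℂ)) ^ k = (-1) ^ k * ((1 / 4) ^ (2 * k)) := by
    rw [pow_mul, ← mul_pow]; norm_num
  rw [e1, show 4 * k = 2 * (2 * k) by ring, pow_mul (w.im : ℂ) 2]
  generalize (-1 : ℂ) ^ k = u
  generalize 2 * k = K
  simp only [mul_pow, div_pow, one_pow]
  have e2 : (D ^ 2) ^ K = D ^ K * D ^ K := by rw [sq, mul_pow]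
  rw [e2]
  have := pow_ne_zero K hD'
  field_simp

/-- The local integral as an integral of the diagonal term of `P`. -/
theorem integral_annulus {E : Type*} [NormedAddCommGroup E] [NormedSpace ℝ E] (τ : SL(2, ℝ))
    (f : ℍ → E) (S : Set ℍ) :
    ∫ z in (fun z : ℍ ↦ τ • z) ⁻¹' S, f z = ∫ w in S, f (τ⁻¹ • w) := by
  have := (measurePreserving_smul τ (volume : Measure ℍ)).setIntegral_preimage_emb
    (measurableEmbedding_const_smul τ) (fun w ↦ f (τ⁻¹ • w)) S
  simpa using this

theorem integrableOn_annulus {E : Type*} [NormedAddCommGroup E] (τ : SL(2, ℝ))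
    (f : ℍ → E) (S : Set ℍ) :
    IntegrableOn f ((fun z : ℍ ↦ τ • z) ⁻¹' S) ↔ IntegrableOn (fun w ↦ f (τ⁻¹ • w)) S := by
  have := (measurePreserving_smul τ (volume : Measure ℍ)).integrableOn_comp_preimage
    (measurableEmbedding_const_smul τ) (f := fun w ↦ f (τ⁻¹ • w)) (s := S)
  rw [← this]
  simp [Function.comp_def]

theorem diagTerm_eq_localDensity {γ τ : SL(2, ℝ)} (h : IsHyp γ)
    (hτ : τ * posRep γ * τ⁻¹ = diagL (√(normN γ)) (zero_lt_one.trans h.one_lt_sqrt).ne')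
    {s : ℂ} (hs : 1 < s.re) (k : ℕ) (g : ℍ → ℂ) (w : ℍ) :
    diagTerm k s g γ (τ⁻¹ • w) =
      ((normN γ ^ k / (normN γ - 1) ^ (2 * k) : ℝ) : ℂ) * localDensity k s g (normN γ) τ w := by
  have hk : kerE s k (τ * γ * τ⁻¹) w w = kerE s k (τ * posRep γ * τ⁻¹) w w := by
    rcases posRep_eq_or γ with h' | h' <;> rw [h']
    rw [neg_conj, kerE_neg]
  rw [diagTerm_inv_smul, hk, hτ, kerE_diagL hs k h.one_lt_sqrt,
    Real.sq_sqrt (zero_lt_one.trans h.one_lt_normN).le, localDensity]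
  ring

/-! ### Parabolic classes -/

theorem setIntegral_strip_eq_zero {f : ℍ → ℂ}
    (h : ∀ y : ℝ, 0 < y → ∫ x in (0 : ℝ)..1, f (UpperHalfPlane.ofComplex (x + y * I)) = 0) :
    ∫ z in {z : ℍ | z.re ∈ Set.Ico (0 : ℝ) 1}, f z = 0 := by
  have hm : MeasurableSet {z : ℍ | z.re ∈ Set.Ico (0 : ℝ) 1} :=
    UpperHalfPlane.continuous_re.measurable measurableSet_Ico
  rw [← integral_indicator hm,
    ← measurePreserving_horo.integral_comp horoHomeo.measurableEmbedding]
  by_cases hi : Integrable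
      (fun p ↦ ({z : ℍ | z.re ∈ Set.Ico (0 : ℝ) 1}.indicator f (horoHomeo p)))
      (volume : Measure (ℝ × ℝ))
  · rw [Measure.volume_eq_prod] at hi ⊢
    rw [integral_prod_symm _ hi]
    refine integral_eq_zero_of_ae (Filter.Eventually.of_forall fun u ↦ ?_)
    have hu := Real.exp_pos u
    have h1 (t : ℝ) : {z : ℍ | z.re ∈ Set.Ico (0 : ℝ) 1}.indicator f (horoHomeo (t, u)) =
        (Set.Ico (0 : ℝ) 1).indicator
          (fun x : ℝ ↦ f (UpperHalfPlane.ofComplex (x + (Real.exp u : ℝ) * I))) (Real.exp u * t) := by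
      have h2 : UpperHalfPlane.ofComplex (((Real.exp u * t : ℝ) : ℂ) + (Real.exp u : ℝ) * I) =
          horo (t, u) := by
        rw [← UpperHalfPlane.ofComplex_apply (horo (t, u)), coe_horo]
        congr 1
        push_cast
        ring
      by_cases ht : Real.exp u * t ∈ Set.Ico (0 : ℝ) 1
      · rw [Set.indicator_of_mem ht, h2]
        exact Set.indicator_of_mem (s := {z : ℍ | z.re ∈ Set.Ico (0 : ℝ) 1}) (a := horo (t, u)) ht f
      · rw [Set.indicator_of_notMem ht]
        exact Set.indicator_of_notMem (s := {z : ℍ | z.re ∈ Set.Ico (0 : ℝ) 1}) (a := horo (t, u))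
          ht f
    simp_rw [h1]
    rw [Measure.integral_comp_mul_left (fun x ↦ (Set.Ico (0 : ℝ) 1).indicator
          (fun x : ℝ ↦ f (UpperHalfPlane.ofComplex (x + (Real.exp u : ℝ) * I))) x),
      integral_indicator measurableSet_Ico, integral_Ico_eq_integral_Ioc,
      ← intervalIntegral.integral_of_le zero_le_one, h _ hu, smul_zero]
    rfl
  -- The integral of a function that is not integrable is 0 by convention, so integrability need not
  -- be assumed.
  · exact integral_undef hi

/-- The integral over a period is the constant Fourier coefficient, that is, the value at the cusp.
-/
theorem integral_period_eq_zero {F : ℍ → ℂ}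
    (hF : DifferentiableOn ℂ (F ∘ UpperHalfPlane.ofComplex) {z | 0 < z.im})
    (hper : Function.Periodic (F ∘ UpperHalfPlane.ofComplex) (1 : ℝ))
    (hzero : UpperHalfPlane.IsZeroAtImInfty F) {y : ℝ} (hy : 0 < y) :
    ∫ x in (0 : ℝ)..1, F (UpperHalfPlane.ofComplex (x + y * I)) = 0 := by
  have h := UpperHalfPlane.qExpansion_coeff_eq_intervalIntegral one_pos hper
    (UpperHalfPlane.mdifferentiable_iff.2 hF) hzero.isBoundedAtImInfty 0 hy
  have h0 : (UpperHalfPlane.qExpansion 1 F).coeff 0 = 0 := by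
    rw [UpperHalfPlane.qExpansion_coeff_zero one_pos
      (UpperHalfPlane.analyticAt_cuspFunction_zero one_pos hper
        (UpperHalfPlane.mdifferentiable_iff.2 hF) hzero.isBoundedAtImInfty) hper]
    exact hzero.valueAtInfty_eq_zero
  rw [h0] at h
  simp only [pow_zero, div_one, one_mul, ofReal_one] at h
  rw [h]
  refine intervalIntegral.integral_congr fun x _ ↦ ?_
  rw [UpperHalfPlane.ofComplex_apply_of_im_pos (by simpa using hy)]
  rfl

/-- For a translation h(z,z) is constant and |h(z̄,z)| depends on Im z alone. This is what reduces a
parabolic class to the constant Fourier coefficient of g. -/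
theorem kerE_unip (s : ℂ) (k : ℕ) (c : ℝ) (w : ℂ) :
    kerE s k (unip c) w w = kerE s k (unip c) (w.im * I) (w.im * I) := by
  have h1 (z : ℂ) : bilin (unip c) z z = -c := by simp [bilin]
  have h2 (z : ℂ) : bilin (unip c) ((starRingEnd ℂ) z) z = -(2 * z.im * I) - c := by
    have h := Complex.sub_conj z
    simp only [bilin, unip_00, unip_01, unip_10, unip_11]
    push_cast at h ⊢
    linear_combination -h
  rw [kerE, kerE, rGam, rGam, h1, h1, h2, h2]
  simp

theorem exists_parabolic_gen {Γ : Subgroup SL(2, ℝ)} [DiscreteTopology Γ]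
    (htf : ∀ γ ∈ Γ, IsOfFinOrder γ → γ = 1) {k : ℕ} {g : ℍ → ℂ} (hg : IsCuspidal Γ k g) {P : Γ}
    (h1 : P ≠ 1) (hP : ¬IsHyp (P : SL(2, ℝ))) :
    ∃ (P₀ : Γ) (τ : SL(2, ℝ)) (c : ℝ), (∀ δ : Γ, Commute δ P → ∃ n : ℤ, δ = P₀ ^ n) ∧
      Commute P₀ P ∧ (∀ w : ℍ, ((τ • (P₀ : SL(2, ℝ)) • w : ℍ) : ℂ) = (τ • w : ℍ) + 1) ∧
      (τ * P * τ⁻¹ = unip c ∨ τ * P * τ⁻¹ = -unip c) ∧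
      UpperHalfPlane.IsZeroAtImInfty (twist k g τ) ∧
      Function.Periodic (twist k g τ ∘ UpperHalfPlane.ofComplex) (1 : ℝ) := by
  obtain ⟨γ₀, hgen, m, hm, hPm⟩ := exists_isGen htf P.2 (fun h ↦ h1 (Subtype.ext h))
  have hnh : ¬IsHyp γ₀ := by
    rwa [hPm, isHyp_pow_iff hm.ne' (four_le_tr_sq htf hgen.mem)] at hP
  have htr : tr (posRep γ₀) = 2 := by
    have h4 := four_le_tr_sq htf hgen.mem
    rw [isHyp_iff, not_lt] at hnh
    rw [abs_tr_posRep, ← Real.sqrt_sq_eq_abs, le_antisymm hnh h4,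
      show (4 : ℝ) = 2 ^ 2 by norm_num, Real.sqrt_sq (by norm_num)]
  have hp1 : posRep γ₀ ≠ 1 := by
    rcases posRep_eq_or γ₀ with h | h <;> rw [h]
    · exact hgen.ne_one
    · intro h'
      exact neg_one_notMem htf (by rw [← h', neg_neg]; exact hgen.mem)
  obtain ⟨τ, t, ht, hτ⟩ := exists_unip_conj htr hp1
  have ht0 : t ≠ 0 := by rcases ht with rfl | rfl <;> norm_num
  have hconj : τ * P * τ⁻¹ = unip (m * t) ∨ τ * P * τ⁻¹ = -unip (m * t) := by
    rcases posRep_pow_eq_or γ₀ m with h | h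
    · left; rw [hPm, h, conj_pow_eq, hτ, unip_pow]
    · right; rw [hPm, h, neg_conj, conj_pow_eq, hτ, unip_pow]
  have hcomm (δ : Γ) (hδ : Commute δ P) : ∃ n : ℤ, (δ : SL(2, ℝ)) = γ₀ ^ n := by
    refine hgen.exists_zpow δ δ.2 ?_
    have h2 : Commute (δ : SL(2, ℝ)) (P : SL(2, ℝ)) := congrArg Subtype.val hδ
    have h3 : Commute (τ * δ * τ⁻¹) (unip (m * t)) := by
      have := commute_conj τ h2
      rcases hconj with h | h <;> rw [h] at this
      · exact this
      · simpa using this.neg_right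
    obtain ⟨e1, e2⟩ := commute_unip (mul_ne_zero (Nat.cast_ne_zero.2 hm.ne') ht0) h3
    have h4 : Commute (τ * δ * τ⁻¹) (unip t) := by
      apply ext_entries <;> simp only [mul_entry, unip_00, unip_01, unip_10, unip_11, e1, e2] <;> ring
    rw [← hτ] at h4
    have h5 := commute_conj τ⁻¹ h4
    have h6 (x : SL(2, ℝ)) : τ⁻¹ * (τ * x * τ⁻¹) * τ⁻¹⁻¹ = x := by group
    rw [h6, h6] at h5
    rcases posRep_eq_or γ₀ with h | h <;> rw [h] at h5
    · exact h5
    · simpa using h5.neg_right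
  have hsm (w : ℍ) : ((τ • γ₀ • w : ℍ) : ℂ) = (τ • w : ℍ) + t := by
    rw [← unip_smul, ← hτ, ← posRep_smul γ₀]
    simp [mul_smul]
  have hPγ : Commute γ₀ (P : SL(2, ℝ)) := by rw [hPm]; exact Commute.self_pow γ₀ m
  have hz := hg.zero_at γ₀ hgen.mem τ t ht0 hτ
  have hper : Function.Periodic (twist k g τ ∘ UpperHalfPlane.ofComplex) (1 : ℝ) :=
    periodic_of_unip ht fun w ↦ by
      rw [← hτ, hg.twist_smul_posRep hgen.mem, hτ]
      simp [autj]
  rcases ht with rfl | rfl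
  · refine ⟨⟨γ₀, hgen.mem⟩, τ, _, fun δ hδ ↦ ?_, Subtype.ext hPγ, fun w ↦ by simpa using hsm w,
      hconj, hz, hper⟩
    obtain ⟨n, hn⟩ := hcomm δ hδ
    exact ⟨n, Subtype.ext (by simpa using hn)⟩
  -- When t = -1 it is the inverse of the generator that translates by +1.
  · refine ⟨⟨γ₀, hgen.mem⟩⁻¹, τ, _, fun δ hδ ↦ ?_, Subtype.ext hPγ.inv_left, fun w ↦ ?_,
      hconj, hz, hper⟩
    · obtain ⟨n, hn⟩ := hcomm δ hδ
      exact ⟨-n, Subtype.ext (by simpa using hn)⟩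
    · have := hsm (γ₀⁻¹ • w)
      rw [smul_inv_smul] at this
      simp only [InvMemClass.coe_inv, this]
      simp

/-! ### Hyperbolic classes: powers and diagonalisation -/

section LocalData

variable {Γ : Subgroup SL(2, ℝ)}

theorem LocalData.isHyp {c : HypClass Γ} (D : LocalData Γ c) : IsHyp (D.P : SL(2, ℝ)) := by
  obtain ⟨γ, hγ, hh⟩ := c.2
  rw [← D.mk_P, ConjClasses.mk_eq_mk_iff_isConj, isConj_iff] at hγ
  obtain ⟨σ, hσ⟩ := hγ
  rw [isHyp_iff] at hh ⊢
  rw [← hσ]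
  rwa [Subgroup.coe_mul, Subgroup.coe_mul, Subgroup.coe_inv, tr_conj]

theorem LocalData.n_ne_zero {c : HypClass Γ} (D : LocalData Γ c) : D.n ≠ 0 := by
  intro h
  have h1 := D.isHyp
  rw [← D.pow_eq, h, pow_zero, isHyp_iff] at h1
  norm_num [tr] at h1

theorem LocalData.coe_pow_eq {c : HypClass Γ} (D : LocalData Γ c) :
    (D.P : SL(2, ℝ)) = (D.P₀ : SL(2, ℝ)) ^ D.n := by
  rw [← D.pow_eq, Subgroup.coe_pow]

theorem LocalData.normN_eq {c : HypClass Γ} (D : LocalData Γ c) :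
    normN D.P = normN D.P₀ ^ D.n := by
  rw [D.coe_pow_eq, D.prim.1.normN_pow D.n_ne_zero]

theorem LocalData.conj_eq {c : HypClass Γ} (D : LocalData Γ c) :
    D.τ * posRep D.P * D.τ⁻¹ =
      diagL (√(normN D.P)) (zero_lt_one.trans D.isHyp.one_lt_sqrt).ne' := by
  have h := D.prim.1.conj_pow_posRep ((diag_iff D.prim.1).1 D.diag) D.n
  rw [← D.coe_pow_eq] at h
  rw [h]
  apply Subtype.ext
  have h1 : √(normN D.P) = √(normN D.P₀) ^ D.n := by
    rw [D.normN_eq, Real.sqrt_eq_iff_mul_self_eq (by have := D.prim.1.one_lt_normN; positivity)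
      (by positivity), ← pow_two, ← pow_mul, mul_comm, pow_mul,
      Real.sq_sqrt (by have := D.prim.1.one_lt_normN; positivity)]
  simp only [diagL, h1]

end LocalData

/-! ### Contributions of the conjugacy classes -/

section ClassSum

variable {Γ : Subgroup SL(2, ℝ)} [DiscreteTopology Γ] {𝓕 : Set ℍ} {k : ℕ} {g : ℍ → ℂ} {s : ℂ}

/-- The identity contributes 0 by definition of `classTerm`. A parabolic class unfolds to the strip
0 ≤ Re w < 1, where the kernel depends on Im w alone and the remaining integral of conj(g) over a
period vanishes. -/
theorem IsCuspidal.tsum_class_eq_zero (htf : ∀ γ ∈ Γ, IsOfFinOrder γ → γ = 1)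
    (h𝓕 : IsFundamentalDomain Γ 𝓕 (volume : Measure ℍ)) (hg : IsCuspidal Γ k g) (hs : 1 < s.re)
    {P : Γ} (hP : ¬IsHyp (P : SL(2, ℝ)))
    (hfin : ∑' γ : {γ : Γ // ConjClasses.mk γ = ConjClasses.mk P},
      ∫⁻ z in 𝓕, ‖classTerm k s g γ.1 z‖ₑ ≠ ⊤) :
    ∑' γ : {γ : Γ // ConjClasses.mk γ = ConjClasses.mk P},
      ∫ z in 𝓕, classTerm k s g γ.1 z = 0 := by
  by_cases h1 : P = 1
  · have h2 (γ : {γ : Γ // ConjClasses.mk γ = ConjClasses.mk P}) :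
        ∫ z in 𝓕, classTerm k s g γ.1 z = 0 := by
      obtain ⟨γ, hγ⟩ := γ
      rw [h1, ConjClasses.mk_eq_mk_iff_isConj, isConj_comm, isConj_one_right] at hγ
      simp [classTerm, hγ]
    simp [h2]
  obtain ⟨P₀, τ, c, hcomm, hP₀, hsm, hconj, hz, hper⟩ := exists_parabolic_gen htf hg h1 hP
  have hS : MeasurableSet {z : ℍ | z.re ∈ Set.Ico (0 : ℝ) 1} :=
    UpperHalfPlane.continuous_re.measurable measurableSet_Ico
  have h := (hg.integral_class htf h𝓕 hs hcomm hP₀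
    (𝓓 := (fun z : ℍ ↦ τ • z) ⁻¹' {z : ℍ | z.re ∈ Set.Ico (0 : ℝ) 1})
    (existsUnique_zpow_smul (ψ := fun w : ℍ ↦ (τ • w).re) one_pos fun w ↦ by
      have := congrArg Complex.re (hsm w)
      simpa using this)
    (measurable_const_smul τ hS) hfin).2
  rw [← h, integral_annulus, classTerm_of_ne h1]
  refine setIntegral_strip_eq_zero fun y hy ↦ ?_
  have hk (w : ℍ) : diagTerm k s g P (τ⁻¹ • w) = (starRingEnd ℂ) (twist k g τ w) *
      kerE s k (unip c) (w.im * I) (w.im * I) := by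
    rw [diagTerm_inv_smul]
    have := kerE_unip s k c w
    rcases hconj with h | h <;> rw [h]
    · rw [this]; rfl
    · rw [kerE_neg, this]; rfl
  have him (x : ℝ) : (UpperHalfPlane.ofComplex (x + y * I)).im = y := by
    rw [UpperHalfPlane.ofComplex_apply_of_im_pos (by simpa using hy)]
    simp [UpperHalfPlane.im]
  simp_rw [hk, him]
  rw [intervalIntegral.integral_mul_const, intervalIntegral.intervalIntegral_eq_integral_uIoc,
    integral_conj]
  have h0 := integral_period_eq_zero (hg.twist_holo τ) hper hz hy
  rw [intervalIntegral.intervalIntegral_eq_integral_uIoc] at h0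
  rw [if_pos zero_le_one, one_smul] at h0 ⊢
  rw [h0]
  simp

/-- The centraliser of P is generated by P₀, which acts in the coordinate τz as multiplication by
N(P₀). So the annulus of P₀ is the domain of integration, while the kernel is that of P. The right
side depends on the class only, which makes every choice of representatives admissible. -/
theorem LocalData.tsum_class {c : HypClass Γ} (D : LocalData Γ c)
    (htf : ∀ γ ∈ Γ, IsOfFinOrder γ → γ = 1)
    (h𝓕 : IsFundamentalDomain Γ 𝓕 (volume : Measure ℍ)) (hg : IsCuspidal Γ k g) (hs : 1 < s.re)
    (hfin : ∑' γ : {γ : Γ // ConjClasses.mk γ = c.1},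
      ∫⁻ z in 𝓕, ‖classTerm k s g γ.1 z‖ₑ ≠ ⊤) :
    IntegrableOn (localDensity k s g (normN D.P) D.τ) (annulus (normN D.P₀)) ∧
      localI k s g D = ∑' γ : {γ : Γ // ConjClasses.mk γ = c.1},
        ∫ z in 𝓕, classTerm k s g γ.1 z := by
  have hcomm (δ : Γ) (hδ : Commute δ D.P) : ∃ n : ℤ, δ = D.P₀ ^ n := by
    have h1 : Commute (δ : SL(2, ℝ)) ((D.P₀ : SL(2, ℝ)) ^ D.n) := by
      rw [← D.coe_pow_eq]; exact congrArg Subtype.val hδ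
    obtain ⟨n, hn⟩ := (D.prim.isGen htf).exists_zpow δ δ.2
      (D.prim.1.commute_of_commute_pow D.n_ne_zero h1)
    exact ⟨n, Subtype.ext (by simpa using hn)⟩
  have hP : Commute D.P₀ D.P := by rw [← D.pow_eq]; exact Commute.self_pow _ _
  have h1 : D.P ≠ 1 := by
    intro h
    have := D.isHyp
    rw [h, isHyp_iff] at this
    norm_num [tr] at this
  rw [← D.mk_P] at hfin ⊢
  obtain ⟨e1, e2⟩ := hg.integral_class htf h𝓕 hs hcomm hP
    (D.prim.1.existsUnique_annulus ((diag_iff D.prim.1).1 D.diag))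
    (measurable_const_smul D.τ (measurableSet_annulus _)) hfin
  rw [integrableOn_annulus, classTerm_of_ne h1] at e1
  rw [integral_annulus, classTerm_of_ne h1] at e2
  have hd (w : ℍ) := diagTerm_eq_localDensity D.isHyp D.conj_eq hs k g w
  have hN := D.isHyp.one_lt_normN
  have hc : ((normN D.P ^ k / (normN D.P - 1) ^ (2 * k) : ℝ) : ℂ) ≠ 0 := by
    rw [Complex.ofReal_ne_zero]
    exact (div_pos (by positivity) (pow_pos (by linarith) _)).ne'
  simp_rw [hd] at e1 e2
  refine ⟨?_, ?_⟩
  · have := e1.const_mul (((normN D.P ^ k / (normN D.P - 1) ^ (2 * k) : ℝ) : ℂ)⁻¹)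
    simp only [← mul_assoc, inv_mul_cancel₀ hc, one_mul] at this
    exact this
  · rw [← e2, integral_const_mul]; rfl

theorem IsCuspidal.integral_scalarDensity (htf : ∀ γ ∈ Γ, IsOfFinOrder γ → γ = 1)
    (h𝓕 : IsFundamentalDomain Γ 𝓕 (volume : Measure ℍ)) (hcof : volume 𝓕 < ⊤)
    (hg : IsCuspidal Γ k g) (hs : 1 < s.re) (D : (c : HypClass Γ) → LocalData Γ c) :
    (∀ c, IntegrableOn (localDensity k s g (normN (D c).P) (D c).τ) (annulus (normN (D c).P₀))) ∧
      (Summable fun c ↦ ‖localI k s g (D c)‖) ∧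
      ∫ z in 𝓕, scalarDensity Γ k s g z = ∑' c, localI k s g (D c) := by
  obtain ⟨-, hfin, heq⟩ := hg.scalarDensity_sum htf h𝓕 hcof hs
  have hfinc (c : ConjClasses Γ) : ∑' γ : {γ : Γ // ConjClasses.mk γ = c},
      ∫⁻ z in 𝓕, ‖classTerm k s g γ.1 z‖ₑ ≠ ⊤ :=
    ne_top_of_le_ne_top hfin (ENNReal.tsum_comp_le_tsum_of_injective Subtype.val_injective _)
  have hloc (c : HypClass Γ) := (D c).tsum_class htf h𝓕 hg hs (hfinc c.1)
  set a : Γ → ℂ := fun γ ↦ ∫ z in 𝓕, classTerm k s g γ z with ha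
  have hsum : Summable fun γ ↦ ‖a γ‖ := by
    have h1 := ENNReal.summable_toReal hfin
    refine Summable.of_nonneg_of_le (fun _ ↦ norm_nonneg _) (fun γ ↦ ?_) h1
    rw [← toReal_enorm]
    exact ENNReal.toReal_mono (ENNReal.ne_top_of_tsum_ne_top hfin γ) (enorm_integral_le_lintegral_enorm _)
  let e := Equiv.sigmaFiberEquiv (fun γ : Γ ↦ ConjClasses.mk γ)
  have hsum' : Summable fun p ↦ ‖a (e p)‖ := e.summable_iff.2 hsum
  have hfib : Summable fun c : ConjClasses Γ ↦ ∑' γ : {γ : Γ // ConjClasses.mk γ = c}, ‖a γ.1‖ :=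
    hsum'.sigma
  refine ⟨fun c ↦ (hloc c).1, ?_, ?_⟩
  · refine Summable.of_nonneg_of_le (fun _ ↦ norm_nonneg _) (fun c ↦ ?_)
      (hfib.comp_injective (i := fun c : HypClass Γ ↦ c.1) Subtype.val_injective)
    rw [(hloc c).2]
    exact norm_tsum_le_tsum_norm (hsum'.sigma_factor c.1)
  · have h1 : ∑' γ, a γ = ∑' c : ConjClasses Γ, ∑' γ : {γ : Γ // ConjClasses.mk γ = c}, a γ.1 := by
      rw [← e.tsum_eq]
      exact (Summable.of_norm hsum').tsum_sigma
    rw [heq, h1, tsum_congr fun c ↦ (hloc c).2]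
    symm
    -- The sum over all classes is supported on the hyperbolic ones, the others contributing 0.
    refine tsum_subtype_eq_of_support_subset
      (f := fun c : ConjClasses Γ ↦ ∑' γ : {γ : Γ // ConjClasses.mk γ = c}, a γ.1)
      (s := {c | ∃ γ : Γ, ConjClasses.mk γ = c ∧ IsHyp (γ : SL(2, ℝ))}) fun c hc ↦ ?_
    obtain ⟨P, rfl⟩ := ConjClasses.mk_surjective c
    by_contra hn
    refine hc (hg.tsum_class_eq_zero htf h𝓕 hs (fun h ↦ hn ⟨P, rfl, h⟩) (hfinc _))

end ClassSum

/-! ### A hypergeometric generating function -/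

theorem one_add_mem_slitPlane {z : ℂ} (hz : ‖z‖ < 1) : 1 + z ∈ slitPlane :=
  mem_slitPlane_of_norm_lt_one hz

theorem choose_eq_Gamma {a : ℂ} (ha : 0 < a.re) (n : ℕ) :
    Ring.choose (a + 2 * n - 1) n =
      Complex.Gamma (a + 2 * n) / (Complex.Gamma (a + n) * n.factorial) := by
  have h1 := Ring.multichoose_eq (a + n) n
  rw [show a + 2 * n - 1 = a + n + n - 1 by ring, ← h1]
  have h2 := Ring.factorial_nsmul_multichoose_eq_ascPochhammer (a + n) n
  rw [nsmul_eq_mul, Polynomial.ascPochhammer_smeval_eq_eval,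
    ← Complex.Gamma_add_nat_div_Gamma_eq _ (ne_neg_nat (by
      simp; linarith [(Nat.cast_nonneg n : (0 : ℝ) ≤ n)]))] at h2
  have h3 : (n.factorial : ℂ) ≠ 0 := by exact_mod_cast n.factorial_ne_zero
  rw [show a + n + n = a + 2 * n by ring] at h2
  rw [← div_div, ← h2]
  field_simp

theorem circleIntegral_one_add_cpow (α : ℂ) {ρ : ℝ} (h0 : 0 < ρ) (h1 : ρ < 1) (n : ℕ) :
    ∮ z in C(0, ρ), (1 / z ^ (n + 1)) * (1 + z) ^ α = 2 * Real.pi * I * Ring.choose α n := by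
  have hd : DifferentiableOn ℂ (fun z : ℂ ↦ (1 + z) ^ α) (Metric.closedBall 0 ρ) := fun z hz ↦ by
    have hz' : ‖z‖ < 1 := (mem_closedBall_zero_iff.1 hz).trans_lt h1
    exact (((differentiableAt_const _).add differentiableAt_id).cpow_const
      (one_add_mem_slitPlane hz')).differentiableWithinAt
  have h2 := hd.circleIntegral_one_div_sub_center_pow_smul h0 n
  simp only [sub_zero, smul_eq_mul] at h2
  have h3 := one_add_cpow_hasFPowerSeriesOnBall_zero (a := α) |>.factorial_smul 1 n
  rw [← iteratedDeriv_eq_iteratedFDeriv, binomialSeries_apply] at h3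
  rw [h2, ← h3]
  have h4 : (n.factorial : ℂ) ≠ 0 := by exact_mod_cast n.factorial_ne_zero
  simp only [nsmul_eq_mul, smul_eq_mul, List.ofFn_const, List.prod_replicate, one_pow, mul_one]
  field_simp

/-- By Cauchy's formula the binomial coefficient is the n-th Taylor coefficient of (1+z)^{a+2n-1}.
Under the integral sign the series over n is geometric with ratio t = y(1+z)²/z, and what remains
has a single pole inside the circle, at z = q. -/
theorem hasSum_choose {a : ℂ} {q : ℝ} (h0 : 0 < q) (h1 : q < 1) :
    HasSum (fun n : ℕ ↦ Ring.choose (a + 2 * n - 1) n * ((q / (1 + q) ^ 2 : ℝ) : ℂ) ^ n)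
      ((1 + q : ℂ) ^ a / (1 - q)) := by
  obtain ⟨ρ, hqρ, hρ1⟩ := exists_between h1
  have hρ0 : 0 < ρ := h0.trans hqρ
  set y : ℝ := q / (1 + q) ^ 2 with hy
  have hy0 : 0 < y := by positivity
  have hz (θ : ℝ) : ‖circleMap 0 ρ θ‖ = ρ := by rw [norm_circleMap_zero, abs_of_pos hρ0]
  have hz0 (θ : ℝ) : circleMap 0 ρ θ ≠ 0 := by rw [← norm_pos_iff, hz]; exact hρ0
  have hsl (θ : ℝ) := one_add_mem_slitPlane ((hz θ).trans_lt hρ1)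
  set G : ℝ → ℂ := fun θ ↦ deriv (circleMap 0 ρ) θ *
    ((1 + circleMap 0 ρ θ) ^ (a - 1) / circleMap 0 ρ θ) with hG
  set t : ℝ → ℂ := fun θ ↦ y * (1 + circleMap 0 ρ θ) ^ 2 / circleMap 0 ρ θ with ht
  have hcm : Continuous (circleMap 0 ρ) := continuous_circleMap 0 ρ
  have hGc : Continuous G := by
    simp only [hG, deriv_circleMap]
    refine (hcm.mul continuous_const).mul (Continuous.div ?_ hcm hz0)
    exact continuous_iff_continuousAt.2 fun θ ↦
      (continuousAt_cpow_const (hsl θ)).comp (f := fun θ ↦ 1 + circleMap 0 ρ θ)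
        (continuous_const.add hcm).continuousAt
  have htc : Continuous t := (continuous_const.mul ((continuous_const.add hcm).pow 2)).div hcm hz0
  set κ : ℝ := y * (1 + ρ) ^ 2 / ρ with hκ
  have htκ (θ : ℝ) : ‖t θ‖ ≤ κ := by
    rw [ht, norm_div, norm_mul, norm_pow, hz, Complex.norm_of_nonneg hy0.le]
    have h2 : ‖1 + circleMap 0 ρ θ‖ ≤ 1 + ρ := (norm_add_le _ _).trans (by rw [hz, norm_one])
    rw [hκ]
    gcongr
  -- The function ρ/(1+ρ)² increases on (0, 1), so ρ > q keeps the ratio below 1 on the circle.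
  have hκ1 : κ < 1 := by
    rw [hκ, hy, div_lt_one hρ0, div_mul_eq_mul_div, div_lt_iff₀ (by positivity)]
    nlinarith [mul_pos (sub_pos.2 hqρ) (sub_pos.2 (mul_lt_one_of_nonneg_of_lt_one_left h0.le h1 hρ1.le))]
  have hκ0 : 0 ≤ κ := by positivity
  obtain ⟨C, hC⟩ := (isCompact_uIcc (a := 0) (b := 2 * Real.pi)).exists_bound_of_continuousOn
    hGc.continuousOn
  have hsum := intervalIntegral.hasSum_integral_of_dominated_convergence (a := 0)
    (b := 2 * Real.pi) (μ := volume)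
    (F := fun (n : ℕ) θ ↦ G θ * t θ ^ n) (f := fun θ ↦ G θ * (1 - t θ)⁻¹)
    (fun n _ ↦ C * κ ^ n) (fun n ↦ (hGc.mul (htc.pow n)).aestronglyMeasurable)
    (fun n ↦ Filter.Eventually.of_forall fun θ hθ ↦ by
      rw [norm_mul, norm_pow]
      have := hC θ (Set.uIoc_subset_uIcc hθ)
      gcongr
      · exact (norm_nonneg _).trans this
      · exact htκ θ)
    (Filter.Eventually.of_forall fun θ _ ↦ (summable_geometric_of_lt_one hκ0 hκ1).mul_left C)
    (by simp)
    (Filter.Eventually.of_forall fun θ _ ↦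
      (hasSum_geometric_of_norm_lt_one ((htκ θ).trans_lt hκ1)).mul_left _)
  have hterm (n : ℕ) : ∫ θ in (0 : ℝ)..2 * Real.pi, G θ * t θ ^ n =
      2 * Real.pi * I * (Ring.choose (a + 2 * n - 1) n * (y : ℂ) ^ n) := by
    have h2 := circleIntegral_one_add_cpow (a + 2 * n - 1) hρ0 hρ1 n
    rw [← mul_assoc, ← h2, circleIntegral, ← intervalIntegral.integral_mul_const]
    refine intervalIntegral.integral_congr fun θ _ ↦ ?_
    have h3 : (1 + circleMap 0 ρ θ) ^ (a + 2 * n - 1) =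
        (1 + circleMap 0 ρ θ) ^ (a - 1) * ((1 + circleMap 0 ρ θ) ^ 2) ^ n := by
      rw [← pow_mul, ← cpow_natCast, ← cpow_add _ _ (slitPlane_ne_zero (hsl θ))]
      congr 1; push_cast; ring
    have := hz0 θ
    simp only [hG, ht, smul_eq_mul, h3, div_pow, mul_pow]
    field_simp
    ring
  have hval : ∫ θ in (0 : ℝ)..2 * Real.pi, G θ * (1 - t θ)⁻¹ =
      2 * Real.pi * I * ((1 + q : ℂ) ^ a / (1 - q)) := by
    have hq1 : (1 + q : ℂ) ≠ 0 := by norm_cast; positivity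
    have hq2 : (1 - q : ℂ) ≠ 0 := by norm_cast; linarith
    have hqz {z : ℂ} (hz : ‖z‖ ≤ ρ) : 1 - q * z ≠ 0 := fun h ↦ by
      have h2 : ‖(q : ℂ) * z‖ = 1 := by rw [← sub_eq_zero.1 h, norm_one]
      rw [norm_mul, Complex.norm_of_nonneg h0.le] at h2
      nlinarith [norm_nonneg z]
    have hd : DifferentiableOn ℂ (fun z : ℂ ↦ (1 + q : ℂ) ^ 2 * (1 + z) ^ (a - 1) / (1 - q * z))
        (Metric.closedBall 0 ρ) := fun z hz ↦ by
      have hz' := mem_closedBall_zero_iff.1 hz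
      refine DifferentiableAt.differentiableWithinAt (DifferentiableAt.div ?_ ?_ (hqz hz'))
      · exact (((differentiableAt_const _).add differentiableAt_id).cpow_const
          (one_add_mem_slitPlane (hz'.trans_lt hρ1))).const_mul _
      · fun_prop
    have h2 := hd.circleIntegral_sub_inv_smul (w := q) (by
      rw [mem_ball_zero_iff, Complex.norm_of_nonneg h0.le]; exact hqρ)
    have h3 : ((1 + q : ℂ) ^ a / (1 - q)) =
        (1 + q : ℂ) ^ 2 * (1 + q) ^ (a - 1) / (1 - q * q) := by
      rw [cpow_sub _ _ hq1, cpow_one, show (1 - q * q : ℂ) = (1 - q) * (1 + q) by ring]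
      field_simp
    rw [h3, ← smul_eq_mul (2 * (Real.pi : ℂ) * I), ← h2, circleIntegral]
    refine intervalIntegral.integral_congr fun θ _ ↦ ?_
    have e1 := hz0 θ
    have e2 := hqz (hz θ).le
    have e3 : circleMap 0 ρ θ - q ≠ 0 := fun h ↦ by
      have := hz θ
      rw [sub_eq_zero.1 h, Complex.norm_of_nonneg h0.le] at this
      exact hqρ.ne this
    -- The choice y = q/(1+q)² puts the zeros of 1 - t at z = q and z = 1/q; only the first is
    -- inside the circle.
    have e4 : 1 - t θ = (circleMap 0 ρ θ - q) * (1 - q * circleMap 0 ρ θ) /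
        ((1 + q) ^ 2 * circleMap 0 ρ θ) := by
      simp only [ht, hy]
      push_cast
      field_simp
      ring
    simp only [hG, smul_eq_mul, e4]
    field_simp
  rw [hval] at hsum
  simp_rw [hterm] at hsum
  exact (hasSum_mul_left_iff Complex.two_pi_I_ne_zero).1 hsum

/-- `Γ(s + m/2 + n) Γ(s + m/2 + 1/2 + n) / (Γ(2s + n) n!)`. -/
def horoCoeff (s : ℂ) (m n : ℕ) : ℂ :=
  Complex.Gamma (s + m / 2 + n) * Complex.Gamma (s + m / 2 + 1 / 2 + n) /
    (Complex.Gamma (2 * s + n) * n.factorial)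

theorem horoCoeff_succ {s : ℂ} (hs : 0 < s.re) (m n : ℕ) :
    horoCoeff s (m + 1) n = (s + m / 2 + n) * horoCoeff s m n := by
  have h1 : 0 < (s + m / 2).re := by
    simp only [add_re, div_ofNat_re, natCast_re]; positivity
  rw [horoCoeff, horoCoeff, show s + ((m + 1 : ℕ) : ℂ) / 2 + 1 / 2 + n = s + m / 2 + (n + 1 : ℕ) by
    push_cast; ring, Gamma_add_succ h1,
    show s + ((m + 1 : ℕ) : ℂ) / 2 + n = s + m / 2 + 1 / 2 + n by push_cast; ring]
  ring

/-- Legendre's duplication formula merges Γ(s+n)Γ(s+n+1/2) into Γ(2s+2n), which leaves a binomial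
coefficient. -/
theorem horoCoeff_zero {s : ℂ} (hs : 1 < s.re) (n : ℕ) :
    horoCoeff s 0 n = 2 * √Real.pi * 4 ^ (-s) * (Ring.choose (2 * s + 2 * n - 1) n * (1 / 4) ^ n) := by
  rw [choose_eq_Gamma (by simp; linarith), horoCoeff, Nat.cast_zero, zero_div, add_zero,
    show s + 1 / 2 + n = s + n + 1 / 2 by ring, Complex.Gamma_mul_Gamma_add_half,
    show 2 * (s + n) = 2 * s + 2 * n by ring]
  have h4 : (4 : ℂ) ^ (-s) = 2 ^ (-s) * 2 ^ (-s) := by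
    have := Complex.mul_cpow_ofReal_nonneg (a := 2) (b := 2) zero_le_two zero_le_two (-s)
    norm_num at this
    exact this
  have h1 : (2 : ℂ) ^ (1 - (2 * s + 2 * n)) = 2 * 4 ^ (-s) * (1 / 4) ^ n := by
    rw [show 1 - (2 * s + 2 * n) = 1 + -s + -s - ((2 * n : ℕ) : ℂ) by push_cast; ring,
      cpow_sub _ _ two_ne_zero, cpow_add _ _ two_ne_zero, cpow_add _ _ two_ne_zero, cpow_one,
      cpow_natCast, h4, pow_mul, one_div, inv_pow]
    norm_num
    ring
  rw [h1]
  ring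

theorem polyBdd_horoCoeff {s : ℂ} (hs : 1 < s.re) (m : ℕ) : PolyBdd (horoCoeff s m) := by
  induction m with
  | zero =>
    obtain ⟨A, hA⟩ := exists_nat_ge (‖s‖ + 1)
    refine polyBdd_of_ratio A fun n ↦ ?_
    have hs0 : 0 < s.re := by linarith
    have h2 : 0 < (2 * s).re := by simp [hs0]
    have h2' : 0 < (s + 1 / 2).re := by simp; linarith
    have h3 : (2 * s + n : ℂ) ≠ 0 := fun h ↦ ne_neg_nat h2 n (eq_neg_of_add_eq_zero_left h)
    have h4 : ((n : ℂ) + 1) ≠ 0 := Nat.cast_add_one_ne_zero n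
    have h6 : Complex.Gamma (2 * s + n) ≠ 0 := Gamma_ne_zero fun m ↦ ne_neg_nat (by
      simp; linarith [(Nat.cast_nonneg n : (0 : ℝ) ≤ n)]) m
    have h7 : (n.factorial : ℂ) ≠ 0 := by exact_mod_cast n.factorial_ne_zero
    have h8 : horoCoeff s 0 (n + 1) =
        (s + n) * (s + 1 / 2 + n) / ((2 * s + n) * (n + 1)) * horoCoeff s 0 n := by
      rw [horoCoeff, horoCoeff, Nat.cast_zero, zero_div, add_zero, Gamma_add_succ hs0,
        Gamma_add_succ h2', Gamma_add_succ h2, Nat.factorial_succ]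
      push_cast
      field_simp
    rw [h8, norm_mul]
    gcongr
    rw [norm_div, norm_mul, norm_mul, div_pow, sq, sq]
    have e1 : ‖s + n‖ ≤ n + A := by
      refine (norm_add_le _ _).trans ?_
      rw [Complex.norm_natCast]; linarith
    have e1' : ‖s + 1 / 2 + n‖ ≤ n + A := by
      refine (norm_add_le _ _).trans ?_
      have := norm_add_le s (1 / 2)
      have h12 : ‖(1 / 2 : ℂ)‖ = 1 / 2 := by norm_num
      rw [Complex.norm_natCast]; linarith
    have e2 : (n : ℝ) + 1 ≤ ‖2 * s + n‖ := by
      refine le_trans ?_ (Complex.re_le_norm _)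
      simp; linarith
    have e3 : ‖(n : ℂ) + 1‖ = n + 1 := by exact_mod_cast Complex.norm_natCast (n + 1)
    rw [e3]
    gcongr
  | succ m ih =>
    have : horoCoeff s (m + 1) = fun n : ℕ ↦ (s + m / 2 + n) * horoCoeff s m n := by
      funext n; exact horoCoeff_succ (by linarith) m n
    rw [this]
    exact ih.affine_mul _

/-- With q = e^{-ℓ} the argument is 1/cosh²(ℓ/2), the largest value of r along an orbit of
hyperbolic displacements. In q the series becomes elementary. -/
theorem frob_horoCoeff_zero {s : ℂ} (hs : 1 < s.re) {q : ℝ} (h0 : 0 < q) (h1 : q < 1) :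
    frob (horoCoeff s 0) s ((4 * q / (1 + q) ^ 2 : ℝ) : ℂ) =
      2 * √Real.pi * ((q : ℂ) ^ s * (1 / (1 - q))) := by
  have h2 := (hasSum_choose (a := 2 * s) h0 h1).tsum_eq
  have h3 : ∑' n, horoCoeff s 0 n * ((4 * q / (1 + q) ^ 2 : ℝ) : ℂ) ^ n =
      2 * √Real.pi * 4 ^ (-s) * ((1 + q : ℂ) ^ (2 * s) / (1 - q)) := by
    rw [← h2, ← tsum_mul_left]
    refine tsum_congr fun n ↦ ?_
    have e : ((4 * q / (1 + q) ^ 2 : ℝ) : ℂ) = 4 * ((q / (1 + q) ^ 2 : ℝ) : ℂ) := by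
      push_cast; ring
    rw [horoCoeff_zero hs, e, mul_pow, one_div, inv_pow]
    field_simp
  have h4 : ((4 * q / (1 + q) ^ 2 : ℝ) : ℂ) ^ s =
      4 ^ s * (q : ℂ) ^ s * ((1 + q : ℂ) ^ (2 * s))⁻¹ := by
    have e : ((1 + q : ℂ) ^ (2 * s)) = (((1 + q) ^ 2 : ℝ) : ℂ) ^ s := by
      have hq : 0 < 1 + q := by positivity
      rw [sq, ofReal_mul, Complex.mul_cpow_ofReal_nonneg hq.le hq.le, two_mul,
        cpow_add _ _ (by norm_cast; exact hq.ne')]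
      push_cast; rfl
    rw [e, ofReal_div, Complex.div_cpow_ofReal_nonneg (by positivity) (by positivity), ofReal_mul,
      Complex.mul_cpow_ofReal_nonneg (by norm_num) h0.le]
    push_cast; rw [div_eq_mul_inv]
  rw [frob, h3, h4, cpow_neg]
  have e1 : (4 : ℂ) ^ s ≠ 0 := by simp [cpow_eq_zero_iff]
  have e2 : (1 + q : ℂ) ^ (2 * s) ≠ 0 := by
    rw [Ne, cpow_eq_zero_iff]; push Not
    intro h; norm_cast at h; linarith
  field_simp

/-! ### Higher coefficients of the generating function -/

theorem factorial_mul_choose_succ (m i : ℕ) :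
    ((i + 1).factorial * m.choose (i + 1) * (m + (i + 1)).choose (i + 1) * (i + 1) : ℤ) =
      i.factorial * m.choose i * (m + i).choose i * ((m - i) * (m + i + 1)) := by
  have h1 := Nat.choose_succ_right_eq m i
  have h2 := Nat.add_one_mul_choose_eq (m + i) i
  have h1' : (m.choose (i + 1) * (i + 1) : ℤ) = m.choose i * (m - i) := by
    rcases le_or_gt i m with h | h
    · rw [← Nat.cast_sub h]; exact_mod_cast h1
    · rw [Nat.choose_eq_zero_of_lt h, Nat.choose_eq_zero_of_lt (by omega)]; simp
  have h2' : ((m + i + 1) * (m + i).choose i : ℤ) = (m + (i + 1)).choose (i + 1) * (i + 1) := by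
    exact_mod_cast h2
  rw [Nat.factorial_succ]
  push_cast
  linear_combination (i.factorial * (m + (i + 1)).choose (i + 1) * (i + 1) : ℤ) * h1' -
    (i.factorial * m.choose i * (m - i) : ℤ) * h2'

theorem factorial_mul_choose_succ' (m i : ℕ) :
    (i.factorial * (m + 1).choose i * (m + 1 + i).choose i * (m + 1 - i) : ℤ) =
      i.factorial * m.choose i * (m + i).choose i * (m + 1 + i) := by
  have h1 := Nat.choose_mul_succ_eq m i
  have h2 := Nat.choose_mul_succ_eq (m + i) i
  have h1' : (m.choose i * (m + 1) : ℤ) = (m + 1).choose i * (m + 1 - i) := by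
    rcases le_or_gt i (m + 1) with h | h
    · have := h1
      zify [h] at this
      exact this
    · rw [Nat.choose_eq_zero_of_lt h, Nat.choose_eq_zero_of_lt (by omega)]; simp
  have h2' : ((m + i).choose i * (m + i + 1) : ℤ) = (m + 1 + i).choose i * (m + 1) := by
    rw [show m + i + 1 - i = m + 1 by omega, show m + i + 1 = m + 1 + i by ring] at h2
    exact_mod_cast (by linarith [h2] : (m + i).choose i * (m + i + 1) = (m + 1 + i).choose i * (m + 1))
  have h3 : (m + 1 : ℤ) ≠ 0 := by positivity
  apply mul_right_cancel₀ h3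
  linear_combination -(i.factorial * (m + 1 + i).choose i * (m + 1) : ℤ) * h1' -
    (i.factorial * m.choose i * (m + 1) : ℤ) * h2'

/-- The numerical factor of `p_{i+1}` for the index `m + 1`. -/
def factCoeff (m i : ℕ) : ℕ := i.factorial * m.choose i * (m + i).choose i

theorem factCoeff_succ (m i : ℕ) :
    (factCoeff m (i + 1) * (i + 1) : ℂ) = factCoeff m i * ((m - i) * (m + i + 1)) := by
  have := factorial_mul_choose_succ m i
  unfold factCoeff
  exact_mod_cast congrArg (Int.cast : ℤ → ℂ) this

theorem factCoeff_succ_succ (m i : ℕ) :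
    (factCoeff (m + 1) (i + 1) * (i + 1) : ℂ) = factCoeff m i * ((m + 1 + i) * (m + i + 2)) := by
  have h1 := factorial_mul_choose_succ (m + 1) i
  have h2 := factorial_mul_choose_succ' m i
  have h3 : ((i + 1).factorial * (m + 1).choose (i + 1) * (m + 1 + (i + 1)).choose (i + 1) * (i + 1) : ℤ)
      = i.factorial * m.choose i * (m + i).choose i * ((m + 1 + i) * (m + i + 2)) := by
    push_cast at h1 ⊢
    linear_combination h1 + (m + i + 2 : ℤ) * h2
  unfold factCoeff
  exact_mod_cast congrArg (Int.cast : ℤ → ℂ) h3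

/-- `p_{i+1}`, with `2k` replaced by `m + 1` and `2s` by `a`. -/
def genP (a : ℂ) (m i : ℕ) : ℂ := factCoeff m i * ∏ l ∈ Finset.Icc (i + 2) (m + 1), (a - l)

theorem genP_eq_zero (a : ℂ) (m : ℕ) : genP a m (m + 1) = 0 := by
  simp [genP, factCoeff]

theorem genP_succ_zero (a : ℂ) (m : ℕ) : genP a (m + 1) 0 = (a + m - 2 * (0 + 1 + m)) * genP a m 0 := by
  simp only [genP, factCoeff, zero_add]
  rw [Finset.prod_Icc_succ_top (by omega : 2 ≤ m + 1 + 1)]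
  simp
  ring

theorem genP_succ_succ (a : ℂ) {m i : ℕ} (hi : i ≤ m) : genP a (m + 1) (i + 1) =
    (a + m - 2 * ((i + 1 : ℕ) + 1 + m)) * genP a m (i + 1) + 2 * (i + 1 + m) * genP a m i := by
  have h0 : (i + 1 : ℂ) ≠ 0 := Nat.cast_add_one_ne_zero i
  have h1 := factCoeff_succ m i
  have h2 := factCoeff_succ_succ m i
  apply mul_left_cancel₀ h0
  rcases hi.lt_or_eq with hi | rfl
  · have e1 : ∏ l ∈ Finset.Icc (i + 2) (m + 1), (a - l) =
        (a - (i + 2 : ℕ)) * ∏ l ∈ Finset.Icc (i + 3) (m + 1), (a - l) := by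
      rw [← Finset.insert_Icc_add_one_left_eq_Icc (by omega : i + 2 ≤ m + 1),
        Finset.prod_insert (by simp)]
      rfl
    have e2 : ∏ l ∈ Finset.Icc (i + 3) (m + 2), (a - l) =
        (a - (m + 2 : ℕ)) * ∏ l ∈ Finset.Icc (i + 3) (m + 1), (a - l) := by
      rw [Finset.prod_Icc_succ_top (by omega : i + 3 ≤ m + 1 + 1), mul_comm]
    simp only [genP]
    rw [show i + 1 + 2 = i + 3 by ring, show m + 1 + 1 = m + 2 by ring, e1, e2]
    generalize ∏ l ∈ Finset.Icc (i + 3) (m + 1), (a - (l : ℂ)) = R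
    push_cast
    linear_combination (a - (m + 2)) * R * h2 - (a + m - 2 * (i + 1 + 1 + m)) * R * h1
  · rw [genP_eq_zero]
    simp only [genP]
    rw [Finset.Icc_eq_empty (by omega), Finset.Icc_eq_empty (by omega)]
    simp only [Finset.prod_empty]
    linear_combination h2

/-- `∑ p_{i+1} u^{i+1+m}`. -/
def genS (a : ℂ) (m : ℕ) (u : ℂ) : ℂ := ∑ i ∈ Finset.range (m + 1), genP a m i * u ^ (i + 1 + m)

/-- `u` times the derivative of `genS`. -/
def genS' (a : ℂ) (m : ℕ) (u : ℂ) : ℂ :=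
  ∑ i ∈ Finset.range (m + 1), genP a m i * ((i + 1 + m) * u ^ (i + m))

theorem hasDerivAt_genS (a : ℂ) (m : ℕ) (u : ℂ) : HasDerivAt (genS a m) (genS' a m u) u := by
  refine HasDerivAt.fun_sum fun i _ ↦ ?_
  refine ((hasDerivAt_pow (i + 1 + m) u).const_mul _).congr_deriv ?_
  rw [show i + 1 + m - 1 = i + m by omega]
  push_cast; ring

/-- This mirrors one step of the operator in `frob_horoCoeff`: u = 1/(1-q) satisfies q du/dq = u² -
u. The recursion for the coefficients p_j is exactly the comparison of powers of u. -/
theorem genS_succ (a : ℂ) (m : ℕ) (u : ℂ) :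
    genS a (m + 1) u = u * ((a + m) * genS a m u + 2 * (u ^ 2 - u) * genS' a m u) := by
  have h1 : u * ((a + m) * genS a m u + 2 * (u ^ 2 - u) * genS' a m u) =
      ∑ i ∈ Finset.range (m + 1), (a + m - 2 * (i + 1 + m)) * genP a m i * u ^ (i + m + 2) +
      ∑ i ∈ Finset.range (m + 1), 2 * (i + 1 + m) * genP a m i * u ^ (i + m + 3) := by
    rw [genS, genS', Finset.mul_sum, Finset.mul_sum, ← Finset.sum_add_distrib, Finset.mul_sum,
      ← Finset.sum_add_distrib]
    refine Finset.sum_congr rfl fun i _ ↦ ?_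
    ring
  have h2 : ∑ i ∈ Finset.range (m + 1), (a + m - 2 * (i + 1 + m)) * genP a m i * u ^ (i + m + 2) =
      ∑ i ∈ Finset.range (m + 2), (a + m - 2 * (i + 1 + m)) * genP a m i * u ^ (i + m + 2) := by
    rw [Finset.sum_range_succ _ (m + 1), genP_eq_zero]; simp
  rw [h1, h2, Finset.sum_range_succ', genS, Finset.sum_range_succ', add_right_comm (Finset.sum _ _),
    ← Finset.sum_add_distrib]
  congr 1
  · refine Finset.sum_congr rfl fun i hi ↦ ?_
    rw [genP_succ_succ a (by simp at hi; omega)]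
    push_cast; ring
  · rw [genP_succ_zero]; push_cast; ring

/-- Raising m by one applies x^{1/2} · x d/dx. For x = 4q/(1+q)² this is 2 q^{1/2} u · q d/dq with u
= 1/(1-q), and it sends q^{s+m/2} times a polynomial in u to an expression of the same shape. -/
theorem frob_horoCoeff {s : ℂ} (hs : 1 < s.re) (m : ℕ) {q : ℝ} (h0 : 0 < q) (h1 : q < 1) :
    frob (horoCoeff s m) (s + m / 2) ((4 * q / (1 + q) ^ 2 : ℝ) : ℂ) =
      2 * √Real.pi * ((q : ℂ) ^ (s + m / 2) * genS (2 * s) m (1 / (1 - q))) := by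
  induction m generalizing q with
  | zero =>
    have := frob_horoCoeff_zero hs h0 h1
    simpa [genS, genP, factCoeff] using this
  | succ m ih =>
    set σ := s + m / 2 with hσ
    have hq0 : (q : ℂ) ≠ 0 := by exact_mod_cast h0.ne'
    have hq1 : (1 + q : ℂ) ≠ 0 := by norm_cast; positivity
    have hq2 : (1 - q : ℂ) ≠ 0 := by norm_cast; linarith
    have hx0 : 0 < 4 * q / (1 + q) ^ 2 := by positivity
    have hx1 : 4 * q / (1 + q) ^ 2 < 1 := by
      rw [div_lt_one (by positivity)]; nlinarith [mul_pos (sub_pos.2 h1) (sub_pos.2 h1)]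
    have hxe : ((4 * q / (1 + q) ^ 2 : ℝ) : ℂ) = 4 * q / (1 + q) ^ 2 := by push_cast; rfl
    have hd1 : HasDerivAt (fun z : ℂ ↦ 4 * z / (1 + z) ^ 2) (4 * (1 - q) / (1 + q) ^ 3 : ℂ) (q : ℂ) := by
      have e1 : HasDerivAt (fun z : ℂ ↦ 4 * z) 4 (q : ℂ) := by
        simpa using (hasDerivAt_id (q : ℂ)).const_mul 4
      have e2 : HasDerivAt (fun z : ℂ ↦ (1 + z) ^ 2) (2 * (1 + q) : ℂ) (q : ℂ) := by
        simpa using ((hasDerivAt_id (q : ℂ)).const_add 1).fun_pow 2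
      refine (e1.div e2 (pow_ne_zero 2 hq1)).congr_deriv ?_
      field_simp
      ring
    have hd2 := (polyBdd_horoCoeff hs m).hasDerivAt_frob σ (x := ((4 * q / (1 + q) ^ 2 : ℝ) : ℂ))
      (by rwa [Complex.norm_of_nonneg hx0.le]) (Complex.ofReal_mem_slitPlane.2 hx0)
    have hd3 : HasDerivAt (fun z : ℂ ↦ frob (horoCoeff s m) σ (4 * z / (1 + z) ^ 2)) _ (q : ℂ) :=
      HasDerivAt.comp (h₂ := frob (horoCoeff s m) σ) (q : ℂ) (hxe ▸ hd2) hd1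
    have hd4 : HasDerivAt (fun z : ℂ ↦ 2 * √Real.pi * (z ^ σ * genS (2 * s) m (1 / (1 - z))))
        (2 * √Real.pi * (σ * (q : ℂ) ^ (σ - 1) * genS (2 * s) m (1 / (1 - q)) +
          (q : ℂ) ^ σ * (genS' (2 * s) m (1 / (1 - q)) * (1 / (1 - q) ^ 2)))) (q : ℂ) := by
      refine HasDerivAt.const_mul _ (HasDerivAt.mul ?_ ?_)
      · simpa using (hasDerivAt_id (q : ℂ)).cpow_const (c := σ) (Complex.ofReal_mem_slitPlane.2 h0)
      · refine HasDerivAt.comp (h₂ := genS (2 * s) m) (q : ℂ) (hasDerivAt_genS _ _ _) ?_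
        have := ((hasDerivAt_id (q : ℂ)).const_sub 1).fun_inv hq2
        simpa [one_div] using this
    -- The induction hypothesis is known for real q only, so the derivatives are compared along the
    -- real axis.
    have hev : (fun x : ℝ ↦ frob (horoCoeff s m) σ (4 * (x : ℂ) / (1 + x) ^ 2)) =ᶠ[nhds q]
        fun x : ℝ ↦ 2 * √Real.pi * ((x : ℂ) ^ σ * genS (2 * s) m (1 / (1 - x))) := by
      filter_upwards [Ioo_mem_nhds h0 h1] with x hx
      have := ih hx.1 hx.2
      push_cast at this
      exact this
    have huniq := (hd3.comp_ofReal.congr_of_eventuallyEq hev.symm).unique hd4.comp_ofReal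
    have hhalf : ((4 * q / (1 + q) ^ 2 : ℝ) : ℂ) ^ (1 / 2 : ℂ) = 2 * (q : ℂ) ^ (1 / 2 : ℂ) / (1 + q) := by
      have e1 : (4 * q / (1 + q) ^ 2 : ℝ) = (2 / (1 + q)) * (2 / (1 + q)) * q := by field_simp; ring
      have e2 : 0 < 2 / (1 + q) := by positivity
      rw [e1, ofReal_mul, Complex.mul_cpow_ofReal_nonneg (by positivity) h0.le, ofReal_mul,
        Complex.mul_cpow_ofReal_nonneg e2.le e2.le, ← cpow_add _ _ (by exact_mod_cast e2.ne')]
      norm_num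
      field_simp
    have hfrob : frob (horoCoeff s (m + 1)) (s + ((m + 1 : ℕ) : ℂ) / 2)
        ((4 * q / (1 + q) ^ 2 : ℝ) : ℂ) = 2 * (q : ℂ) ^ (1 / 2 : ℂ) / (1 + q) *
        frob (fun n ↦ (σ + n) * horoCoeff s m n) σ ((4 * q / (1 + q) ^ 2 : ℝ) : ℂ) := by
      have e : horoCoeff s (m + 1) = fun n : ℕ ↦ (σ + n) * horoCoeff s m n := by
        funext n; exact horoCoeff_succ (by linarith) m n
      rw [e, frob, frob, show s + ((m + 1 : ℕ) : ℂ) / 2 = 1 / 2 + σ by rw [hσ]; push_cast; ring,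
        cpow_add _ _ (by exact_mod_cast hx0.ne'), hhalf, mul_assoc]
    rw [hfrob, show s + ((m + 1 : ℕ) : ℂ) / 2 = 1 / 2 + σ by rw [hσ]; push_cast; ring,
      cpow_add _ _ hq0, genS_succ]
    rw [hxe]
    rw [cpow_sub _ _ hq0, cpow_one] at huniq
    have hsol : frob (fun n ↦ (σ + n) * horoCoeff s m n) σ (4 * (q : ℂ) / (1 + q) ^ 2) =
        q * (1 + q) / (1 - q) * (frob (fun n ↦ (σ + n) * horoCoeff s m n) σ (4 * q / (1 + q) ^ 2) /
          (4 * q / (1 + q) ^ 2) * (4 * (1 - q) / (1 + q) ^ 3)) := by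
      generalize frob (fun n ↦ (σ + n) * horoCoeff s m n) σ (4 * (q : ℂ) / (1 + q) ^ 2) = W
      field_simp
    rw [hsol, huniq, show 2 * s + m = 2 * σ by rw [hσ]; ring]
    generalize genS (2 * s) m (1 / (1 - q)) = S
    generalize genS' (2 * s) m (1 / (1 - q)) = S'
    generalize (q : ℂ) ^ σ = Q
    field_simp
    ring

/-! ### The horocyclic integral of the radial kernel -/

theorem integrable_gaussian_Gamma {σ A B : ℝ} (hσ : 1 / 2 < σ) (hA : 0 < A) (hB : 0 < B) :
    Integrable (fun p : ℝ × ℝ ↦ p.2 ^ (σ - 1) * Real.exp (-((B + A * p.1 ^ 2) * p.2)))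
      ((volume : Measure ℝ).prod (volume.restrict (Set.Ioi 0))) := by
  have hm : AEStronglyMeasurable
      (fun p : ℝ × ℝ ↦ p.2 ^ (σ - 1) * Real.exp (-((B + A * p.1 ^ 2) * p.2)))
      ((volume : Measure ℝ).prod (volume.restrict (Set.Ioi 0))) := by
    refine Measurable.aestronglyMeasurable ?_
    exact (measurable_snd.pow_const _).mul (by fun_prop)
  have hsplit (t u : ℝ) : u ^ (σ - 1) * Real.exp (-((B + A * t ^ 2) * u)) =
      u ^ (σ - 1) * Real.exp (-(B * u)) * Real.exp (-(A * u) * t ^ 2) := by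
    rw [mul_assoc, ← Real.exp_add]; congr 2; ring
  rw [integrable_prod_iff' hm]
  constructor
  · filter_upwards [ae_restrict_mem measurableSet_Ioi] with u hu
    simp only [hsplit]
    exact (integrable_exp_neg_mul_sq (mul_pos hA hu)).const_mul _
  · have h1 : IntegrableOn (fun u : ℝ ↦ √(Real.pi / A) * (u ^ (σ - 3 / 2) * Real.exp (-B * u ^ (1 : ℝ))))
        (Set.Ioi 0) :=
      (integrableOn_rpow_mul_exp_neg_mul_rpow (by linarith) one_pos hB).const_mul _
    refine h1.congr_fun (fun u hu ↦ ?_) measurableSet_Ioi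
    have hu : 0 < u := hu
    have hn (t : ℝ) : ‖u ^ (σ - 1) * Real.exp (-((B + A * t ^ 2) * u))‖ =
        u ^ (σ - 1) * Real.exp (-(B * u)) * Real.exp (-(A * u) * t ^ 2) := by
      rw [← hsplit, Real.norm_of_nonneg (by positivity)]
    simp only [hn]
    rw [integral_const_mul, integral_gaussian, show Real.pi / (A * u) = Real.pi / A / u by field_simp,
      Real.sqrt_div' _ hu.le, Real.sqrt_eq_rpow u, Real.rpow_one,
      show σ - 3 / 2 = σ - 1 - 1 / 2 by ring, Real.rpow_sub hu, neg_mul]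
    ring

/-- Write Γ(a)(B + At²)^{-a} as the Laplace integral of u^{a-1} e^{-(B+At²)u}, and integrate the
Gaussian in t first. -/
theorem integral_inv_quadratic_cpow {a : ℂ} {A B : ℝ} (ha : 1 / 2 < a.re) (hA : 0 < A) (hB : 0 < B) :
    Integrable (fun t : ℝ ↦ ((1 / (B + A * t ^ 2) : ℝ) : ℂ) ^ a) ∧
      ∫ t : ℝ, ((1 / (B + A * t ^ 2) : ℝ) : ℂ) ^ a =
        √Real.pi / √A * (Complex.Gamma (a - 1 / 2) / Complex.Gamma a) *
          ((1 / B : ℝ) : ℂ) ^ (a - 1 / 2) := by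
  have ha0 : 0 < a.re := by linarith
  have hΓ : Complex.Gamma a ≠ 0 := Gamma_ne_zero (ne_neg_nat ha0)
  set f : ℝ × ℝ → ℂ := fun p ↦ (p.2 : ℂ) ^ (a - 1) * cexp (-(((B + A * p.1 ^ 2 : ℝ) : ℂ) * p.2)) with hf
  have hfi : Integrable f ((volume : Measure ℝ).prod (volume.restrict (Set.Ioi 0))) := by
    refine (integrable_gaussian_Gamma ha hA hB).mono' ?_ ?_
    · refine Measurable.aestronglyMeasurable ?_
      refine Measurable.mul ?_ (by fun_prop)
      exact (Complex.measurable_ofReal.comp measurable_snd).pow_const _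
    · have hae : ∀ᵐ p ∂((volume : Measure ℝ).prod (volume.restrict (Set.Ioi (0 : ℝ)))),
          p.2 ∈ Set.Ioi (0 : ℝ) := by
        have := (Measure.quasiMeasurePreserving_snd (μ := (volume : Measure ℝ))
          (ν := volume.restrict (Set.Ioi (0 : ℝ)))).ae (ae_restrict_mem measurableSet_Ioi)
        exact this
      filter_upwards [hae] with p hp
      rw [hf, norm_mul, norm_cpow_eq_rpow_re_of_pos hp, ← ofReal_mul, ← ofReal_neg,
        Complex.norm_exp_ofReal]
      simp
  have h1 (t : ℝ) : ∫ u in Set.Ioi (0 : ℝ), f (t, u) =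
      Complex.Gamma a * ((1 / (B + A * t ^ 2) : ℝ) : ℂ) ^ a := by
    have h2 : 0 < B + A * t ^ 2 := by positivity
    have := integral_cpow_mul_exp_neg_mul_Ioi ha0 h2
    simp only [hf, this]
    push_cast
    ring
  refine ⟨?_, ?_⟩
  · have := hfi.integral_prod_left
    simp only [h1] at this
    have := this.const_mul (Complex.Gamma a)⁻¹
    simpa only [← mul_assoc, inv_mul_cancel₀ hΓ, one_mul] using this
  · have h2 := integral_integral_swap (f := fun t u ↦ f (t, u)) hfi
    simp only [h1] at h2
    rw [integral_const_mul] at h2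
    have h3 : ∫ u in Set.Ioi (0 : ℝ), ∫ t : ℝ, f (t, u) =
        √Real.pi / √A * Complex.Gamma (a - 1 / 2) * ((1 / B : ℝ) : ℂ) ^ (a - 1 / 2) := by
      have h4 : ∀ u ∈ Set.Ioi (0 : ℝ), ∫ t : ℝ, f (t, u) =
          √Real.pi / √A * ((u : ℂ) ^ (a - 1 / 2 - 1) * cexp (-((B : ℂ) * u))) := by
        intro u hu
        have hu : 0 < u := hu
        have e1 (t : ℝ) : f (t, u) = (u : ℂ) ^ (a - 1) * cexp (-((B : ℂ) * u)) *
            ((Real.exp (-(A * u) * t ^ 2) : ℝ) : ℂ) := by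
          simp only [hf]
          rw [mul_assoc, ofReal_exp, ← Complex.exp_add]
          congr 2; push_cast; ring
        simp only [e1]
        rw [integral_const_mul, integral_complex_ofReal, integral_gaussian,
          show Real.pi / (A * u) = Real.pi / A / u by field_simp,
          Real.sqrt_div' _ hu.le, Real.sqrt_div' _ hA.le, Real.sqrt_eq_rpow u]
        have hu0 : (u : ℂ) ≠ 0 := by exact_mod_cast hu.ne'
        rw [show a - 1 / 2 - 1 = a - 1 - 1 / 2 by ring, cpow_sub (a - 1) _ hu0]
        push_cast [Complex.ofReal_cpow hu.le]
        ring
      rw [setIntegral_congr_fun measurableSet_Ioi h4, integral_const_mul,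
        integral_cpow_mul_exp_neg_mul_Ioi (by simp; linarith) hB]
      push_cast
      ring
    rw [h3] at h2
    rw [mul_comm (_ / _), div_mul_eq_mul_div, div_mul_eq_mul_div, eq_div_iff hΓ, mul_comm _ (Complex.Gamma a), h2]
    ring

/-- Integrating term by term replaces one of the two factors Γ(s+k+n) by Γ(s+k+n-1/2); this is
`horoCoeff` with m = 2k - 1. The maximum x of r at t = 0 dominates the series. -/
theorem integral_resB {s : ℂ} (hs : 1 < s.re) {k : ℕ} (hk : 1 ≤ k) {A : ℝ} (hA : 0 < A) :
    Integrable (fun t : ℝ ↦ resB s k ((1 / (1 + A * (1 + t ^ 2)) : ℝ) : ℂ)) ∧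
    ∫ t : ℝ, resB s k ((1 / (1 + A * (1 + t ^ 2)) : ℝ) : ℂ) =
      1 / (√Real.pi * √A) * frob (horoCoeff s (2 * k - 1)) (s + ((2 * k - 1 : ℕ) : ℂ) / 2)
        ((1 / (1 + A) : ℝ) : ℂ) := by
  set x : ℝ := 1 / (1 + A) with hx
  have hx0 : 0 < x := by positivity
  have hx1 : x < 1 := by rw [hx, div_lt_one (by positivity)]; linarith
  set r : ℝ → ℝ := fun t ↦ 1 / (1 + A + A * t ^ 2) with hr
  have hre (t : ℝ) : 1 / (1 + A * (1 + t ^ 2)) = r t := by simp only [hr]; congr 1; ring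
  have hr0 (t : ℝ) : 0 < r t := by simp only [hr]; positivity
  have hrx (t : ℝ) : r t ≤ x := by
    exact one_div_le_one_div_of_le (by positivity) (le_add_of_nonneg_right (by positivity))
  have hrn (t : ℝ) : ‖(r t : ℂ)‖ = r t := Complex.norm_of_nonneg (hr0 t).le
  have hrmeas : Measurable r := by simp only [hr]; fun_prop
  simp_rw [hre]
  have hsk (n : ℕ) : 1 / 2 < (s + k + n).re := by
    simp only [add_re, natCast_re]
    have : (0 : ℝ) ≤ k := by positivity
    have : (0 : ℝ) ≤ n := by positivity
    linarith
  have hcp (n : ℕ) (t : ℝ) : (r t : ℂ) ^ (s + k) * (resCoeff s k n * (r t : ℂ) ^ n) =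
      resCoeff s k n * (r t : ℂ) ^ (s + k + n) := by
    rw [cpow_add _ (n : ℂ) (by exact_mod_cast (hr0 t).ne'), cpow_natCast]; ring
  have hA1 : 0 < 1 + A := by positivity
  have hF (n : ℕ) : Integrable fun t : ℝ ↦ resCoeff s k n * (r t : ℂ) ^ (s + k + n) :=
    ((integral_inv_quadratic_cpow (hsk n) hA hA1).1).const_mul _
  have hF0 : Integrable fun t : ℝ ↦ ‖(r t : ℂ) ^ (s + k)‖ := by
    have := (integral_inv_quadratic_cpow (hsk 0) hA hA1).1.norm
    simp only [Nat.cast_zero, add_zero] at this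
    exact this
  have hbd (n : ℕ) (t : ℝ) : ‖resCoeff s k n * (r t : ℂ) ^ (s + k + n)‖ ≤
      ‖resCoeff s k n * (x : ℂ) ^ n‖ * ‖(r t : ℂ) ^ (s + k)‖ := by
    rw [← hcp, norm_mul, mul_comm, norm_mul, norm_mul, norm_pow, norm_pow, hrn,
      Complex.norm_of_nonneg hx0.le]
    have := (hr0 t).le
    gcongr
    exact hrx t
  have hcs := (polyBdd_resCoeff hs k).norm_summable (x := (x : ℂ))
    (by rwa [Complex.norm_of_nonneg hx0.le])
  have hsum : Summable fun n : ℕ ↦ ∫ t : ℝ, ‖resCoeff s k n * (r t : ℂ) ^ (s + k + n)‖ := by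
    refine Summable.of_nonneg_of_le (fun n ↦ integral_nonneg fun t ↦ norm_nonneg _) (fun n ↦ ?_)
      (hcs.mul_right (∫ t : ℝ, ‖(r t : ℂ) ^ (s + k)‖))
    rw [← integral_const_mul]
    exact integral_mono (hF n).norm (hF0.const_mul _) (hbd n)
  have hres (t : ℝ) : resB s k (r t) = ∑' n : ℕ, resCoeff s k n * (r t : ℂ) ^ (s + k + n) := by
    rw [resB, frob, ← tsum_mul_left]
    exact tsum_congr fun n ↦ hcp n t
  have h1 := hasSum_integral_of_summable_integral_norm hF hsum
  simp_rw [← hres] at h1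
  refine ⟨?_, ?_⟩
  · refine (hF0.const_mul (∑' n, ‖resCoeff s k n * (x : ℂ) ^ n‖)).mono' ?_
      (Filter.Eventually.of_forall fun t ↦ ?_)
    · refine Measurable.aestronglyMeasurable ?_
      simp_rw [hres]
      exact Measurable.tsum fun n ↦ (((Complex.measurable_ofReal.comp hrmeas).pow_const _).const_mul _)
    · rw [hres]
      have hle := hcs.mul_right ‖(r t : ℂ) ^ (s + k)‖
      have hsm := Summable.of_nonneg_of_le (fun n ↦ norm_nonneg _) (fun n ↦ hbd n t) hle
      exact (norm_tsum_le_tsum_norm hsm).trans ((hsm.tsum_le_tsum (fun n ↦ hbd n t) hle).trans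
        (by rw [tsum_mul_right]))
  · rw [← h1.tsum_eq, frob, ← mul_assoc, ← tsum_mul_left]
    refine tsum_congr fun n ↦ ?_
    have hm : ((2 * k - 1 : ℕ) : ℂ) / 2 = k - 1 / 2 := by
      rw [Nat.cast_sub (by omega)]; push_cast; ring
    rw [integral_const_mul, (integral_inv_quadratic_cpow (hsk n) hA hA1).2, ← hx, horoCoeff, hm,
      resCoeff, show s + (k - 1 / 2) + n = s + k + n - 1 / 2 by ring,
      show s + (k - 1 / 2) + 1 / 2 + n = s + k + n by ring,
      show s + k + n - 1 / 2 = s + (k - 1 / 2) + n by ring,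
      cpow_add _ (n : ℂ) (by exact_mod_cast hx0.ne'), cpow_natCast]
    have e1 : Complex.Gamma (s + k + n) ≠ 0 := Gamma_ne_zero (ne_neg_nat (by linarith [hsk n]))
    have e2 : (√Real.pi : ℂ) ≠ 0 := by
      exact_mod_cast (Real.sqrt_pos.2 Real.pi_pos).ne'
    have e3 : (Real.pi : ℂ) = √Real.pi * √Real.pi := by
      rw [← ofReal_mul, Real.mul_self_sqrt Real.pi_pos.le]
    rw [e3]
    field_simp

theorem aeval_polyP {k i : ℕ} (hk : 1 ≤ k) (a : ℂ) :
    Polynomial.aeval a (polyP k (i + 1)) = genP a (2 * k - 1) i := by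
  simp only [polyP, genP, factCoeff, map_mul, map_prod, map_sub, Polynomial.aeval_X,
    Polynomial.aeval_C]
  rw [show i + 1 - 1 = i by omega, show 2 * k + (i + 1) - 2 = 2 * k - 1 + i by omega,
    show 2 * k - 1 + 1 = 2 * k by omega]
  simp

/-- The horocyclic integral of `B_k` in terms of the polynomials `p_j`. -/
theorem integral_resB_eq_sum {s : ℂ} (hs : 1 < s.re) {k : ℕ} (hk : 1 ≤ k) {q : ℝ} (h0 : 0 < q)
    (h1 : q < 1) :
    2 ^ (2 * k - 2) * (((1 - q) ^ 2 / (4 * q) : ℝ) : ℂ) ^ k *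
      ∫ t : ℝ, resB s k ((1 / (1 + (1 - q) ^ 2 / (4 * q) * (1 + t ^ 2)) : ℝ) : ℂ) =
    ∑ j ∈ Finset.Icc 1 (2 * k), Polynomial.aeval (2 * s) (polyP k j) *
      ((q : ℂ) ^ s * ((1 / (1 - q)) ^ j)) := by
  have hq1 : 0 < 1 - q := by linarith
  -- With q = e^{-ℓ} the constant (1-q)²/(4q) is sinh²(ℓ/2).
  rw [(integral_resB hs hk (A := (1 - q) ^ 2 / (4 * q)) (by positivity)).2,
    show 1 / (1 + (1 - q) ^ 2 / (4 * q)) = 4 * q / (1 + q) ^ 2 by field_simp; ring,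
    frob_horoCoeff hs _ h0 h1]
  have hsq : √((1 - q) ^ 2 / (4 * q)) = (1 - q) / (2 * √q) := by
    rw [Real.sqrt_div (by positivity), Real.sqrt_sq hq1.le, Real.sqrt_mul (by norm_num),
      show (4 : ℝ) = 2 ^ 2 by norm_num, Real.sqrt_sq (by norm_num)]
  have hq0 : (q : ℂ) ≠ 0 := by exact_mod_cast h0.ne'
  have hqs : (√q : ℂ) ≠ 0 := by exact_mod_cast (Real.sqrt_pos.2 h0).ne'
  have hqq : (√q : ℂ) ^ 2 = q := by rw [← ofReal_pow, Real.sq_sqrt h0.le]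
  have hq1' : (1 - q : ℂ) ≠ 0 := by exact_mod_cast hq1.ne'
  have hpi : (√Real.pi : ℂ) ≠ 0 := by exact_mod_cast (Real.sqrt_pos.2 Real.pi_pos).ne'
  obtain ⟨m, rfl⟩ : ∃ m, k = m + 1 := ⟨k - 1, by omega⟩
  have hcp : (q : ℂ) ^ (s + ((2 * (m + 1) - 1 : ℕ) : ℂ) / 2) = (q : ℂ) ^ s * (q ^ m * √q) := by
    rw [show ((2 * (m + 1) - 1 : ℕ) : ℂ) / 2 = m + 1 / 2 by
      rw [show 2 * (m + 1) - 1 = 2 * m + 1 by omega]; push_cast; ring,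
      cpow_add _ _ hq0, cpow_add _ _ hq0, cpow_natCast, Real.sqrt_eq_rpow, Complex.ofReal_cpow h0.le]
    norm_num
  -- Every power of 1/(1-q) in `genS` exceeds the wanted one by 2k - 1. The surplus is cancelled by
  -- the power of 1 - q in A^k/√A.
  have hS : genS (2 * s) (2 * (m + 1) - 1) (1 / (1 - q)) * (1 - q) ^ (2 * m + 1) =
      ∑ j ∈ Finset.Icc 1 (2 * (m + 1)), Polynomial.aeval (2 * s) (polyP (m + 1) j) *
        ((1 / (1 - q)) ^ j) := by
    rw [← Finset.Ico_succ_right_eq_Icc, Finset.sum_Ico_eq_sum_range, genS, Finset.sum_mul]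
    refine Finset.sum_congr (by congr 1) fun i _ ↦ ?_
    rw [add_comm 1 i, aeval_polyP hk, show 2 * (m + 1) - 1 = 2 * m + 1 by omega,
      pow_add _ (i + 1), one_div, inv_pow _ (2 * m + 1), mul_assoc, mul_assoc,
      inv_mul_cancel₀ (pow_ne_zero _ hq1'), mul_one]
  have hR : ∑ j ∈ Finset.Icc 1 (2 * (m + 1)), Polynomial.aeval (2 * s) (polyP (m + 1) j) *
      ((q : ℂ) ^ s * ((1 / (1 - q)) ^ j)) =
      (q : ℂ) ^ s * (genS (2 * s) (2 * (m + 1) - 1) (1 / (1 - q)) * (1 - q) ^ (2 * m + 1)) := by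
    rw [hS, Finset.mul_sum]
    exact Finset.sum_congr rfl fun j _ ↦ by ring
  rw [hR, hcp, hsq, show 2 * (m + 1) - 2 = 2 * m by omega]
  generalize genS (2 * s) (2 * (m + 1) - 1) (1 / (1 - q)) = S
  generalize (q : ℂ) ^ s = Q
  push_cast
  generalize (1 - q : ℂ) = d at hq1' ⊢
  rw [div_pow, mul_pow, show (4 : ℂ) = 2 ^ 2 by norm_num, ← pow_mul 2]
  rw [show (2 : ℂ) ^ (2 * (m + 1)) = 2 ^ (2 * m) * 4 by rw [mul_add, pow_add]; norm_num, pow_succ (q : ℂ),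
    ← pow_mul, ← hqq]
  field_simp
  ring

/-! ### Primitives on the upper half-plane -/

/-- The Cayley transform carries the problem to the unit disc, where holomorphic functions have
primitives. -/
theorem exists_primitive {f : ℂ → ℂ} (hf : DifferentiableOn ℂ f {z | 0 < z.im}) :
    ∃ Ω : ℂ → ℂ, ∀ z : ℂ, 0 < z.im → HasDerivAt Ω (f z) z := by
  have hne {w : ℂ} (hw : w ∈ Metric.ball (0 : ℂ) 1) : 1 - w ≠ 0 := fun h ↦ by
    rw [mem_ball_zero_iff, ← sub_eq_zero.1 h, norm_one] at hw
    exact lt_irrefl _ hw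
  have him {w : ℂ} (hw : w ∈ Metric.ball (0 : ℂ) 1) : 0 < (I * (1 + w) / (1 - w)).im := by
    have h1 : 0 < normSq (1 - w) := normSq_pos.2 (hne hw)
    have h2 : normSq w < 1 := by
      rw [mem_ball_zero_iff] at hw
      rw [normSq_eq_norm_sq]; nlinarith [norm_nonneg w]
    have h3 : (I * (1 + w) / (1 - w)).im = (1 - normSq w) / normSq (1 - w) := by
      rw [div_im]
      simp [normSq_apply] at h1 ⊢
      field_simp
      ring
    rw [h3]
    exact div_pos (by linarith) h1
  have hd : DifferentiableOn ℂ (fun w ↦ f (I * (1 + w) / (1 - w)) * (2 * I / (1 - w) ^ 2))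
      (Metric.ball 0 1) := by
    have e1 : DifferentiableOn ℂ (fun w : ℂ ↦ I * (1 + w) / (1 - w)) (Metric.ball 0 1) :=
      DifferentiableOn.div (by fun_prop) (by fun_prop) fun w hw ↦ hne hw
    exact (hf.comp e1 fun w hw ↦ him hw).mul
      (DifferentiableOn.div (by fun_prop) (by fun_prop) fun w hw ↦ pow_ne_zero 2 (hne hw))
  obtain ⟨G, hG⟩ := hd.isExactOn_ball
  refine ⟨fun z ↦ G ((z - I) / (z + I)), fun z hz ↦ ?_⟩
  have hzI : z + I ≠ 0 := fun h ↦ by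
    have := congrArg Complex.im h
    simp at this
    linarith
  have hc : (z - I) / (z + I) ∈ Metric.ball (0 : ℂ) 1 := by
    rw [mem_ball_zero_iff, norm_div, div_lt_one (norm_pos_iff.2 hzI), ← sq_lt_sq₀ (norm_nonneg _)
      (norm_nonneg _), ← normSq_eq_norm_sq, ← normSq_eq_norm_sq]
    simp [normSq_apply]
    nlinarith
  have hcd : HasDerivAt (fun z : ℂ ↦ (z - I) / (z + I)) (2 * I / (z + I) ^ 2) z := by
    refine (((hasDerivAt_id z).sub_const I).div ((hasDerivAt_id z).add_const I) hzI).congr_deriv ?_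
    simp only [id]
    ring
  refine ((hG _ hc).comp z hcd).congr_deriv ?_
  have h1 : 1 - (z - I) / (z + I) = 2 * I / (z + I) := by field_simp; ring
  have h2 : 1 + (z - I) / (z + I) = 2 * z / (z + I) := by field_simp; ring
  have h3 : I * (2 * z / (z + I)) / (2 * I / (z + I)) = z := by
    have := I_ne_zero
    field_simp
  dsimp only
  rw [h1, h2, h3]
  have := I_ne_zero
  field_simp

/-! ### Local integrals in horocyclic coordinates -/

theorem setIntegral_annulus_horo {f : ℍ → ℂ} {N : ℝ} (hN : 1 < N) (hf : IntegrableOn f (annulus N)) :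
    ∫ z in annulus N, f z = ∫ t : ℝ, ∫ u in (-Real.log ‖(t : ℂ) + I‖)..(Real.log N -
      Real.log ‖(t : ℂ) + I‖), f (horo (t, u)) := by
  have hm := measurableSet_annulus N
  have hi := hf.integrable_indicator hm
  rw [← integral_indicator hm,
    ← measurePreserving_horo.integral_comp horoHomeo.measurableEmbedding]
  rw [← measurePreserving_horo.integrable_comp_emb horoHomeo.measurableEmbedding,
    Measure.volume_eq_prod] at hi
  have hi' : Integrable (fun p ↦ (annulus N).indicator f (horoHomeo p))
      ((volume : Measure ℝ).prod volume) := hi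
  rw [Measure.volume_eq_prod, integral_prod _ hi']
  refine integral_congr_ae (Filter.Eventually.of_forall fun t ↦ ?_)
  dsimp only
  set b := Real.log ‖(t : ℂ) + I‖ with hb
  have hℓ := Real.log_pos hN
  have ht0 : ‖(t : ℂ) + I‖ ≠ 0 := by
    rw [norm_ne_zero_iff]
    intro h
    have := congrArg Complex.im h
    simp at this
  have h1 (u : ℝ) : (annulus N).indicator f (horoHomeo (t, u)) =
      (Set.Ico (-b) (Real.log N - b)).indicator (fun u ↦ f (horo (t, u))) u := by
    have h2 : horoHomeo (t, u) ∈ annulus N ↔ u ∈ Set.Ico (-b) (Real.log N - b) := by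
      have h3 : Real.log ‖((horo (t, u) : ℍ) : ℂ)‖ = u + b := by
        rw [coe_horo, norm_mul, Real.log_mul (by simp) ht0, Complex.norm_of_nonneg
          (Real.exp_pos u).le, Real.log_exp]
      rw [mem_annulus_iff hN]
      change Real.log ‖((horo (t, u) : ℍ) : ℂ)‖ ∈ _ ↔ _
      rw [h3, Set.mem_Ico, Set.mem_Ico]
      constructor <;> rintro ⟨h4, h5⟩ <;> constructor <;> linarith
    by_cases hu : u ∈ Set.Ico (-b) (Real.log N - b)
    · rw [Set.indicator_of_mem hu, Set.indicator_of_mem (h2.2 hu)]; rfl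
    · rw [Set.indicator_of_notMem hu, Set.indicator_of_notMem fun h ↦ hu (h2.1 h)]
  simp_rw [h1]
  rw [integral_indicator measurableSet_Ico, integral_Ico_eq_integral_Ioc,
    ← intervalIntegral.integral_of_le (by linarith)]

/-- The rays t = const are equidistant curves of the axis, and a dilation displaces all their points
equally; hence r does not depend on u. -/
theorem kerE_diagL_horo (s : ℂ) (k : ℕ) {L : ℝ} (hL : 1 < L) (hL0 : L ≠ 0) (t u : ℝ) :
    kerE s k (diagL L hL0) (horo (t, u)) (horo (t, u)) =
      (-1 / 16) ^ k * (((L - L⁻¹) ^ (2 * k) : ℝ) : ℂ) *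
        (resB s k ((1 / (1 + (L - L⁻¹) ^ 2 / 4 * (1 + t ^ 2)) : ℝ) : ℂ) *
          (starRingEnd ℂ) ((horo (t, u) : ℂ) ^ (2 * k))) := by
  have hu := Real.exp_pos u
  have h1 : bilin (diagL L hL0) (horo (t, u)) (horo (t, u)) =
      -(((L - L⁻¹ : ℝ) : ℂ)) * (horo (t, u) : ℂ) := by
    simp [bilin]; ring
  have hLi : L⁻¹ < 1 := inv_lt_one_of_one_lt₀ hL
  have h2 : rGam (diagL L hL0) (horo (t, u)) (horo (t, u)) =
      1 / (1 + (L - L⁻¹) ^ 2 / 4 * (1 + t ^ 2)) := by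
    have e1 : bilin (diagL L hL0) ((starRingEnd ℂ) (horo (t, u))) (horo (t, u)) =
        (Real.exp u : ℝ) * (((-(L - L⁻¹) * t : ℝ) : ℂ) + ((-(L + L⁻¹) : ℝ) : ℂ) * I) := by
      rw [coe_horo]
      generalize Real.exp u = E
      simp [bilin]
      ring
    have e2 : ‖bilin (diagL L hL0) ((starRingEnd ℂ) (horo (t, u))) (horo (t, u))‖ ^ 2 =
        Real.exp u ^ 2 * ((L - L⁻¹) ^ 2 * t ^ 2 + (L + L⁻¹) ^ 2) := by
      rw [e1, norm_mul, mul_pow, Complex.norm_of_nonneg hu.le, ← normSq_eq_norm_sq,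
        normSq_add_mul_I]
      ring
    have e3 : ((horo (t, u) : ℍ) : ℂ).im = Real.exp u := rfl
    rw [rGam, e2, e3]
    have e4 : (L + L⁻¹) ^ 2 = (L - L⁻¹) ^ 2 + 4 := by field_simp; ring
    rw [e4]
    have e5 : 0 < (L - L⁻¹) ^ 2 := pow_pos (by linarith) 2
    generalize (L - L⁻¹) ^ 2 = d at *
    field_simp
    ring
  rw [kerE, h1, h2, map_mul, map_neg, Complex.conj_ofReal, mul_pow, Even.neg_pow (even_two_mul k),
    map_pow]
  push_cast
  ring

/-- Along a ray dw = w du, so the u-integral of w^{2k}F is the integral of w^{2k-1}F dw from a point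
to its N-multiple. Its value J is the same on all rays, and the t-integral splits off. -/
theorem integral_annulus_kerE (s : ℂ) {k : ℕ} (hk : 1 ≤ k) {L N : ℝ} (hL : 1 < L) (hL0 : L ≠ 0)
    (hN : 1 < N) {F : ℍ → ℂ} (hF : Continuous F) {Ω : ℂ → ℂ} {J : ℂ}
    (hΩ : ∀ w : ℍ, HasDerivAt Ω ((w : ℂ) ^ (2 * k - 1) * F w) w)
    (hJ : ∀ w : ℍ, Ω (N * w) - Ω w = J)
    (hint : IntegrableOn (fun w : ℍ ↦ (starRingEnd ℂ) (F w) * kerE s k (diagL L hL0) w w)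
      (annulus N)) :
    ∫ w in annulus N, (starRingEnd ℂ) (F w) * kerE s k (diagL L hL0) w w =
      (-1 / 16) ^ k * (((L - L⁻¹) ^ (2 * k) : ℝ) : ℂ) * (starRingEnd ℂ) J *
        ∫ t : ℝ, resB s k ((1 / (1 + (L - L⁻¹) ^ 2 / 4 * (1 + t ^ 2)) : ℝ) : ℂ) := by
  rw [setIntegral_annulus_horo hN hint, ← integral_const_mul]
  refine integral_congr_ae (Filter.Eventually.of_forall fun t ↦ ?_)
  dsimp only
  set b := Real.log ‖(t : ℂ) + I‖
  simp_rw [kerE_diagL_horo s k hL hL0]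
  have hcont : Continuous fun u : ℝ ↦ (horo (t, u) : ℂ) ^ (2 * k) * F (horo (t, u)) := by
    have h1 : Continuous fun u : ℝ ↦ horo (t, u) :=
      horoHomeo.continuous.comp (continuous_const.prodMk continuous_id)
    exact ((UpperHalfPlane.continuous_coe.comp h1).pow _).mul (hF.comp h1)
  have hder (u : ℝ) : HasDerivAt (fun u : ℝ ↦ Ω (horo (t, u)))
      ((horo (t, u) : ℂ) ^ (2 * k) * F (horo (t, u))) u := by
    have h1 : HasDerivAt (fun u : ℝ ↦ ((horo (t, u) : ℍ) : ℂ)) (horo (t, u) : ℂ) u := by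
      simp_rw [coe_horo]
      exact ((Real.hasDerivAt_exp u).ofReal_comp).mul_const _
    refine ((hΩ (horo (t, u))).comp u h1).congr_deriv ?_
    obtain ⟨m, hm⟩ : ∃ m, 2 * k = m + 1 := ⟨2 * k - 1, by omega⟩
    rw [hm, Nat.add_sub_cancel, pow_succ]
    ring
  have hval : ∫ u in (-b)..(Real.log N - b), (horo (t, u) : ℂ) ^ (2 * k) * F (horo (t, u)) = J := by
    rw [intervalIntegral.integral_eq_sub_of_hasDerivAt (fun u _ ↦ hder u)
      (hcont.intervalIntegrable _ _), ← hJ (horo (t, -b))]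
    congr 2
    rw [coe_horo, coe_horo, sub_eq_add_neg, Real.exp_add, Real.exp_log (by linarith)]
    push_cast; ring
  have hconj : ∫ u in (-b)..(Real.log N - b),
      (starRingEnd ℂ) ((horo (t, u) : ℂ) ^ (2 * k) * F (horo (t, u))) = (starRingEnd ℂ) J := by
    rw [← hval, intervalIntegral.integral_of_le (by linarith [Real.log_pos hN]),
      intervalIntegral.integral_of_le (by linarith [Real.log_pos hN]), integral_conj]
  rw [← hconj, mul_right_comm, mul_comm _ (∫ _ in _.._, _), ← intervalIntegral.integral_mul_const]
  refine intervalIntegral.integral_congr fun u _ ↦ ?_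
  simp only [map_mul]
  ring

/-! ### Periods -/

/-- With W = τz one has Q_γ(z) = -(L - L⁻¹) W j(τ,z)², g(z) = j(τ,z)^{-4k} g_τ(W) and dW =
j(τ,z)^{-2} dz. The automorphy factors cancel, and Ω(τz) times a constant is a primitive of the
integrand. -/
theorem period_eq {k : ℕ} {g : ℍ → ℂ}
    (hg : DifferentiableOn ℂ (g ∘ UpperHalfPlane.ofComplex) {z | 0 < z.im})
    {γ τ : SL(2, ℝ)} {L : ℝ} (hL0 : L ≠ 0) (hτ : τ * γ * τ⁻¹ = diagL L hL0) {Ω : ℂ → ℂ}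
    {J : ℂ} (hΩ : ∀ w : ℍ, HasDerivAt Ω ((w : ℂ) ^ (2 * k - 1) * twist k g τ w) w)
    (hJ : ∀ w : ℍ, Ω ((L ^ 2 : ℝ) * w) - Ω w = J) (hk : 1 ≤ k) (z₀ : ℍ) :
    period k g z₀ γ = (-((L - L⁻¹ : ℝ) : ℂ)) ^ (2 * k - 1) * J := by
  set v : ℂ := ((γ • z₀ : ℍ) : ℂ) - z₀ with hv
  set ζ : ℝ → ℂ := fun t ↦ (z₀ : ℂ) + t * v with hζ
  have hpos (t : ℝ) (ht : t ∈ Set.uIcc (0 : ℝ) 1) : 0 < (ζ t).im := by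
    rw [Set.uIcc_of_le zero_le_one] at ht
    have h1 : (ζ t).im = (1 - t) * z₀.im + t * (γ • z₀).im := by
      simp [hζ, hv]; ring
    have h2 := z₀.im_pos
    have h3 := (γ • z₀).im_pos
    rw [h1]
    rcases ht.1.eq_or_lt with rfl | h4
    · linarith
    · nlinarith [mul_pos h4 h3, mul_nonneg (sub_nonneg.2 ht.2) h2.le]
  set mob : ℂ → ℂ := fun z ↦ ((τ 0 0 : ℂ) * z + (τ 0 1 : ℂ)) / autj τ z with hmob
  have hmobw (w : ℍ) : mob w = (τ • w : ℍ) := (coe_smul_eq τ w).symm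
  have hmobd (w : ℍ) : HasDerivAt mob (1 / autj τ w ^ 2) (w : ℂ) := by
    have e1 : HasDerivAt (fun z : ℂ ↦ (τ 0 0 : ℂ) * z + (τ 0 1 : ℂ)) (τ 0 0 : ℂ) (w : ℂ) := by
      simpa using ((hasDerivAt_id (w : ℂ)).const_mul (τ 0 0 : ℂ)).add_const (τ 0 1 : ℂ)
    have e2 : HasDerivAt (autj τ) (τ 1 0 : ℂ) (w : ℂ) := by
      have := ((hasDerivAt_id (w : ℂ)).const_mul (τ 1 0 : ℂ)).add_const (τ 1 1 : ℂ)
      rw [mul_one] at this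
      exact this
    refine (e1.div e2 (autj_ne_zero τ w)).congr_deriv ?_
    have hdet : (τ 0 0 : ℂ) * τ 1 1 - τ 0 1 * τ 1 0 = 1 := by exact_mod_cast det_entries τ
    congr 1
    rw [autj]
    linear_combination hdet
  set c : ℂ := (-((L - L⁻¹ : ℝ) : ℂ)) ^ (2 * k - 1) with hc
  have hder (t : ℝ) (ht : t ∈ Set.uIcc (0 : ℝ) 1) : HasDerivAt (fun t : ℝ ↦ c * Ω (mob (ζ t)))
      (quadQ γ (ζ t) ^ (2 * k - 1) * g (UpperHalfPlane.ofComplex (ζ t)) * v) t := by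
    have him := hpos t ht
    set w : ℍ := ⟨ζ t, him⟩ with hw
    have hwζ : (w : ℂ) = ζ t := rfl
    have hζd : HasDerivAt ζ v t := by
      exact ((((hasDerivAt_id t).ofReal_comp).mul_const v).const_add (z₀ : ℂ)).congr_deriv (by simp)
    have h1 : HasDerivAt (fun t : ℝ ↦ mob (ζ t)) (1 / autj τ w ^ 2 * v) t :=
      HasDerivAt.comp t (h₂ := mob) (hmobd w) hζd
    have h2 := hΩ (τ • w)
    rw [← hmobw w] at h2
    have h3 := (HasDerivAt.comp t (h₂ := Ω) h2 h1).const_mul c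
    refine h3.congr_deriv ?_
    rw [UpperHalfPlane.ofComplex_apply_of_im_pos him]
    have h11 : quadQ γ (ζ t) = bilin γ w w := quadQ_eq_bilin γ w
    have hj := autj_ne_zero τ w
    have h4 := bilin_conj τ γ w w
    rw [hτ, eq_div_iff (mul_ne_zero hj hj)] at h4
    have h5 := autj_pow_mul_twist k g τ (τ • w)
    rw [inv_smul_smul] at h5
    have h6 := autj_mul τ⁻¹ τ w
    rw [inv_mul_cancel] at h6
    have h7 : autj (1 : SL(2, ℝ)) w = 1 := by simp [autj]
    rw [h7] at h6
    have h8 : bilin (diagL L hL0) (τ • w : ℍ) (τ • w : ℍ) =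
        -(((L - L⁻¹ : ℝ) : ℂ)) * (τ • w : ℍ) := by
      simp [bilin]; ring
    have h9 : autj τ⁻¹ ((τ • w : ℍ) : ℂ) = (autj τ w)⁻¹ := eq_inv_of_mul_eq_one_left h6.symm
    have h10 : g ⟨ζ t, him⟩ = g w := rfl
    rw [h9] at h5
    rw [h10, h11, ← h4, h8, ← h5, hmobw]
    obtain ⟨m, hm⟩ : ∃ m, k = m + 1 := ⟨k - 1, by omega⟩
    subst hm
    rw [hc, show 2 * (m + 1) - 1 = 2 * m + 1 by omega, show 4 * (m + 1) = 2 * (2 * m + 1) + 2 by ring]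
    generalize autj τ w = j at *
    generalize ((L - L⁻¹ : ℝ) : ℂ) = d
    generalize twist (m + 1) g τ (τ • w) = T
    generalize ((τ • w : ℍ) : ℂ) = W
    rw [mul_pow, mul_pow, pow_add j⁻¹, pow_mul j⁻¹, ← sq, inv_pow, inv_pow]
    field_simp
  have hint : IntervalIntegrable
      (fun t ↦ quadQ γ (ζ t) ^ (2 * k - 1) * g (UpperHalfPlane.ofComplex (ζ t)) * v) volume 0 1 := by
    refine ContinuousOn.intervalIntegrable ?_
    have hζc : Continuous ζ := by simp only [hζ]; fun_prop
    have hq : Continuous fun z : ℂ ↦ quadQ γ z := by unfold quadQ; fun_prop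
    exact (((hq.comp hζc).pow _).continuousOn.mul
      (hg.continuousOn.comp hζc.continuousOn fun t ht ↦ hpos t ht)).mul continuousOn_const
  rw [period, intervalIntegral.integral_eq_sub_of_hasDerivAt hder hint, ← mul_sub]
  have e0 : mob (ζ 0) = (τ • z₀ : ℍ) := by rw [← hmobw]; simp [hζ]
  have e1 : mob (ζ 1) = (L ^ 2 : ℝ) * (τ • z₀ : ℍ) := by
    have h1 : ζ 1 = (γ • z₀ : ℍ) := by simp [hζ, hv]
    have h2 : τ • γ • z₀ = (τ * γ * τ⁻¹) • τ • z₀ := by simp [mul_smul]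
    rw [h1, hmobw, h2, hτ, diagL_smul]
    push_cast; rfl
  rw [e0, e1, hJ]

/-! ### The local integral in terms of a period -/

theorem IsHyp.sinh_half_len {γ : SL(2, ℝ)} (h : IsHyp γ) :
    2 * Real.sinh (len γ / 2) = √(normN γ) - (√(normN γ))⁻¹ := by
  have h1 := zero_lt_one.trans h.one_lt_normN
  rw [len, ← Real.log_sqrt h1.le, Real.sinh_log (Real.sqrt_pos.2 h1)]
  ring

/-- Automorphy under P₀ reads F(Nw) = N^{-2k}F(w) for the twisted form, so w^{2k-1}F dw is invariant
under w ↦ Nw and Ω(Nw) - Ω(w) has derivative 0. -/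
theorem IsCuspidal.exists_period_primitive {Γ : Subgroup SL(2, ℝ)} {k : ℕ} {g : ℍ → ℂ}
    (hg : IsCuspidal Γ k g) (hk : 1 ≤ k) {γ τ : SL(2, ℝ)} (hγ : γ ∈ Γ) (h : IsHyp γ)
    (hτ : τ * posRep γ * τ⁻¹ = diagL (√(normN γ)) (zero_lt_one.trans h.one_lt_sqrt).ne') :
    ∃ (Ω : ℂ → ℂ) (J : ℂ), (∀ w : ℍ, HasDerivAt Ω ((w : ℂ) ^ (2 * k - 1) * twist k g τ w) w) ∧
      ∀ w : ℍ, Ω (normN γ * w) - Ω w = J := by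
  have hN := zero_lt_one.trans h.one_lt_normN
  have hf : DifferentiableOn ℂ
      (fun z ↦ z ^ (2 * k - 1) * (twist k g τ ∘ UpperHalfPlane.ofComplex) z) {z | 0 < z.im} :=
    (differentiableOn_id.pow _).mul (hg.twist_holo τ)
  obtain ⟨Ω, hΩ⟩ := exists_primitive hf
  have hΩ' (w : ℍ) : HasDerivAt Ω ((w : ℂ) ^ (2 * k - 1) * twist k g τ w) w := by
    have := hΩ w w.im_pos
    rwa [Function.comp_apply, UpperHalfPlane.ofComplex_apply] at this
  have hder (z : ℂ) (hz : 0 < z.im) : HasDerivAt (fun z ↦ Ω (normN γ * z) - Ω z) 0 z := by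
    set w : ℍ := ⟨z, hz⟩ with hw
    have h1 := hg.twist_smul_posRep hγ τ w
    rw [hτ] at h1
    have h2 : autj (diagL (√(normN γ)) (zero_lt_one.trans h.one_lt_sqrt).ne') w ^ (4 * k) =
        ((normN γ : ℂ) ^ (2 * k))⁻¹ := by
      have e : (√(normN γ) : ℂ) ^ 2 = normN γ := by rw [← ofReal_pow, Real.sq_sqrt hN.le]
      simp only [autj, diagL_10, diagL_11]
      rw [← e, ← pow_mul, show 2 * (2 * k) = 4 * k by ring]
      simp
    have h3 : ((diagL (√(normN γ)) (zero_lt_one.trans h.one_lt_sqrt).ne' • w : ℍ) : ℂ) =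
        normN γ * z := by
      rw [diagL_smul, ← ofReal_pow, Real.sq_sqrt hN.le]
    have h4 := hΩ' (diagL (√(normN γ)) (zero_lt_one.trans h.one_lt_sqrt).ne' • w)
    rw [h3, h1, h2] at h4
    have h5 : HasDerivAt (fun z : ℂ ↦ (normN γ : ℂ) * z) (normN γ : ℂ) z := by
      simpa using (hasDerivAt_id z).const_mul (normN γ : ℂ)
    refine ((HasDerivAt.comp z (h₂ := Ω) h4 h5).sub (hΩ' w)).congr_deriv ?_
    have hN0 : (normN γ : ℂ) ≠ 0 := by exact_mod_cast hN.ne'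
    have hwz : (w : ℂ) = z := rfl
    obtain ⟨m, hm⟩ : ∃ m, 2 * k = m + 1 := ⟨2 * k - 1, by omega⟩
    rw [hwz, hm, Nat.add_sub_cancel, mul_pow]
    field_simp
    ring
  refine ⟨Ω, Ω (normN γ * UpperHalfPlane.I) - Ω UpperHalfPlane.I, hΩ', fun w ↦ ?_⟩
  exact UpperHalfPlane.isOpen_upperHalfPlaneSet.is_const_of_deriv_eq_zero
    (f := fun z ↦ Ω (normN γ * z) - Ω z) (convex_halfSpace_im_gt 0).isPreconnected
    (fun z hz ↦ (hder z hz).differentiableAt.differentiableWithinAt)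
    (fun z hz ↦ (hder z hz).deriv) w.im_pos UpperHalfPlane.I.im_pos

/-- The period comes from the annulus of P₀ and the t-integral from the kernel of P; this is why
`beta` is taken at P₀ but q at P. The sign (-1)^{k+1} is cancelled by (-1)^k from the kernel and by
the odd power of -(L - L⁻¹) in the period. -/
theorem LocalData.localI_eq {Γ : Subgroup SL(2, ℝ)} {k : ℕ} {g : ℍ → ℂ} {s : ℂ} {c : HypClass Γ}
    (D : LocalData Γ c) (hg : IsCuspidal Γ k g) (hk : 1 ≤ k) (hs : 1 < s.re)
    (hint : IntegrableOn (localDensity k s g (normN D.P) D.τ) (annulus (normN D.P₀))) (z₀ : ℍ) :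
    (-1) ^ (k + 1) * localI k s g D = beta k g z₀ D.P₀ *
      ∑ j ∈ Finset.Icc 1 (2 * k), Polynomial.aeval (2 * s) (polyP k j) *
        ((((normN D.P)⁻¹ : ℝ) : ℂ) ^ s * ((1 / (1 - (((normN D.P)⁻¹ : ℝ) : ℂ))) ^ j)) := by
  have hN := D.isHyp.one_lt_normN
  have hN₀ := D.prim.1.one_lt_normN
  have hL := D.isHyp.one_lt_sqrt
  have hL₀ := D.prim.1.one_lt_sqrt
  have hτ := (diag_iff D.prim.1).1 D.diag
  obtain ⟨Ω, J, hΩ, hJ⟩ := hg.exists_period_primitive hk D.P₀.2 D.prim.1 hτ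
  set F := twist k g D.τ with hF
  have hFc : Continuous F := continuous_of_differentiableOn (hg.twist_holo D.τ)
  have hd (w : ℍ) := diagTerm_eq_localDensity D.isHyp D.conj_eq hs k g w
  have hL0 : √(normN D.P) ≠ 0 := (zero_lt_one.trans hL).ne'
  have hd' (w : ℍ) : diagTerm k s g D.P (D.τ⁻¹ • w) =
      (starRingEnd ℂ) (F w) * kerE s k (diagL (√(normN D.P)) hL0) w w := by
    have h1 : kerE s k (D.τ * D.P * D.τ⁻¹) w w = kerE s k (D.τ * posRep D.P * D.τ⁻¹) w w := by
      rcases posRep_eq_or (D.P : SL(2, ℝ)) with h' | h' <;> rw [h']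
      rw [neg_conj, kerE_neg]
    rw [diagTerm_inv_smul, h1, D.conj_eq]
  simp_rw [hd'] at hd
  have hint' : IntegrableOn (fun w : ℍ ↦ (starRingEnd ℂ) (F w) *
      kerE s k (diagL (√(normN D.P)) hL0) w w) (annulus (normN D.P₀)) := by
    simp_rw [hd]
    exact hint.const_mul _
  have hI := integral_annulus_kerE s hk hL hL0 hN₀ hFc hΩ hJ hint'
  have hloc : localI k s g D = ∫ w in annulus (normN D.P₀), (starRingEnd ℂ) (F w) *
      kerE s k (diagL (√(normN D.P)) hL0) w w := by
    rw [localI, ← integral_const_mul]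
    simp_rw [hd]
  have hN0 : 0 < normN D.P := by linarith
  have hq0 : 0 < (normN D.P)⁻¹ := inv_pos.2 hN0
  have hq1 : (normN D.P)⁻¹ < 1 := inv_lt_one_of_one_lt₀ hN
  have hA : (√(normN D.P) - (√(normN D.P))⁻¹) ^ 2 / 4 =
      (1 - (normN D.P)⁻¹) ^ 2 / (4 * (normN D.P)⁻¹) := by
    have e : normN D.P = √(normN D.P) ^ 2 := (Real.sq_sqrt hN0.le).symm
    generalize √(normN D.P) = L at *
    rw [e]
    field_simp
  have hper := period_eq hg.holo (zero_lt_one.trans hL₀).ne' hτ hΩ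
    (fun w ↦ by rw [Real.sq_sqrt (by linarith)]; exact hJ w) hk z₀
  rw [hloc, hI, ← integral_resB_eq_sum hs hk hq0 hq1, hA, pow_mul,
    show (√(normN D.P) - (√(normN D.P))⁻¹) ^ 2 =
      4 * ((1 - (normN D.P)⁻¹) ^ 2 / (4 * (normN D.P)⁻¹)) by rw [← hA]; ring,
    beta, hper, ← D.prim.1.sinh_half_len]
  have hsh : (Real.sinh (len D.P₀ / 2) : ℂ) ≠ 0 := by
    have h1 := D.prim.1.sinh_half_len
    have h2 : (√(normN D.P₀))⁻¹ < 1 := inv_lt_one_of_one_lt₀ hL₀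
    exact_mod_cast (by linarith : 0 < Real.sinh (len D.P₀ / 2)).ne'
  generalize ((1 - (normN D.P)⁻¹) ^ 2 / (4 * (normN D.P)⁻¹)) = A
  generalize (∫ t : ℝ, resB s k ((1 / (1 + A * (1 + t ^ 2)) : ℝ) : ℂ)) = B
  obtain ⟨m, hm⟩ : ∃ m, k = m + 1 := ⟨k - 1, by omega⟩
  rw [map_mul, map_pow, map_neg, Complex.conj_ofReal]
  generalize (starRingEnd ℂ) J = J'
  generalize Real.sinh (len D.P₀ / 2) = S at *
  subst hm
  rw [show 2 * (m + 1) - 1 = 2 * m + 1 by omega, show 6 * (m + 1) - 3 = 6 * m + 3 by omega,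
    show 2 * (m + 1) - 2 = 2 * m by omega]
  push_cast
  rw [mul_pow, neg_mul_eq_neg_mul, mul_pow (-2 : ℂ), div_pow, show (16 : ℂ) = 2 ^ 4 by norm_num,
    show (4 : ℂ) = 2 ^ 2 by norm_num, ← pow_mul, ← pow_mul]
  have e1 : (-2 : ℂ) ^ (2 * m + 1) = -(2 ^ (2 * m + 1)) := Odd.neg_pow ⟨m, rfl⟩ 2
  have e2 : (-1 : ℂ) ^ (m + 1 + 1) * (-1) ^ (m + 1) = -1 := by
    rw [← pow_add, show m + 1 + 1 + (m + 1) = 2 * (m + 1) + 1 by ring, pow_succ, pow_mul]; simp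
  rw [e1]
  have e3 : (2 : ℂ) ^ (4 * (m + 1)) = 2 ^ (4 * m) * 16 := by rw [mul_add, pow_add]; norm_num
  have e4 : (2 : ℂ) ^ (2 * (m + 1)) = 2 ^ (2 * m) * 4 := by rw [mul_add, pow_add]; norm_num
  have e5 : (2 : ℂ) ^ (6 * m + 3) = 2 ^ (4 * m) * 2 ^ (2 * m) * 8 := by
    rw [← pow_add, pow_add _ (6 * m), show 4 * m + 2 * m = 6 * m by ring]; norm_num
  have e6 : (2 : ℂ) ^ (2 * m + 1) = 2 ^ (2 * m) * 2 := pow_succ 2 (2 * m)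
  rw [e3, e4, e5, e6]
  rw [pow_succ (-1 : ℂ) (m + 1)] at e2 ⊢
  generalize (-1 : ℂ) ^ (m + 1) = ε at *
  have e7 : (2 : ℂ) ^ (2 * m) ≠ 0 := pow_ne_zero _ two_ne_zero
  have e8 : (2 : ℂ) ^ (4 * m) ≠ 0 := pow_ne_zero _ two_ne_zero
  generalize (2 : ℂ) ^ (2 * m) = a at *
  generalize (2 : ℂ) ^ (4 * m) = b at *
  field_simp
  linear_combination (32 * J' * B * A ^ (m + 1)) * e2

/-! ### The logarithmic derivative of the local zeta functions -/

theorem hasSum_of_forall_eq {f g : ℕ → ℂ} {a : ℂ} (h : HasSum g a) (e : ∀ n, f n = g n) :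
    HasSum f a := by
  rwa [funext e]

theorem summable_choose_mul_pow {j : ℕ} (hj : 1 ≤ j) {r : ℝ} (h0 : 0 ≤ r) (h1 : r < 1) :
    Summable fun m : ℕ ↦ ((j + m - 1).choose m : ℝ) * r ^ m := by
  have h := summable_choose_mul_geometric_of_norm_lt_one (R := ℝ) (j - 1) (r := r)
    (by rwa [Real.norm_of_nonneg h0])
  refine h.congr fun m ↦ ?_
  rw [show m + (j - 1) = j + m - 1 by omega, ← Nat.choose_symm_of_eq_add (show j + m - 1 = m + (j - 1) by omega)]

theorem hasSum_choose_mul_pow {j : ℕ} (hj : 1 ≤ j) {r : ℂ} (h1 : ‖r‖ < 1) :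
    HasSum (fun m : ℕ ↦ ((j + m - 1).choose m : ℂ) * r ^ m) ((1 / (1 - r)) ^ j) := by
  have h := hasSum_choose_mul_geometric_of_norm_lt_one (j - 1) h1
  rw [Nat.sub_add_cancel hj, ← one_div_pow] at h
  refine hasSum_of_forall_eq h fun m ↦ ?_
  rw [show m + (j - 1) = j + m - 1 by omega, ← Nat.choose_symm_of_eq_add (show j + m - 1 = m + (j - 1) by omega)]

theorem norm_one_sub_pow_sub_one_le {x : ℂ} {n : ℕ} (h : n * ‖x‖ ≤ 1) :
    ‖(1 - x) ^ n - 1‖ ≤ 2 * (n * ‖x‖) := by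
  have h1 := (Finset.range n).norm_prod_one_add_sub_one_le (fun _ ↦ -x)
  simp only [Finset.prod_const, Finset.sum_const, Finset.card_range, norm_neg, nsmul_eq_mul,
    ← sub_eq_add_neg] at h1
  refine h1.trans ?_
  have h2 := Real.abs_exp_sub_one_le (x := n * ‖x‖) (by rwa [abs_of_nonneg (by positivity)])
  rw [abs_of_nonneg (by positivity : 0 ≤ n * ‖x‖)] at h2
  exact (le_abs_self _).trans h2

theorem summable_prod_choose_mul_pow {j : ℕ} (hj : 1 ≤ j) {r : ℝ} (h0 : 0 ≤ r) (h1 : r < 1) {a : ℂ}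
    (ha : ‖a‖ < 1) : Summable fun p : ℕ × ℕ ↦
      ((j + p.1 - 1).choose p.1 : ℂ) * (a ^ (p.2 + 1) * ((r : ℂ) ^ (p.2 + 1)) ^ p.1) := by
  have hC := summable_choose_mul_pow hj h0 h1
  have hA : Summable fun n : ℕ ↦ ‖a‖ ^ (n + 1) :=
    (summable_nat_add_iff 1).2 (summable_geometric_of_lt_one (norm_nonneg _) ha)
  have h2 := hC.mul_of_nonneg hA (fun m ↦ mul_nonneg (Nat.cast_nonneg _) (pow_nonneg h0 _))
    (fun n ↦ pow_nonneg (norm_nonneg _) _)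
  refine h2.of_norm_bounded fun p ↦ ?_
  rw [norm_mul, norm_mul, norm_pow, norm_pow, norm_pow, Complex.norm_natCast,
    Complex.norm_of_nonneg h0]
  have h3 : (r ^ (p.2 + 1)) ^ p.1 ≤ r ^ p.1 :=
    pow_le_pow_left₀ (pow_nonneg h0 _) (pow_le_of_le_one h0 h1.le (by omega)) _
  calc ((j + p.1 - 1).choose p.1 : ℝ) * (‖a‖ ^ (p.2 + 1) * (r ^ (p.2 + 1)) ^ p.1) ≤
      ((j + p.1 - 1).choose p.1 : ℝ) * (‖a‖ ^ (p.2 + 1) * r ^ p.1) := by gcongr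
    _ = _ := by ring

/-- Expand into a double series. Summing first over n gives the quotients a r^m/(1 - a r^m), summing
first over m gives the powers (1 - r^{n+1})^{-j}; absolute convergence allows the exchange. -/
theorem tsum_lambert_choose {j : ℕ} (hj : 1 ≤ j) {r : ℝ} (h0 : 0 ≤ r) (h1 : r < 1) {a : ℂ}
    (ha : ‖a‖ < 1) :
    (Summable fun n : ℕ ↦ a ^ (n + 1) * (1 / (1 - (r : ℂ) ^ (n + 1))) ^ j) ∧
    (Summable fun m : ℕ ↦ ((j + m - 1).choose m : ℂ) * (a * (r : ℂ) ^ m / (1 - a * (r : ℂ) ^ m))) ∧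
    ∑' m : ℕ, ((j + m - 1).choose m : ℂ) * (a * (r : ℂ) ^ m / (1 - a * (r : ℂ) ^ m)) =
      ∑' n : ℕ, a ^ (n + 1) * (1 / (1 - (r : ℂ) ^ (n + 1))) ^ j := by
  have hG := summable_prod_choose_mul_pow hj h0 h1 ha
  have hrow (m : ℕ) : HasSum (fun n : ℕ ↦
      ((j + m - 1).choose m : ℂ) * (a ^ (n + 1) * ((r : ℂ) ^ (n + 1)) ^ m))
      (((j + m - 1).choose m : ℂ) * (a * (r : ℂ) ^ m / (1 - a * (r : ℂ) ^ m))) := by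
    have hx : ‖a * (r : ℂ) ^ m‖ < 1 := by
      rw [norm_mul, norm_pow, Complex.norm_of_nonneg h0]
      exact (mul_le_of_le_one_right (norm_nonneg _) (pow_le_one₀ h0 h1.le)).trans_lt ha
    have h2 := ((hasSum_geometric_of_norm_lt_one hx).mul_left (a * (r : ℂ) ^ m)).mul_left
      ((j + m - 1).choose m : ℂ)
    rw [← div_eq_mul_inv] at h2
    refine hasSum_of_forall_eq h2 fun n ↦ ?_
    rw [← pow_succ', mul_pow, ← pow_mul, ← pow_mul, mul_comm m]
  have hcol (n : ℕ) : HasSum (fun m : ℕ ↦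
      ((j + m - 1).choose m : ℂ) * (a ^ (n + 1) * ((r : ℂ) ^ (n + 1)) ^ m))
      (a ^ (n + 1) * (1 / (1 - (r : ℂ) ^ (n + 1))) ^ j) := by
    have hx : ‖(r : ℂ) ^ (n + 1)‖ < 1 := by
      rw [norm_pow, Complex.norm_of_nonneg h0]
      exact pow_lt_one₀ h0 h1 (by omega)
    refine hasSum_of_forall_eq ((hasSum_choose_mul_pow hj hx).mul_left (a ^ (n + 1))) fun m ↦ ?_
    ring
  have e1 := funext fun m ↦ (hrow m).tsum_eq
  have e2 := funext fun n ↦ (hcol n).tsum_eq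
  have s1 := hG.prod
  have s2 := hG.prod_symm.prod
  have hsw := (hG.tsum_prod' fun m ↦ (hrow m).summable).symm.trans
    (((Equiv.prodComm ℕ ℕ).tsum_eq _).symm.trans
      (hG.prod_symm.tsum_prod' fun n ↦ (hcol n).summable))
  simp only [Prod.swap_prod_mk] at s2 hsw
  dsimp only at s1 hsw e1 e2
  rw [e1] at s1
  rw [e2] at s2
  refine ⟨s2, s1, ?_⟩
  rw [← e1, ← e2]
  exact hsw

theorem hasDerivAt_one_sub_cpow {N : ℝ} (hN : 0 < N) (m : ℕ) (z : ℂ) :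
    HasDerivAt (fun z : ℂ ↦ 1 - (N : ℂ) ^ (-(z + m))) (Real.log N * (N : ℂ) ^ (-(z + m))) z := by
  have h1 : HasDerivAt (fun z : ℂ ↦ -(z + m)) (-1) z := ((hasDerivAt_id z).add_const (m : ℂ)).neg
  refine ((h1.const_cpow (c := (N : ℂ)) (Or.inl (by exact_mod_cast hN.ne'))).const_sub
    1).congr_deriv ?_
  rw [← Complex.ofReal_log hN.le]
  ring

theorem cpow_neg_add_natCast {N : ℝ} (hN : 0 < N) (m : ℕ) (z : ℂ) :
    (N : ℂ) ^ (-(z + m)) = (N : ℂ) ^ (-z) * ((N⁻¹ : ℝ) : ℂ) ^ m := by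
  rw [neg_add, cpow_add _ _ (by exact_mod_cast hN.ne'), cpow_neg _ (m : ℂ), cpow_natCast,
    ofReal_inv, inv_pow]

theorem norm_cpow_neg_lt_inv {N : ℝ} (hN : 1 < N) {z : ℂ} (hz : 1 < z.re) :
    ‖(N : ℂ) ^ (-z)‖ < N⁻¹ := by
  rw [norm_cpow_eq_rpow_re_of_pos (by linarith), ← Real.rpow_neg_one, neg_re]
  exact Real.rpow_lt_rpow_of_exponent_lt hN (by linarith)

theorem norm_cpow_neg_add_natCast_le {N : ℝ} (hN : 1 < N) (m : ℕ) {z : ℂ} (hz : 1 < z.re) :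
    ‖(N : ℂ) ^ (-(z + m))‖ ≤ N⁻¹ * N⁻¹ ^ m := by
  have h0 : (0 : ℝ) ≤ N⁻¹ := inv_nonneg.2 (by linarith)
  rw [cpow_neg_add_natCast (by linarith), norm_mul, norm_pow, Complex.norm_of_nonneg h0]
  exact mul_le_mul_of_nonneg_right (norm_cpow_neg_lt_inv hN hz).le (pow_nonneg h0 _)

theorem norm_cpow_neg_add_natCast_lt_one {N : ℝ} (hN : 1 < N) (m : ℕ) {z : ℂ} (hz : 1 < z.re) :
    ‖(N : ℂ) ^ (-(z + m))‖ < 1 := by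
  refine (norm_cpow_neg_add_natCast_le hN m hz).trans_lt ?_
  rw [← pow_succ']
  exact pow_lt_one₀ (inv_nonneg.2 (by linarith)) (inv_lt_one_of_one_lt₀ hN) (by omega)

theorem one_sub_cpow_ne_zero {N : ℝ} (hN : 1 < N) (m : ℕ) {z : ℂ} (hz : 1 < z.re) :
    1 - (N : ℂ) ^ (-(z + m)) ≠ 0 := fun h0 ↦ by
  have h1 := norm_cpow_neg_add_natCast_lt_one hN m hz
  rw [← sub_eq_zero.1 h0, norm_one] at h1
  exact lt_irrefl _ h1

theorem eventually_norm_euler_factor_sub_one_le {N : ℝ} (hN : 1 < N) {j : ℕ} (hj : 1 ≤ j) :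
    ∀ᶠ m : ℕ in Filter.atTop, ∀ z ∈ {z : ℂ | 1 < z.re},
      ‖(1 - (N : ℂ) ^ (-(z + m))) ^ ((j + m - 1).choose m) - 1‖ ≤
        2 * (((j + m - 1).choose m : ℝ) * N⁻¹ ^ m) := by
  have h0 : (0 : ℝ) ≤ N⁻¹ := inv_nonneg.2 (by linarith)
  have h1 : N⁻¹ < 1 := inv_lt_one_of_one_lt₀ hN
  filter_upwards [(summable_choose_mul_pow hj h0 h1).tendsto_atTop_zero.eventually
    (gt_mem_nhds one_pos)] with m hm z hz
  have h2 : ((j + m - 1).choose m : ℝ) * ‖(N : ℂ) ^ (-(z + m))‖ ≤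
      ((j + m - 1).choose m : ℝ) * N⁻¹ ^ m := by
    refine mul_le_mul_of_nonneg_left ((norm_cpow_neg_add_natCast_le hN m hz).trans ?_)
      (Nat.cast_nonneg _)
    exact mul_le_of_le_one_left (pow_nonneg h0 _) h1.le
  exact (norm_one_sub_pow_sub_one_le (h2.trans hm.le)).trans
    (mul_le_mul_of_nonneg_left h2 two_pos.le)

/-- The product converges locally uniformly and without zeros on Re z > 1, because the exponents
grow polynomially against N^{-m}; so it may be differentiated logarithmically factor by factor. -/
theorem logDeriv_euler_product {N : ℝ} (hN : 1 < N) {j : ℕ} (hj : 1 ≤ j) {s : ℂ} (hs : 1 < s.re) :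
    logDeriv (fun z : ℂ ↦ ∏' m : ℕ, (1 - (N : ℂ) ^ (-(z + m))) ^ ((j + m - 1).choose m)) s =
      Real.log N * ∑' m : ℕ, ((j + m - 1).choose m : ℂ) *
        ((N : ℂ) ^ (-s) * ((N⁻¹ : ℝ) : ℂ) ^ m / (1 - (N : ℂ) ^ (-s) * ((N⁻¹ : ℝ) : ℂ) ^ m)) := by
  have hN0 : 0 < N := by linarith
  have h0 : (0 : ℝ) ≤ N⁻¹ := inv_nonneg.2 hN0.le
  have h1 : N⁻¹ < 1 := inv_lt_one_of_one_lt₀ hN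
  have hKo : IsOpen {z : ℂ | 1 < z.re} := isOpen_lt continuous_const Complex.continuous_re
  have hu := (summable_choose_mul_pow hj h0 h1).mul_left 2
  have hbd := eventually_norm_euler_factor_sub_one_le hN hj
  have hfd (m : ℕ) : DifferentiableOn ℂ
      (fun z : ℂ ↦ (1 - (N : ℂ) ^ (-(z + m))) ^ ((j + m - 1).choose m)) {z : ℂ | 1 < z.re} :=
    fun z _ ↦ ((hasDerivAt_one_sub_cpow hN0 m z).differentiableAt.pow _).differentiableWithinAt
  have hmul : MultipliableLocallyUniformlyOn
      (fun (m : ℕ) (z : ℂ) ↦ (1 - (N : ℂ) ^ (-(z + m))) ^ ((j + m - 1).choose m))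
      {z : ℂ | 1 < z.re} := by
    have h2 := Summable.multipliableLocallyUniformlyOn_nat_one_add hKo hu hbd
      fun m ↦ (hfd m).continuousOn.sub continuousOn_const
    simpa only [add_sub_cancel] using h2
  have hprod : ∏' m : ℕ, (1 - (N : ℂ) ^ (-(s + m))) ^ ((j + m - 1).choose m) ≠ 0 := by
    have h2 := tprod_one_add_ne_zero_of_summable
      (f := fun m : ℕ ↦ (1 - (N : ℂ) ^ (-(s + m))) ^ ((j + m - 1).choose m) - 1) (fun m ↦ by
        rw [add_sub_cancel]
        exact pow_ne_zero _ (one_sub_cpow_ne_zero hN m hs))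
      (Summable.of_norm_bounded_eventually_nat hu (by
        filter_upwards [hbd] with m hm
        rw [norm_norm]
        exact hm s hs))
    simpa only [add_sub_cancel] using h2
  have hlog (m : ℕ) :
      logDeriv (fun z : ℂ ↦ (1 - (N : ℂ) ^ (-(z + m))) ^ ((j + m - 1).choose m)) s =
      Real.log N * (((j + m - 1).choose m : ℂ) *
        ((N : ℂ) ^ (-s) * ((N⁻¹ : ℝ) : ℂ) ^ m / (1 - (N : ℂ) ^ (-s) * ((N⁻¹ : ℝ) : ℂ) ^ m))) := by
    rw [logDeriv_fun_pow (hasDerivAt_one_sub_cpow hN0 m s).differentiableAt, logDeriv_apply,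
      (hasDerivAt_one_sub_cpow hN0 m s).deriv, cpow_neg_add_natCast hN0]
    ring
  have hsum := (tsum_lambert_choose hj h0 h1 ((norm_cpow_neg_lt_inv hN hs).trans h1)).2.1
  have hne (m : ℕ) : (1 - (N : ℂ) ^ (-(s + m))) ^ ((j + m - 1).choose m) ≠ 0 :=
    pow_ne_zero _ (one_sub_cpow_ne_zero hN m hs)
  have hsum' := (summable_congr hlog).2 (hsum.mul_left _)
  have hfin := logDeriv_tprod_eq_tsum (x := s)
    (f := fun (m : ℕ) (z : ℂ) ↦ (1 - (N : ℂ) ^ (-(z + m))) ^ ((j + m - 1).choose m))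
    hKo hs hne hfd hsum' hmul hprod
  rw [hfin, tsum_congr hlog, tsum_mul_left]

theorem inv_pow_cpow {N : ℝ} (hN : 0 < N) (n : ℕ) (s : ℂ) :
    (((N ^ n)⁻¹ : ℝ) : ℂ) ^ s = ((N : ℂ) ^ (-s)) ^ n := by
  induction n with
  | zero => simp
  | succ n ih =>
    rw [pow_succ, mul_inv, ofReal_mul, mul_cpow_ofReal_nonneg (by positivity) (by positivity), ih,
      pow_succ, ofReal_inv, inv_cpow, cpow_neg]
    rw [arg_ofReal_of_nonneg hN.le]
    exact Real.pi_pos.ne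

/-- In this form the n-th term belongs to the power γ^{n+1}, whose norm is N(γ)^{n+1}. -/
theorem logDeriv_localZeta {γ : SL(2, ℝ)} (h : IsHyp γ) {j : ℕ} (hj : 1 ≤ j) {s : ℂ}
    (hs : 1 < s.re) :
    (Summable fun n : ℕ ↦ ((((normN γ ^ (n + 1))⁻¹ : ℝ) : ℂ) ^ s *
      (1 / (1 - (((normN γ ^ (n + 1))⁻¹ : ℝ) : ℂ))) ^ j)) ∧
    logDeriv (localZeta γ j) s = len γ * ∑' n : ℕ, ((((normN γ ^ (n + 1))⁻¹ : ℝ) : ℂ) ^ s *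
      (1 / (1 - (((normN γ ^ (n + 1))⁻¹ : ℝ) : ℂ))) ^ j) := by
  have hN := h.one_lt_normN
  have hN0 : 0 < normN γ := by linarith
  have h1 := inv_lt_one_of_one_lt₀ hN
  have e (n : ℕ) : (((normN γ ^ (n + 1))⁻¹ : ℝ) : ℂ) ^ s *
      (1 / (1 - (((normN γ ^ (n + 1))⁻¹ : ℝ) : ℂ))) ^ j =
      ((normN γ : ℂ) ^ (-s)) ^ (n + 1) * (1 / (1 - (((normN γ)⁻¹ : ℝ) : ℂ) ^ (n + 1))) ^ j := by
    rw [inv_pow_cpow hN0, ← inv_pow, ofReal_pow]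
  obtain ⟨s1, -, s3⟩ := tsum_lambert_choose hj (inv_nonneg.2 hN0.le) h1
    ((norm_cpow_neg_lt_inv hN hs).trans h1)
  refine ⟨(summable_congr e).2 s1, ?_⟩
  rw [tsum_congr e, ← s3]
  exact logDeriv_euler_product hN hj hs

/-! ### Hyperbolic classes as powers of primitive ones -/

theorem zpow_exponent_eq_zero {Γ : Subgroup SL(2, ℝ)}
    (htf : ∀ γ ∈ Γ, IsOfFinOrder γ → γ = 1) {γ : SL(2, ℝ)} (hγ : γ ∈ Γ) (h1 : γ ≠ 1) {m : ℤ}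
    (h : γ ^ m = 1) : m = 0 := by
  by_contra hm
  exact h1 (htf γ hγ (isOfFinOrder_iff_zpow_eq_one.2 ⟨m, hm, h⟩))

theorem IsGen.eq_one_of_zpow_mul {Γ : Subgroup SL(2, ℝ)}
    (htf : ∀ γ ∈ Γ, IsOfFinOrder γ → γ = 1) {γ : SL(2, ℝ)} (h : IsGen Γ γ) {m : ℤ}
    (hm : γ ^ m = γ) : m = 1 := by
  have h1 : γ ^ (m - 1) = 1 := by rw [zpow_sub_one, hm, mul_inv_cancel]
  have := zpow_exponent_eq_zero htf h.mem h.ne_one h1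
  omega

theorem IsGen.isPrimHyp {Γ : Subgroup SL(2, ℝ)}
    (htf : ∀ γ ∈ Γ, IsOfFinOrder γ → γ = 1) {γ : Γ} (h : IsGen Γ γ) (hh : IsHyp (γ : SL(2, ℝ))) :
    IsPrimHyp Γ γ := by
  refine ⟨hh, fun δ n hδ ↦ ?_⟩
  have h0 : (δ : SL(2, ℝ)) ^ n = γ := by rw [← hδ, Subgroup.coe_pow]
  obtain ⟨j, hj⟩ := h.exists_zpow δ δ.2 (by rw [← h0]; exact (Commute.refl _).pow_right n)
  rw [hj, ← zpow_natCast, ← zpow_mul] at h0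
  have h1 := h.eq_one_of_zpow_mul htf h0
  have h2 := Int.isUnit_iff.1 (IsUnit.of_mul_eq_one_right j h1)
  omega

theorem IsPrimHyp.conj {Γ : Subgroup SL(2, ℝ)} {γ : Γ} (h : IsPrimHyp Γ γ) (σ : Γ) :
    IsPrimHyp Γ (σ * γ * σ⁻¹) := by
  refine ⟨?_, fun δ n hδ ↦ h.2 (σ⁻¹ * δ * σ) n ?_⟩
  · have h1 := h.1
    rw [isHyp_iff] at h1 ⊢
    rwa [Subgroup.coe_mul, Subgroup.coe_mul, Subgroup.coe_inv, tr_conj]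
  · have h2 := conj_pow (i := n) (a := σ⁻¹) (b := δ)
    rw [inv_inv] at h2
    rw [h2, hδ]
    group

/-- The representative of a primitive class, as an element of the group. -/
def PrimClass.elt {Γ : Subgroup SL(2, ℝ)} (c : PrimClass Γ) : Γ := c.2.choose

theorem PrimClass.mk_elt {Γ : Subgroup SL(2, ℝ)} (c : PrimClass Γ) :
    ConjClasses.mk c.elt = c.1 := c.2.choose_spec.1

theorem PrimClass.isPrimHyp {Γ : Subgroup SL(2, ℝ)} (c : PrimClass Γ) : IsPrimHyp Γ c.elt :=
  c.2.choose_spec.2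

theorem PrimClass.isHyp_pow {Γ : Subgroup SL(2, ℝ)} (c : PrimClass Γ) (n : ℕ) :
    IsHyp ((c.elt ^ (n + 1) : Γ) : SL(2, ℝ)) := by
  rw [Subgroup.coe_pow]
  exact (isHyp_pow_iff n.succ_ne_zero ((isHyp_iff _).1 c.isPrimHyp.1).le).2 c.isPrimHyp.1

/-- The class of the `(n + 1)`-st power of a primitive class. -/
def primPow {Γ : Subgroup SL(2, ℝ)} (p : PrimClass Γ × ℕ) : HypClass Γ :=
  ⟨ConjClasses.mk (p.1.elt ^ (p.2 + 1)), _, rfl, p.1.isHyp_pow p.2⟩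

/-- After conjugation both elements lie in one cyclic centraliser, so Q = d^j with j(n+1) = m+1.
Hence j is positive, and primitivity of Q, which speaks of natural exponents only, gives j = 1. -/
theorem primPow_injective {Γ : Subgroup SL(2, ℝ)} [DiscreteTopology Γ]
    (htf : ∀ γ ∈ Γ, IsOfFinOrder γ → γ = 1) : Function.Injective (primPow (Γ := Γ)) := by
  rintro ⟨c, n⟩ ⟨d, m⟩ h
  have h1 : ConjClasses.mk (c.elt ^ (n + 1)) = ConjClasses.mk (d.elt ^ (m + 1)) :=
    congrArg Subtype.val h
  rw [ConjClasses.mk_eq_mk_iff_isConj, isConj_iff] at h1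
  obtain ⟨σ, hσ⟩ := h1
  rw [← conj_pow] at hσ
  have hQ := c.isPrimHyp.conj σ
  have hmk : ConjClasses.mk (σ * c.elt * σ⁻¹) = c.1 := by
    rw [← c.mk_elt, ConjClasses.mk_eq_mk_iff_isConj, isConj_comm, isConj_iff]
    exact ⟨σ, rfl⟩
  generalize σ * c.elt * σ⁻¹ = Q at *
  have hd := d.isPrimHyp.isGen htf
  have hσ' : (Q : SL(2, ℝ)) ^ (n + 1) = (d.elt : SL(2, ℝ)) ^ (m + 1) := by
    rw [← Subgroup.coe_pow, hσ, Subgroup.coe_pow]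
  obtain ⟨j, hj⟩ := hd.exists_zpow Q Q.2 (d.isPrimHyp.1.commute_of_commute_pow m.succ_ne_zero
    (by rw [← hσ']; exact (Commute.refl _).pow_right _))
  have hj1 : j * (n + 1 : ℕ) = (m + 1 : ℕ) := by
    rw [hj, ← zpow_natCast, ← zpow_natCast, ← zpow_mul] at hσ'
    have h2 : (d.elt : SL(2, ℝ)) ^ (j * (n + 1 : ℕ) - (m + 1 : ℕ)) = 1 := by
      rw [zpow_sub, hσ', mul_inv_cancel]
    have := zpow_exponent_eq_zero htf hd.mem hd.ne_one h2
    omega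
  have hj0 : 0 < j := by
    by_contra! hneg
    have : j * (n + 1 : ℕ) ≤ 0 := mul_nonpos_of_nonpos_of_nonneg hneg (by positivity)
    omega
  lift j to ℕ using hj0.le
  have hj2 : j = 1 := hQ.2 d.elt j (Subtype.ext (by rw [Subgroup.coe_pow, hj, zpow_natCast]))
  have hnm : n = m := by
    rw [hj2] at hj1
    push_cast at hj1
    omega
  have hcd : c = d := by
    refine Subtype.ext ?_
    rw [← hmk, ← d.mk_elt]
    congr 1
    exact Subtype.ext (by rw [hj, hj2, Nat.cast_one, zpow_one])
  rw [hnm, hcd]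

theorem primPow_surjective {Γ : Subgroup SL(2, ℝ)} [DiscreteTopology Γ]
    (htf : ∀ γ ∈ Γ, IsOfFinOrder γ → γ = 1) : Function.Surjective (primPow (Γ := Γ)) := by
  rintro ⟨c, γ, rfl, hγ⟩
  have h1 : (γ : SL(2, ℝ)) ≠ 1 := by
    intro h'
    rw [isHyp_iff, h'] at hγ
    norm_num [tr] at hγ
  obtain ⟨γ₀, hgen, m, hm, hP⟩ := exists_isGen htf γ.2 h1
  have hh : IsHyp γ₀ := by
    rw [hP] at hγ
    exact (isHyp_pow_iff hm.ne' (four_le_tr_sq htf hgen.mem)).1 hγ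
  have hprim : IsPrimHyp Γ ⟨γ₀, hgen.mem⟩ := IsGen.isPrimHyp htf hgen hh
  let d : PrimClass Γ := ⟨ConjClasses.mk ⟨γ₀, hgen.mem⟩, _, rfl, hprim⟩
  have hd : ConjClasses.mk d.elt = ConjClasses.mk ⟨γ₀, hgen.mem⟩ := d.mk_elt
  rw [ConjClasses.mk_eq_mk_iff_isConj, isConj_iff] at hd
  obtain ⟨σ, hσ⟩ := hd
  refine ⟨(d, m - 1), Subtype.ext ?_⟩
  change ConjClasses.mk (d.elt ^ (m - 1 + 1)) = ConjClasses.mk γ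
  rw [Nat.sub_add_cancel hm, ConjClasses.mk_eq_mk_iff_isConj, isConj_iff]
  refine ⟨σ, ?_⟩
  rw [← conj_pow, hσ]
  exact Subtype.ext (by rw [Subgroup.coe_pow, hP])

theorem exists_localData_primPow {Γ : Subgroup SL(2, ℝ)} (p : PrimClass Γ × ℕ) :
    ∃ D : LocalData Γ (primPow p), D.P₀ = p.1.elt ∧ D.n = p.2 + 1 := by
  obtain ⟨τ, hτ⟩ := p.1.isPrimHyp.1.exists_diag
  exact ⟨⟨p.1.elt ^ (p.2 + 1), rfl, p.1.elt, p.1.isPrimHyp, p.2 + 1, rfl, τ,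
    (diag_iff p.1.isPrimHyp.1).2 hτ⟩, rfl, rfl⟩

/-- The Dirichlet series uses a fixed representative of each primitive class. Taking the same
element as P₀ makes the periods on both sides literally equal. -/
theorem exists_localData_compatible {Γ : Subgroup SL(2, ℝ)} [DiscreteTopology Γ]
    (htf : ∀ γ ∈ Γ, IsOfFinOrder γ → γ = 1) (c : HypClass Γ) :
    ∃ D : LocalData Γ c, ∀ p, primPow p = c → D.P₀ = p.1.elt ∧ D.n = p.2 + 1 := by
  obtain ⟨q, rfl⟩ := primPow_surjective htf c
  obtain ⟨D, hD⟩ := exists_localData_primPow q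
  refine ⟨D, fun p hp ↦ ?_⟩
  rw [primPow_injective htf hp]
  exact hD

/-! ### The Dirichlet series -/

theorem hasSum_psiTerm {k : ℕ} {g : ℍ → ℂ} {z₀ : ℍ} {s : ℂ} (hs : 1 < s.re) {γ : SL(2, ℝ)}
    (h : IsHyp γ) :
    HasSum (fun n : ℕ ↦ beta k g z₀ γ * ∑ j ∈ Finset.Icc 1 (2 * k),
      Polynomial.aeval (2 * s) (polyP k j) * ((((normN γ ^ (n + 1))⁻¹ : ℝ) : ℂ) ^ s *
        (1 / (1 - (((normN γ ^ (n + 1))⁻¹ : ℝ) : ℂ))) ^ j)) (psiTerm k g z₀ s γ) := by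
  have hl : (len γ : ℂ) ≠ 0 := by exact_mod_cast (Real.log_pos h.one_lt_normN).ne'
  have h1 := (hasSum_sum (s := Finset.Icc 1 (2 * k)) fun j hj ↦
    ((logDeriv_localZeta h (Finset.mem_Icc.1 hj).1 hs).1.hasSum.mul_left
      (Polynomial.aeval (2 * s) (polyP k j)))).mul_left (beta k g z₀ γ)
  suffices e : psiTerm k g z₀ s γ = _ by
    rw [e]
    exact h1
  rw [psiTerm, div_mul_eq_mul_div, mul_div_assoc, Finset.sum_div]
  congr 1
  refine Finset.sum_congr rfl fun j hj ↦ ?_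
  rw [(logDeriv_localZeta h (Finset.mem_Icc.1 hj).1 hs).2]
  field_simp

/-- Hyperbolic classes correspond to pairs of a primitive class and an exponent. Absolute
convergence of the sum of the local integrals allows summing over the exponent first, which yields
one term of the Dirichlet series. -/
theorem IsCuspidal.psi_eq {Γ : Subgroup SL(2, ℝ)} [DiscreteTopology Γ] {𝓕 : Set ℍ} {k : ℕ}
    {g : ℍ → ℂ} {s : ℂ} (hg : IsCuspidal Γ k g) (hk : 1 ≤ k)
    (htf : ∀ γ ∈ Γ, IsOfFinOrder γ → γ = 1)
    (h𝓕 : IsFundamentalDomain Γ 𝓕 (volume : Measure ℍ)) (hcof : volume 𝓕 < ⊤)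
    (hs : 1 < s.re) (z₀ : ℍ) :
    (Summable fun c : PrimClass Γ ↦ ‖psiTerm k g z₀ s c.rep‖) ∧
      Psi Γ k g z₀ s = (-1) ^ (k + 1) * ∫ z in 𝓕, scalarDensity Γ k s g z := by
  choose D hD using exists_localData_compatible htf
  obtain ⟨hint, hsum, heq⟩ := hg.integral_scalarDensity htf h𝓕 hcof hs D
  let e := Equiv.ofBijective (primPow (Γ := Γ)) ⟨primPow_injective htf, primPow_surjective htf⟩
  let a (c : HypClass Γ) : ℂ := (-1) ^ (k + 1) * localI k s g (D c)
  have ha : Summable fun c ↦ ‖a c‖ := by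
    refine hsum.congr fun c ↦ ?_
    simp [a]
  have hrow (c : PrimClass Γ) : HasSum (fun n : ℕ ↦ a (e (c, n))) (psiTerm k g z₀ s c.rep) := by
    refine hasSum_of_forall_eq (hasSum_psiTerm hs c.isPrimHyp.1) fun n ↦ ?_
    obtain ⟨h1, h2⟩ := hD (primPow (c, n)) (c, n) rfl
    have h3 := (D (primPow (c, n))).localI_eq hg hk hs (hint _) z₀
    rw [(D (primPow (c, n))).normN_eq, h1, h2] at h3
    exact h3
  have ha' : Summable fun p ↦ ‖a (e p)‖ := e.summable_iff.2 ha
  constructor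
  · refine Summable.of_nonneg_of_le (fun _ ↦ norm_nonneg _) (fun c ↦ ?_) ha'.prod
    rw [← (hrow c).tsum_eq]
    exact norm_tsum_le_tsum_norm (ha'.prod_factor c)
  · rw [heq, ← tsum_mul_left, ← e.tsum_eq]
    exact ((Summable.of_norm ha').tsum_prod' fun c ↦ (hrow c).summable).trans
      (tsum_congr fun c ↦ (hrow c).tsum_eq) |>.symm

end GeodesicPeriods

end

/-! ### The theorem -/

theorem mainTheorem6 (k : ℕ) (hk : 1 ≤ k)
    (Γ : Subgroup (Matrix.SpecialLinearGroup (Fin 2) ℝ))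
    (hdisc : DiscreteTopology Γ)
    (htf : ∀ γ ∈ Γ, IsOfFinOrder γ → γ = 1)
    (𝓕 : Set UpperHalfPlane)
    (h𝓕 : MeasureTheory.IsFundamentalDomain Γ 𝓕 (MeasureTheory.volume : MeasureTheory.Measure UpperHalfPlane))
    (hcof : MeasureTheory.volume 𝓕 < ⊤)
    (g : GeodesicPeriods.CuspForms Γ k) (z₀ : UpperHalfPlane) (s : ℂ) (hs : 1 < s.re) :
    -- the series `Ψ_Γ(s; g)` converges absolutely
    (Summable fun c : GeodesicPeriods.PrimClass Γ ↦
      ‖GeodesicPeriods.psiTerm k g z₀ s c.rep‖) ∧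
    -- the scalar product converges absolutely and gives `Ψ_Γ(s; g)`
    MeasureTheory.IntegrableOn (GeodesicPeriods.scalarDensity Γ k s g) 𝓕 ∧
    GeodesicPeriods.Psi Γ k g z₀ s =
      (-1) ^ (k + 1) * ∫ z in 𝓕, GeodesicPeriods.scalarDensity Γ k s g z ∧
    -- expansion in the local integrals over all hyperbolic classes, for all choices in them
    (∀ c : GeodesicPeriods.HypClass Γ, Nonempty (GeodesicPeriods.LocalData Γ c)) ∧
    ∀ D : (c : GeodesicPeriods.HypClass Γ) → GeodesicPeriods.LocalData Γ c,
      (∀ c, MeasureTheory.IntegrableOn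
        (GeodesicPeriods.localDensity k s g (GeodesicPeriods.normN (D c).P) (D c).τ)
        (GeodesicPeriods.annulus (GeodesicPeriods.normN (D c).P₀))) ∧
      (Summable fun c ↦ ‖GeodesicPeriods.localI k s g (D c)‖) ∧
      GeodesicPeriods.Psi Γ k g z₀ s =
        ∑' c, (-1) ^ (k + 1) * GeodesicPeriods.localI k s g (D c) := by
  have := hdisc
  have hg := GeodesicPeriods.isCuspidal_of_cuspForm g
  obtain ⟨h1, h2⟩ := hg.psi_eq hk htf h𝓕 hcof hs z₀
  refine ⟨h1, (hg.scalarDensity_sum htf h𝓕 hcof hs).1, h2,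
    fun c ↦ ⟨(GeodesicPeriods.exists_localData_compatible htf c).choose⟩, fun D ↦ ?_⟩
  obtain ⟨h3, h4, h5⟩ := hg.integral_scalarDensity htf h𝓕 hcof hs D
  exact ⟨h3, h4, by rw [h2, h5, tsum_mul_left]⟩
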